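/- Let $\varphi(\xi_1,\xi_2)$ be one of the following five polynomials with a real parameter $\alpha$ (the real parabolic singularities of corank two): - $+X_9$: $\xi_1^4+\alpha\xi_1^2\xi_2^2+\xi_2^4$, $\alpha>-2$, $\alpha\neq 2$; - $X_9^1$: $\xi_1\xi_2(\xi_1^2+\alpha\xi_1\xi_2+\xi_2^2)$, $\alpha^2<4$; - $X_9^2$: $\xi_1\xi_2(\xi_1+\xi_2)(\xi_1+\alpha\xi_2)$, $0<\alpha<1$; - $J_{10}^3$: $\xi_1(\xi_1-\xi_2^2)(\xi_1-\alpha\xi_2^2)$, $0<\alpha<1$; - $J_{10}^1$: $\xi_1(\xi_1^2+\alpha\xi_1\xi_2^2+\xi_2^4)$, $\alpha^2<4$. Put $f=\varphi(\xi_1,\xi_2)+\xi_3^2$ and let $\mu(f)$ be its Milnor number at $0$. Let $f_\lambda=\Phi(\cdot,\lambda)$ be any real deformation of $f$, that is, a holomorphic germ $\Phi:(\mathbb C^3\times\mathbb C^l,\mathbb R^3\times\mathbb R^l,0)\to(\mathbb C,\mathbb R,0)$ with $f_0=f$. Let $B\subset\mathbb C^3$ be a sufficiently small ball centered at $0$,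 and let $U\subset\mathbb R^l$ be a ball centered at $0$ that is sufficiently small with respect to $B$. The discriminant $\Sigma$ is the set of all real $\lambda$ such that $f_\lambda$ has a (real or imaginary) critical point in $B$ with critical value $0$. For each of the five classes fix the following model function on $\mathbb R^2$: - $+X_9$: $(4x^2+y^2-4)(x^2+4y^2-4)$ (two ellipses meeting in four points); - $X_9^1$: $(4y^2-x^2)(4(x-2)^2+y^2-4)$ (an ellipse and two lines, each meeting it in two points, that cross outside it); - $X_9^2$: $xy(y-x+3)(y+x+7)$ (four lines in general position); - $J_{10}^3$: $y(y+3-x^2)(y-1+x^2)$ (a line and two parabolas, pairwise meeting in two points); - $J_{10}^1$: $(6(x-3)^2-3-y)(x^4-16x^2+16y^2)$ (a figure eight, and a parabola meeting one of its loops in four points and not meeting the other). Let $\tilde\lambda\in U\setminus\Sigma$ be such that in $B$ we have $f_{\tilde\lambda}=\tilde f:=\tilde\varphi(\xi_1,\xi_2)+\xi_3^2$, where $\tilde\varphi$ is the following perturbation of $\varphi$: for some constant $c>0$ there is a homeomorphism of the real disc $B\cap\{\xi_3=0\}\cap\mathbb R^3$ onto $\mathbb R^2$ that takes the zero set, the domain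 of positivity and the domain of negativity of $\tilde\varphi-c$ to those of the model function, and $\tilde\varphi$ is negative at all its local minima in this disc. Let $\lambda$ be any point of the connected component of $U\setminus\Sigma$ containing $\tilde\lambda$, such that $f_\lambda$ is Morse in $B$ (all its real and imaginary critical points in $B$ are non-degenerate). Then $f_\lambda$ has at most one pair of imaginary (complex conjugate, non-real) critical points in $B$, and the number of its real critical points in $B$ is equal to either $\mu(f)$ or $\mu(f)-2$. -/

import Mathlib

open Topology

noncomputable section

/-- The five classes of corank two parabolic singularities `+X₉`, `X₉¹`, `X₉²`, `J₁₀³`, `J₁₀¹`. -/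
inductive ParabolicClass where
  | X9plus | X9one | X9two | J10three | J10one

namespace ParabolicClass

/-- The restriction on the parameter `α` of the normal form. For `+X₉` the value `α = 2` is
excluded because `x⁴ + 2 x² y² + y⁴ = (x² + y²)²` has a non-isolated complex critical point. -/
def Admissible : ParabolicClass → ℝ → Prop
  | X9plus, α => -2 < α ∧ α ≠ 2
  | X9one, α => α ^ 2 < 4
  | X9two, α => 0 < α ∧ α < 1
  | J10three, α => 0 < α ∧ α < 1
  | J10one, α => α ^ 2 < 4

open MvPolynomial in
/-- The normal form `φ(ξ₁, ξ₂)` of the class, as a polynomial with complex coefficients. -/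
def normalForm : ParabolicClass → ℝ → MvPolynomial (Fin 2) ℂ
  | X9plus, α => X 0 ^ 4 + C (α : ℂ) * X 0 ^ 2 * X 1 ^ 2 + X 1 ^ 4
  | X9one, α => X 0 * X 1 * (X 0 ^ 2 + C (α : ℂ) * X 0 * X 1 + X 1 ^ 2)
  | X9two, α => X 0 * X 1 * (X 0 + X 1) * (X 0 + C (α : ℂ) * X 1)
  | J10three, α => X 0 * (X 0 - X 1 ^ 2) * (X 0 - C (α : ℂ) * X 1 ^ 2)
  | J10one, α => X 0 * (X 0 ^ 2 + C (α : ℂ) * X 0 * X 1 ^ 2 + X 1 ^ 4)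

open MvPolynomial in
/-- The function `f(ξ₁, ξ₂, ξ₃) = φ(ξ₁, ξ₂) + ξ₃²`. -/
def stabilized (T : ParabolicClass) (α : ℝ) : MvPolynomial (Fin 3) ℂ :=
  rename Fin.castSucc (T.normalForm α) + X 2 ^ 2

/-- Model of the picture of the perturbed real function in the plane. Its zero set consists of:
* `+X₉`: two ellipses meeting in four points;
* `X₉¹`: an ellipse and two lines, each meeting the ellipse in two points, which cross outside
  the ellipse;
* `X₉²`: four lines in general position;
* `J₁₀³`: a line and two parabolas, any two of these curves meeting in two points;
* `J₁₀¹`: a figure eight and a parabola, which meets one of the two loops in four points and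
  does not meet the other one.
All bounded domains of the complement of the zero set are negative, except for the only one
(the lens in the middle for `+X₉`, the quadrangle for `X₉²`, and so on) that is positive. -/
def picture : ParabolicClass → EuclideanSpace ℝ (Fin 2) → ℝ
  | X9plus, p => (4 * p 0 ^ 2 + p 1 ^ 2 - 4) * (p 0 ^ 2 + 4 * p 1 ^ 2 - 4)
  | X9one, p => (4 * p 1 ^ 2 - p 0 ^ 2) * (4 * (p 0 - 2) ^ 2 + p 1 ^ 2 - 4)
  | X9two, p => p 0 * p 1 * (p 1 - p 0 + 3) * (p 1 + p 0 + 7)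
  | J10three, p => p 1 * (p 1 + 3 - p 0 ^ 2) * (p 1 - 1 + p 0 ^ 2)
  | J10one, p =>
      (6 * (p 0 - 3) ^ 2 - 3 - p 1) * (p 0 ^ 4 - 16 * p 0 ^ 2 + 16 * p 1 ^ 2)

end ParabolicClass

/-- The Milnor number at the origin of a polynomial `f` in `n` complex variables: the dimension
of its local algebra `ℂ[[x₁, …, xₙ]] / (∂f/∂x₁, …, ∂f/∂xₙ)`. -/
def milnorNumber {n : ℕ} (f : MvPolynomial (Fin n) ℂ) : ℕ :=
  Module.finrank ℂ (MvPowerSeries (Fin n) ℂ ⧸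
    Ideal.span (Set.range fun i : Fin n =>
      ((MvPolynomial.pderiv i f : MvPolynomial (Fin n) ℂ) : MvPowerSeries (Fin n) ℂ)))

/-- The inclusion `ℝⁿ ⊂ ℂⁿ`. -/
def complexify {n : ℕ} (x : EuclideanSpace ℝ (Fin n)) : EuclideanSpace ℂ (Fin n) :=
  WithLp.toLp 2 fun i => (x i : ℂ)

/-- Complex conjugation in `ℂⁿ`. -/
def conjPoint {n : ℕ} (z : EuclideanSpace ℂ (Fin n)) : EuclideanSpace ℂ (Fin n) :=
  WithLp.toLp 2 fun i => (starRingEnd ℂ) (z i)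

/-- A real deformation with `l` parameters of the germ of `f` at the origin: a holomorphic germ
`Φ : (ℂⁿ × ℂˡ, ℝⁿ × ℝˡ, 0) → (ℂ, ℝ)` with `Φ(·, 0) = f`. -/
structure IsRealDeformation {n l : ℕ} (f : MvPolynomial (Fin n) ℂ)
    (Φ : EuclideanSpace ℂ (Fin n) × EuclideanSpace ℂ (Fin l) → ℂ) : Prop where
  analytic : AnalyticAt ℂ Φ 0
  base : ∀ᶠ z in 𝓝 (0 : EuclideanSpace ℂ (Fin n)), Φ (z, 0) = MvPolynomial.eval z.ofLp f
  real : ∀ᶠ p in 𝓝 (0 : EuclideanSpace ℝ (Fin n) × EuclideanSpace ℝ (Fin l)),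
    (Φ (complexify p.1, complexify p.2)).im = 0

/-- The member `f_λ = Φ(·, λ)` of a deformation, for a real value `t` of the parameter `λ`. -/
def deformationMember {n l : ℕ} (Φ : EuclideanSpace ℂ (Fin n) × EuclideanSpace ℂ (Fin l) → ℂ)
    (t : EuclideanSpace ℝ (Fin l)) : EuclideanSpace ℂ (Fin n) → ℂ :=
  fun z => Φ (z, complexify t)

/-- The critical points of `F` in the ball of radius `r` centered at the origin of `ℂⁿ`. -/
def criticalPoints {n : ℕ} (F : EuclideanSpace ℂ (Fin n) → ℂ) (r : ℝ) :
    Set (EuclideanSpace ℂ (Fin n)) :=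
  {z | z ∈ Metric.ball 0 r ∧ fderiv ℂ F z = 0}

/-- The real critical points of `F` in the ball of radius `r`. -/
def realCriticalPoints {n : ℕ} (F : EuclideanSpace ℂ (Fin n) → ℂ) (r : ℝ) :
    Set (EuclideanSpace ℂ (Fin n)) :=
  criticalPoints F r ∩ Set.range complexify

/-- The imaginary (i.e. non-real) critical points of `F` in the ball of radius `r`. -/
def imaginaryCriticalPoints {n : ℕ} (F : EuclideanSpace ℂ (Fin n) → ℂ) (r : ℝ) :
    Set (EuclideanSpace ℂ (Fin n)) :=
  criticalPoints F r \ Set.range complexify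

/-- `F` is Morse in the ball of radius `r`: at any of its critical points, real or imaginary, the
second differential is non-degenerate. -/
def IsMorseOn {n : ℕ} (F : EuclideanSpace ℂ (Fin n) → ℂ) (r : ℝ) : Prop :=
  ∀ z ∈ criticalPoints F r, Function.Injective (fderiv ℂ (fderiv ℂ F) z)

/-- The discriminant of a deformation: the set of real values of the parameter such that the
zero set of `f_λ` is singular in the ball of radius `r` in `ℂⁿ`. -/
def discriminant {n l : ℕ} (Φ : EuclideanSpace ℂ (Fin n) × EuclideanSpace ℂ (Fin l) → ℂ)
    (r : ℝ) : Set (EuclideanSpace ℝ (Fin l)) :=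
  {t | ∃ z ∈ criticalPoints (deformationMember Φ t) r, deformationMember Φ t z = 0}

/-- The real function `ψ` in the disc of radius `r` is obtained by adding a positive constant `c`
to a function whose zero set and domains of constant sign look topologically as in the picture of
the class `T`, in such a way that the values of `ψ` at its local minima are still negative. -/
def IsShiftedPicture (T : ParabolicClass) (r : ℝ) (ψ : EuclideanSpace ℝ (Fin 2) → ℝ) : Prop :=
  ∃ c : ℝ, 0 < c ∧
    (∃ h : Metric.ball (0 : EuclideanSpace ℝ (Fin 2)) r ≃ₜ EuclideanSpace ℝ (Fin 2),
      ∀ x : Metric.ball (0 : EuclideanSpace ℝ (Fin 2)) r,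
        SignType.sign (ψ x - c) = SignType.sign (T.picture (h x))) ∧
    ∀ x ∈ Metric.ball (0 : EuclideanSpace ℝ (Fin 2)) r, IsLocalMin ψ x → ψ x < 0

/-- In the ball of radius `r`, `F` has the form `φ̃(ξ₁, ξ₂) + ξ₃²`, where `φ̃` is the function of
the picture of the class `T`, shifted by a positive constant. -/
def IsChosenPerturbation (T : ParabolicClass) (r : ℝ) (F : EuclideanSpace ℂ (Fin 3) → ℂ) :
    Prop :=
  ∃ g : EuclideanSpace ℂ (Fin 2) → ℂ,
    (∀ z ∈ Metric.ball (0 : EuclideanSpace ℂ (Fin 3)) r, F z = g !₂[z 0, z 1] + z 2 ^ 2) ∧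
    IsShiftedPicture T r fun x => (g (complexify x)).re

end

/-! The invariant behind the theorem is the degree of the real gradient of `f_λ` on the part of the
real ball where `f_λ` is negative. Off the discriminant the gradient vanishes neither on the zero
level nor on the boundary sphere, so this degree is constant along each component of the complement
(`IsControlled.hasDegree_negativeSet_of_mem_component`).

For the chosen perturbation the degree is read off the picture. Each bounded negative domain
contains a minimum, each crossing point of the zero set is critical, and the bounded positive domain
contains a maximum. With `m` negative domains and `s` crossings these `m + s + 1` real points
already exhaust the Milnor number `μ`. Hence there are no other critical points and all of them are
non-degenerate. After the shift by `c` only the minima have negative values, and each of them counts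
as `+1`, so the degree on the negative set is `m` (`IsControlled.hasDegree_negativeSet_of_card`).
The picture is known only up to a homeomorphism preserving signs, so these critical points are found
topologically: by minimizing over a compact cell, and from the fact that near a regular point the
sublevel set is connected, while at a crossing it is split.

Now let `f_λ` be a Morse function in the same component, with `p` real critical points of positive
Hessian determinant, `n` of negative one, and `k` imaginary points. The signed count over the
negative set is `m`, hence `p ≥ m`. The total degree of the real gradient is `I = p - n`, and `μ = p
+ n + k`. In all five cases `I = m + 1 - s` and `μ = m + 1 + s`, that is `μ = 2 m - I + 2`.
Therefore `k = 2 (m + 1 - p) ≤ 2`, so `k` is `0` or `2`, and two imaginary points are exchanged by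
conjugation (`IsControlled.critical_points_of_isMorseOn`).

The inputs are a degree theory and explicit computations. The degree is defined by integrating
pulled-back bump forms, and its homotopy invariance is the closedness of these forms. For
holomorphic maps it bounds the number of zeros, and equality forces all zeros to be simple
(`HasComplexDegree.det_ne_zero_of_card_eq`). The real and complex degrees of the gradients of the
normal forms are found by deforming to maps with evident simple zeros. The Milnor number is computed
separately from a monomial basis of the local algebra, and the two numbers agree. -/

section

open MeasureTheory Set Filter

/-! ### Degree by integrals of pulled-back forms, and its homotopy invariance. -/

section Degree

variable {E : Type*} [NormedAddCommGroup E] [NormedSpace ℝ E] [FiniteDimensional ℝ E]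

/-- The determinant with respect to a basis, as a continuous alternating form. -/
noncomputable def basisVolumeForm {n : ℕ} (b : Module.Basis (Fin n) ℝ E) : E [⋀^Fin n]→L[ℝ] ℝ :=
  { b.det with
    cont := by
      have h : Continuous fun v : Fin n → E => (b.toMatrix v).det := by
        refine Continuous.matrix_det (continuous_matrix fun i j => ?_)
        simp only [Module.Basis.toMatrix_apply]
        exact (b.coord i).continuous_of_finiteDimensional.comp (continuous_apply j)
      exact h }

theorem basisVolumeForm_apply {n : ℕ} (b : Module.Basis (Fin n) ℝ E) (v : Fin n → E) :
    basisVolumeForm b v = b.det v := rfl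

theorem basisVolumeForm_map {n : ℕ} (b : Module.Basis (Fin n) ℝ E) (A : E →L[ℝ] E) :
    basisVolumeForm b (fun i => A (b i)) = A.det := by
  rw [basisVolumeForm_apply]
  have := b.det_comp (A : E →ₗ[ℝ] E) b
  rw [Module.Basis.det_self, mul_one] at this
  exact this

/-- An alternating form of degree larger than the dimension vanishes. -/
theorem alternating_eq_zero_of_finrank_lt {n : ℕ} (h : Module.finrank ℝ E < n)
    (ω : E [⋀^Fin n]→L[ℝ] ℝ) : ω = 0 := by
  ext v
  refine ω.toAlternatingMap.map_linearDependent v fun hv => ?_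
  have := hv.fintype_card_le_finrank
  simp at this
  omega

/-- The pull-back of a top degree form is closed. -/
theorem extDeriv_pullback_top {P : Type*} [NormedAddCommGroup P] [NormedSpace ℝ P]
    (b : Module.Basis (Fin (Module.finrank ℝ E)) ℝ E) {H : P → E} {p : P} {ρ : E → ℝ}
    (hH : ContDiffAt ℝ 2 H p) (hρ : Differentiable ℝ ρ) :
    extDeriv (fun q => (ρ (H q) • basisVolumeForm b).compContinuousLinearMap (fderiv ℝ H q)) p
      = 0 := by
  have := extDeriv_pullback (𝕜 := ℝ) (ω := fun y => ρ y • basisVolumeForm b) (f := H) (x := p)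
    (r := 2) ((hρ _).smul_const _) hH (by simp [minSmoothness_of_isRCLikeNormedField])
  -- The exterior derivative commutes with pull-back, and on the target it would be a form of degree
  -- larger than the dimension.
  rw [this, alternating_eq_zero_of_finrank_lt (Nat.lt_succ_self _) (extDeriv _ _)]
  ext v; simp

/-- The scalar components of the pull-back of a top degree form, restricted to the points with
second coordinate in `Ω`. -/
noncomputable def pullbackDensity {n : ℕ} (b : Module.Basis (Fin n) ℝ E) (H : ℝ × E → E)
    (ρ : E → ℝ) (Ω : Set E) (w : Fin n → ℝ × E) (p : ℝ × E) : ℝ :=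
  {q : ℝ × E | q.2 ∈ Ω}.indicator
    (fun q => ρ (H q) * basisVolumeForm b fun i => fderiv ℝ H q (w i)) p

theorem pullbackDensity_eventuallyEq {n : ℕ} (b : Module.Basis (Fin n) ℝ E) (H : ℝ × E → E)
    (ρ : E → ℝ) {Ω : Set E} (hΩ : IsOpen Ω) (w : Fin n → ℝ × E) {p : ℝ × E} (hp : p.2 ∈ Ω) :
    pullbackDensity b H ρ Ω w =ᶠ[𝓝 p]
      fun q => ρ (H q) * basisVolumeForm b fun i => fderiv ℝ H q (w i) := by
  filter_upwards [(hΩ.preimage continuous_snd).mem_nhds hp] with q hq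
  exact indicator_of_mem (s := {q : ℝ × E | q.2 ∈ Ω}) hq _

/-- Outside the closure of `Ω` the indicator is zero, and near a frontier point `‖H‖ > ε`, where `ρ
∘ H` already vanishes. -/
theorem pullbackDensity_eventuallyEq_zero {n : ℕ} (b : Module.Basis (Fin n) ℝ E) {H : ℝ × E → E}
    {ρ : E → ℝ} {Ω : Set E} (hΩ : IsOpen Ω) (w : Fin n → ℝ × E) {p : ℝ × E} {ε : ℝ}
    (hρ : ∀ y, ε ≤ ‖y‖ → ρ y = 0) (hH : p.2 ∈ closure Ω → ContinuousAt H p)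
    (hfr : p.2 ∈ frontier Ω → ε < ‖H p‖) (hp : p.2 ∉ Ω) :
    pullbackDensity b H ρ Ω w =ᶠ[𝓝 p] fun _ => 0 := by
  by_cases hc : p.2 ∈ closure Ω
  · have : p.2 ∈ frontier Ω := by rw [hΩ.frontier_eq]; exact ⟨hc, hp⟩
    filter_upwards [(hH hc).norm.eventually (lt_mem_nhds (hfr this))] with q hq
    have hq0 : ρ (H q) = 0 := hρ _ (le_of_lt hq)
    refine (indicator_apply_eq_zero (M := ℝ)).2 fun _ => ?_
    rw [hq0, zero_mul]
  · filter_upwards [(isClosed_closure.isOpen_compl.preimage continuous_snd).mem_nhds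
      (show p ∈ Prod.snd ⁻¹' (closure Ω)ᶜ from hc)] with q hq
    exact indicator_of_notMem (s := {q : ℝ × E | q.2 ∈ Ω})
      (fun h : q.2 ∈ Ω => hq (subset_closure h)) _

/-- The cut-off by the indicator does no harm: near the frontier the factor `ρ ∘ H` is zero anyway.
One derivative of `H` enters the density, which is why `H` is taken `C²`. -/
theorem contDiffAt_pullbackDensity {n : ℕ} (b : Module.Basis (Fin n) ℝ E) {H : ℝ × E → E}
    {ρ : E → ℝ} {Ω : Set E} (hΩ : IsOpen Ω) (w : Fin n → ℝ × E) {p : ℝ × E} {ε : ℝ}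
    (hρc : ContDiff ℝ 1 ρ)
    (hρ : ∀ y, ε ≤ ‖y‖ → ρ y = 0) (hH : p.2 ∈ closure Ω → ContDiffAt ℝ 2 H p)
    (hfr : p.2 ∈ frontier Ω → ε < ‖H p‖) :
    ContDiffAt ℝ 1 (pullbackDensity b H ρ Ω w) p := by
  by_cases hp : p.2 ∈ Ω
  · have h2 := hH (subset_closure hp)
    have h1 : ContDiffAt ℝ 1 (fderiv ℝ H) p := h2.fderiv_right (by norm_num)
    refine ContDiffAt.congr_of_eventuallyEq ?_ (pullbackDensity_eventuallyEq b H ρ hΩ w hp)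
    refine (hρc.contDiffAt.comp p (h2.of_le (by norm_num))).mul ?_
    exact ((basisVolumeForm b).toContinuousMultilinearMap.contDiff).contDiffAt.comp p
      (contDiffAt_pi.2 fun i => h1.clm_apply contDiffAt_const)
  · exact contDiffAt_const.congr_of_eventuallyEq (pullbackDensity_eventuallyEq_zero b hΩ w hρ
      (fun h => (hH h).continuousAt) hfr hp)

/-- This is the closedness of the pulled-back form written in components. It expresses the time
derivative of the density through spatial derivatives, and so takes the place of Stokes' formula. -/
theorem sum_fderiv_pullbackDensity (b : Module.Basis (Fin (Module.finrank ℝ E)) ℝ E)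
    {H : ℝ × E → E}
    {ρ : E → ℝ} {Ω : Set E} (hΩ : IsOpen Ω) (v : Fin (Module.finrank ℝ E + 1) → ℝ × E)
    {p : ℝ × E} {ε : ℝ} (hρc : ContDiff ℝ 1 ρ)
    (hρ : ∀ y, ε ≤ ‖y‖ → ρ y = 0) (hH : p.2 ∈ closure Ω → ContDiffAt ℝ 2 H p)
    (hfr : p.2 ∈ frontier Ω → ε < ‖H p‖) :
    ∑ i, (-1 : ℝ) ^ i.val *
      fderiv ℝ (pullbackDensity b H ρ Ω (i.removeNth v)) p (v i) = 0 := by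
  by_cases hp : p.2 ∈ Ω
  · have h2 := hH (subset_closure hp)
    have h1 : DifferentiableAt ℝ (fderiv ℝ H) p :=
      (h2.fderiv_right (m := 1) (by norm_num)).differentiableAt (by norm_num)
    have hρd := hρc.differentiable (by norm_num)
    have hd : DifferentiableAt ℝ (fun q => (ρ (H q) • basisVolumeForm b).compContinuousLinearMap
        (fderiv ℝ H q)) p := by
      refine DifferentiableAt.continuousAlternatingMapCompContinuousLinearMap ?_ h1
      exact ((hρd _).comp p (h2.differentiableAt (by norm_num))).smul_const _
    have h := extDeriv_apply hd v
    rw [extDeriv_pullback_top b h2 hρd] at h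
    refine Eq.trans ?_ h.symm
    refine Finset.sum_congr rfl fun i _ => ?_
    rw [(pullbackDensity_eventuallyEq b H ρ hΩ _ hp).fderiv_eq]
    have he : ((-1 : ℝ) ^ i.val) = (((-1 : ℤ) ^ i.val : ℤ) : ℝ) := by push_cast; rfl
    rw [he, ← zsmul_eq_mul]
    rfl
  · refine Finset.sum_eq_zero fun i _ => ?_
    rw [(pullbackDensity_eventuallyEq_zero b hΩ _ hρ
      (fun h => (hH h).continuousAt) hfr hp).fderiv_eq]
    simp

variable [MeasurableSpace E] [BorelSpace E]

theorem integral_fderiv_eq_zero_of_hasCompactSupport (μ : Measure E) [μ.IsAddHaarMeasure]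
    {g : E → ℝ} (hg : ContDiff ℝ 1 g) (hc : HasCompactSupport g) (v : E) :
    ∫ x, fderiv ℝ g x v ∂μ = 0 := by
  have h := integral_mul_fderiv_eq_neg_fderiv_mul_of_integrable (μ := μ) (f := fun _ : E => (1 : ℝ))
    (g := g) (v := v) (by simp) ?_ ?_ (by simp) (fun x _ => hg.differentiable (by norm_num) x)
  · simpa using h
  · simp only [one_mul]
    exact ((hg.continuous_fderiv (by norm_num)).clm_apply continuous_const).integrable_of_hasCompactSupport
      (hc.fderiv_apply ℝ v)
  · simp only [one_mul]
    exact hg.continuous.integrable_of_hasCompactSupport hc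

/-- Differentiating under the integral gives the integral of the time derivative of the density. By
closedness this is a combination of spatial derivatives of compactly supported functions, whose
integrals vanish. -/
theorem hasDerivAt_integral_pullbackDensity (μ : Measure E) [μ.IsAddHaarMeasure]
    (b : Module.Basis (Fin (Module.finrank ℝ E)) ℝ E) {H : ℝ × E → E}
    {ρ : E → ℝ} {Ω : Set E} (hΩ : IsOpen Ω) (hb : Bornology.IsBounded Ω) {ε : ℝ}
    (hρc : ContDiff ℝ 1 ρ)
    (hρ : ∀ y, ε ≤ ‖y‖ → ρ y = 0) (hH : ∀ s : ℝ, ∀ x ∈ closure Ω, ContDiffAt ℝ 2 H (s, x))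
    {s₀ : ℝ} (hfr : ∀ x ∈ frontier Ω, ε < ‖H (s₀, x)‖) :
    HasDerivAt (fun s => ∫ x, pullbackDensity b H ρ Ω (fun i => ((0 : ℝ), b i)) (s, x) ∂μ)
      0 s₀ := by
  have hcl : IsCompact (closure Ω) := hb.isCompact_closure
  have hcf : IsCompact (frontier Ω) := hcl.of_isClosed_subset isClosed_frontier frontier_subset_closure
  -- The inequality on the frontier persists for nearby times because the frontier is compact.
  have hev : ∀ᶠ s in 𝓝 s₀, ∀ x ∈ frontier Ω, ε < ‖H (s, x)‖ := by
    refine hcf.eventually_forall_of_forall_eventually (P := fun s x => ε < ‖H (s, x)‖) fun x hx => ?_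
    exact (hH s₀ x (frontier_subset_closure hx)).continuousAt.norm.eventually (lt_mem_nhds (hfr x hx))
  obtain ⟨η, hη, hS⟩ := Metric.eventually_nhds_iff_ball.1 hev
  set S := Metric.ball s₀ η
  have hC1 : ∀ w : Fin (Module.finrank ℝ E) → ℝ × E, ∀ s ∈ S, ∀ x,
      ContDiffAt ℝ 1 (pullbackDensity b H ρ Ω w) (s, x) := fun w s hs x =>
    contDiffAt_pullbackDensity b hΩ w hρc hρ (hH s x) (hS s hs x)
  have hsupp : ∀ w : Fin (Module.finrank ℝ E) → ℝ × E, ∀ s, HasCompactSupport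
      fun x => pullbackDensity b H ρ Ω w (s, x) := fun w s =>
    HasCompactSupport.intro hcl fun x hx =>
      indicator_of_notMem (s := {q : ℝ × E | q.2 ∈ Ω}) (a := (s, x))
        (fun h : x ∈ Ω => hx (subset_closure h)) _
  have hslice : ∀ w : Fin (Module.finrank ℝ E) → ℝ × E, ∀ s ∈ S,
      ContDiff ℝ 1 fun x => pullbackDensity b H ρ Ω w (s, x) := fun w s hs =>
    contDiff_iff_contDiffAt.2 fun x => (hC1 w s hs x).comp x
      (contDiffAt_const.prodMk contDiffAt_id)
  have hfd : ∀ w : Fin (Module.finrank ℝ E) → ℝ × E, ∀ s ∈ S, ∀ x,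
      HasFDerivAt (pullbackDensity b H ρ Ω w) (fderiv ℝ (pullbackDensity b H ρ Ω w) (s, x)) (s, x) :=
    fun w s hs x => ((hC1 w s hs x).differentiableAt (by norm_num)).hasFDerivAt
  have hzero : ∀ w : Fin (Module.finrank ℝ E) → ℝ × E, ∀ e : E,
      ∫ x, fderiv ℝ (pullbackDensity b H ρ Ω w) (s₀, x) (0, e) ∂μ = 0 := by
    intro w e
    refine Eq.trans ?_ (integral_fderiv_eq_zero_of_hasCompactSupport μ
      (hslice w s₀ (Metric.mem_ball_self hη)) (hsupp w s₀) e)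
    refine integral_congr_ae (Eventually.of_forall fun x => ?_)
    have := (hfd w s₀ (Metric.mem_ball_self hη) x).comp x (hasFDerivAt_prodMk_right s₀ x)
    rw [show (fun x => pullbackDensity b H ρ Ω w (s₀, x)) =
      pullbackDensity b H ρ Ω w ∘ (fun x => (s₀, x)) from rfl]
    simp only
    rw [this.fderiv]
    simp
  set w₀ : Fin (Module.finrank ℝ E) → ℝ × E := fun i => ((0 : ℝ), b i)
  have hcont : ContinuousOn (fun q : ℝ × E => fderiv ℝ (pullbackDensity b H ρ Ω w₀) q)
      (Metric.closedBall s₀ (η / 2) ×ˢ closure Ω) := by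
    rintro ⟨s, x⟩ ⟨hs, hx⟩
    have hs' : s ∈ S := by
      simp only [S, Metric.mem_ball, Metric.mem_closedBall] at hs ⊢
      linarith
    exact ((hC1 w₀ s hs' x).continuousAt_fderiv (by norm_num)).continuousWithinAt
  -- Halving the radius puts the times into a compact set, which yields the dominating constant.
  obtain ⟨C, hC⟩ := ((isCompact_closedBall s₀ (η / 2)).prod hcl).exists_bound_of_continuousOn hcont
  have hsub : Metric.ball s₀ (η / 2) ⊆ S := Metric.ball_subset_ball (by linarith)
  have key := hasDerivAt_integral_of_dominated_loc_of_deriv_le (μ := μ)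
    (F := fun s x => pullbackDensity b H ρ Ω w₀ (s, x))
    (F' := fun s x => fderiv ℝ (pullbackDensity b H ρ Ω w₀) (s, x) (1, 0))
    (bound := (closure Ω).indicator fun _ => C * ‖((1 : ℝ), (0 : E))‖) (x₀ := s₀)
    (Metric.ball_mem_nhds s₀ (half_pos hη)) ?_ ?_ ?_ ?_ ?_ ?_
  · have hval : ∫ x, fderiv ℝ (pullbackDensity b H ρ Ω w₀) (s₀, x) (1, 0) ∂μ = 0 := by
      -- The time direction is put in position `0`, so the term `i = 0` of the closedness relation
      -- is the time derivative and all the others are spatial.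
      set v : Fin (Module.finrank ℝ E + 1) → ℝ × E := Fin.cons ((1 : ℝ), (0 : E)) w₀
      have hrel : ∀ x, fderiv ℝ (pullbackDensity b H ρ Ω w₀) (s₀, x) (1, 0) =
          - ∑ i : Fin (Module.finrank ℝ E), (-1 : ℝ) ^ (i.val + 1) *
            fderiv ℝ (pullbackDensity b H ρ Ω (i.succ.removeNth v)) (s₀, x) (0, b i) := by
        intro x
        have := sum_fderiv_pullbackDensity (p := (s₀, x)) b hΩ v hρc hρ (hH s₀ x)
          (hS s₀ (Metric.mem_ball_self hη) x)
        rw [Fin.sum_univ_succ] at this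
        have hr : (0 : Fin (Module.finrank ℝ E + 1)).removeNth v = w₀ := by
          ext i <;> simp [v, Fin.removeNth]
        simp only [hr, Fin.val_zero, pow_zero, one_mul, Fin.val_succ] at this
        rw [show v 0 = ((1 : ℝ), (0 : E)) from rfl] at this
        exact eq_neg_of_add_eq_zero_left this
      simp_rw [hrel]
      rw [integral_neg, integral_finsetSum]
      · simp [integral_const_mul, hzero]
      · intro i _
        refine Integrable.const_mul ?_ _
        refine Continuous.integrable_of_hasCompactSupport ?_ ?_
        · refine continuous_iff_continuousAt.2 fun x => ?_
          have h1 := (hC1 (i.succ.removeNth v) s₀ (Metric.mem_ball_self hη) x).continuousAt_fderiv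
            (by norm_num)
          have h2 : ContinuousAt (fun x : E => (s₀, x)) x := by fun_prop
          exact (ContinuousAt.comp (f := fun x : E => (s₀, x)) h1 h2).clm_apply continuousAt_const
        · refine HasCompactSupport.intro hcl fun x hx => ?_
          rw [(pullbackDensity_eventuallyEq_zero b hΩ _ hρ (fun h => absurd h hx)
            (fun h => absurd (frontier_subset_closure h) hx) (p := (s₀, x))
            (fun h => hx (subset_closure h))).fderiv_eq]
          simp
    rw [← hval]
    exact key.2
  · filter_upwards [Metric.ball_mem_nhds s₀ hη] with s hs
    exact (hslice w₀ s hs).continuous.aestronglyMeasurable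
  · exact (hslice w₀ s₀ (Metric.mem_ball_self hη)).continuous.integrable_of_hasCompactSupport
      (hsupp w₀ s₀)
  · refine Continuous.aestronglyMeasurable (continuous_iff_continuousAt.2 fun x => ?_)
    have h1 := (hC1 w₀ s₀ (Metric.mem_ball_self hη) x).continuousAt_fderiv (by norm_num)
    have h2 : ContinuousAt (fun x : E => (s₀, x)) x := by fun_prop
    exact (ContinuousAt.comp (f := fun x : E => (s₀, x)) h1 h2).clm_apply continuousAt_const
  · refine Eventually.of_forall fun x s hs => ?_
    by_cases hx : x ∈ closure Ω
    · rw [indicator_of_mem hx]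
      refine (ContinuousLinearMap.le_opNorm _ _).trans ?_
      gcongr
      exact hC (s, x) ⟨Metric.ball_subset_closedBall hs, hx⟩
    · rw [indicator_of_notMem hx, (pullbackDensity_eventuallyEq_zero b hΩ _ hρ (fun h => absurd h hx)
        (fun h => absurd (frontier_subset_closure h) hx) (p := (s, x))
        (fun h => hx (subset_closure h))).fderiv_eq]
      simp
  · refine (integrable_indicator_iff isClosed_closure.measurableSet).2 ?_
    exact integrableOn_const hcl.measure_lt_top.ne
  · refine Eventually.of_forall fun x s hs => ?_
    have := (hfd w₀ s (hsub hs) x).comp_hasDerivAt s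
      ((hasDerivAt_id s).prodMk (hasDerivAt_const s x))
    exact this

/-- The topological degree over `0` of a map `G` on a set `Ω`, expressed through the integrals of
the pull-backs of bump functions. -/
def HasDegree (G : E → E) (Ω : Set E) (d : ℤ) : Prop :=
  ∃ ε > 0, ∀ ρ : E → ℝ, ContDiff ℝ 1 ρ → (∀ y, ε ≤ ‖y‖ → ρ y = 0) →
    ∫ x in Ω, ρ (G x) * (fderiv ℝ G x).det ∂Measure.addHaar =
      d * ∫ y, ρ y ∂(Measure.addHaar : Measure E)

theorem integral_pullbackDensity_eq (μ : Measure E)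
    (b : Module.Basis (Fin (Module.finrank ℝ E)) ℝ E) {H : ℝ × E → E}
    (ρ : E → ℝ) {Ω : Set E} (hΩ : IsOpen Ω) {s : ℝ}
    (hH : ∀ x ∈ closure Ω, ContDiffAt ℝ 2 H (s, x)) :
    ∫ x, pullbackDensity b H ρ Ω (fun i => ((0 : ℝ), b i)) (s, x) ∂μ =
      ∫ x in Ω, ρ (H (s, x)) * (fderiv ℝ (fun y => H (s, y)) x).det ∂μ := by
  rw [← integral_indicator hΩ.measurableSet]
  congr 1; ext x
  by_cases hx : x ∈ Ω
  · rw [indicator_of_mem hx, pullbackDensity, indicator_of_mem (show (s, x) ∈ {q : ℝ × E | q.2 ∈ Ω} from hx)]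
    congr 1
    rw [← basisVolumeForm_map b]
    congr 1; ext i
    have hd := ((hH x (subset_closure hx)).differentiableAt (by norm_num)).hasFDerivAt
    have := hd.comp x (hasFDerivAt_prodMk_right s x)
    rw [show (fun y => H (s, y)) = H ∘ (fun y => (s, y)) from rfl, this.fderiv]
    simp
  · rw [indicator_of_notMem hx, pullbackDensity,
      indicator_of_notMem (show (s, x) ∉ {q : ℝ × E | q.2 ∈ Ω} from hx)]

/-- Homotopy invariance of the degree. -/
theorem HasDegree.homotopy {H : ℝ × E → E} {Ω : Set E} (hΩ : IsOpen Ω)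
    (hb : Bornology.IsBounded Ω) (hH : ∀ s : ℝ, ∀ x ∈ closure Ω, ContDiffAt ℝ 2 H (s, x))
    (hfr : ∀ s ∈ Icc (0 : ℝ) 1, ∀ x ∈ frontier Ω, H (s, x) ≠ 0) {d : ℤ}
    (h : HasDegree (fun x => H (0, x)) Ω d) : HasDegree (fun x => H (1, x)) Ω d := by
  obtain ⟨ε₁, hε₁, h⟩ := h
  have hcl : IsCompact (closure Ω) := hb.isCompact_closure
  have hcf : IsCompact (frontier Ω) := hcl.of_isClosed_subset isClosed_frontier frontier_subset_closure
  -- One threshold serves all times: half of the minimum of `‖H‖` over the compact product of the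
  -- interval and the frontier.
  obtain ⟨ε₂, hε₂, hε⟩ : ∃ ε > 0, ∀ s ∈ Icc (0 : ℝ) 1, ∀ x ∈ frontier Ω, ε < ‖H (s, x)‖ := by
    have hK := (isCompact_Icc (a := (0 : ℝ)) (b := 1)).prod hcf
    rcases (Icc (0 : ℝ) 1 ×ˢ frontier Ω).eq_empty_or_nonempty with he | hne
    · exact ⟨1, one_pos, fun s hs x hx => absurd (mk_mem_prod hs hx) (by simp [he])⟩
    obtain ⟨p, hp, hmin⟩ := hK.exists_isMinOn hne (f := fun q => ‖H q‖) (by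
      rintro ⟨s, x⟩ ⟨_, hx⟩
      exact (hH s x (frontier_subset_closure hx)).continuousAt.norm.continuousWithinAt)
    have hpos : 0 < ‖H p‖ := norm_pos_iff.2 (hfr p.1 hp.1 p.2 hp.2)
    exact ⟨‖H p‖ / 2, half_pos hpos, fun s hs x hx =>
      lt_of_lt_of_le (half_lt_self hpos) (hmin (mk_mem_prod hs hx))⟩
  refine ⟨min ε₁ ε₂, lt_min hε₁ hε₂, fun ρ hρc hρ => ?_⟩
  set b := Module.finBasis ℝ E
  have hder : ∀ s ∈ Icc (0 : ℝ) 1, HasDerivAt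
      (fun s => ∫ x, pullbackDensity b H ρ Ω (fun i => ((0 : ℝ), b i)) (s, x) ∂Measure.addHaar) 0 s :=
    fun s hs => hasDerivAt_integral_pullbackDensity _ b hΩ hb hρc hρ hH
      fun x hx => (min_le_right _ _).trans_lt (hε s hs x hx)
  have hconst := constant_of_has_deriv_right_zero
    (fun s hs => (hder s hs).continuousAt.continuousWithinAt)
    (fun s hs => (hder s (Ico_subset_Icc_self hs)).hasDerivWithinAt) 1 (right_mem_Icc.2 zero_le_one)
  rw [integral_pullbackDensity_eq _ b ρ hΩ (hH 1), integral_pullbackDensity_eq _ b ρ hΩ (hH 0)]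
    at hconst
  rw [hconst]
  exact h ρ hρc fun y hy => hρ y ((min_le_left _ _).trans hy)

end Degree

/-! ### Uniqueness, excision, counting of simple zeros, regular values, Rouché's principle. -/

section Degree

variable {E : Type*} [NormedAddCommGroup E] [NormedSpace ℝ E] [FiniteDimensional ℝ E]
  [MeasurableSpace E] [BorelSpace E]

theorem exists_bump (E : Type*) [NormedAddCommGroup E] [NormedSpace ℝ E] [FiniteDimensional ℝ E]
    [MeasurableSpace E] [BorelSpace E] {ε : ℝ} (hε : 0 < ε) :
    ∃ ρ : E → ℝ, ContDiff ℝ 1 ρ ∧ (∀ y, ε ≤ ‖y‖ → ρ y = 0) ∧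
      0 < ∫ y, ρ y ∂(Measure.addHaar : Measure E) := by
  let f : ContDiffBump (0 : E) := ⟨ε / 2, ε, half_pos hε, half_lt_self hε⟩
  refine ⟨f, f.contDiff, fun y hy => f.zero_of_le_dist (by simpa using hy), f.integral_pos⟩

/-- A bump of positive integral supported below both thresholds compares the two numbers. -/
theorem HasDegree.unique {G : E → E} {Ω : Set E} {d d' : ℤ} (h : HasDegree G Ω d)
    (h' : HasDegree G Ω d') : d = d' := by
  obtain ⟨ε, hε, h⟩ := h
  obtain ⟨ε', hε', h'⟩ := h'
  obtain ⟨ρ, hρc, hρ, hpos⟩ := exists_bump E (lt_min hε hε')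
  have h1 := h ρ hρc fun y hy => hρ y ((min_le_left _ _).trans hy)
  have h2 := h' ρ hρc fun y hy => hρ y ((min_le_right _ _).trans hy)
  have := mul_right_cancel₀ hpos.ne' (h1.symm.trans h2)
  exact_mod_cast this

/-- The two integrals can differ only over the symmetric difference of the domains, where `‖G‖ ≥ ε`
and the bump vanishes. -/
theorem HasDegree.excision {G : E → E} {Ω Ω' : Set E} (hΩ : IsOpen Ω)
    (hΩ' : IsOpen Ω') {d : ℤ} (h : HasDegree G Ω d) {ε : ℝ} (hε : 0 < ε)
    (h₁ : ∀ x ∈ Ω, x ∉ Ω' → ε ≤ ‖G x‖) (h₂ : ∀ x ∈ Ω', x ∉ Ω → ε ≤ ‖G x‖) :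
    HasDegree G Ω' d := by
  obtain ⟨ε', hε', h⟩ := h
  refine ⟨min ε ε', lt_min hε hε', fun ρ hρc hρ => ?_⟩
  rw [← h ρ hρc fun y hy => hρ y ((min_le_right _ _).trans hy),
    ← integral_indicator hΩ.measurableSet, ← integral_indicator hΩ'.measurableSet]
  congr 1; ext x
  by_cases hx : x ∈ Ω <;> by_cases hx' : x ∈ Ω' <;> simp only [hx, hx', indicator_of_mem,
    indicator_of_notMem, not_false_eq_true]
  · rw [hρ _ ((min_le_left _ _).trans (h₁ x hx hx')), zero_mul]
  · rw [hρ _ ((min_le_left _ _).trans (h₂ x hx' hx)), zero_mul]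

theorem HasDegree.congr {G G' : E → E} {Ω : Set E} (hΩ : IsOpen Ω) {d : ℤ} (h : HasDegree G Ω d)
    (hG : EqOn G G' Ω) : HasDegree G' Ω d := by
  obtain ⟨ε, hε, h⟩ := h
  refine ⟨ε, hε, fun ρ hρc hρ => ?_⟩
  rw [← h ρ hρc hρ]
  refine setIntegral_congr_fun hΩ.measurableSet fun x hx => ?_
  have : G =ᶠ[𝓝 x] G' := by filter_upwards [hΩ.mem_nhds hx] with y hy using hG hy
  simp only [hG hx, this.fderiv_eq]

omit [MeasurableSpace E] [BorelSpace E] in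
-- The inverse function theorem, in the form needed for the change of variables: the neighbourhood
-- is also small enough for the sign of the Jacobian to be constant.
theorem exists_injOn_nhds_of_det_ne_zero {G : E → E} {z : E} (hG : ContDiffAt ℝ 1 G z)
    (hdet : (fderiv ℝ G z).det ≠ 0) {W : Set E} (hW : W ∈ 𝓝 z) :
    ∃ V, IsOpen V ∧ z ∈ V ∧ V ⊆ W ∧ InjOn G V ∧ G '' V ∈ 𝓝 (G z) ∧
      ∀ x ∈ V, DifferentiableAt ℝ G x ∧
        SignType.sign (fderiv ℝ G x).det = SignType.sign (fderiv ℝ G z).det := by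
  have hs : HasStrictFDerivAt G
      ((fderiv ℝ G z).toContinuousLinearEquivOfDetNeZero hdet : E →L[ℝ] E) z := by
    rw [ContinuousLinearMap.coe_toContinuousLinearEquivOfDetNeZero]
    exact hG.hasStrictFDerivAt (by norm_num)
  let e := hs.toOpenPartialHomeomorph G
  have he : ∀ x, e x = G x := fun x => by simp [e]
  have hsign : ∀ᶠ x in 𝓝 z, SignType.sign (fderiv ℝ G x).det = SignType.sign (fderiv ℝ G z).det := by
    have hc : ContinuousAt (fun x => (fderiv ℝ G x).det) z :=
      ContinuousLinearMap.continuous_det.continuousAt.comp (hG.continuousAt_fderiv (by norm_num))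
    rcases lt_or_gt_of_ne hdet with h | h
    · filter_upwards [hc.eventually (gt_mem_nhds h)] with x hx
      rw [sign_neg hx, sign_neg h]
    · filter_upwards [hc.eventually (lt_mem_nhds h)] with x hx
      rw [sign_pos hx, sign_pos h]
  have hdiff : ∀ᶠ x in 𝓝 z, DifferentiableAt ℝ G x :=
    (hG.eventually (by simp)).mono fun x hx => hx.differentiableAt (by norm_num)
  have hall : W ∩ e.source ∩ {x | DifferentiableAt ℝ G x ∧
      SignType.sign (fderiv ℝ G x).det = SignType.sign (fderiv ℝ G z).det} ∈ 𝓝 z :=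
    inter_mem (inter_mem hW (e.open_source.mem_nhds (hs.mem_toOpenPartialHomeomorph_source)))
      (hdiff.and hsign)
  obtain ⟨V, hVs, hVo, hzV⟩ := mem_nhds_iff.1 hall
  have hsrc : V ⊆ e.source := fun x hx => (hVs hx).1.2
  refine ⟨V, hVo, hzV, fun x hx => (hVs hx).1.1, ?_, ?_, fun x hx => (hVs hx).2⟩
  · intro x hx y hy hxy
    exact e.injOn (hsrc hx) (hsrc hy) (by rw [he, he, hxy])
  · have := e.isOpen_image_of_subset_source hVo hsrc
    rw [show e '' V = G '' V from image_congr fun x _ => he x] at this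
    exact this.mem_nhds (mem_image_of_mem _ hzV)

omit [MeasurableSpace E] [BorelSpace E] in
-- The zero set is compact, since it avoids the frontier, and discrete by local injectivity.
theorem finite_zeros_of_det_ne_zero {G : E → E} {Ω : Set E} (hΩ : IsOpen Ω)
    (hb : Bornology.IsBounded Ω) (hG : ∀ x ∈ closure Ω, ContDiffAt ℝ 1 G x)
    (hfr : ∀ x ∈ frontier Ω, G x ≠ 0)
    (hdet : ∀ x ∈ Ω, G x = 0 → (fderiv ℝ G x).det ≠ 0) : {x | x ∈ Ω ∧ G x = 0}.Finite := by
  have hZ : {x | x ∈ Ω ∧ G x = 0} = closure Ω ∩ G ⁻¹' {0} := by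
    ext x
    refine ⟨fun h => ⟨subset_closure h.1, h.2⟩, fun h => ⟨?_, h.2⟩⟩
    by_contra hx
    exact hfr x (by rw [hΩ.frontier_eq]; exact ⟨h.1, hx⟩) h.2
  have hcl : IsCompact (closure Ω) := hb.isCompact_closure
  have hK : IsCompact {x | x ∈ Ω ∧ G x = 0} := by
    rw [hZ]
    have hc : ContinuousOn G (closure Ω) := fun x hx => (hG x hx).continuousAt.continuousWithinAt
    exact hcl.of_isClosed_subset (hc.preimage_isClosed_of_isClosed isClosed_closure
      isClosed_singleton) inter_subset_left
  refine hK.finite ?_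
  refine isDiscrete_iff_forall_mem_exists_isOpen.2 fun z hz => ?_
  obtain ⟨V, hVo, hzV, -, hinj, -, -⟩ := exists_injOn_nhds_of_det_ne_zero
    (hG z (subset_closure hz.1)) (hdet z hz.1 hz.2) univ_mem
  refine ⟨V, hVo, ?_⟩
  ext x
  simp only [mem_inter_iff, mem_ofPred_eq, mem_singleton_iff]
  constructor
  · rintro ⟨hx, -, h0⟩
    exact hinj hx hzV (h0.trans hz.2.symm)
  · rintro rfl
    exact ⟨hzV, hz⟩

/-- If all zeros are non-degenerate then the degree is the sum of their signs. -/
theorem hasDegree_of_det_ne_zero {G : E → E} {Ω : Set E} (hΩ : IsOpen Ω)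
    (hb : Bornology.IsBounded Ω) (hG : ∀ x ∈ closure Ω, ContDiffAt ℝ 1 G x)
    (hfr : ∀ x ∈ frontier Ω, G x ≠ 0)
    (hdet : ∀ x ∈ Ω, G x = 0 → (fderiv ℝ G x).det ≠ 0) (Z : Finset E)
    (hZ : ∀ x, x ∈ Z ↔ x ∈ Ω ∧ G x = 0) :
    HasDegree G Ω (∑ z ∈ Z, (SignType.sign (fderiv ℝ G z).det : ℤ)) := by
  classical
  -- Disjoint neighbourhoods of the zeros, so that the integral splits into local contributions.
  obtain ⟨U, hU, hUd⟩ := Z.finite_toSet.t2_separation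
  have hloc : ∀ z : E, ∃ V : Set E, z ∈ Z → IsOpen V ∧ z ∈ V ∧ V ⊆ Ω ∩ U z ∧ InjOn G V ∧
      G '' V ∈ 𝓝 (0 : E) ∧ ∀ x ∈ V, DifferentiableAt ℝ G x ∧
        SignType.sign (fderiv ℝ G x).det = SignType.sign (fderiv ℝ G z).det := by
    intro z
    by_cases hz : z ∈ Z
    · obtain ⟨hzΩ, hz0⟩ := (hZ z).1 hz
      obtain ⟨V, h1, h2, h3, h4, h5, h6⟩ := exists_injOn_nhds_of_det_ne_zero
        (hG z (subset_closure hzΩ)) (hdet z hzΩ hz0)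
        (inter_mem (hΩ.mem_nhds hzΩ) ((hU z).2.mem_nhds (hU z).1))
      exact ⟨V, fun _ => ⟨h1, h2, h3, h4, hz0 ▸ h5, h6⟩⟩
    · exact ⟨∅, fun h => absurd h hz⟩
  choose V hV using hloc
  -- For small `ε` each local image covers the support of the bump, so each zero contributes the
  -- full integral of `ρ`, up to sign.
  have hball : ∀ᶠ ε in 𝓝[>] (0 : ℝ), ∀ z ∈ Z, Metric.ball 0 ε ⊆ G '' V z := by
    refine (Finset.eventually_all Z).2 fun z hz => ?_
    obtain ⟨ε, hε, hs⟩ := Metric.mem_nhds_iff.1 (hV z hz).2.2.2.2.1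
    filter_upwards [Ioo_mem_nhdsGT hε] with ε' hε'
    exact (Metric.ball_subset_ball hε'.2.le).trans hs
  -- Away from the chosen neighbourhoods `‖G‖` is bounded below by compactness, so nothing else
  -- contributes.
  have hfar : ∀ᶠ ε in 𝓝[>] (0 : ℝ), ∀ x ∈ Ω, (∀ z ∈ Z, x ∉ V z) → ε ≤ ‖G x‖ := by
    have hK : IsCompact (closure Ω \ ⋃ z ∈ Z, V z) :=
      hb.isCompact_closure.diff (isOpen_biUnion fun z hz => (hV z hz).1)
    rcases (closure Ω \ ⋃ z ∈ Z, V z).eq_empty_or_nonempty with he | hne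
    · filter_upwards with ε x hx hxV
      exact absurd (show x ∈ closure Ω \ ⋃ z ∈ Z, V z from ⟨subset_closure hx, by simpa using hxV⟩)
        (by simp [he])
    obtain ⟨p, hp, hmin⟩ := hK.exists_isMinOn hne (f := fun q => ‖G q‖)
      fun x hx => (hG x hx.1).continuousAt.norm.continuousWithinAt
    have hpos : 0 < ‖G p‖ := by
      refine norm_pos_iff.2 fun h0 => ?_
      by_cases hpΩ : p ∈ Ω
      · exact hp.2 (mem_biUnion ((hZ p).2 ⟨hpΩ, h0⟩) (hV p ((hZ p).2 ⟨hpΩ, h0⟩)).2.1)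
      · exact hfr p (by rw [hΩ.frontier_eq]; exact ⟨hp.1, hpΩ⟩) h0
    filter_upwards [Ioo_mem_nhdsGT hpos] with ε hε x hx hxV
    exact hε.2.le.trans (hmin ⟨subset_closure hx, by simpa using hxV⟩)
  obtain ⟨ε, ⟨hε1, hε2⟩, hε⟩ := ((hball.and hfar).and self_mem_nhdsWithin).exists
  refine ⟨ε, hε, fun ρ hρc hρ => ?_⟩
  have hρi : Integrable ρ (Measure.addHaar : Measure E) := by
    refine hρc.continuous.integrable_of_hasCompactSupport ?_
    exact HasCompactSupport.intro (isCompact_closedBall 0 ε) fun x hx => hρ x (by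
      simp only [Metric.mem_closedBall, dist_zero_right, not_le] at hx; exact hx.le)
  -- The constant sign is extracted, which leaves the absolute Jacobian of the change of variables
  -- formula.
  have hFV : ∀ z ∈ Z, ∀ x ∈ V z, ρ (G x) * (fderiv ℝ G x).det =
      (SignType.sign (fderiv ℝ G z).det : ℝ) * (|(fderiv ℝ G x).det| • ρ (G x)) := by
    intro z hz x hx
    rw [← ((hV z hz).2.2.2.2.2 x hx).2, smul_eq_mul, ← mul_assoc, sign_mul_abs, mul_comm]
  have hder : ∀ z ∈ Z, ∀ x ∈ V z, HasFDerivWithinAt G (fderiv ℝ G x) (V z) x := fun z hz x hx =>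
    ((hV z hz).2.2.2.2.2 x hx).1.hasFDerivAt.hasFDerivWithinAt
  have hint : ∀ z ∈ Z, IntegrableOn (fun x => ρ (G x) * (fderiv ℝ G x).det) (V z)
      Measure.addHaar := by
    intro z hz
    refine IntegrableOn.congr_fun ?_ (fun x hx => (hFV z hz x hx).symm) (hV z hz).1.measurableSet
    refine Integrable.const_mul ?_ _
    exact (integrableOn_image_iff_integrableOn_abs_det_fderiv_smul _ (hV z hz).1.measurableSet
      (hder z hz) (hV z hz).2.2.2.1 ρ).1 hρi.integrableOn
  have hval : ∀ z ∈ Z, ∫ x in V z, ρ (G x) * (fderiv ℝ G x).det ∂Measure.addHaar =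
      (SignType.sign (fderiv ℝ G z).det : ℝ) * ∫ y, ρ y ∂(Measure.addHaar : Measure E) := by
    intro z hz
    rw [setIntegral_congr_fun (hV z hz).1.measurableSet (fun x hx => hFV z hz x hx),
      integral_const_mul, ← integral_image_eq_integral_abs_det_fderiv_smul _
      (hV z hz).1.measurableSet (hder z hz) (hV z hz).2.2.2.1 ρ]
    congr 1
    refine setIntegral_eq_integral_of_forall_compl_eq_zero fun y hy => hρ y ?_
    by_contra hlt
    exact hy (hε1 z hz (by simpa using hlt))
  have hsub : (⋃ z ∈ Z, V z) ⊆ Ω := iUnion₂_subset fun z hz x hx => ((hV z hz).2.2.1 hx).1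
  rw [setIntegral_eq_of_subset_of_forall_sdiff_eq_zero hΩ.measurableSet hsub, integral_biUnion_finset Z
    (fun z hz => (hV z hz).1.measurableSet) ?_ hint, Finset.sum_congr rfl hval, ← Finset.sum_mul]
  · push_cast; rfl
  · intro z hz z' hz' hne
    refine (hUd hz hz' hne).mono ?_ ?_
    · exact fun x hx => ((hV z hz).2.2.1 hx).2
    · exact fun x hx => ((hV z' hz').2.2.1 hx).2
  · rintro x ⟨hx, hxV⟩
    rw [hρ _ (hε2 x hx (by simpa using hxV)), zero_mul]

/-- Sard's theorem: there are arbitrarily small regular values. -/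
theorem exists_small_regular_value {G : E → E} {Ω : Set E} (hG : ∀ x ∈ Ω, DifferentiableAt ℝ G x)
    {ε : ℝ} (hε : 0 < ε) :
    ∃ v : E, ‖v‖ < ε ∧ ∀ x ∈ Ω, G x = v → (fderiv ℝ G x).det ≠ 0 := by
  -- The critical values form a null set, so they cannot fill a ball.
  have h0 := addHaar_image_eq_zero_of_det_fderivWithin_eq_zero (Measure.addHaar : Measure E)
    (s := {x | x ∈ Ω ∧ (fderiv ℝ G x).det = 0}) (f := G) (f' := fun x => fderiv ℝ G x)
    (fun x hx => (hG x hx.1).hasFDerivAt.hasFDerivWithinAt) (fun x hx => hx.2)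
  have hpos : 0 < (Measure.addHaar : Measure E) (Metric.ball 0 ε) := Metric.measure_ball_pos _ _ hε
  by_contra hcon
  push Not at hcon
  refine absurd (measure_mono (μ := (Measure.addHaar : Measure E))
    (show Metric.ball (0 : E) ε ⊆ G '' {x | x ∈ Ω ∧ (fderiv ℝ G x).det = 0} from ?_))
    (by rw [h0]; exact not_le.2 hpos)
  intro v hv
  obtain ⟨x, hx, hxv, hd⟩ := hcon v (by simpa using hv)
  exact ⟨x, ⟨hx, hd⟩, hxv⟩

/-- Invariance of the degree under the linear homotopy. -/
theorem HasDegree.of_segment {G G' : E → E} {Ω : Set E} (hΩ : IsOpen Ω)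
    (hb : Bornology.IsBounded Ω) (hG : ∀ x ∈ closure Ω, ContDiffAt ℝ 2 G x)
    (hG' : ∀ x ∈ closure Ω, ContDiffAt ℝ 2 G' x)
    (hfr : ∀ s ∈ Icc (0 : ℝ) 1, ∀ x ∈ frontier Ω, (1 - s) • G x + s • G' x ≠ 0) {d : ℤ}
    (h : HasDegree G Ω d) : HasDegree G' Ω d := by
  have := HasDegree.homotopy (H := fun p : ℝ × E => (1 - p.1) • G p.2 + p.1 • G' p.2) hΩ hb
    (fun s x hx => ?_) hfr (d := d) (by simpa using h)
  · simpa using this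
  · have h1 : ContDiffAt ℝ 2 (fun p : ℝ × E => G p.2) (s, x) :=
      (hG x hx).comp (s, x) contDiffAt_snd
    have h2 : ContDiffAt ℝ 2 (fun p : ℝ × E => G' p.2) (s, x) :=
      (hG' x hx).comp (s, x) contDiffAt_snd
    exact ((contDiffAt_const.sub contDiffAt_fst).smul h1).add (contDiffAt_fst.smul h2)

/-- The degree does not change under perturbations that are small on the boundary. -/
theorem HasDegree.of_norm_sub_lt {G G' : E → E} {Ω : Set E} (hΩ : IsOpen Ω)
    (hb : Bornology.IsBounded Ω) (hG : ∀ x ∈ closure Ω, ContDiffAt ℝ 2 G x)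
    (hG' : ∀ x ∈ closure Ω, ContDiffAt ℝ 2 G' x)
    (hfr : ∀ x ∈ frontier Ω, ‖G' x - G x‖ < ‖G x‖) {d : ℤ}
    (h : HasDegree G Ω d) : HasDegree G' Ω d := by
  refine h.of_segment hΩ hb hG hG' fun s hs x hx h0 => ?_
  -- At a zero of the segment `‖G x‖ = s ‖G' x - G x‖` with `s ≤ 1`, against the assumed strict
  -- inequality.
  have h1 : G x = -(s • (G' x - G x)) := by
    rw [smul_sub]; rw [sub_smul, one_smul] at h0
    rw [← sub_eq_zero, ← h0]; abel
  have h2 : ‖G x‖ ≤ ‖G' x - G x‖ := by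
    conv_lhs => rw [h1, norm_neg, norm_smul, Real.norm_of_nonneg hs.1]
    exact mul_le_of_le_one_left (norm_nonneg _) hs.2
  exact absurd (hfr x hx) (not_lt.2 h2)

end Degree

/-! ### Degree of holomorphic maps as a bound for the number of zeros. -/

section ComplexDegree

variable {E : Type*} [NormedAddCommGroup E] [NormedSpace ℂ E]

/-- Lagrange interpolation: `θ p` equals `1` at `p` and `0` at the other points of `P`, and its
square has zero derivative there too. Adding a multiple of `A` to a map keeps its zeros at `P` while
moving its derivatives there by a multiple of the identity. -/
theorem exists_interpolating_identity (P : Finset E) : ∃ A : E → E, AnalyticOnNhd ℂ A univ ∧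
    ∀ p ∈ P, A p = 0 ∧ HasFDerivAt A (ContinuousLinearMap.id ℂ E) p := by
  classical
  have hℓ : ∀ p q : E, ∃ ℓ : E →L[ℂ] ℂ, p ≠ q → ℓ (p - q) = 1 := by
    intro p q
    by_cases h : p = q
    · exact ⟨0, fun h' => absurd h h'⟩
    · obtain ⟨f, hf⟩ := SeparatingDual.exists_eq_one (R := ℂ) (sub_ne_zero.2 h)
      exact ⟨f, fun _ => hf⟩
  choose ℓ hℓ using hℓ
  let θ : E → E → ℂ := fun p x => ∏ q ∈ P.erase p, ℓ p q (x - q)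
  have hθa : ∀ p, AnalyticOnNhd ℂ (θ p) univ := fun p x _ =>
    Finset.analyticAt_fun_prod _ fun q _ =>
      ((ℓ p q).analyticAt _).comp (f := fun x => x - q) (analyticAt_id.sub analyticAt_const)
  have hθ1 : ∀ p, θ p p = 1 := fun p => Finset.prod_eq_one fun q hq =>
    hℓ p q (Finset.ne_of_mem_erase hq).symm
  have hθ0 : ∀ p, ∀ q ∈ P, q ≠ p → θ p q = 0 := fun p q hq hne =>
    Finset.prod_eq_zero (Finset.mem_erase.2 ⟨hne, hq⟩) (by simp)
  refine ⟨fun x => ∑ p ∈ P, (θ p x) ^ 2 • (x - p), fun x _ => ?_, fun p hp => ⟨?_, ?_⟩⟩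
  · exact Finset.analyticAt_fun_sum _ fun p _ =>
      ((hθa p x (mem_univ _)).pow 2).smul (analyticAt_id.sub analyticAt_const)
  · refine Finset.sum_eq_zero fun q hq => ?_
    by_cases h : p = q
    · simp [h]
    · simp [hθ0 q p hp h]
  · have hd : ∀ q ∈ P, HasFDerivAt (fun x => (θ q x) ^ 2 • (x - q))
        (if q = p then ContinuousLinearMap.id ℂ E else 0) p := by
      intro q hq
      have h1 := ((hθa q p (mem_univ _)).differentiableAt.hasFDerivAt).pow 2
      have h2 := h1.smul ((hasFDerivAt_id (𝕜 := ℂ) p).sub_const q)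
      refine h2.congr_fderiv ?_
      split_ifs with h
      · subst h
        ext y; simp [hθ1]
      · ext y; simp [hθ0 q p hp (Ne.symm h)]
    have := HasFDerivAt.fun_sum hd
    simpa [hp] using this

variable [FiniteDimensional ℂ E]

instance finiteDimensional_real_of_complex : FiniteDimensional ℝ E :=
  FiniteDimensional.complexToReal E

/-- The real determinant of a complex linear map is the squared modulus of the complex one. Hence
every simple zero of a holomorphic map counts as `+1`. -/
theorem det_fderiv_real {G : E → E} {x : E} (hG : DifferentiableAt ℂ G x) :
    (fderiv ℝ G x).det = Complex.normSq (fderiv ℂ G x).det := by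
  rw [hG.fderiv_restrictScalars ℝ]
  have := LinearMap.det_restrictScalars (R := ℝ) (S := ℂ) (A := E)
    (f := (fderiv ℂ G x : E →ₗ[ℂ] E))
  rw [Algebra.norm_complex_eq] at this
  exact this

theorem exists_pos_le_norm_on_frontier {G : E → E} {Ω : Set E} (hb : Bornology.IsBounded Ω)
    (hG : ∀ x ∈ closure Ω, ContinuousAt G x) (hfr : ∀ x ∈ frontier Ω, G x ≠ 0) :
    ∃ c > 0, ∀ x ∈ frontier Ω, c ≤ ‖G x‖ := by
  have hcf : IsCompact (frontier Ω) :=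
    hb.isCompact_closure.of_isClosed_subset isClosed_frontier frontier_subset_closure
  rcases (frontier Ω).eq_empty_or_nonempty with he | hne
  · exact ⟨1, one_pos, by simp [he]⟩
  obtain ⟨p, hp, hmin⟩ := hcf.exists_isMinOn hne (f := fun q => ‖G q‖)
    fun x hx => (hG x (frontier_subset_closure hx)).norm.continuousWithinAt
  exact ⟨‖G p‖, norm_pos_iff.2 (hfr p hp), fun x hx => hmin hx⟩

/-- The determinant vanishes only when `-s` is one of the finitely many eigenvalues of `L`. -/
theorem eventually_det_add_smul_id_ne_zero (L : E →L[ℂ] E) :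
    ∀ᶠ s : ℝ in 𝓝[>] 0, (L + (s : ℂ) • ContinuousLinearMap.id ℂ E).det ≠ 0 := by
  have hfin : {μ : ℂ | Module.End.HasEigenvalue (L : E →ₗ[ℂ] E) μ}.Finite :=
    Module.End.finite_hasEigenvalue _
  have hfin' : {s : ℝ | Module.End.HasEigenvalue (L : E →ₗ[ℂ] E) (-(s : ℂ))}.Finite :=
    hfin.preimage (f := fun s : ℝ => -(s : ℂ)) (fun a _ b _ h => by simpa using h)
  have hev : ∀ᶠ s : ℝ in 𝓝[>] 0, s ∉ {s : ℝ | Module.End.HasEigenvalue (L : E →ₗ[ℂ] E) (-(s : ℂ))} := by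
    have h1 : ({s : ℝ | Module.End.HasEigenvalue (L : E →ₗ[ℂ] E) (-(s : ℂ))} \ {0})ᶜ ∈ 𝓝 (0 : ℝ) :=
      (hfin'.sdiff.isClosed.isOpen_compl).mem_nhds (by simp)
    filter_upwards [mem_nhdsWithin_of_mem_nhds h1, self_mem_nhdsWithin] with s hs hs0 hmem
    exact hs ⟨hmem, ne_of_gt hs0⟩
  filter_upwards [hev] with s hs hdet
  refine hs ?_
  have h0 : LinearMap.det ((L : E →ₗ[ℂ] E) + (s : ℂ) • LinearMap.id) = 0 := hdet
  have hk := LinearMap.bot_lt_ker_of_det_eq_zero h0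
  obtain ⟨v, hv, hv0⟩ := Submodule.exists_mem_ne_zero_of_ne_bot hk.ne'
  refine Module.End.hasEigenvalue_of_hasEigenvector (x := v) ⟨?_, hv0⟩
  rw [Module.End.mem_eigenspace_iff]
  have : L v + (s : ℂ) • v = 0 := by simpa using hv
  simpa using eq_neg_of_add_eq_zero_left this

variable [MeasurableSpace E] [BorelSpace E]

/-- The degree of a map between complex vector spaces. -/
def HasComplexDegree (G : E → E) (Ω : Set E) (d : ℤ) : Prop := HasDegree G Ω d

theorem HasComplexDegree.unique {G : E → E} {Ω : Set E} {d d' : ℤ} (h : HasComplexDegree G Ω d)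
    (h' : HasComplexDegree G Ω d') : d = d' :=
  HasDegree.unique h h'

theorem HasComplexDegree.congr {G G' : E → E} {Ω : Set E} (hΩ : IsOpen Ω) {d : ℤ}
    (h : HasComplexDegree G Ω d) (hG : EqOn G G' Ω) : HasComplexDegree G' Ω d :=
  HasDegree.congr hΩ h hG

/-- A holomorphic map whose zeros are non-degenerate has as many zeros as is its degree. -/
theorem hasComplexDegree_card {G : E → E} {Ω : Set E} (hΩ : IsOpen Ω)
    (hb : Bornology.IsBounded Ω) (hG : ∀ x ∈ closure Ω, AnalyticAt ℂ G x)
    (hfr : ∀ x ∈ frontier Ω, G x ≠ 0)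
    (hdet : ∀ x ∈ Ω, G x = 0 → (fderiv ℂ G x).det ≠ 0) (Z : Finset E)
    (hZ : ∀ x, x ∈ Z ↔ x ∈ Ω ∧ G x = 0) : HasComplexDegree G Ω Z.card := by
  have hpos : ∀ x ∈ Ω, G x = 0 → 0 < (fderiv ℝ G x).det := fun x hx h0 => by
    rw [det_fderiv_real (hG x (subset_closure hx)).differentiableAt]
    exact Complex.normSq_pos.2 (hdet x hx h0)
  have := hasDegree_of_det_ne_zero hΩ hb
    (fun x hx => ((hG x hx).contDiffAt (n := 1)).restrict_scalars ℝ) hfr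
    (fun x hx h0 => (hpos x hx h0).ne') Z hZ
  rw [Finset.sum_congr rfl (g := fun _ => 1)] at this
  · simpa [HasComplexDegree] using this
  · intro z hz
    have hz' := (hZ z).1 hz
    rw [sign_pos (hpos z hz'.1 hz'.2)]; rfl

omit [MeasurableSpace E] [BorelSpace E] in
theorem finite_complex_zeros {G : E → E} {Ω : Set E} (hΩ : IsOpen Ω)
    (hb : Bornology.IsBounded Ω) (hG : ∀ x ∈ closure Ω, AnalyticAt ℂ G x)
    (hfr : ∀ x ∈ frontier Ω, G x ≠ 0)
    (hdet : ∀ x ∈ Ω, G x = 0 → (fderiv ℂ G x).det ≠ 0) : {x | x ∈ Ω ∧ G x = 0}.Finite := by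
  refine finite_zeros_of_det_ne_zero hΩ hb
    (fun x hx => ((hG x hx).contDiffAt (n := 1)).restrict_scalars ℝ) hfr fun x hx h0 => ?_
  rw [det_fderiv_real (hG x (subset_closure hx)).differentiableAt]
  exact (Complex.normSq_pos.2 (hdet x hx h0)).ne'

theorem HasComplexDegree.perturb {G G' : E → E} {Ω : Set E} (hΩ : IsOpen Ω)
    (hb : Bornology.IsBounded Ω) (hG : ∀ x ∈ closure Ω, AnalyticAt ℂ G x)
    (hG' : ∀ x ∈ closure Ω, AnalyticAt ℂ G' x)
    (hfr : ∀ x ∈ frontier Ω, ‖G' x - G x‖ < ‖G x‖) {d : ℤ}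
    (h : HasComplexDegree G Ω d) : HasComplexDegree G' Ω d :=
  HasDegree.of_norm_sub_lt hΩ hb (fun x hx => ((hG x hx).contDiffAt (n := 2)).restrict_scalars ℝ)
    (fun x hx => ((hG' x hx).contDiffAt (n := 2)).restrict_scalars ℝ) hfr h

theorem HasComplexDegree.of_segment {G G' : E → E} {Ω : Set E} (hΩ : IsOpen Ω)
    (hb : Bornology.IsBounded Ω) (hG : ∀ x ∈ closure Ω, AnalyticAt ℂ G x)
    (hG' : ∀ x ∈ closure Ω, AnalyticAt ℂ G' x)
    (hfr : ∀ s ∈ Icc (0 : ℝ) 1, ∀ x ∈ frontier Ω, (1 - (s : ℂ)) • G x + (s : ℂ) • G' x ≠ 0) {d : ℤ}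
    (h : HasComplexDegree G Ω d) : HasComplexDegree G' Ω d := by
  refine HasDegree.of_segment hΩ hb (fun x hx => ((hG x hx).contDiffAt (n := 2)).restrict_scalars ℝ)
    (fun x hx => ((hG' x hx).contDiffAt (n := 2)).restrict_scalars ℝ) (fun s hs x hx h0 => ?_) h
  refine hfr s hs x hx ?_
  rw [← h0, ← Complex.coe_smul, ← Complex.coe_smul]
  push_cast
  rfl

/-- The number of distinct zeros of a holomorphic map does not exceed its degree. -/
theorem HasComplexDegree.card_le {G : E → E} {Ω : Set E} (hΩ : IsOpen Ω)
    (hb : Bornology.IsBounded Ω) (hG : ∀ x ∈ closure Ω, AnalyticAt ℂ G x)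
    (hfr : ∀ x ∈ frontier Ω, G x ≠ 0) {d : ℤ} (h : HasComplexDegree G Ω d)
    (P : Finset E) (hP : ∀ p ∈ P, p ∈ Ω ∧ G p = 0) : (P.card : ℤ) ≤ d := by
  classical
  obtain ⟨A, hA, hAP⟩ := exists_interpolating_identity P
  obtain ⟨c, hc, hcG⟩ := exists_pos_le_norm_on_frontier hb (fun x hx => (hG x hx).continuousAt) hfr
  obtain ⟨C, hC⟩ := hb.isCompact_closure.exists_bound_of_continuousOn (f := A)
    fun x _ => (hA x (mem_univ _)).continuousAt.continuousWithinAt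
  -- Adding `s A` keeps all points of `P` as zeros and makes them simple. The bound by `c / 2`
  -- leaves room for a second perturbation of the same size.
  obtain ⟨s, ⟨⟨hs1, hs2⟩, hs0⟩⟩ : ∃ s : ℝ, ((∀ p ∈ P,
      (fderiv ℂ G p + (s : ℂ) • ContinuousLinearMap.id ℂ E).det ≠ 0) ∧ s * C < c / 2) ∧ 0 < s := by
    have h1 : ∀ᶠ s : ℝ in 𝓝[>] 0, ∀ p ∈ P,
        (fderiv ℂ G p + (s : ℂ) • ContinuousLinearMap.id ℂ E).det ≠ 0 :=
      (Finset.eventually_all P).2 fun p _ => eventually_det_add_smul_id_ne_zero _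
    have h2 : ∀ᶠ s : ℝ in 𝓝[>] 0, s * C < c / 2 := by
      have : Tendsto (fun s : ℝ => s * C) (𝓝 0) (𝓝 0) := by
        simpa using (continuous_id.mul continuous_const).tendsto (x := (0 : ℝ)) (f := fun s : ℝ => s * C)
      exact mem_nhdsWithin_of_mem_nhds (this.eventually (gt_mem_nhds (half_pos hc)))
    exact ((h1.and h2).and self_mem_nhdsWithin).exists
  set G₁ : E → E := fun x => G x + (s : ℂ) • A x
  have hG₁ : ∀ x ∈ closure Ω, AnalyticAt ℂ G₁ x := fun x hx =>
    (hG x hx).add (analyticAt_const.smul (hA x (mem_univ _)))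
  have hdiff1 : ∀ x ∈ frontier Ω, ‖G₁ x - G x‖ < c / 2 := by
    intro x hx
    simp only [G₁, add_sub_cancel_left, norm_smul, Complex.norm_real, Real.norm_of_nonneg hs0.le]
    exact (mul_le_mul_of_nonneg_left (hC x (frontier_subset_closure hx)) hs0.le).trans_lt hs2
  have hP1 : ∀ p ∈ P, G₁ p = 0 ∧ (fderiv ℂ G₁ p).det ≠ 0 := by
    intro p hp
    refine ⟨by simp [G₁, (hP p hp).2, (hAP p hp).1], ?_⟩
    have hd := ((hG p (subset_closure (hP p hp).1)).differentiableAt.hasFDerivAt).add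
      ((hAP p hp).2.const_smul (s : ℂ))
    have : fderiv ℂ G₁ p = fderiv ℂ G p + (s : ℂ) • ContinuousLinearMap.id ℂ E := hd.fderiv
    rw [this]
    exact hs1 p hp
  obtain ⟨U, hU, hUd⟩ := P.finite_toSet.t2_separation
  -- Each simple zero survives, near its own place, as a solution of `G₁ = v` for small `v`.
  have hloc : ∀ p ∈ P, ∀ᶠ ε in 𝓝[>] (0 : ℝ), ∀ v : E, ‖v‖ < ε → ∃ x ∈ Ω ∩ U p, G₁ x = v := by
    intro p hp
    have hp1 := subset_closure (hP p hp).1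
    obtain ⟨V, -, -, hVs, -, hVn, -⟩ := exists_injOn_nhds_of_det_ne_zero (G := G₁) (z := p)
      (((hG₁ p hp1).contDiffAt (n := 1)).restrict_scalars ℝ)
      (by rw [det_fderiv_real (hG₁ p hp1).differentiableAt]
          exact (Complex.normSq_pos.2 (hP1 p hp).2).ne')
      (inter_mem (hΩ.mem_nhds (hP p hp).1) ((hU p).2.mem_nhds (hU p).1))
    rw [(hP1 p hp).1] at hVn
    obtain ⟨ε, hε, hs⟩ := Metric.mem_nhds_iff.1 hVn
    filter_upwards [Ioo_mem_nhdsGT hε] with ε' hε' v hv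
    obtain ⟨x, hx, hxv⟩ := hs (show v ∈ Metric.ball 0 ε by simpa using hv.trans hε'.2)
    exact ⟨x, hVs hx, hxv⟩
  obtain ⟨ε, ⟨hε1, hεc⟩⟩ := (((Finset.eventually_all P).2 hloc).and
    (Ioo_mem_nhdsGT (half_pos hc))).exists
  -- The zeros of `G₁` outside `P` may still be degenerate. Passing to a regular value `v` makes all
  -- zeros of `G₁ - v` simple, and then the degree counts them exactly.
  obtain ⟨v, hvε, hv⟩ := exists_small_regular_value (G := G₁) (Ω := Ω)
    (fun x hx => (hG₁ x (subset_closure hx)).differentiableAt.restrictScalars ℝ) hεc.1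
  set G₂ : E → E := fun x => G₁ x - v
  have hG₂ : ∀ x ∈ closure Ω, AnalyticAt ℂ G₂ x := fun x hx => (hG₁ x hx).sub analyticAt_const
  have hsmall : ∀ x ∈ frontier Ω, ‖G₂ x - G x‖ < ‖G x‖ := by
    intro x hx
    have h1 := hdiff1 x hx
    have h2 := hcG x hx
    have h3 := hεc.2
    calc ‖G₂ x - G x‖ = ‖(G₁ x - G x) - v‖ := by simp only [G₂]; congr 1; abel
      _ ≤ ‖G₁ x - G x‖ + ‖v‖ := norm_sub_le _ _
      _ < ‖G x‖ := by linarith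
  have hfr₂ : ∀ x ∈ frontier Ω, G₂ x ≠ 0 := by
    intro x hx h0
    have := hsmall x hx
    simp [h0] at this
  have hreg : ∀ x ∈ Ω, G₂ x = 0 → (fderiv ℂ G₂ x).det ≠ 0 := by
    intro x hx h0 hd
    have hf : fderiv ℂ G₂ x = fderiv ℂ G₁ x := fderiv_sub_const _
    refine hv x hx (sub_eq_zero.1 h0) ?_
    rw [det_fderiv_real (hG₁ x (subset_closure hx)).differentiableAt, ← hf, hd, map_zero]
  have hfin := finite_complex_zeros hΩ hb hG₂ hfr₂ hreg
  have hd₂ := hasComplexDegree_card hΩ hb hG₂ hfr₂ hreg hfin.toFinset (by simp)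
  have hd := (h.perturb hΩ hb hG hG₂ hsmall).unique hd₂
  rw [hd]
  have hx : ∀ p : E, ∃ x, p ∈ P → x ∈ Ω ∩ U p ∧ G₁ x = v := by
    intro p
    by_cases hp : p ∈ P
    · obtain ⟨x, h1, h2⟩ := hε1 p hp v hvε
      exact ⟨x, fun _ => ⟨h1, h2⟩⟩
    · exact ⟨0, fun h => absurd h hp⟩
  choose x hx using hx
  have hcard := Finset.card_le_card_of_injOn (s := P) (t := hfin.toFinset) x
    (fun p hp => by
      have := hx p hp
      simp [G₂, this.1.1, this.2])
    (fun p hp q hq hpq => by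
      by_contra hne
      exact Set.disjoint_left.1 (hUd hp hq hne) (hx p hp).1.2 (hpq ▸ (hx q hq).1.2))
  exact_mod_cast hcard

/-- If a holomorphic map has as many distinct zeros as is its degree, then they are all its zeros,
and they are non-degenerate. -/
theorem HasComplexDegree.det_ne_zero_of_card_eq {G : E → E} {Ω : Set E} (hΩ : IsOpen Ω)
    (hb : Bornology.IsBounded Ω) (hG : ∀ x ∈ closure Ω, AnalyticAt ℂ G x)
    (hfr : ∀ x ∈ frontier Ω, G x ≠ 0) (P : Finset E) (h : HasComplexDegree G Ω P.card)
    (hP : ∀ p ∈ P, p ∈ Ω ∧ G p = 0) {x : E} (hx : x ∈ Ω) (hx0 : G x = 0) :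
    x ∈ P ∧ (fderiv ℂ G x).det ≠ 0 := by
  classical
  -- One more zero would exceed the bound by the degree.
  have hxP : x ∈ P := by
    by_contra hxP
    have := h.card_le hΩ hb hG hfr (insert x P) (by
      intro p hp
      rcases Finset.mem_insert.1 hp with rfl | hp
      · exact ⟨hx, hx0⟩
      · exact hP p hp)
    rw [Finset.card_insert_of_notMem hxP] at this
    push_cast at this
    omega
  refine ⟨hxP, fun hdet => ?_⟩
  have hk := LinearMap.bot_lt_ker_of_det_eq_zero
    (show LinearMap.det (fderiv ℂ G x : E →ₗ[ℂ] E) = 0 from hdet)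
  obtain ⟨w, hw, hw0⟩ := Submodule.exists_mem_ne_zero_of_ne_bot hk.ne'
  have hw' : fderiv ℂ G x w = 0 := by simpa using hw
  obtain ⟨ℓ, hℓ⟩ := SeparatingDual.exists_eq_one (R := ℂ) hw0
  obtain ⟨A, hA, hAP⟩ := exists_interpolating_identity P
  obtain ⟨c, hc, hcG⟩ := exists_pos_le_norm_on_frontier hb (fun x hx => (hG x hx).continuousAt) hfr
  -- This function vanishes on `P` and has derivative `1` at `x` along the kernel vector `w`,
  -- whereas `G` has zero derivative in this direction.
  set q : E → ℂ := fun y => ℓ (A y)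
  have hq : ∀ y, AnalyticAt ℂ q y := fun y =>
    ((ℓ.analyticAt _).comp (hA y (mem_univ _)))
  obtain ⟨C, hC⟩ := hb.isCompact_closure.exists_bound_of_continuousOn (f := q)
    fun x _ => (hq x).continuousAt.continuousWithinAt
  have hline : HasDerivAt (fun s : ℂ => x + s • w) w 0 := by
    simpa using ((hasDerivAt_id (0 : ℂ)).smul_const w).const_add x
  have hqd : HasDerivAt (fun s : ℂ => q (x + s • w)) 1 0 := by
    have h1 : HasFDerivAt q (ℓ.comp (ContinuousLinearMap.id ℂ E)) (x + (0 : ℂ) • w) := by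
      rw [zero_smul, add_zero]
      exact ℓ.hasFDerivAt.comp x (hAP x hxP).2
    exact (h1.comp_hasDerivAt (0 : ℂ) hline).congr_deriv hℓ
  have hGd : HasDerivAt (fun s : ℂ => G (x + s • w)) 0 0 := by
    have h1 : HasFDerivAt G (fderiv ℂ G x) (x + (0 : ℂ) • w) := by
      simpa using (hG x (subset_closure hx)).differentiableAt.hasFDerivAt
    exact (h1.comp_hasDerivAt (0 : ℂ) hline).congr_deriv hw'
  have hqs := hqd.tendsto_slope
  have hGs := hGd.tendsto_slope
  -- Hence `G / q` tends to zero along the line through `x` in the direction `w`.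
  have hratio : Tendsto (fun s : ℂ => (slope (fun s : ℂ => q (x + s • w)) 0 s)⁻¹ •
      slope (fun s : ℂ => G (x + s • w)) 0 s) (𝓝[≠] 0) (𝓝 0) := by
    simpa using (hqs.inv₀ one_ne_zero).smul hGs
  have hratio' : Tendsto (fun s : ℂ => ‖(q (x + s • w))⁻¹ • G (x + s • w)‖ * C) (𝓝[≠] 0) (𝓝 0) := by
    have := (hratio.norm.mul_const C)
    rw [norm_zero, zero_mul] at this
    refine this.congr' ?_
    filter_upwards [self_mem_nhdsWithin] with s hs
    have hs' : s ≠ 0 := hs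
    have hqx : q x = 0 := by simp [q, (hAP x hxP).1]
    simp only [slope, sub_zero, zero_smul, add_zero, hqx, hx0, vsub_eq_sub, smul_eq_mul]
    rw [mul_inv, inv_inv, smul_smul, mul_assoc, mul_comm _ s⁻¹, ← mul_assoc, mul_inv_cancel₀ hs', one_mul]
  have hev1 : ∀ᶠ s in 𝓝[≠] (0 : ℂ), ‖(q (x + s • w))⁻¹ • G (x + s • w)‖ * C < c :=
    hratio'.eventually (gt_mem_nhds hc)
  have hev2 : ∀ᶠ s in 𝓝[≠] (0 : ℂ), q (x + s • w) ≠ 0 := by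
    filter_upwards [hqs.eventually_ne one_ne_zero] with s hs h0
    exact hs (by simp [slope, h0, q, (hAP x hxP).1])
  have hev3 : ∀ᶠ s in 𝓝[≠] (0 : ℂ), x + s • w ∈ Ω := by
    have : Tendsto (fun s : ℂ => x + s • w) (𝓝 0) (𝓝 x) := by
      simpa using hline.continuousAt.tendsto
    exact mem_nhdsWithin_of_mem_nhds (this.eventually (hΩ.mem_nhds hx))
  obtain ⟨s, ⟨h1, h2⟩, h3⟩ := ((hev1.and hev2).and hev3).exists
  set y := x + s • w
  -- The map `G - q e` is a small perturbation of `G` on the frontier, vanishing on `P` and also at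
  -- `y`. This is one zero more than its degree permits.
  set e := (q y)⁻¹ • G y
  set G₁ : E → E := fun z => G z - q z • e
  have hG₁ : ∀ x ∈ closure Ω, AnalyticAt ℂ G₁ x := fun x hx =>
    (hG x hx).sub ((hq x).smul analyticAt_const)
  have hsmall : ∀ z ∈ frontier Ω, ‖G₁ z - G z‖ < ‖G z‖ := by
    intro z hz
    have : ‖G₁ z - G z‖ = ‖q z‖ * ‖e‖ := by simp [G₁, norm_smul]
    rw [this]
    refine lt_of_lt_of_le (lt_of_le_of_lt ?_ h1) (hcG z hz)
    rw [mul_comm]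
    exact mul_le_mul_of_nonneg_left (hC z (frontier_subset_closure hz)) (norm_nonneg _)
  have hfr₁ : ∀ x ∈ frontier Ω, G₁ x ≠ 0 := by
    intro x hx h0
    have := hsmall x hx
    simp [h0] at this
  have hyP : y ∉ P := fun hyP => h2 (by simp [q, (hAP y hyP).1])
  have := (h.perturb hΩ hb hG hG₁ hsmall).card_le hΩ hb hG₁ hfr₁ (insert y P) (by
    intro p hp
    rcases Finset.mem_insert.1 hp with rfl | hp
    · exact ⟨h3, by simp [G₁, e, smul_smul, mul_inv_cancel₀ h2]⟩
    · exact ⟨(hP p hp).1, by simp [G₁, (hP p hp).2, q, (hAP p hp).1]⟩)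
  rw [Finset.card_insert_of_notMem hyP] at this
  push_cast at this
  omega

end ComplexDegree

/-! ### Maps of three-space that are suspensions of planar maps. -/

section Planar

variable {𝕜 : Type*} [RCLike 𝕜]

/-- The map of the three-dimensional space with the first two components depending on the
first two coordinates, and the third one equal to the doubled third coordinate. -/
noncomputable def planarMap (A B : 𝕜 × 𝕜 → 𝕜) (z : EuclideanSpace 𝕜 (Fin 3)) :
    EuclideanSpace 𝕜 (Fin 3) :=
  !₂[A (z 0, z 1), B (z 0, z 1), 2 * z 2]

theorem planarMap_eq_zero {A B : 𝕜 × 𝕜 → 𝕜} {z : EuclideanSpace 𝕜 (Fin 3)} :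
    planarMap A B z = 0 ↔ A (z 0, z 1) = 0 ∧ B (z 0, z 1) = 0 ∧ z 2 = 0 := by
  constructor
  · intro h
    have h0 := congrArg (fun w : EuclideanSpace 𝕜 (Fin 3) => w 0) h
    have h1 := congrArg (fun w : EuclideanSpace 𝕜 (Fin 3) => w 1) h
    have h2 := congrArg (fun w : EuclideanSpace 𝕜 (Fin 3) => w 2) h
    simp [planarMap] at h0 h1 h2
    exact ⟨h0, h1, h2⟩
  · rintro ⟨h0, h1, h2⟩
    ext i
    fin_cases i <;> simp [planarMap, h0, h1, h2]

theorem planarMap_smul_add_smul (A B A' B' : 𝕜 × 𝕜 → 𝕜) (s : 𝕜) (z : EuclideanSpace 𝕜 (Fin 3)) :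
    (1 - s) • planarMap A B z + s • planarMap A' B' z =
      planarMap (fun p => (1 - s) * A p + s * A' p) (fun p => (1 - s) * B p + s * B' p) z := by
  ext i
  fin_cases i <;> simp [planarMap]
  ring

theorem norm_sq_eq_three (z : EuclideanSpace 𝕜 (Fin 3)) :
    ‖z‖ ^ 2 = ‖z 0‖ ^ 2 + ‖z 1‖ ^ 2 + ‖z 2‖ ^ 2 := by
  rw [EuclideanSpace.norm_sq_eq, Fin.sum_univ_three]

theorem analyticAt_planarMap {A B : 𝕜 × 𝕜 → 𝕜} {z : EuclideanSpace 𝕜 (Fin 3)}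
    (hA : AnalyticAt 𝕜 A (z 0, z 1)) (hB : AnalyticAt 𝕜 B (z 0, z 1)) :
    AnalyticAt 𝕜 (planarMap A B) z := by
  have hp : ∀ i : Fin 3, AnalyticAt 𝕜 (fun w : EuclideanSpace 𝕜 (Fin 3) => w i) z := fun i =>
    (EuclideanSpace.proj i : EuclideanSpace 𝕜 (Fin 3) →L[𝕜] 𝕜).analyticAt z
  have hA' : AnalyticAt 𝕜 (fun w : EuclideanSpace 𝕜 (Fin 3) => A (w 0, w 1)) z :=
    AnalyticAt.fun_comp (g := A) hA ((hp 0).prod (hp 1))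
  have hB' : AnalyticAt 𝕜 (fun w : EuclideanSpace 𝕜 (Fin 3) => B (w 0, w 1)) z :=
    AnalyticAt.fun_comp (g := B) hB ((hp 0).prod (hp 1))
  have hv : AnalyticAt 𝕜 (fun w : EuclideanSpace 𝕜 (Fin 3) =>
      (![A (w 0, w 1), B (w 0, w 1), 2 * w 2] : Fin 3 → 𝕜)) z := by
    refine AnalyticAt.pi fun i => ?_
    fin_cases i
    · exact hA'
    · exact hB'
    · exact analyticAt_const.mul (hp 2)
  exact ((PiLp.continuousLinearEquiv 2 𝕜 (fun _ : Fin 3 => 𝕜)).symm.toContinuousLinearMap.analyticAt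
    _).comp hv

/-- The linear map of the plane with given matrix, extended to the space by multiplication by 2
along the third coordinate. -/
noncomputable def planarLinear (a b c d : 𝕜) :
    EuclideanSpace 𝕜 (Fin 3) →ₗ[𝕜] EuclideanSpace 𝕜 (Fin 3) :=
  Matrix.toLin (EuclideanSpace.basisFun (Fin 3) 𝕜).toBasis (EuclideanSpace.basisFun (Fin 3) 𝕜).toBasis
    !![a, b, 0; c, d, 0; 0, 0, 2]

theorem det_planarLinear (a b c d : 𝕜) :
    LinearMap.det (planarLinear a b c d) = 2 * (a * d - b * c) := by
  rw [planarLinear, LinearMap.det_toLin, Matrix.det_fin_three]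
  simp
  ring

theorem planarLinear_apply (a b c d : 𝕜) (v : EuclideanSpace 𝕜 (Fin 3)) :
    planarLinear a b c d v = !₂[a * v 0 + b * v 1, c * v 0 + d * v 1, 2 * v 2] := by
  rw [planarLinear, Matrix.toLin_apply]
  ext i
  fin_cases i <;> simp [Fin.sum_univ_three, Matrix.mulVec, dotProduct]

theorem det_fderiv_planarMap {A B : 𝕜 × 𝕜 → 𝕜} {z : EuclideanSpace 𝕜 (Fin 3)} {a b c d : 𝕜}
    (hA : HasFDerivAt A (a • ContinuousLinearMap.fst 𝕜 𝕜 𝕜 + b • ContinuousLinearMap.snd 𝕜 𝕜 𝕜)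
      (z 0, z 1))
    (hB : HasFDerivAt B (c • ContinuousLinearMap.fst 𝕜 𝕜 𝕜 + d • ContinuousLinearMap.snd 𝕜 𝕜 𝕜)
      (z 0, z 1)) :
    (fderiv 𝕜 (planarMap A B) z).det = 2 * (a * d - b * c) := by
  have hp : ∀ i : Fin 3, HasFDerivAt (fun w : EuclideanSpace 𝕜 (Fin 3) => w i)
      (EuclideanSpace.proj i : EuclideanSpace 𝕜 (Fin 3) →L[𝕜] 𝕜) z := fun i =>
    (EuclideanSpace.proj i : EuclideanSpace 𝕜 (Fin 3) →L[𝕜] 𝕜).hasFDerivAt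
  have hpr := (hp 0).prodMk (hp 1)
  have hA' := HasFDerivAt.comp z hA hpr
  have hB' := HasFDerivAt.comp z hB hpr
  have hd : HasFDerivAt (planarMap A B) (LinearMap.toContinuousLinearMap (planarLinear a b c d)) z := by
    rw [← hasFDerivWithinAt_univ, hasFDerivWithinAt_euclidean]
    intro i
    fin_cases i
    · refine (HasFDerivAt.congr_fderiv hA' ?_).hasFDerivWithinAt
      ext v; simp [planarLinear_apply]
    · refine (HasFDerivAt.congr_fderiv hB' ?_).hasFDerivWithinAt
      ext v; simp [planarLinear_apply]
    · refine (HasFDerivAt.congr_fderiv ((hp 2).const_mul 2) ?_).hasFDerivWithinAt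
      ext v; simp [planarLinear_apply]
  rw [hd.fderiv, ← det_planarLinear]
  rfl

/-- The inclusion of the coordinate plane. -/
noncomputable def planePoint : 𝕜 × 𝕜 ↪ EuclideanSpace 𝕜 (Fin 3) :=
  ⟨fun p => !₂[p.1, p.2, 0], fun p q h => by
    have h0 := congrArg (fun w : EuclideanSpace 𝕜 (Fin 3) => w 0) h
    have h1 := congrArg (fun w : EuclideanSpace 𝕜 (Fin 3) => w 1) h
    simp at h0 h1
    exact Prod.ext h0 h1⟩

theorem planePoint_apply (p : 𝕜 × 𝕜) : planePoint p = !₂[p.1, p.2, 0] := rfl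

theorem planePoint_eq {z : EuclideanSpace 𝕜 (Fin 3)} (hz : z 2 = 0) :
    planePoint (z 0, z 1) = z := by
  ext i
  fin_cases i <;> simp [planePoint_apply, hz]

end Planar

/-! ### Degrees of suspended planar maps: homotopies and counting of zeros. -/

section PlanarComplex

theorem norm_of_mem_frontier_ball {𝕜 : Type*} [RCLike 𝕜] {r : ℝ} {z : EuclideanSpace 𝕜 (Fin 3)}
    (hz : z ∈ frontier (Metric.ball (0 : EuclideanSpace 𝕜 (Fin 3)) r)) : ‖z‖ = r := by
  have := Metric.frontier_ball_subset_sphere hz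
  simpa using this

/-- Change of the planar map along a segment. -/
theorem HasComplexDegree.planar_segment {r : ℝ} {A B A' B' : ℂ × ℂ → ℂ}
    (hA : ∀ p, AnalyticAt ℂ A p) (hB : ∀ p, AnalyticAt ℂ B p)
    (hA' : ∀ p, AnalyticAt ℂ A' p) (hB' : ∀ p, AnalyticAt ℂ B' p)
    (h0 : ∀ s ∈ Icc (0 : ℝ) 1, ∀ x y : ℂ, (1 - (s : ℂ)) * A (x, y) + s * A' (x, y) = 0 →
      (1 - (s : ℂ)) * B (x, y) + s * B' (x, y) = 0 → ‖x‖ ^ 2 + ‖y‖ ^ 2 < r ^ 2) {d : ℤ}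
    (h : HasComplexDegree (planarMap A B) (Metric.ball 0 r) d) :
    HasComplexDegree (planarMap A' B') (Metric.ball 0 r) d := by
  refine HasComplexDegree.of_segment Metric.isOpen_ball Metric.isBounded_ball
    (fun x _ => analyticAt_planarMap (hA _) (hB _)) (fun x _ => analyticAt_planarMap (hA' _) (hB' _))
    (fun s hs z hz hz0 => ?_) h
  rw [planarMap_smul_add_smul, planarMap_eq_zero] at hz0
  have h1 := h0 s hs _ _ hz0.1 hz0.2.1
  have h2 := norm_sq_eq_three z
  rw [norm_of_mem_frontier_ball hz, hz0.2.2] at h2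
  simp at h2
  linarith

/-- The degree of a planar map with known non-degenerate zeros. -/
theorem hasComplexDegree_planarMap {r : ℝ} {A B : ℂ × ℂ → ℂ}
    (hA : ∀ p, AnalyticAt ℂ A p) (hB : ∀ p, AnalyticAt ℂ B p) {a b c d : ℂ × ℂ → ℂ}
    (hA' : ∀ p, HasFDerivAt A
      (a p • ContinuousLinearMap.fst ℂ ℂ ℂ + b p • ContinuousLinearMap.snd ℂ ℂ ℂ) p)
    (hB' : ∀ p, HasFDerivAt B
      (c p • ContinuousLinearMap.fst ℂ ℂ ℂ + d p • ContinuousLinearMap.snd ℂ ℂ ℂ) p)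
    (Z : Finset (ℂ × ℂ)) (hZ : ∀ p, p ∈ Z ↔ A p = 0 ∧ B p = 0)
    (hdet : ∀ p ∈ Z, a p * d p - b p * c p ≠ 0)
    (hsmall : ∀ p ∈ Z, ‖p.1‖ ^ 2 + ‖p.2‖ ^ 2 < r ^ 2) (hr : 0 < r) :
    HasComplexDegree (planarMap A B) (Metric.ball 0 r) Z.card := by
  have hzero : ∀ z, planarMap A B z = 0 → (z 0, z 1) ∈ Z ∧ ‖z‖ < r := by
    intro z hz
    rw [planarMap_eq_zero] at hz
    have hmem := (hZ (z 0, z 1)).2 ⟨hz.1, hz.2.1⟩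
    refine ⟨hmem, ?_⟩
    have h1 := hsmall _ hmem
    have h2 := norm_sq_eq_three z
    rw [hz.2.2] at h2
    simp at h2 h1
    exact lt_of_pow_lt_pow_left₀ 2 hr.le (by linarith)
  rw [← Finset.card_map planePoint]
  refine hasComplexDegree_card Metric.isOpen_ball Metric.isBounded_ball
    (fun x _ => analyticAt_planarMap (hA _) (hB _)) ?_ ?_ _ ?_
  · intro z hz hz0
    exact absurd (norm_of_mem_frontier_ball hz) (hzero z hz0).2.ne
  · intro z _ hz0
    rw [det_fderiv_planarMap (hA' _) (hB' _)]
    exact mul_ne_zero two_ne_zero (hdet _ (hzero z hz0).1)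
  · intro z
    simp only [Finset.mem_map]
    constructor
    · rintro ⟨p, hp, rfl⟩
      have h0 : planarMap A B (planePoint p) = 0 := by
        rw [planarMap_eq_zero]
        have := (hZ p).1 hp
        simpa [planePoint_apply] using this
      exact ⟨by simpa using (hzero _ h0).2, h0⟩
    · rintro ⟨-, hz0⟩
      exact ⟨_, (hzero z hz0).1, planePoint_eq (planarMap_eq_zero.1 hz0).2.2⟩

/-- Arbitrary analytic homotopies are allowed here, since the real normal forms will be joined by
moving the roots of a polynomial, which is not a linear path. -/
theorem HasDegree.planar_homotopy {r : ℝ} {A B : ℝ → ℝ × ℝ → ℝ}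
    (hA : ∀ q : ℝ × ℝ × ℝ, AnalyticAt ℝ (fun q : ℝ × ℝ × ℝ => A q.1 q.2) q)
    (hB : ∀ q : ℝ × ℝ × ℝ, AnalyticAt ℝ (fun q : ℝ × ℝ × ℝ => B q.1 q.2) q)
    (h0 : ∀ s ∈ Icc (0 : ℝ) 1, ∀ x y : ℝ, A s (x, y) = 0 → B s (x, y) = 0 → x ^ 2 + y ^ 2 < r ^ 2)
    {d : ℤ} (h : HasDegree (planarMap (A 0) (B 0)) (Metric.ball 0 r) d) :
    HasDegree (planarMap (A 1) (B 1)) (Metric.ball 0 r) d := by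
  refine HasDegree.homotopy (H := fun p => planarMap (A p.1) (B p.1) p.2) Metric.isOpen_ball
    Metric.isBounded_ball (fun s z _ => ?_) (fun s hs z hz hz0 => ?_) h
  · refine AnalyticAt.contDiffAt ?_
    have hp : ∀ i : Fin 3, AnalyticAt ℝ (fun w : ℝ × EuclideanSpace ℝ (Fin 3) => w.2 i) (s, z) :=
      fun i => ((EuclideanSpace.proj i : EuclideanSpace ℝ (Fin 3) →L[ℝ] ℝ).comp
        (ContinuousLinearMap.snd ℝ ℝ (EuclideanSpace ℝ (Fin 3)))).analyticAt (s, z)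
    have hin : AnalyticAt ℝ (fun w : ℝ × EuclideanSpace ℝ (Fin 3) => (w.1, w.2 0, w.2 1)) (s, z) :=
      analyticAt_fst.prod ((hp 0).prod (hp 1))
    have hv : AnalyticAt ℝ (fun w : ℝ × EuclideanSpace ℝ (Fin 3) =>
        (![A w.1 (w.2 0, w.2 1), B w.1 (w.2 0, w.2 1), 2 * w.2 2] : Fin 3 → ℝ)) (s, z) := by
      refine AnalyticAt.pi fun i => ?_
      fin_cases i
      · exact AnalyticAt.fun_comp (g := fun q : ℝ × ℝ × ℝ => A q.1 q.2) (hA _) hin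
      · exact AnalyticAt.fun_comp (g := fun q : ℝ × ℝ × ℝ => B q.1 q.2) (hB _) hin
      · exact analyticAt_const.mul (hp 2)
    exact ((PiLp.continuousLinearEquiv 2 ℝ (fun _ : Fin 3 => ℝ)).symm.toContinuousLinearMap.analyticAt
      _).comp hv
  · rw [planarMap_eq_zero] at hz0
    have h1 := h0 s hs _ _ hz0.1 hz0.2.1
    have h2 := norm_sq_eq_three z
    rw [norm_of_mem_frontier_ball hz, hz0.2.2] at h2
    simp at h2
    linarith

/-- The degree of a real planar map with known zeros, all of them of the same sign `ε`. -/
theorem hasDegree_planarMap {r : ℝ} {A B : ℝ × ℝ → ℝ}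
    (hA : ∀ p, AnalyticAt ℝ A p) (hB : ∀ p, AnalyticAt ℝ B p) {a b c d : ℝ × ℝ → ℝ}
    (hA' : ∀ p, HasFDerivAt A
      (a p • ContinuousLinearMap.fst ℝ ℝ ℝ + b p • ContinuousLinearMap.snd ℝ ℝ ℝ) p)
    (hB' : ∀ p, HasFDerivAt B
      (c p • ContinuousLinearMap.fst ℝ ℝ ℝ + d p • ContinuousLinearMap.snd ℝ ℝ ℝ) p)
    (Z : Finset (ℝ × ℝ)) (hZ : ∀ p, p ∈ Z ↔ A p = 0 ∧ B p = 0) (ε : SignType) (hε : ε ≠ 0)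
    (hdet : ∀ p ∈ Z, SignType.sign (a p * d p - b p * c p) = ε)
    (hsmall : ∀ p ∈ Z, p.1 ^ 2 + p.2 ^ 2 < r ^ 2) (hr : 0 < r) :
    HasDegree (planarMap A B) (Metric.ball 0 r) (Z.card * (ε : ℤ)) := by
  have hzero : ∀ z, planarMap A B z = 0 → (z 0, z 1) ∈ Z ∧ ‖z‖ < r := by
    intro z hz
    rw [planarMap_eq_zero] at hz
    have hmem := (hZ (z 0, z 1)).2 ⟨hz.1, hz.2.1⟩
    refine ⟨hmem, ?_⟩
    have h1 := hsmall _ hmem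
    have h2 := norm_sq_eq_three z
    rw [hz.2.2] at h2
    simp at h2 h1
    exact lt_of_pow_lt_pow_left₀ 2 hr.le (by linarith)
  have hsgn : ∀ z, planarMap A B z = 0 → SignType.sign (fderiv ℝ (planarMap A B) z).det = ε := by
    intro z hz0
    rw [det_fderiv_planarMap (hA' _) (hB' _), sign_mul, sign_pos two_pos, one_mul]
    exact hdet _ (hzero z hz0).1
  have hmem : ∀ z, z ∈ Z.map planePoint ↔ z ∈ Metric.ball (0 : EuclideanSpace ℝ (Fin 3)) r ∧
      planarMap A B z = 0 := by
    intro z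
    simp only [Finset.mem_map]
    constructor
    · rintro ⟨p, hp, rfl⟩
      have h0 : planarMap A B (planePoint p) = 0 := by
        rw [planarMap_eq_zero]
        have := (hZ p).1 hp
        simpa [planePoint_apply] using this
      exact ⟨by simpa using (hzero _ h0).2, h0⟩
    · rintro ⟨-, hz0⟩
      exact ⟨_, (hzero z hz0).1, planePoint_eq (planarMap_eq_zero.1 hz0).2.2⟩
  have := hasDegree_of_det_ne_zero Metric.isOpen_ball Metric.isBounded_ball
    (fun x _ => (analyticAt_planarMap (hA _) (hB _)).contDiffAt) 
    (fun z hz hz0 => absurd (norm_of_mem_frontier_ball hz) (hzero z hz0).2.ne)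
    (fun z _ hz0 => sign_ne_zero.1 (by rw [hsgn z hz0]; exact hε)) (Z.map planePoint) hmem
  rw [Finset.sum_congr rfl (g := fun _ => (ε : ℤ)) (fun z hz => by
    rw [hsgn z ((hmem z).1 hz).2])] at this
  simpa using this

end PlanarComplex

attribute [local fun_prop] analyticAt_fst analyticAt_snd

/-! ### Partial derivatives of planar functions. -/

section HasGrad

variable {𝕜 : Type*} [RCLike 𝕜]

/-- `a` and `b` are the partial derivatives of `A` at `p`. -/
def HasGrad (A : 𝕜 × 𝕜 → 𝕜) (a b : 𝕜) (p : 𝕜 × 𝕜) : Prop :=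
  HasFDerivAt A (a • ContinuousLinearMap.fst 𝕜 𝕜 𝕜 + b • ContinuousLinearMap.snd 𝕜 𝕜 𝕜) p

theorem hasGrad_monomial (c : 𝕜) (m n : ℕ) (p : 𝕜 × 𝕜) :
    HasGrad (fun p => c * p.1 ^ m * p.2 ^ n) (c * (m * p.1 ^ (m - 1)) * p.2 ^ n)
      (c * p.1 ^ m * (n * p.2 ^ (n - 1))) p := by
  have h1 : HasFDerivAt (fun p : 𝕜 × 𝕜 => p.1) (ContinuousLinearMap.fst 𝕜 𝕜 𝕜) p := hasFDerivAt_fst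
  have h2 : HasFDerivAt (fun p : 𝕜 × 𝕜 => p.2) (ContinuousLinearMap.snd 𝕜 𝕜 𝕜) p := hasFDerivAt_snd
  refine (((h1.pow m).const_mul c).mul (h2.pow n)).congr_fderiv ?_
  ext <;> simp; ring

theorem HasGrad.add {A B : 𝕜 × 𝕜 → 𝕜} {a b c d : 𝕜} {p : 𝕜 × 𝕜} (hA : HasGrad A a b p)
    (hB : HasGrad B c d p) : HasGrad (fun p => A p + B p) (a + c) (b + d) p := by
  refine (HasFDerivAt.add hA hB).congr_fderiv ?_
  ext <;> simp

theorem HasGrad.congr {A B : 𝕜 × 𝕜 → 𝕜} {a b c d : 𝕜} {p : 𝕜 × 𝕜} (hA : HasGrad A a b p)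
    (h : ∀ q, A q = B q) (hc : a = c) (hd : b = d) : HasGrad B c d p := by
  rw [← funext h, ← hc, ← hd]; exact hA

end HasGrad

/-! ### Complex degrees of the gradients of the normal forms. -/

section ComplexDegrees

set_option linter.unusedSimpArgs false

/-- The form with middle coefficient `c` degenerates only for `c² = 4 b`. A real path from `0` to
`a` may cross this set, so the coefficient goes through `i`. On the segment from `i` to `a` the
square is real only if `s = 1` or `s a = 0`, and in the latter case it is not positive. -/
theorem sq_segment_ne {a b : ℝ} (hb : 0 < b) (h : a ^ 2 ≠ 4 * b) {s : ℝ} :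
    ((1 - (s : ℂ)) * Complex.I + s * a) ^ 2 ≠ 4 * b := by
  intro h0
  have hre := congrArg Complex.re h0
  have him := congrArg Complex.im h0
  simp [pow_two] at hre him
  have : (1 - s) * (s * a) = 0 := by linarith
  rcases mul_eq_zero.1 this with h1 | h1
  · have : s = 1 := by linarith
    subst this
    exact h (by nlinarith)
  · rw [h1] at hre
    nlinarith [mul_self_nonneg (1 - s)]

theorem sq_mul_I_ne {b : ℝ} (hb : 0 < b) {s : ℝ} : ((s : ℂ) * Complex.I) ^ 2 ≠ 4 * b := by
  rw [mul_pow, Complex.I_sq]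
  intro h
  have := congrArg Complex.re h
  norm_num [← Complex.ofReal_pow] at this
  nlinarith [sq_nonneg s]

theorem ne_neg_of_ne_zero {x : ℂ} (hx : x ≠ 0) : x ≠ -x := fun h => hx (self_eq_neg.1 h)

/-- If `x` and `y` are both non-zero, the equations become linear in `x²` and `y²`, with determinant
`4 - c²`. -/
theorem fermat_zero {c x y : ℂ} (hc : c ^ 2 ≠ 4) (h1 : 4 * x ^ 3 + 2 * c * x * y ^ 2 = 0)
    (h2 : 4 * y ^ 3 + 2 * c * x ^ 2 * y = 0) : x = 0 ∧ y = 0 := by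
  by_cases hx : x = 0
  · subst hx; simpa using h2
  by_cases hy : y = 0
  · subst hy; simp [hx] at h1
  exfalso
  have e1 : 2 * x ^ 2 + c * y ^ 2 = 0 := by
    refine (mul_eq_zero.1 (?_ : 2 * x * (2 * x ^ 2 + c * y ^ 2) = 0)).resolve_left (by simp [hx])
    linear_combination h1
  have e2 : 2 * y ^ 2 + c * x ^ 2 = 0 := by
    refine (mul_eq_zero.1 (?_ : 2 * y * (2 * y ^ 2 + c * x ^ 2) = 0)).resolve_left (by simp [hy])
    linear_combination h2
  refine hc (sub_eq_zero.1 ((mul_eq_zero.1 (?_ : x ^ 2 * (c ^ 2 - 4) = 0)).resolve_left (by simp [hx])))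
  linear_combination c * e2 - 2 * e1

/-- The degree of the gradient of `x⁴ + a x² y² + y⁴`. -/
theorem hasComplexDegree_fermat {a : ℝ} (ha : a ^ 2 ≠ 4) {r : ℝ} (hr : 0 < r) :
    HasComplexDegree (planarMap (fun p : ℂ × ℂ => 4 * p.1 ^ 3 + 2 * a * p.1 * p.2 ^ 2)
      (fun p => 4 * p.2 ^ 3 + 2 * a * p.1 ^ 2 * p.2)) (Metric.ball 0 r) 9 := by
  obtain ⟨τ, hτ, hτr⟩ : ∃ τ : ℝ, 0 < τ ∧ τ ^ 2 + τ ^ 2 < r ^ 2 :=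
    ⟨r / 2, half_pos hr, by nlinarith⟩
  have hτ0 : (τ : ℂ) ≠ 0 := by exact_mod_cast hτ.ne'
  have hτ1 : (τ : ℂ) ≠ -τ := fun h => hτ0 (by
    have : (2 : ℂ) * τ = 0 := by linear_combination h
    simpa using this)
  have hroot : ∀ x : ℂ, x ∈ ({0, (τ : ℂ), -(τ : ℂ)} : Finset ℂ) ↔ 4 * x ^ 3 - 4 * τ ^ 2 * x = 0 := by
    intro x
    rw [show 4 * x ^ 3 - 4 * τ ^ 2 * x = 4 * (x * ((x - τ) * (x + τ))) by ring]
    simp [sub_eq_zero, add_eq_zero_iff_eq_neg]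
  -- For zero middle coefficient the gradient splits into two cubes. Each is perturbed to have the
  -- simple roots `0` and `±τ`, which gives a grid of nine simple zeros.
  have h0 : HasComplexDegree (planarMap (fun p : ℂ × ℂ => 4 * p.1 ^ 3 - 4 * τ ^ 2 * p.1)
      (fun p => 4 * p.2 ^ 3 - 4 * τ ^ 2 * p.2)) (Metric.ball 0 r) 9 := by
    have := hasComplexDegree_planarMap (r := r)
      (A := fun p : ℂ × ℂ => 4 * p.1 ^ 3 - 4 * τ ^ 2 * p.1)
      (B := fun p : ℂ × ℂ => 4 * p.2 ^ 3 - 4 * τ ^ 2 * p.2)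
      (fun p => by fun_prop) (fun p => by fun_prop)
      (a := fun p => 12 * p.1 ^ 2 - 4 * τ ^ 2) (b := fun _ => 0) (c := fun _ => 0)
      (d := fun p => 12 * p.2 ^ 2 - 4 * τ ^ 2)
      (fun p => ((hasGrad_monomial 4 3 0 p).add (hasGrad_monomial (-4 * (τ : ℂ) ^ 2) 1 0 p)).congr
        (fun q => by ring) (by norm_num; ring) (by norm_num))
      (fun p => ((hasGrad_monomial 4 0 3 p).add (hasGrad_monomial (-4 * (τ : ℂ) ^ 2) 0 1 p)).congr
        (fun q => by ring) (by norm_num) (by norm_num; ring))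
      ({0, (τ : ℂ), -(τ : ℂ)} ×ˢ {0, (τ : ℂ), -(τ : ℂ)})
      (fun p => by rw [Finset.mem_product, hroot, hroot]) ?_ ?_ hr
    · have hc : ({0, (τ : ℂ), -(τ : ℂ)} : Finset ℂ).card = 3 := by
        rw [Finset.card_eq_three]
        exact ⟨0, τ, -τ, hτ0.symm, by simpa using hτ0, hτ1, rfl⟩
      rw [Finset.card_product, hc] at this
      exact this
    · have hnd : ∀ x ∈ ({0, (τ : ℂ), -(τ : ℂ)} : Finset ℂ), 12 * x ^ 2 - 4 * (τ : ℂ) ^ 2 ≠ 0 := by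
        intro x hx
        simp only [Finset.mem_insert, Finset.mem_singleton] at hx
        rcases hx with rfl | rfl | rfl
        · simp [hτ0]
        · ring_nf; simp [hτ0]
        · ring_nf; simp [hτ0]
      intro p hp
      rw [Finset.mem_product] at hp
      simpa using ⟨hnd _ hp.1, hnd _ hp.2⟩
    · have hn : ∀ x ∈ ({0, (τ : ℂ), -(τ : ℂ)} : Finset ℂ), ‖x‖ ^ 2 ≤ τ ^ 2 := by
        intro x hx
        simp only [Finset.mem_insert, Finset.mem_singleton] at hx
        rcases hx with rfl | rfl | rfl <;> simp [sq_nonneg]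
      intro p hp
      rw [Finset.mem_product] at hp
      linarith [hn _ hp.1, hn _ hp.2]
  have h1 : HasComplexDegree (planarMap (fun p : ℂ × ℂ => 4 * p.1 ^ 3) (fun p => 4 * p.2 ^ 3))
      (Metric.ball 0 r) 9 := by
    refine h0.planar_segment (fun p => by fun_prop) (fun p => by fun_prop) (fun p => by fun_prop)
      (fun p => by fun_prop) fun s hs x y e1 e2 => ?_
    have key : ∀ x : ℂ, (1 - (s : ℂ)) * (4 * x ^ 3 - 4 * τ ^ 2 * x) + s * (4 * x ^ 3) = 0 →
        ‖x‖ ^ 2 ≤ τ ^ 2 := by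
      intro x hx
      have : 4 * (x * (x ^ 2 - ((1 - s : ℝ) : ℂ) * (τ : ℂ) ^ 2)) = 0 := by
        push_cast; linear_combination hx
      rcases mul_eq_zero.1 ((mul_eq_zero.1 this).resolve_left (by norm_num)) with h | h
      · simp [h, sq_nonneg]
      · have h' : ‖x‖ ^ 2 = (1 - s) * τ ^ 2 := by
          rw [← norm_pow, sub_eq_zero.1 h, norm_mul, Complex.norm_real, norm_pow, Complex.norm_real,
            Real.norm_of_nonneg (by linarith [hs.2]), Real.norm_of_nonneg hτ.le]
        rw [h']
        nlinarith [hs.1, sq_nonneg τ]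
    linarith [key x e1, key y e2]
  -- The middle coefficient moves from `0` to `i` and then to `a`, away from the degenerate values.
  have hI : HasComplexDegree (planarMap
      (fun p : ℂ × ℂ => 4 * p.1 ^ 3 + 2 * Complex.I * p.1 * p.2 ^ 2)
      (fun p => 4 * p.2 ^ 3 + 2 * Complex.I * p.1 ^ 2 * p.2)) (Metric.ball 0 r) 9 := by
    refine h1.planar_segment (fun p => by fun_prop) (fun p => by fun_prop) (fun p => by fun_prop)
      (fun p => by fun_prop) fun s hs x y e1 e2 => ?_
    obtain ⟨rfl, rfl⟩ := fermat_zero (c := s * Complex.I) (x := x) (y := y) (by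
      simpa using sq_mul_I_ne one_pos (s := s)) (by linear_combination e1) (by linear_combination e2)
    simpa using pow_pos hr 2
  refine hI.planar_segment (fun p => by fun_prop) (fun p => by fun_prop) (fun p => by fun_prop)
      (fun p => by fun_prop) fun s hs x y e1 e2 => ?_
  have hne := sq_segment_ne one_pos (a := a) (by simpa using ha) (s := s)
  obtain ⟨rfl, rfl⟩ := fermat_zero (c := (1 - (s : ℂ)) * Complex.I + s * a) (x := x) (y := y)
    (by simpa using hne) (by linear_combination e1) (by linear_combination e2)
  simpa using pow_pos hr 2

/-- For non-zero `x` and `y` the equations give `x² = b y²` and `c x = -2 b y`, whence `c² = 4 b`.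
-/
theorem quartic_zero {b c x y : ℂ} (hb : b ≠ 0) (hc : c ^ 2 ≠ 4 * b)
    (h1 : 3 * x ^ 2 * y + 2 * c * x * y ^ 2 + b * y ^ 3 = 0)
    (h2 : x ^ 3 + 2 * c * x ^ 2 * y + 3 * b * x * y ^ 2 = 0) : x = 0 ∧ y = 0 := by
  by_cases hx : x = 0
  · subst hx; simpa [hb] using h1
  by_cases hy : y = 0
  · subst hy; simp [hx] at h2
  exfalso
  have e1 : 3 * x ^ 2 + 2 * c * x * y + b * y ^ 2 = 0 :=
    (mul_eq_zero.1 (by linear_combination h1 :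
      y * (3 * x ^ 2 + 2 * c * x * y + b * y ^ 2) = 0)).resolve_left hy
  have e2 : x ^ 2 + 2 * c * x * y + 3 * b * y ^ 2 = 0 :=
    (mul_eq_zero.1 (by linear_combination h2 :
      x * (x ^ 2 + 2 * c * x * y + 3 * b * y ^ 2) = 0)).resolve_left hx
  have e3 : x ^ 2 - b * y ^ 2 = 0 := by linear_combination (e1 - e2) / 2
  have e5 : 2 * b * y + c * x = 0 :=
    (mul_eq_zero.1 (by linear_combination e1 - 3 * e3 :
      2 * y * (2 * b * y + c * x) = 0)).resolve_left (by simp [hy])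
  refine hc (sub_eq_zero.1 ((mul_eq_zero.1 (?_ : b * y ^ 2 * (c ^ 2 - 4 * b) = 0)).resolve_left
    (by simp [hb, hy])))
  linear_combination -(2 * b * y - c * x) * e5 - c ^ 2 * e3

theorem norm_sq_le_of_sq_eq {x : ℂ} {k : ℝ} (h : x ^ 2 = k) : ‖x‖ ^ 2 ≤ |k| := by
  rw [← norm_pow, h, Complex.norm_real, Real.norm_eq_abs]

/-- The degree of the gradient of `x y (x² + a x y + b y²)`. -/
theorem hasComplexDegree_quartic {a b : ℝ} (hb : 0 < b) (ha : a ^ 2 ≠ 4 * b) {r : ℝ} (hr : 0 < r) :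
    HasComplexDegree (planarMap
      (fun p : ℂ × ℂ => 3 * p.1 ^ 2 * p.2 + 2 * a * p.1 * p.2 ^ 2 + b * p.2 ^ 3)
      (fun p => p.1 ^ 3 + 2 * a * p.1 ^ 2 * p.2 + 3 * b * p.1 * p.2 ^ 2)) (Metric.ball 0 r) 9 := by
  -- The polynomial `x³ y + b x y³ - 4 τ² x y` with `b σ² = τ²` has the nine critical points `0`,
  -- `(±2τ, 0)`, `(0, ±2σ)`, `(±τ, ±σ)`. The last inequality keeps them inside the ball.
  obtain ⟨σ, τ, hσ, hτ, hστ, hsm⟩ : ∃ σ τ : ℝ, 0 < σ ∧ 0 < τ ∧ b * σ ^ 2 = τ ^ 2 ∧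
      4 * τ ^ 2 + 4 * σ ^ 2 < r ^ 2 := by
    have hq : 0 < 4 * (b + 1) + 4 := by linarith
    refine ⟨r / √(4 * (b + 1) + 4), √b * (r / √(4 * (b + 1) + 4)), by positivity, by positivity,
      by rw [mul_pow, Real.sq_sqrt hb.le], ?_⟩
    rw [mul_pow, Real.sq_sqrt hb.le, div_pow, Real.sq_sqrt hq.le]
    have : 4 * (b * (r ^ 2 / (4 * (b + 1) + 4))) + 4 * (r ^ 2 / (4 * (b + 1) + 4)) =
      r ^ 2 * ((4 * b + 4) / (4 * (b + 1) + 4)) := by ring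
    rw [this]
    have h1 : (4 * b + 4) / (4 * (b + 1) + 4) < 1 := by rw [div_lt_one hq]; linarith
    nlinarith [pow_pos hr 2]
  have hb0 : (b : ℂ) ≠ 0 := by exact_mod_cast hb.ne'
  have hτ0 : (τ : ℂ) ≠ 0 := by exact_mod_cast hτ.ne'
  have hσ0 : (σ : ℂ) ≠ 0 := by exact_mod_cast hσ.ne'
  have hst : (b : ℂ) * σ ^ 2 = τ ^ 2 := by exact_mod_cast hστ
  have h0 : HasComplexDegree (planarMap
      (fun p : ℂ × ℂ => 3 * p.1 ^ 2 * p.2 + b * p.2 ^ 3 - 4 * τ ^ 2 * p.2)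
      (fun p => p.1 ^ 3 + 3 * b * p.1 * p.2 ^ 2 - 4 * τ ^ 2 * p.1)) (Metric.ball 0 r) 9 := by
    have := hasComplexDegree_planarMap (r := r)
      (A := fun p : ℂ × ℂ => 3 * p.1 ^ 2 * p.2 + b * p.2 ^ 3 - 4 * τ ^ 2 * p.2)
      (B := fun p : ℂ × ℂ => p.1 ^ 3 + 3 * b * p.1 * p.2 ^ 2 - 4 * τ ^ 2 * p.1)
      (fun p => by fun_prop) (fun p => by fun_prop)
      (a := fun p => 6 * p.1 * p.2) (b := fun p => 3 * p.1 ^ 2 + 3 * b * p.2 ^ 2 - 4 * τ ^ 2)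
      (c := fun p => 3 * p.1 ^ 2 + 3 * b * p.2 ^ 2 - 4 * τ ^ 2) (d := fun p => 6 * b * p.1 * p.2)
      (fun p => (((hasGrad_monomial 3 2 1 p).add (hasGrad_monomial (b : ℂ) 0 3 p)).add
        (hasGrad_monomial (-4 * (τ : ℂ) ^ 2) 0 1 p)).congr
        (fun q => by ring) (by norm_num; left; ring) (by norm_num; ring))
      (fun p => (((hasGrad_monomial 1 3 0 p).add (hasGrad_monomial (3 * b : ℂ) 1 2 p)).add
        (hasGrad_monomial (-4 * (τ : ℂ) ^ 2) 1 0 p)).congr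
        (fun q => by ring) (by norm_num; ring) (by norm_num; ring))
      {(0, 0), (2 * (τ : ℂ), 0), (-2 * (τ : ℂ), 0), (0, 2 * (σ : ℂ)), (0, -2 * (σ : ℂ)),
        ((τ : ℂ), (σ : ℂ)), ((τ : ℂ), -(σ : ℂ)), (-(τ : ℂ), (σ : ℂ)), (-(τ : ℂ), -(σ : ℂ))}
      ?_ ?_ ?_ hr
    · have n1 := ne_neg_of_ne_zero hτ0
      have n2 := ne_neg_of_ne_zero hσ0
      have n3 := ne_neg_of_ne_zero (mul_ne_zero two_ne_zero hτ0)
      have n4 := ne_neg_of_ne_zero (mul_ne_zero two_ne_zero hσ0)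
      rwa [Finset.card_insert_of_notMem (by simp [hτ0, hσ0, hτ0.symm, hσ0.symm, n1, n2, n3, n4, n1.symm, n2.symm]),
        Finset.card_insert_of_notMem (by simp [hτ0, hσ0, hτ0.symm, hσ0.symm, n1, n2, n3, n4, n1.symm, n2.symm]),
        Finset.card_insert_of_notMem (by simp [hτ0, hσ0, hτ0.symm, hσ0.symm, n1, n2, n3, n4, n1.symm, n2.symm]),
        Finset.card_insert_of_notMem (by simp [hτ0, hσ0, hτ0.symm, hσ0.symm, n1, n2, n3, n4, n1.symm, n2.symm]),
        Finset.card_insert_of_notMem (by simp [hτ0, hσ0, hτ0.symm, hσ0.symm, n1, n2, n3, n4, n1.symm, n2.symm]),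
        Finset.card_insert_of_notMem (by simp [hτ0, hσ0, hτ0.symm, hσ0.symm, n1, n2, n3, n4, n1.symm, n2.symm]),
        Finset.card_insert_of_notMem (by simp [hτ0, hσ0, hτ0.symm, hσ0.symm, n1, n2, n3, n4, n1.symm, n2.symm]),
        Finset.card_insert_of_notMem (by simp [hτ0, hσ0, hτ0.symm, hσ0.symm, n1, n2, n3, n4, n1.symm, n2.symm]), Finset.card_singleton] at this
    · rintro ⟨x, y⟩
      simp only [Finset.mem_insert, Finset.mem_singleton, Prod.mk.injEq]
      constructor
      · rintro (⟨rfl, rfl⟩ | ⟨rfl, rfl⟩ | ⟨rfl, rfl⟩ | ⟨rfl, rfl⟩ | ⟨rfl, rfl⟩ | ⟨rfl, rfl⟩ |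
          ⟨rfl, rfl⟩ | ⟨rfl, rfl⟩ | ⟨rfl, rfl⟩)
        · simp
        · constructor <;> ring
        · constructor <;> ring
        · constructor
          · linear_combination 8 * (σ : ℂ) * hst
          · ring
        · constructor
          · linear_combination -8 * (σ : ℂ) * hst
          · ring
        · constructor
          · linear_combination (σ : ℂ) * hst
          · linear_combination 3 * (τ : ℂ) * hst
        · constructor
          · linear_combination -(σ : ℂ) * hst
          · linear_combination 3 * (τ : ℂ) * hst
        · constructor
          · linear_combination (σ : ℂ) * hst
          · linear_combination -3 * (τ : ℂ) * hst
        · constructor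
          · linear_combination -(σ : ℂ) * hst
          · linear_combination -3 * (τ : ℂ) * hst
      · rintro ⟨h1, h2⟩
        by_cases hx : x = 0
        · subst hx
          have : (b : ℂ) * (y * ((y - 2 * σ) * (y + 2 * σ))) = 0 := by
            linear_combination h1 - 4 * y * hst
          have := (mul_eq_zero.1 this).resolve_left hb0
          rcases mul_eq_zero.1 this with h | h
          · simp [h]
          rcases mul_eq_zero.1 h with h | h
          · simp [sub_eq_zero.1 h]
          · simp [eq_neg_of_add_eq_zero_left h]
        by_cases hy : y = 0
        · subst hy
          have : x * ((x - 2 * τ) * (x + 2 * τ)) = 0 := by linear_combination h2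
          rcases mul_eq_zero.1 this with h | h
          · simp [h]
          rcases mul_eq_zero.1 h with h | h
          · simp [sub_eq_zero.1 h]
          · simp [eq_neg_of_add_eq_zero_left h]
        have e1 : 3 * x ^ 2 + b * y ^ 2 - 4 * τ ^ 2 = 0 :=
          (mul_eq_zero.1 (by linear_combination h1 :
            y * (3 * x ^ 2 + b * y ^ 2 - 4 * τ ^ 2) = 0)).resolve_left hy
        have e2 : x ^ 2 + 3 * b * y ^ 2 - 4 * τ ^ 2 = 0 :=
          (mul_eq_zero.1 (by linear_combination h2 :
            x * (x ^ 2 + 3 * b * y ^ 2 - 4 * τ ^ 2) = 0)).resolve_left hx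
        have hx2 : x ^ 2 = (τ : ℂ) ^ 2 := by linear_combination (3 * e1 - e2) / 8
        have hy2 : y ^ 2 = (σ : ℂ) ^ 2 := by
          refine mul_left_cancel₀ hb0 ?_
          linear_combination (3 * e2 - e1) / 8 - hst
        rcases sq_eq_sq_iff_eq_or_eq_neg.1 hx2 with h | h <;>
          rcases sq_eq_sq_iff_eq_or_eq_neg.1 hy2 with h' | h' <;> simp [h, h']
    · intro p hp
      simp only [Finset.mem_insert, Finset.mem_singleton] at hp
      have h4 : (τ : ℂ) ^ 4 ≠ 0 := pow_ne_zero _ hτ0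
      have aux : ∀ (k : ℂ) {w : ℂ}, k ≠ 0 → w = k * τ ^ 4 → w ≠ 0 := fun k w hk h =>
        h ▸ mul_ne_zero hk h4
      rcases hp with rfl | rfl | rfl | rfl | rfl | rfl | rfl | rfl | rfl
      · exact aux (-16) (by norm_num) (by ring)
      · exact aux (-64) (by norm_num) (by ring)
      · exact aux (-64) (by norm_num) (by ring)
      · exact aux (-64) (by norm_num) (by
          linear_combination (-(144 * (b : ℂ) * σ ^ 2 + 48 * τ ^ 2)) * hst)
      · exact aux (-64) (by norm_num) (by
          linear_combination (-(144 * (b : ℂ) * σ ^ 2 + 48 * τ ^ 2)) * hst)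
      · exact aux 32 (by norm_num) (by linear_combination (33 * (τ : ℂ) ^ 2 - 9 * b * σ ^ 2) * hst)
      · exact aux 32 (by norm_num) (by linear_combination (33 * (τ : ℂ) ^ 2 - 9 * b * σ ^ 2) * hst)
      · exact aux 32 (by norm_num) (by linear_combination (33 * (τ : ℂ) ^ 2 - 9 * b * σ ^ 2) * hst)
      · exact aux 32 (by norm_num) (by linear_combination (33 * (τ : ℂ) ^ 2 - 9 * b * σ ^ 2) * hst)
    · intro p hp
      simp only [Finset.mem_insert, Finset.mem_singleton] at hp
      rcases hp with rfl | rfl | rfl | rfl | rfl | rfl | rfl | rfl | rfl <;>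
        simp [mul_pow] <;> nlinarith [sq_nonneg τ, sq_nonneg σ, pow_pos hr 2]
  have h1 : HasComplexDegree (planarMap (fun p : ℂ × ℂ => 3 * p.1 ^ 2 * p.2 + b * p.2 ^ 3)
      (fun p => p.1 ^ 3 + 3 * b * p.1 * p.2 ^ 2)) (Metric.ball 0 r) 9 := by
    refine h0.planar_segment (fun p => by fun_prop) (fun p => by fun_prop) (fun p => by fun_prop)
      (fun p => by fun_prop) fun s hs x y h1 h2 => ?_
    have hs1 : |(1 - s)| ≤ 1 := by rw [abs_le]; constructor <;> linarith [hs.1, hs.2]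
    have bx : ∀ k : ℝ, 0 ≤ k → k ≤ 4 → x ^ 2 = ((k * ((1 - s) * τ ^ 2) : ℝ) : ℂ) →
        ‖x‖ ^ 2 ≤ 4 * τ ^ 2 := by
      intro k hk hk4 h
      refine (norm_sq_le_of_sq_eq h).trans ?_
      rw [abs_mul, abs_mul, abs_of_nonneg hk, abs_of_nonneg (sq_nonneg τ)]
      exact mul_le_mul hk4 (mul_le_of_le_one_left (sq_nonneg τ) hs1) (by positivity) (by norm_num)
    have by' : ∀ k : ℝ, 0 ≤ k → k ≤ 4 → y ^ 2 = ((k * ((1 - s) * σ ^ 2) : ℝ) : ℂ) →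
        ‖y‖ ^ 2 ≤ 4 * σ ^ 2 := by
      intro k hk hk4 h
      refine (norm_sq_le_of_sq_eq h).trans ?_
      rw [abs_mul, abs_mul, abs_of_nonneg hk, abs_of_nonneg (sq_nonneg σ)]
      exact mul_le_mul hk4 (mul_le_of_le_one_left (sq_nonneg σ) hs1) (by positivity) (by norm_num)
    have hx : ‖x‖ ^ 2 ≤ 4 * τ ^ 2 ∧ ‖y‖ ^ 2 ≤ 4 * σ ^ 2 := by
      by_cases hx : x = 0
      · refine ⟨by simp [hx, sq_nonneg], ?_⟩
        by_cases hy : y = 0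
        · simp [hy, sq_nonneg]
        refine by' 4 (by norm_num) le_rfl (mul_left_cancel₀ (mul_ne_zero hb0 hy) ?_)
        subst hx
        push_cast
        linear_combination h1 - (1 - (s : ℂ)) * 4 * y * hst
      by_cases hy : y = 0
      · refine ⟨bx 4 (by norm_num) le_rfl (mul_left_cancel₀ hx ?_), by simp [hy, sq_nonneg]⟩
        subst hy
        push_cast
        linear_combination h2
      have e1 : 3 * x ^ 2 + b * y ^ 2 - (1 - (s : ℂ)) * 4 * τ ^ 2 = 0 :=
        (mul_eq_zero.1 (by linear_combination h1 :
          y * (3 * x ^ 2 + b * y ^ 2 - (1 - (s : ℂ)) * 4 * τ ^ 2) = 0)).resolve_left hy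
      have e2 : x ^ 2 + 3 * b * y ^ 2 - (1 - (s : ℂ)) * 4 * τ ^ 2 = 0 :=
        (mul_eq_zero.1 (by linear_combination h2 :
          x * (x ^ 2 + 3 * b * y ^ 2 - (1 - (s : ℂ)) * 4 * τ ^ 2) = 0)).resolve_left hx
      refine ⟨bx 1 (by norm_num) (by norm_num) ?_, by' 1 (by norm_num) (by norm_num)
        (mul_left_cancel₀ hb0 ?_)⟩
      · push_cast; linear_combination (3 * e1 - e2) / 8
      · push_cast; linear_combination (3 * e2 - e1) / 8 - (1 - (s : ℂ)) * hst
    linarith [hx.1, hx.2]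
  have hI : HasComplexDegree (planarMap
      (fun p : ℂ × ℂ => 3 * p.1 ^ 2 * p.2 + 2 * Complex.I * p.1 * p.2 ^ 2 + b * p.2 ^ 3)
      (fun p => p.1 ^ 3 + 2 * Complex.I * p.1 ^ 2 * p.2 + 3 * b * p.1 * p.2 ^ 2))
      (Metric.ball 0 r) 9 := by
    refine h1.planar_segment (fun p => by fun_prop) (fun p => by fun_prop) (fun p => by fun_prop)
      (fun p => by fun_prop) fun s hs x y e1 e2 => ?_
    obtain ⟨rfl, rfl⟩ := quartic_zero (c := s * Complex.I) (b := b) (x := x) (y := y) hb0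
      (sq_mul_I_ne hb) (by linear_combination e1) (by linear_combination e2)
    simpa using pow_pos hr 2
  refine hI.planar_segment (fun p => by fun_prop) (fun p => by fun_prop) (fun p => by fun_prop)
      (fun p => by fun_prop) fun s hs x y e1 e2 => ?_
  have hne := sq_segment_ne hb ha (s := s)
  obtain ⟨rfl, rfl⟩ := quartic_zero (c := (1 - (s : ℂ)) * Complex.I + s * a) (b := b) (x := x) (y := y)
    hb0 hne (by linear_combination e1) (by linear_combination e2)
  simpa using pow_pos hr 2

/-- For non-zero `x` and `y` the second equation reads `c x = -2 b y²`, and substitution into the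
first gives `c² = 4 b`. -/
theorem cubic_zero {b c x y : ℂ} (hb : b ≠ 0) (hc : c ^ 2 ≠ 4 * b)
    (h1 : 3 * x ^ 2 + 2 * c * x * y ^ 2 + b * y ^ 4 = 0)
    (h2 : 2 * c * x ^ 2 * y + 4 * b * x * y ^ 3 = 0) : x = 0 ∧ y = 0 := by
  by_cases hx : x = 0
  · subst hx; simpa [hb] using h1
  by_cases hy : y = 0
  · subst hy; simp [hx] at h1
  exfalso
  have e : c * x + 2 * b * y ^ 2 = 0 :=
    (mul_eq_zero.1 (by linear_combination h2 :
      2 * x * y * (c * x + 2 * b * y ^ 2) = 0)).resolve_left (by simp [hx, hy])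
  refine hc (sub_eq_zero.1 ((mul_eq_zero.1 (?_ : 3 * b * y ^ 4 * (c ^ 2 - 4 * b) = 0)).resolve_left
    (by simp [hb, hy])))
  linear_combination -c ^ 2 * h1 + (3 * c * x - 6 * b * y ^ 2 + 2 * c ^ 2 * y ^ 2) * e

/-- The degree of the gradient of `x (x² + a x y² + b y⁴)`. -/
theorem hasComplexDegree_cubic {a b : ℝ} (hb : 0 < b) (ha : a ^ 2 ≠ 4 * b) {r : ℝ} (hr : 0 < r) :
    HasComplexDegree (planarMap
      (fun p : ℂ × ℂ => 3 * p.1 ^ 2 + 2 * a * p.1 * p.2 ^ 2 + b * p.2 ^ 4)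
      (fun p => 2 * a * p.1 ^ 2 * p.2 + 4 * b * p.1 * p.2 ^ 3)) (Metric.ball 0 r) 10 := by
  -- The ratios make all ten zeros explicit: `b ν⁴ = 3 τ²` gives four zeros with `x = 0`, and `3 ν²
  -- = 5 κ²` makes `x² = (16/25) τ²` on the lines `y = ±κ`. The remaining two are `(±τ, 0)`.
  obtain ⟨κ, ν, τ, hκ, hν, hτ, hκν, hντ, hsm⟩ : ∃ κ ν τ : ℝ, 0 < κ ∧ 0 < ν ∧ 0 < τ ∧
      3 * ν ^ 2 = 5 * κ ^ 2 ∧ b * ν ^ 4 = 3 * τ ^ 2 ∧ 2 * τ ^ 2 + ν ^ 2 < r ^ 2 := by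
    have hlim : Tendsto (fun ν : ℝ => 2 * (b / 3 * ν ^ 4) + ν ^ 2) (𝓝[>] 0) (𝓝 0) := by
      have : Continuous fun ν : ℝ => 2 * (b / 3 * ν ^ 4) + ν ^ 2 := by fun_prop
      have := this.tendsto 0
      norm_num at this
      exact this.mono_left nhdsWithin_le_nhds
    obtain ⟨ν, h1, hν⟩ := ((hlim.eventually (gt_mem_nhds (pow_pos hr 2))).and
      self_mem_nhdsWithin).exists
    have hν' : 0 < ν := hν
    refine ⟨√(3 / 5) * ν, ν, √(b / 3) * ν ^ 2, by positivity, hν', by positivity, ?_, ?_, ?_⟩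
    · rw [mul_pow, Real.sq_sqrt (by norm_num)]; ring
    · rw [mul_pow, Real.sq_sqrt (by positivity)]; ring
    · rw [mul_pow, Real.sq_sqrt (by positivity)]
      calc _ = 2 * (b / 3 * ν ^ 4) + ν ^ 2 := by ring
        _ < r ^ 2 := h1
  have hb0 : (b : ℂ) ≠ 0 := by exact_mod_cast hb.ne'
  have hτ0 : (τ : ℂ) ≠ 0 := by exact_mod_cast hτ.ne'
  have hν0 : (ν : ℂ) ≠ 0 := by exact_mod_cast hν.ne'
  have hκ0 : (κ : ℂ) ≠ 0 := by exact_mod_cast hκ.ne'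
  have hkn : 3 * (ν : ℂ) ^ 2 = 5 * κ ^ 2 := by exact_mod_cast hκν
  have hnt : (b : ℂ) * ν ^ 4 = 3 * τ ^ 2 := by exact_mod_cast hντ
  have hI2 := Complex.I_sq
  -- This perturbed map is not a gradient. The degree does not require that, and the zeros are
  -- simpler this way.
  have h0 : HasComplexDegree (planarMap
      (fun p : ℂ × ℂ => 3 * p.1 ^ 2 + b * p.2 ^ 4 - 3 * τ ^ 2)
      (fun p => 4 * b * p.1 * p.2 ^ 3 - 4 * b * κ ^ 2 * p.1 * p.2)) (Metric.ball 0 r) 10 := by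
    have := hasComplexDegree_planarMap (r := r)
      (A := fun p : ℂ × ℂ => 3 * p.1 ^ 2 + b * p.2 ^ 4 - 3 * τ ^ 2)
      (B := fun p : ℂ × ℂ => 4 * b * p.1 * p.2 ^ 3 - 4 * b * κ ^ 2 * p.1 * p.2)
      (fun p => by fun_prop) (fun p => by fun_prop)
      (a := fun p => 6 * p.1) (b := fun p => 4 * b * p.2 ^ 3)
      (c := fun p => 4 * b * p.2 ^ 3 - 4 * b * κ ^ 2 * p.2)
      (d := fun p => 12 * b * p.1 * p.2 ^ 2 - 4 * b * κ ^ 2 * p.1)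
      (fun p => (((hasGrad_monomial 3 2 0 p).add (hasGrad_monomial (b : ℂ) 0 4 p)).add
        (hasGrad_monomial (-3 * (τ : ℂ) ^ 2) 0 0 p)).congr
        (fun q => by ring) (by norm_num; ring) (by norm_num; ring))
      (fun p => ((hasGrad_monomial (4 * b : ℂ) 1 3 p).add
        (hasGrad_monomial (-4 * (b : ℂ) * κ ^ 2) 1 1 p)).congr
        (fun q => by ring) (by norm_num; ring) (by norm_num; ring))
      {(0, (ν : ℂ)), (0, -(ν : ℂ)), (0, Complex.I * (ν : ℂ)), (0, -(Complex.I * (ν : ℂ))),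
        ((τ : ℂ), 0), (-(τ : ℂ), 0), (4 / 5 * (τ : ℂ), (κ : ℂ)), (4 / 5 * (τ : ℂ), -(κ : ℂ)),
        (-(4 / 5 * (τ : ℂ)), (κ : ℂ)), (-(4 / 5 * (τ : ℂ)), -(κ : ℂ))}
      ?_ ?_ ?_ hr
    · have hI : ∀ e : ℂ, e ^ 2 = 1 → (ν : ℂ) ≠ e * (Complex.I * ν) := by
        intro e he h
        have h2 : (ν : ℂ) ^ 2 = -(ν : ℂ) ^ 2 := by
          calc (ν : ℂ) ^ 2 = (e * (Complex.I * ν)) ^ 2 := by rw [← h]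
            _ = -(ν : ℂ) ^ 2 := by linear_combination (ν : ℂ) ^ 2 * he * Complex.I ^ 2 + (ν : ℂ) ^ 2 * hI2
        rw [self_eq_neg] at h2
        exact pow_ne_zero 2 hν0 h2
      have hI1 : (ν : ℂ) ≠ Complex.I * ν := by simpa using hI 1 (by norm_num)
      have hI3 : (ν : ℂ) ≠ -(Complex.I * ν) := by simpa using hI (-1) (by norm_num)
      have hI4 : -(ν : ℂ) ≠ Complex.I * ν := fun h => hI3 (by rw [← h, neg_neg])
      have n1 := ne_neg_of_ne_zero hτ0
      have n2 := ne_neg_of_ne_zero hν0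
      have n3 := ne_neg_of_ne_zero (mul_ne_zero Complex.I_ne_zero hν0)
      have n4 := ne_neg_of_ne_zero hκ0
      have n5 := ne_neg_of_ne_zero (mul_ne_zero (show (4 / 5 : ℂ) ≠ 0 by norm_num) hτ0)
      rwa [Finset.card_insert_of_notMem (by simp [hτ0, hν0, hκ0, hτ0.symm, hκ0.symm, hI1, hI3, hI4, n1, n2, n3, n4, n5, n1.symm, n4.symm]),
        Finset.card_insert_of_notMem (by simp [hτ0, hν0, hκ0, hτ0.symm, hκ0.symm, hI1, hI3, hI4, n1, n2, n3, n4, n5, n1.symm, n4.symm]),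
        Finset.card_insert_of_notMem (by simp [hτ0, hν0, hκ0, hτ0.symm, hκ0.symm, hI1, hI3, hI4, n1, n2, n3, n4, n5, n1.symm, n4.symm]),
        Finset.card_insert_of_notMem (by simp [hτ0, hν0, hκ0, hτ0.symm, hκ0.symm, hI1, hI3, hI4, n1, n2, n3, n4, n5, n1.symm, n4.symm]),
        Finset.card_insert_of_notMem (by simp [hτ0, hν0, hκ0, hτ0.symm, hκ0.symm, hI1, hI3, hI4, n1, n2, n3, n4, n5, n1.symm, n4.symm]),
        Finset.card_insert_of_notMem (by simp [hτ0, hν0, hκ0, hτ0.symm, hκ0.symm, hI1, hI3, hI4, n1, n2, n3, n4, n5, n1.symm, n4.symm]),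
        Finset.card_insert_of_notMem (by simp [hτ0, hν0, hκ0, hτ0.symm, hκ0.symm, hI1, hI3, hI4, n1, n2, n3, n4, n5, n1.symm, n4.symm]),
        Finset.card_insert_of_notMem (by simp [hτ0, hν0, hκ0, hτ0.symm, hκ0.symm, hI1, hI3, hI4, n1, n2, n3, n4, n5, n1.symm, n4.symm]),
        Finset.card_insert_of_notMem (by simp [hτ0, hν0, hκ0, hτ0.symm, hκ0.symm, hI1, hI3, hI4, n1, n2, n3, n4, n5, n1.symm, n4.symm]), Finset.card_singleton] at this
    · rintro ⟨x, y⟩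
      simp only [Finset.mem_insert, Finset.mem_singleton, Prod.mk.injEq]
      have hnk : (b : ℂ) * κ ^ 4 = 27 / 25 * τ ^ 2 := by
        linear_combination 9 / 25 * hnt - b / 25 * (3 * ν ^ 2 + 5 * κ ^ 2) * hkn
      constructor
      · rintro (⟨rfl, rfl⟩ | ⟨rfl, rfl⟩ | ⟨rfl, rfl⟩ | ⟨rfl, rfl⟩ | ⟨rfl, rfl⟩ | ⟨rfl, rfl⟩ |
          ⟨rfl, rfl⟩ | ⟨rfl, rfl⟩ | ⟨rfl, rfl⟩ | ⟨rfl, rfl⟩)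
        · exact ⟨by linear_combination hnt, by ring⟩
        · exact ⟨by linear_combination hnt, by ring⟩
        · exact ⟨by linear_combination hnt + b * ν ^ 4 * (Complex.I ^ 2 - 1) * hI2, by ring⟩
        · exact ⟨by linear_combination hnt + b * ν ^ 4 * (Complex.I ^ 2 - 1) * hI2, by ring⟩
        · exact ⟨by ring, by ring⟩
        · exact ⟨by ring, by ring⟩
        · exact ⟨by linear_combination hnk, by ring⟩
        · exact ⟨by linear_combination hnk, by ring⟩
        · exact ⟨by linear_combination hnk, by ring⟩
        · exact ⟨by linear_combination hnk, by ring⟩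
      · rintro ⟨h1, h2⟩
        by_cases hx : x = 0
        · subst hx
          have : (b : ℂ) * ((y - ν) * ((y + ν) * ((y - Complex.I * ν) * (y + Complex.I * ν)))) = 0 := by
            linear_combination h1 - hnt - b * ν ^ 2 * (y ^ 2 - ν ^ 2) * hI2
          rcases mul_eq_zero.1 ((mul_eq_zero.1 this).resolve_left hb0) with h | h
          · simp [sub_eq_zero.1 h]
          rcases mul_eq_zero.1 h with h | h
          · simp [eq_neg_of_add_eq_zero_left h]
          rcases mul_eq_zero.1 h with h | h
          · simp [sub_eq_zero.1 h]
          · simp [eq_neg_of_add_eq_zero_left h]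
        by_cases hy : y = 0
        · subst hy
          have : x ^ 2 = (τ : ℂ) ^ 2 := by linear_combination h1 / 3
          rcases sq_eq_sq_iff_eq_or_eq_neg.1 this with h | h <;> simp [h]
        have hy2 : y ^ 2 = (κ : ℂ) ^ 2 := sub_eq_zero.1 ((mul_eq_zero.1 (by linear_combination h2 :
            4 * b * x * y * (y ^ 2 - κ ^ 2) = 0)).resolve_left (by simp [hx, hy, hb0]))
        have hx2 : x ^ 2 = (4 / 5 * τ : ℂ) ^ 2 := by
          linear_combination h1 / 3 - b / 3 * (y ^ 2 + κ ^ 2) * hy2 - hnk / 3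
        rcases sq_eq_sq_iff_eq_or_eq_neg.1 hx2 with h | h <;>
          rcases sq_eq_sq_iff_eq_or_eq_neg.1 hy2 with h' | h' <;> simp [h, h']
    · intro p hp
      simp only [Finset.mem_insert, Finset.mem_singleton] at hp
      have aux : ∀ (k : ℂ) {w v : ℂ}, v ≠ 0 → k ≠ 0 → w = k * v → w ≠ 0 := fun k w v hv hk h =>
        h ▸ mul_ne_zero hk hv
      have h1 : (b : ℂ) ^ 2 * ν ^ 6 ≠ 0 := by simp [hb0, hν0]
      have h2 : (b : ℂ) * τ ^ 2 * κ ^ 2 ≠ 0 := by simp [hb0, hτ0, hκ0]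
      rcases hp with rfl | rfl | rfl | rfl | rfl | rfl | rfl | rfl | rfl | rfl
      · exact aux (-32 / 5) h1 (by norm_num)
          (by linear_combination (-(16 : ℂ) / 5) * b ^ 2 * ν ^ 4 * hkn)
      · exact aux (-32 / 5) h1 (by norm_num)
          (by linear_combination (-(16 : ℂ) / 5) * b ^ 2 * ν ^ 4 * hkn)
      · exact aux (128 / 5) h1 (by norm_num) (by
          linear_combination (-(16 : ℂ) / 5) * b ^ 2 * ν ^ 4 * hkn * Complex.I ^ 4 +
            (-16 * b ^ 2 * ν ^ 6 * (Complex.I ^ 4 - Complex.I ^ 2 + 1) + (48 : ℂ) / 5 * b ^ 2 * ν ^ 6 * (Complex.I ^ 2 - 1)) * hI2)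
      · exact aux (128 / 5) h1 (by norm_num) (by
          linear_combination (-(16 : ℂ) / 5) * b ^ 2 * ν ^ 4 * hkn * Complex.I ^ 4 +
            (-16 * b ^ 2 * ν ^ 6 * (Complex.I ^ 4 - Complex.I ^ 2 + 1) + (48 : ℂ) / 5 * b ^ 2 * ν ^ 6 * (Complex.I ^ 2 - 1)) * hI2)
      · exact aux (-24) h2 (by norm_num) (by ring)
      · exact aux (-24) h2 (by norm_num) (by ring)
      · exact aux (768 / 25) h2 (by norm_num) (by ring)
      · exact aux (768 / 25) h2 (by norm_num) (by ring)
      · exact aux (768 / 25) h2 (by norm_num) (by ring)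
      · exact aux (768 / 25) h2 (by norm_num) (by ring)
    · intro p hp
      simp only [Finset.mem_insert, Finset.mem_singleton] at hp
      rcases hp with rfl | rfl | rfl | rfl | rfl | rfl | rfl | rfl | rfl | rfl <;>
        simp [mul_pow] <;> nlinarith [sq_nonneg τ, sq_nonneg ν, pow_pos hr 2]
  have h1 : HasComplexDegree (planarMap (fun p : ℂ × ℂ => 3 * p.1 ^ 2 + b * p.2 ^ 4)
      (fun p => 4 * b * p.1 * p.2 ^ 3)) (Metric.ball 0 r) 10 := by
    refine h0.planar_segment (fun p => by fun_prop) (fun p => by fun_prop) (fun p => by fun_prop)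
      (fun p => by fun_prop) fun s hs x y h1 h2 => ?_
    have hs0 : 0 ≤ 1 - s := by linarith [hs.2]
    have hs1 : 1 - s ≤ 1 := by linarith [hs.1]
    have hnk : b * κ ^ 4 = 27 / 25 * τ ^ 2 := by
      linear_combination 9 / 25 * hντ - b / 25 * (3 * ν ^ 2 + 5 * κ ^ 2) * hκν
    by_cases hx : x = 0
    · subst hx
      have e : y ^ 4 = (((1 - s) * ν ^ 4 : ℝ) : ℂ) := by
        refine mul_left_cancel₀ hb0 ?_
        push_cast
        linear_combination h1 - (1 - (s : ℂ)) * hnt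
      have e' : (‖y‖ ^ 2) ^ 2 ≤ (ν ^ 2) ^ 2 := by
        calc (‖y‖ ^ 2) ^ 2 = ‖y ^ 4‖ := by rw [norm_pow]; ring
          _ = (1 - s) * ν ^ 4 := by
            rw [e, Complex.norm_real, Real.norm_of_nonneg (by positivity)]
          _ ≤ (ν ^ 2) ^ 2 := by nlinarith [pow_pos hν 4]
      have := (sq_le_sq₀ (by positivity) (by positivity)).1 e'
      simp only [norm_zero]
      nlinarith [sq_nonneg τ]
    by_cases hy : y = 0
    · subst hy
      have e : x ^ 2 = (((1 - s) * τ ^ 2 : ℝ) : ℂ) := by push_cast; linear_combination h1 / 3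
      have := norm_sq_le_of_sq_eq e
      rw [abs_of_nonneg (by positivity)] at this
      simp only [norm_zero]
      nlinarith [sq_nonneg τ, sq_nonneg ν]
    have hy2 : y ^ 2 = (((1 - s) * κ ^ 2 : ℝ) : ℂ) := by
      push_cast
      exact sub_eq_zero.1 ((mul_eq_zero.1 (by linear_combination h2 :
        4 * b * x * y * (y ^ 2 - (1 - (s : ℂ)) * κ ^ 2) = 0)).resolve_left (by simp [hx, hy, hb0]))
    have hx2 : x ^ 2 = (((1 - s) * τ ^ 2 - b / 3 * ((1 - s) * κ ^ 2) ^ 2 : ℝ) : ℂ) := by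
      have h3 : y ^ 4 = ((((1 - s) * κ ^ 2) ^ 2 : ℝ) : ℂ) := by
        rw [show y ^ 4 = (y ^ 2) ^ 2 by ring, hy2]; push_cast; ring
      push_cast at h3 ⊢
      linear_combination h1 / 3 - b / 3 * h3
    have n1 := norm_sq_le_of_sq_eq hx2
    have n2 := norm_sq_le_of_sq_eq hy2
    rw [abs_of_nonneg (by positivity)] at n2
    have n3 : |(1 - s) * τ ^ 2 - b / 3 * ((1 - s) * κ ^ 2) ^ 2| ≤ 2 * τ ^ 2 := by
      have e : b / 3 * ((1 - s) * κ ^ 2) ^ 2 = (1 - s) ^ 2 * (9 / 25 * τ ^ 2) := by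
        linear_combination (1 - s) ^ 2 / 3 * hnk
      rw [e, abs_le]
      have q1 : (1 - s) ^ 2 ≤ 1 := by nlinarith
      constructor <;> nlinarith [sq_nonneg τ, mul_nonneg hs0 (sq_nonneg τ), mul_nonneg (sq_nonneg (1 - s)) (sq_nonneg τ)]
    have n4 : (1 - s) * κ ^ 2 ≤ ν ^ 2 := by nlinarith [sq_nonneg κ]
    linarith
  have hI : HasComplexDegree (planarMap
      (fun p : ℂ × ℂ => 3 * p.1 ^ 2 + 2 * Complex.I * p.1 * p.2 ^ 2 + b * p.2 ^ 4)
      (fun p => 2 * Complex.I * p.1 ^ 2 * p.2 + 4 * b * p.1 * p.2 ^ 3)) (Metric.ball 0 r) 10 := by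
    refine h1.planar_segment (fun p => by fun_prop) (fun p => by fun_prop) (fun p => by fun_prop)
      (fun p => by fun_prop) fun s hs x y e1 e2 => ?_
    obtain ⟨rfl, rfl⟩ := cubic_zero (c := s * Complex.I) (b := b) (x := x) (y := y) hb0
      (sq_mul_I_ne hb) (by linear_combination e1) (by linear_combination e2)
    simpa using pow_pos hr 2
  refine hI.planar_segment (fun p => by fun_prop) (fun p => by fun_prop) (fun p => by fun_prop)
      (fun p => by fun_prop) fun s hs x y e1 e2 => ?_
  have hne := sq_segment_ne hb ha (s := s)
  obtain ⟨rfl, rfl⟩ := cubic_zero (c := (1 - (s : ℂ)) * Complex.I + s * a) (b := b) (x := x) (y := y)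
    hb0 hne (by linear_combination e1) (by linear_combination e2)
  simpa using pow_pos hr 2

end ComplexDegrees

/-! ### Real degrees of the gradients of the normal forms. -/

section RealDegrees

variable {r : ℝ}

/-- The degree of the real gradient of `x⁴ + a x² y² + y⁴`. -/
theorem hasDegree_fermat {a : ℝ} (ha : -2 < a) (hr : 0 < r) :
    HasDegree (planarMap (fun p : ℝ × ℝ => 4 * p.1 ^ 3 + 2 * a * p.1 * p.2 ^ 2)
      (fun p => 4 * p.2 ^ 3 + 2 * a * p.1 ^ 2 * p.2)) (Metric.ball 0 r) 1 := by
  have h0 : HasDegree (planarMap (fun p : ℝ × ℝ => p.1) (fun p => p.2)) (Metric.ball 0 r) 1 := by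
    have := hasDegree_planarMap (r := r) (A := fun p : ℝ × ℝ => p.1) (B := fun p => p.2)
      (fun p => by fun_prop) (fun p => by fun_prop) (a := fun _ => 1) (b := fun _ => 0)
      (c := fun _ => 0) (d := fun _ => 1)
      (fun p => ((hasGrad_monomial 1 1 0 p)).congr (fun q => by ring) (by norm_num) (by norm_num))
      (fun p => ((hasGrad_monomial 1 0 1 p)).congr (fun q => by ring) (by norm_num) (by norm_num))
      {(0, 0)} (fun p => by simp [Prod.ext_iff]) 1 (by decide) (by simp)
      (by simpa using pow_pos hr 2) hr
    simpa using this
  have := HasDegree.planar_homotopy (r := r)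
    (A := fun s p => (1 - s) * p.1 + s * (4 * p.1 ^ 3 + 2 * a * p.1 * p.2 ^ 2))
    (B := fun s p => (1 - s) * p.2 + s * (4 * p.2 ^ 3 + 2 * a * p.1 ^ 2 * p.2))
    (fun q => by fun_prop) (fun q => by fun_prop) (fun s hs x y h1 h2 => ?_) (by simpa using h0)
  · simpa using this
  have hs1 : 0 ≤ 1 - s := by linarith [hs.2]
  -- The field is paired with `(x, y)`. By Euler's identity the gradient contributes four times the
  -- form, which is positive definite for `a > -2`.
  have e : (1 - s) * (x ^ 2 + y ^ 2) + 4 * s * ((x ^ 2 - y ^ 2) ^ 2 + (a + 2) * (x * y) ^ 2) = 0 := by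
    linear_combination x * h1 + y * h2
  have n1 : 0 ≤ (x ^ 2 - y ^ 2) ^ 2 + (a + 2) * (x * y) ^ 2 := by
    have : 0 ≤ a + 2 := by linarith
    positivity
  have n2 : 0 ≤ (1 - s) * (x ^ 2 + y ^ 2) := by positivity
  have n3 := mul_nonneg hs.1 n1
  rcases hs1.eq_or_lt with h | h
  · have hs' : s = 1 := by linarith
    subst hs'
    have n4 : 0 ≤ (a + 2) * (x * y) ^ 2 := mul_nonneg (by linarith) (sq_nonneg _)
    have e1 : (x ^ 2 - y ^ 2) ^ 2 = 0 := by nlinarith [sq_nonneg (x ^ 2 - y ^ 2)]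
    have e2 : (a + 2) * (x * y) ^ 2 = 0 := by nlinarith [sq_nonneg (x ^ 2 - y ^ 2)]
    have e3 : x * y = 0 := pow_eq_zero_iff two_ne_zero |>.1
      ((mul_eq_zero.1 e2).resolve_left (by linarith))
    have e4 : x ^ 2 - y ^ 2 = 0 := pow_eq_zero_iff two_ne_zero |>.1 e1
    rcases mul_eq_zero.1 e3 with h | h
    · subst h
      have : y ^ 2 = 0 := by linarith
      rw [this]; simpa using pow_pos hr 2
    · subst h
      have : x ^ 2 = 0 := by linarith
      rw [this]; simpa using pow_pos hr 2
  · have : x ^ 2 + y ^ 2 = 0 := by nlinarith [sq_nonneg x, sq_nonneg y]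
    rw [this]; exact pow_pos hr 2

/-- The degree of the real gradient of `x y (x² + a x y + y²)` for `a² < 4`. -/
theorem hasDegree_quartic_two_lines {a : ℝ} (ha : a ^ 2 < 4) (hr : 0 < r) :
    HasDegree (planarMap
      (fun p : ℝ × ℝ => 3 * p.1 ^ 2 * p.2 + 2 * a * p.1 * p.2 ^ 2 + p.2 ^ 3)
      (fun p => p.1 ^ 3 + 2 * a * p.1 ^ 2 * p.2 + 3 * p.1 * p.2 ^ 2)) (Metric.ball 0 r) (-1) := by
  have h0 : HasDegree (planarMap (fun p : ℝ × ℝ => p.2) (fun p => p.1)) (Metric.ball 0 r) (-1) := by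
    have := hasDegree_planarMap (r := r) (A := fun p : ℝ × ℝ => p.2) (B := fun p => p.1)
      (fun p => by fun_prop) (fun p => by fun_prop) (a := fun _ => 0) (b := fun _ => 1)
      (c := fun _ => 1) (d := fun _ => 0)
      (fun p => ((hasGrad_monomial 1 0 1 p)).congr (fun q => by ring) (by norm_num) (by norm_num))
      (fun p => ((hasGrad_monomial 1 1 0 p)).congr (fun q => by ring) (by norm_num) (by norm_num))
      {(0, 0)} (fun p => by simp [Prod.ext_iff, and_comm]) (-1) (by decide) (by simp)
      (by simpa using pow_pos hr 2) hr
    simpa using this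
  have := HasDegree.planar_homotopy (r := r)
    (A := fun s p => (1 - s) * p.2 + s * (3 * p.1 ^ 2 * p.2 + 2 * a * p.1 * p.2 ^ 2 + p.2 ^ 3))
    (B := fun s p => (1 - s) * p.1 + s * (p.1 ^ 3 + 2 * a * p.1 ^ 2 * p.2 + 3 * p.1 * p.2 ^ 2))
    (fun q => by fun_prop) (fun q => by fun_prop) (fun s hs x y h1 h2 => ?_) (by simpa using h0)
  · simpa using this
  have hs1 : 0 ≤ 1 - s := by linarith [hs.2]
  -- Here the comparison field is `(y, x)`, the gradient of `x y`, and pairing with it gives a sum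
  -- of squares for `a² < 4`.
  have e : (1 - s) * (x ^ 2 + y ^ 2) + s * ((x ^ 2 + y ^ 2 + a * (x * y)) ^ 2 +
      (4 - a ^ 2) * (x * y) ^ 2) = 0 := by
    linear_combination y * h1 + x * h2
  have n4 : 0 ≤ (4 - a ^ 2) * (x * y) ^ 2 := mul_nonneg (by linarith) (sq_nonneg _)
  have n1 : 0 ≤ (x ^ 2 + y ^ 2 + a * (x * y)) ^ 2 + (4 - a ^ 2) * (x * y) ^ 2 := by positivity
  have n2 : 0 ≤ (1 - s) * (x ^ 2 + y ^ 2) := by positivity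
  have n3 := mul_nonneg hs.1 n1
  have : x ^ 2 + y ^ 2 = 0 := by
    rcases hs1.eq_or_lt with h | h
    · have hs' : s = 1 := by linarith
      subst hs'
      have e1 : (x ^ 2 + y ^ 2 + a * (x * y)) ^ 2 = 0 := by
        nlinarith [sq_nonneg (x ^ 2 + y ^ 2 + a * (x * y))]
      have e2 : (4 - a ^ 2) * (x * y) ^ 2 = 0 := by
        nlinarith [sq_nonneg (x ^ 2 + y ^ 2 + a * (x * y))]
      have e3 : x * y = 0 := pow_eq_zero_iff two_ne_zero |>.1
        ((mul_eq_zero.1 e2).resolve_left (by linarith))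
      have e4 := pow_eq_zero_iff two_ne_zero |>.1 e1
      rw [e3] at e4
      linarith
    · nlinarith [sq_nonneg x, sq_nonneg y]
  rw [this]; exact pow_pos hr 2

/-- The assumptions say that `x` is a multiple root of a cubic with roots `mᵢ w`. These roots are
distinct unless `w = 0`. It keeps a critical point from appearing while distinct branches of a curve
are moved. -/
theorem eq_zero_of_double_root {m₁ m₂ m₃ x w : ℝ} (h12 : m₁ ≠ m₂) (h13 : m₁ ≠ m₃) (h23 : m₂ ≠ m₃)
    (h : (x - m₁ * w) * ((x - m₂ * w) * (x - m₃ * w)) = 0)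
    (h' : (x - m₁ * w) * (x - m₂ * w) + (x - m₁ * w) * (x - m₃ * w) +
      (x - m₂ * w) * (x - m₃ * w) = 0) : w = 0 := by
  rw [← sub_ne_zero] at h12 h13 h23
  rcases mul_eq_zero.1 h with h1 | h1
  · have : (m₁ - m₂) * ((m₁ - m₃) * w ^ 2) = 0 := by
      linear_combination h' - (2 * x - (m₂ + m₃) * w + (x - (m₂ + m₃) * w + m₁ * w)) * h1
    simpa [h12, h13] using this
  rcases mul_eq_zero.1 h1 with h1 | h1
  · have : (m₁ - m₂) * ((m₂ - m₃) * w ^ 2) = 0 := by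
      linear_combination -h' + (2 * x - (m₁ + m₃) * w + (x - (m₁ + m₃) * w + m₂ * w)) * h1
    simpa [h12, h23] using this
  · have : (m₁ - m₃) * ((m₂ - m₃) * w ^ 2) = 0 := by
      linear_combination h' - (2 * x - (m₂ + m₁) * w + (x - (m₂ + m₁) * w + m₃ * w)) * h1
    simpa [h13, h23] using this

/-- The degree of the real gradient of `x y (x + y) (x + a y)` for `0 < a < 1`. -/
theorem hasDegree_quartic_four_lines {a : ℝ} (ha : 0 < a) (ha1 : a < 1) (hr : 0 < r) :
    HasDegree (planarMap
      (fun p : ℝ × ℝ => 3 * p.1 ^ 2 * p.2 + 2 * (1 + a) * p.1 * p.2 ^ 2 + a * p.2 ^ 3)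
      (fun p => p.1 ^ 3 + 2 * (1 + a) * p.1 ^ 2 * p.2 + 3 * a * p.1 * p.2 ^ 2))
      (Metric.ball 0 r) (-3) := by
  obtain ⟨τ, hτ, hτr⟩ : ∃ τ : ℝ, 0 < τ ∧ τ ^ 2 < r ^ 2 := ⟨r / 2, half_pos hr, by nlinarith⟩
  have h3 : √(3 : ℝ) ^ 2 = 3 := Real.sq_sqrt (by norm_num)
  have h3p : 0 < √(3 : ℝ) := by positivity
  -- Up to sign the components are the imaginary and real parts of `(x + i y)³ - τ³`, so the zeros
  -- are the three cube roots of `τ³`. For `τ = 0` this is the gradient of `x y (y - x) (y + x)`.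
  have h0 : HasDegree (planarMap (fun p : ℝ × ℝ => p.2 ^ 3 - 3 * p.1 ^ 2 * p.2)
      (fun p => 3 * p.1 * p.2 ^ 2 - p.1 ^ 3 + τ ^ 3)) (Metric.ball 0 r) (-3) := by
    have hZ : ∀ p : ℝ × ℝ, p ∈ ({(τ, 0), (-τ / 2, √3 * τ / 2), (-τ / 2, -(√3 * τ / 2))} :
        Finset (ℝ × ℝ)) ↔ p.2 ^ 3 - 3 * p.1 ^ 2 * p.2 = 0 ∧
          3 * p.1 * p.2 ^ 2 - p.1 ^ 3 + τ ^ 3 = 0 := by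
      rintro ⟨x, y⟩
      simp only [Finset.mem_insert, Finset.mem_singleton, Prod.mk.injEq]
      constructor
      · rintro (⟨rfl, rfl⟩ | ⟨rfl, rfl⟩ | ⟨rfl, rfl⟩)
        · constructor <;> ring
        · constructor
          · linear_combination √3 * τ ^ 3 / 8 * h3
          · linear_combination -3 * τ ^ 3 / 8 * h3
        · constructor
          · linear_combination -√3 * τ ^ 3 / 8 * h3
          · linear_combination -3 * τ ^ 3 / 8 * h3
      · rintro ⟨h1, h2⟩
        by_cases hy : y = 0
        · subst hy
          left
          exact ⟨(Odd.strictMono_pow (by decide : Odd 3)).injective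
            (by linear_combination -h2 : x ^ 3 = τ ^ 3), rfl⟩
        right
        have e : y ^ 2 = 3 * x ^ 2 := sub_eq_zero.1 ((mul_eq_zero.1 (by linear_combination h1 :
          y * (y ^ 2 - 3 * x ^ 2) = 0)).resolve_left hy)
        have e2 : 2 * x = -τ := (Odd.strictMono_pow (by decide : Odd 3)).injective
          (by linear_combination h2 - 3 * x * e : (2 * x) ^ 3 = (-τ) ^ 3)
        have hx : x = -τ / 2 := by linarith
        have e3 : y ^ 2 = (√3 * τ / 2) ^ 2 := by
          rw [e, hx]; linear_combination -τ ^ 2 / 4 * h3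
        rcases sq_eq_sq_iff_eq_or_eq_neg.1 e3 with h | h
        · left; exact ⟨hx, h⟩
        · right; exact ⟨hx, h⟩
    have hsum : ∀ x y : ℝ, y ^ 3 - 3 * x ^ 2 * y = 0 → 3 * x * y ^ 2 - x ^ 3 + τ ^ 3 = 0 →
        (x ^ 2 + y ^ 2) ^ 3 = (τ ^ 2) ^ 3 := fun x y h1 h2 => by
      linear_combination (y ^ 3 - 3 * x ^ 2 * y) * h1 + (3 * x * y ^ 2 - x ^ 3 - τ ^ 3) * h2
    have hsum' : ∀ x y : ℝ, y ^ 3 - 3 * x ^ 2 * y = 0 → 3 * x * y ^ 2 - x ^ 3 + τ ^ 3 = 0 →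
        x ^ 2 + y ^ 2 = τ ^ 2 := fun x y h1 h2 =>
      (Odd.strictMono_pow (by decide : Odd 3)).injective (hsum x y h1 h2)
    have := hasDegree_planarMap (r := r)
      (A := fun p : ℝ × ℝ => p.2 ^ 3 - 3 * p.1 ^ 2 * p.2)
      (B := fun p => 3 * p.1 * p.2 ^ 2 - p.1 ^ 3 + τ ^ 3)
      (fun p => by fun_prop) (fun p => by fun_prop) (a := fun p => -6 * p.1 * p.2)
      (b := fun p => 3 * p.2 ^ 2 - 3 * p.1 ^ 2)
      (c := fun p => 3 * p.2 ^ 2 - 3 * p.1 ^ 2) (d := fun p => 6 * p.1 * p.2)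
      (fun p => ((hasGrad_monomial 1 0 3 p).add (hasGrad_monomial (-3) 2 1 p)).congr
        (fun q => by ring) (by norm_num; left; ring) (by norm_num; ring))
      (fun p => (((hasGrad_monomial 3 1 2 p).add (hasGrad_monomial (-1) 3 0 p)).add
        (hasGrad_monomial (τ ^ 3) 0 0 p)).congr
        (fun q => by ring) (by norm_num; ring) (by norm_num; ring))
      {(τ, 0), (-τ / 2, √3 * τ / 2), (-τ / 2, -(√3 * τ / 2))} hZ (-1) (by decide)
      (fun p hp => by
        rw [hZ] at hp
        have e := hsum' _ _ hp.1 hp.2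
        refine sign_neg ?_
        have : -6 * p.1 * p.2 * (6 * p.1 * p.2) -
            (3 * p.2 ^ 2 - 3 * p.1 ^ 2) * (3 * p.2 ^ 2 - 3 * p.1 ^ 2) = -9 * (τ ^ 2) ^ 2 := by
          rw [← e]; ring
        rw [this]
        have := pow_pos hτ 4
        nlinarith)
      (fun p hp => by rw [hZ] at hp; rw [hsum' _ _ hp.1 hp.2]; exact hτr) hr
    have hc : ({(τ, 0), (-τ / 2, √3 * τ / 2), (-τ / 2, -(√3 * τ / 2))} :
        Finset (ℝ × ℝ)).card = 3 := by
      rw [Finset.card_eq_three]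
      refine ⟨_, _, _, ?_, ?_, ?_, rfl⟩
      · intro h
        have : τ = -τ / 2 := (Prod.ext_iff.1 h).1
        linarith
      · intro h
        have : τ = -τ / 2 := (Prod.ext_iff.1 h).1
        linarith
      · intro h
        have := (Prod.ext_iff.1 h).2
        simp only at this
        nlinarith [mul_pos h3p hτ]
    rw [hc] at this
    simpa using this
  have h1 : HasDegree (planarMap (fun p : ℝ × ℝ => p.2 ^ 3 - 3 * p.1 ^ 2 * p.2)
      (fun p => 3 * p.1 * p.2 ^ 2 - p.1 ^ 3)) (Metric.ball 0 r) (-3) := by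
    have := HasDegree.planar_homotopy (r := r)
      (A := fun _ p => p.2 ^ 3 - 3 * p.1 ^ 2 * p.2)
      (B := fun s p => 3 * p.1 * p.2 ^ 2 - p.1 ^ 3 + (1 - s) * τ ^ 3)
      (fun q => by fun_prop) (fun q => by fun_prop) (fun s hs x y h1 h2 => ?_) (by simpa using h0)
    · simpa using this
    have e : (x ^ 2 + y ^ 2) ^ 3 = (1 - s) ^ 2 * (τ ^ 2) ^ 3 := by
      linear_combination (y ^ 3 - 3 * x ^ 2 * y) * h1 +
        (3 * x * y ^ 2 - x ^ 3 - (1 - s) * τ ^ 3) * h2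
    have e2 : (1 - s) ^ 2 ≤ 1 := by nlinarith [hs.1, hs.2]
    have e3 : (x ^ 2 + y ^ 2) ^ 3 ≤ (τ ^ 2) ^ 3 := by
      rw [e]; exact mul_le_of_le_one_left (by positivity) e2
    exact (((Odd.strictMono_pow (by decide : Odd 3)).le_iff_le).1 e3).trans_lt hτr
  have hb : 1 < a⁻¹ := (one_lt_inv₀ ha).2 ha1
  have hab : a * a⁻¹ = 1 := mul_inv_cancel₀ ha.ne'
  -- The potential is `x (y - m₁ x) (y - m₂ x) (y - m₃ x)`, with slopes moving from `1, 0, -1` to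
  -- `0, -1, -1/a` and remaining distinct.
  have := HasDegree.planar_homotopy (r := r)
    (A := fun s p => p.2 ^ 3 - 2 * ((1 - s) - s - ((1 - s) + s * a⁻¹)) * p.1 * p.2 ^ 2 +
      3 * (-(1 - s) * s - (1 - 2 * s) * ((1 - s) + s * a⁻¹)) * p.1 ^ 2 * p.2 -
      4 * ((1 - s) * s * ((1 - s) + s * a⁻¹)) * p.1 ^ 3)
    (B := fun s p => 3 * p.1 * p.2 ^ 2 - 2 * ((1 - s) - s - ((1 - s) + s * a⁻¹)) * p.1 ^ 2 * p.2 +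
      (-(1 - s) * s - (1 - 2 * s) * ((1 - s) + s * a⁻¹)) * p.1 ^ 3)
    (d := -3) (fun q => by fun_prop) (fun q => by fun_prop) (fun s hs x y h1 h2 => ?_) ?_
  -- It remains to multiply the potential by `a`, through the positive factors `1 - s + s a`.
  · have h2 := HasDegree.planar_homotopy (r := r)
      (A := fun s p => (1 - s + s * a) * (p.2 ^ 3 + 2 * (1 + a⁻¹) * p.1 * p.2 ^ 2 +
        3 * a⁻¹ * p.1 ^ 2 * p.2))
      (B := fun s p => (1 - s + s * a) * (3 * p.1 * p.2 ^ 2 + 2 * (1 + a⁻¹) * p.1 ^ 2 * p.2 +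
        a⁻¹ * p.1 ^ 3))
      (d := -3) (fun q => by fun_prop) (fun q => by fun_prop) (fun s hs x y h1 h2 => ?_) ?_
    · convert h2 using 2
      · funext p
        linear_combination (-2 * p.1 * p.2 ^ 2 - 3 * p.1 ^ 2 * p.2) * hab
      · funext p
        linear_combination (-2 * p.1 ^ 2 * p.2 - p.1 ^ 3) * hab
    · have hne : 1 - s + s * a ≠ 0 := by nlinarith [hs.1, hs.2]
      have h1 := (mul_eq_zero.1 h1).resolve_left hne
      have h2 := (mul_eq_zero.1 h2).resolve_left hne
      have hx : x = 0 := by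
        by_contra hx
        refine hx (eq_zero_of_double_root (m₁ := 0) (m₂ := -1) (m₃ := -a⁻¹) (x := y) (w := x)
          (by norm_num) (by linarith) (by intro h; linarith) ?_ ?_)
        · refine (mul_eq_zero.1 (?_ : 4 * x * _ = 0)).resolve_left (by simpa using hx)
          linear_combination x * h1 + y * h2
        · refine (mul_eq_zero.1 (?_ : x * _ = 0)).resolve_left hx
          linear_combination h2
      subst hx
      have : y = 0 := by simpa using h1
      subst this
      simpa using pow_pos hr 2
    · convert this using 2
      · funext p; ring
      · funext p; ring
  · have hx : x = 0 := by
      by_contra hx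
      have hp : 0 ≤ s * (a⁻¹ - 1) := mul_nonneg hs.1 (by linarith)
      refine hx (eq_zero_of_double_root (m₁ := 1 - s) (m₂ := -s) (m₃ := -((1 - s) + s * a⁻¹))
        (x := y) (w := x) (by intro h; linarith) (by intro h; linarith [hs.1, hs.2]) ?_ ?_ ?_)
      · intro h
        have h' : s = 1 := by linarith [hs.2]
        rw [h'] at hp h
        linarith
      · refine (mul_eq_zero.1 (?_ : 4 * x * _ = 0)).resolve_left (by simpa using hx)
        linear_combination x * h1 + y * h2
      · refine (mul_eq_zero.1 (?_ : x * _ = 0)).resolve_left hx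
        linear_combination h2
    subst hx
    have : y = 0 := by simpa using h1
    subst this
    simpa using pow_pos hr 2
  · convert h1 using 2
    · funext p; ring
    · funext p; ring

/-- The degree of the real gradient of `x (x - y²) (x - a y²)` for `0 < a < 1`. -/
theorem hasDegree_cubic_three_branches {a : ℝ} (ha : 0 < a) (ha1 : a < 1) (hr : 0 < r) :
    HasDegree (planarMap
      (fun p : ℝ × ℝ => 3 * p.1 ^ 2 + 2 * (-(1 + a)) * p.1 * p.2 ^ 2 + a * p.2 ^ 4)
      (fun p => 2 * (-(1 + a)) * p.1 ^ 2 * p.2 + 4 * a * p.1 * p.2 ^ 3))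
      (Metric.ball 0 r) (-2) := by
  obtain ⟨τ, hτ, hτr⟩ : ∃ τ : ℝ, 0 < τ ∧ τ ^ 2 < r ^ 2 := ⟨r / 2, half_pos hr, by nlinarith⟩
  -- The gradient of `x (x - y²) (x + y²) + τ⁴ x`, with the two simple zeros `(0, ±τ)` of negative
  -- sign.
  have h0 : HasDegree (planarMap (fun p : ℝ × ℝ => 3 * p.1 ^ 2 - p.2 ^ 4 + τ ^ 4)
      (fun p => -4 * p.1 * p.2 ^ 3)) (Metric.ball 0 r) (-2) := by
    have := hasDegree_planarMap (r := r)
      (A := fun p : ℝ × ℝ => 3 * p.1 ^ 2 - p.2 ^ 4 + τ ^ 4)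
      (B := fun p => -4 * p.1 * p.2 ^ 3)
      (fun p => by fun_prop) (fun p => by fun_prop) (a := fun p => 6 * p.1)
      (b := fun p => -4 * p.2 ^ 3) (c := fun p => -4 * p.2 ^ 3) (d := fun p => -12 * p.1 * p.2 ^ 2)
      (fun p => (((hasGrad_monomial 3 2 0 p).add (hasGrad_monomial (-1) 0 4 p)).add
        (hasGrad_monomial (τ ^ 4) 0 0 p)).congr
        (fun q => by ring) (by norm_num; ring) (by norm_num))
      (fun p => ((hasGrad_monomial (-4) 1 3 p)).congr
        (fun q => by ring) (by norm_num) (by norm_num; ring))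
      {(0, τ), (0, -τ)} ?_ (-1) (by decide) ?_ ?_ hr
    · rw [Finset.card_pair (by simp [Prod.ext_iff]; intro h; linarith)] at this
      simpa using this
    · rintro ⟨x, y⟩
      simp only [Finset.mem_insert, Finset.mem_singleton, Prod.mk.injEq]
      constructor
      · rintro (⟨rfl, rfl⟩ | ⟨rfl, rfl⟩) <;> constructor <;> ring
      · rintro ⟨h1, h2⟩
        have hy : y ≠ 0 := by
          rintro rfl
          have := pow_pos hτ 4
          nlinarith [sq_nonneg x]
        have hx : x = 0 := by simpa [hy] using h2
        subst hx
        have e : (y ^ 2) ^ 2 = (τ ^ 2) ^ 2 := by linear_combination -h1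
        have e' : y ^ 2 = τ ^ 2 := (sq_eq_sq₀ (by positivity) (by positivity)).1 e
        rcases sq_eq_sq_iff_eq_or_eq_neg.1 e' with h | h <;> simp [h]
    · intro p hp
      simp only [Finset.mem_insert, Finset.mem_singleton] at hp
      have := pow_pos hτ 6
      rcases hp with rfl | rfl <;> exact sign_neg (by ring_nf; nlinarith)
    · intro p hp
      simp only [Finset.mem_insert, Finset.mem_singleton] at hp
      rcases hp with rfl | rfl <;> simpa using hτr
  have h1 : HasDegree (planarMap (fun p : ℝ × ℝ => 3 * p.1 ^ 2 - p.2 ^ 4)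
      (fun p => -4 * p.1 * p.2 ^ 3)) (Metric.ball 0 r) (-2) := by
    have := HasDegree.planar_homotopy (r := r)
      (A := fun s p => 3 * p.1 ^ 2 - p.2 ^ 4 + (1 - s) * τ ^ 4) (B := fun _ p => -4 * p.1 * p.2 ^ 3)
      (fun q => by fun_prop) (fun q => by fun_prop) (fun s hs x y h1 h2 => ?_) (by simpa using h0)
    · simpa using this
    have hs1 : 0 ≤ 1 - s := by linarith [hs.2]
    have hk : 0 ≤ (1 - s) * τ ^ 4 := by positivity
    by_cases hy : y = 0
    · subst hy
      have : x ^ 2 = 0 := by nlinarith [sq_nonneg x]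
      rw [this]; simpa using pow_pos hr 2
    have hx : x = 0 := by simpa [hy] using h2
    subst hx
    have e : (y ^ 2) ^ 2 ≤ (τ ^ 2) ^ 2 := by nlinarith [hs.1, pow_pos hτ 4]
    have e' := (sq_le_sq₀ (by positivity) (by positivity)).1 e
    linarith
  -- The branches `x = m y²` move with `m` going from `-1, 0, 1` to `0, a, 1`, and remain distinct.
  have := HasDegree.planar_homotopy (r := r)
    (A := fun s p => 3 * p.1 ^ 2 - 2 * (s + s * a) * p.1 * p.2 ^ 2 +
      (-(1 - s) * (s * a) - (1 - s) + s * a) * p.2 ^ 4)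
    (B := fun s p => -2 * (s + s * a) * p.1 ^ 2 * p.2 +
      4 * (-(1 - s) * (s * a) - (1 - s) + s * a) * p.1 * p.2 ^ 3 +
      6 * ((1 - s) * (s * a)) * p.2 ^ 5)
    (d := -2) (fun q => by fun_prop) (fun q => by fun_prop) (fun s hs x y h1 h2 => ?_) ?_
  · convert this using 2
    · funext p; ring
    · funext p; ring
  · have hy : y ^ 2 = 0 := by
      by_contra hy
      have hp : 0 ≤ s * a := mul_nonneg hs.1 ha.le
      have hp' : s * a < 1 := by nlinarith [hs.1, hs.2]
      refine hy (eq_zero_of_double_root (m₁ := -(1 - s)) (m₂ := s * a) (m₃ := 1)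
        (x := x) (w := y ^ 2) ?_ (by intro h; linarith [hs.2])
        (by intro h; nlinarith) ?_ ?_)
      · intro h
        have : s = 1 := by nlinarith [hs.2]
        subst this
        nlinarith
      · linear_combination (2 * x * h1 + y * h2) / 6
      · linear_combination h1
    have hy' : y = 0 := by simpa using hy
    subst hy'
    have : x = 0 := by simpa using h1
    subst this
    simpa using pow_pos hr 2
  · convert h1 using 2
    · funext p; ring
    · funext p; ring

/-- The degree of the real gradient of `x (x² + a x y² + y⁴)` for `a² < 4`. -/
theorem hasDegree_cubic_one_branch {a : ℝ} (ha : a ^ 2 < 4) (hr : 0 < r) :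
    HasDegree (planarMap
      (fun p : ℝ × ℝ => 3 * p.1 ^ 2 + 2 * a * p.1 * p.2 ^ 2 + p.2 ^ 4)
      (fun p => 2 * a * p.1 ^ 2 * p.2 + 4 * p.1 * p.2 ^ 3)) (Metric.ball 0 r) 0 := by
  -- Adding a positive constant to the first component leaves no zeros at all, hence degree zero.
  have h0 : HasDegree (planarMap (fun p : ℝ × ℝ => 3 * p.1 ^ 2 + p.2 ^ 4 + 1)
      (fun p => 4 * p.1 * p.2 ^ 3)) (Metric.ball 0 r) 0 := by
    have := hasDegree_planarMap (r := r)
      (A := fun p : ℝ × ℝ => 3 * p.1 ^ 2 + p.2 ^ 4 + 1)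
      (B := fun p => 4 * p.1 * p.2 ^ 3)
      (fun p => by fun_prop) (fun p => by fun_prop) (a := fun p => 6 * p.1)
      (b := fun p => 4 * p.2 ^ 3) (c := fun p => 4 * p.2 ^ 3) (d := fun p => 12 * p.1 * p.2 ^ 2)
      (fun p => (((hasGrad_monomial 3 2 0 p).add (hasGrad_monomial 1 0 4 p)).add
        (hasGrad_monomial 1 0 0 p)).congr
        (fun q => by ring) (by norm_num; ring) (by norm_num))
      (fun p => ((hasGrad_monomial 4 1 3 p)).congr
        (fun q => by ring) (by norm_num) (by norm_num; ring))
      ∅ (fun p => by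
        simp only [Finset.notMem_empty, false_iff, not_and]
        intro h
        nlinarith [sq_nonneg p.1, sq_nonneg (p.2 ^ 2)]) 1 (by decide) (by simp) (by simp) hr
    simpa using this
  have := HasDegree.planar_homotopy (r := r)
    (A := fun s p => 3 * p.1 ^ 2 + 2 * (s * a) * p.1 * p.2 ^ 2 + p.2 ^ 4 + (1 - s))
    (B := fun s p => 2 * (s * a) * p.1 ^ 2 * p.2 + 4 * p.1 * p.2 ^ 3)
    (fun q => by fun_prop) (fun q => by fun_prop) (fun s hs x y h1 h2 => ?_) (by simpa using h0)
  · simpa using this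
  have hs1 : 0 ≤ 1 - s := by linarith [hs.2]
  have hy4 : 0 ≤ y ^ 4 := by positivity
  have hx : x = 0 := by
    have e : x * (x ^ 2 + s * a * x * y ^ 2 + y ^ 4 + (1 - s) / 3) = 0 := by
      linear_combination (2 * x * h1 + y * h2) / 6
    rcases mul_eq_zero.1 e with h | h
    · exact h
    have hsa : (s * a) ^ 2 < 4 := by nlinarith [hs.1, hs.2, sq_nonneg a, mul_nonneg hs.1 hs1, mul_nonneg (mul_nonneg hs.1 hs1) (sq_nonneg a)]
    have e1 : (4 - (s * a) ^ 2) * x ^ 2 + (2 * y ^ 2 + s * a * x) ^ 2 + 4 * ((1 - s) / 3) = 0 := by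
      linear_combination 4 * h
    have n := sq_nonneg (2 * y ^ 2 + s * a * x)
    have : x ^ 2 = 0 := by nlinarith [sq_nonneg x]
    simpa using this
  subst hx
  have : y ^ 4 = 0 := by linarith
  have : y = 0 := by simpa using this
  subst this
  simpa using pow_pos hr 2

end RealDegrees

/-! ### Monomial bases of the local algebras. -/

section LocalAlgebra

open MvPowerSeries Finsupp

/-- The coefficient of a power series in three variables at the monomial `x^i y^j`. -/
noncomputable def planeCoeff (i j : ℕ) : MvPowerSeries (Fin 3) ℂ →ₗ[ℂ] ℂ :=
  coeff (single 0 i + single 1 j)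

theorem planeCoeff_X_zero_mul (i j : ℕ) (g : MvPowerSeries (Fin 3) ℂ) :
    planeCoeff i j (X 0 * g) = if i = 0 then 0 else planeCoeff (i - 1) j g := by
  classical
  rw [planeCoeff, X_def, coeff_monomial_mul]
  rcases i with _ | i
  · rw [if_neg, if_pos rfl]
    intro h; simpa using h 0
  · rw [if_pos, if_neg (by simp), one_mul, planeCoeff]
    · congr 2
      ext k; fin_cases k <;> simp
    · intro k; fin_cases k <;> simp

theorem planeCoeff_X_one_mul (i j : ℕ) (g : MvPowerSeries (Fin 3) ℂ) :
    planeCoeff i j (X 1 * g) = if j = 0 then 0 else planeCoeff i (j - 1) g := by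
  classical
  rw [planeCoeff, X_def, coeff_monomial_mul]
  rcases j with _ | j
  · rw [if_neg, if_pos rfl]
    intro h; simpa using h 1
  · rw [if_pos, if_neg (by simp), one_mul, planeCoeff]
    · congr 2
      ext k; fin_cases k <;> simp
    · intro k; fin_cases k <;> simp

theorem planeCoeff_X_two_mul (i j : ℕ) (g : MvPowerSeries (Fin 3) ℂ) :
    planeCoeff i j (X 2 * g) = 0 := by
  classical
  rw [planeCoeff, X_def, coeff_monomial_mul, if_neg]
  intro h; simpa using h 2

theorem planeCoeff_C_mul (i j : ℕ) (a : ℂ) (g : MvPowerSeries (Fin 3) ℂ) :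
    planeCoeff i j (C a * g) = a * planeCoeff i j g :=
  coeff_C_mul _ _ _

theorem X_pow_mul_X_pow_eq (a b : ℕ) :
    (X 0 ^ a * X 1 ^ b : MvPowerSeries (Fin 3) ℂ) = monomial (single 0 a + single 1 b) 1 := by
  rw [X_pow_eq, X_pow_eq, monomial_mul_monomial, one_mul]

theorem planeCoeff_X_pow_mul_X_pow (i j a b : ℕ) :
    planeCoeff i j (X 0 ^ a * X 1 ^ b) = if i = a ∧ j = b then 1 else 0 := by
  classical
  rw [X_pow_mul_X_pow_eq, planeCoeff, coeff_monomial]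
  refine if_congr ⟨fun h => ?_, ?_⟩ rfl rfl
  · have h0 := DFunLike.congr_fun h 0
    have h1 := DFunLike.congr_fun h 1
    simp at h0 h1
    exact ⟨h0, h1⟩
  · rintro ⟨rfl, rfl⟩; rfl

/-- Modulo the ideal generated by `x^a`, `y^b` and `z` any power series in three variables is
a polynomial in `x` and `y`. -/
theorem exists_box_decomposition (a b : ℕ) (f : MvPowerSeries (Fin 3) ℂ) :
    ∃ f₁ f₂ f₃ : MvPowerSeries (Fin 3) ℂ, f = X 0 ^ a * f₁ + X 1 ^ b * f₂ + X 2 ^ 1 * f₃ +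
      ∑ i ∈ Finset.range a, ∑ j ∈ Finset.range b, C (planeCoeff i j f) * (X 0 ^ i * X 1 ^ j) := by
  classical
  -- The monomials are sorted: first those divisible by `z`, then by `x^a`, then by `y^b`. What is
  -- left is the box.
  let g₃ : MvPowerSeries (Fin 3) ℂ := fun m => if 1 ≤ m 2 then coeff m f else 0
  let g₁ : MvPowerSeries (Fin 3) ℂ := fun m => if m 2 = 0 ∧ a ≤ m 0 then coeff m f else 0
  let g₂ : MvPowerSeries (Fin 3) ℂ :=
    fun m => if m 2 = 0 ∧ m 0 < a ∧ b ≤ m 1 then coeff m f else 0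
  have c₁ : ∀ m, coeff m g₁ = if m 2 = 0 ∧ a ≤ m 0 then coeff m f else 0 := fun m => rfl
  have c₂ : ∀ m, coeff m g₂ = if m 2 = 0 ∧ m 0 < a ∧ b ≤ m 1 then coeff m f else 0 := fun m => rfl
  have c₃ : ∀ m, coeff m g₃ = if 1 ≤ m 2 then coeff m f else 0 := fun m => rfl
  obtain ⟨f₁, h₁⟩ : X 0 ^ a ∣ g₁ := X_pow_dvd_iff.2 fun m hm => by
    rw [c₁, if_neg (by omega)]
  obtain ⟨f₂, h₂⟩ : X 1 ^ b ∣ g₂ := X_pow_dvd_iff.2 fun m hm => by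
    rw [c₂, if_neg (by omega)]
  obtain ⟨f₃, h₃⟩ : X 2 ^ 1 ∣ g₃ := X_pow_dvd_iff.2 fun m hm => by
    rw [c₃, if_neg (by omega)]
  refine ⟨f₁, f₂, f₃, ?_⟩
  rw [← h₁, ← h₂, ← h₃]
  ext m
  have hbox : coeff m (∑ i ∈ Finset.range a, ∑ j ∈ Finset.range b,
      C (planeCoeff i j f) * (X 0 ^ i * X 1 ^ j) : MvPowerSeries (Fin 3) ℂ) =
      if m 2 = 0 ∧ m 0 < a ∧ m 1 < b then coeff m f else 0 := by
    simp only [map_sum, coeff_C_mul, X_pow_mul_X_pow_eq, coeff_monomial, mul_ite, mul_one, mul_zero]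
    by_cases h2 : m 2 = 0
    · have hm : ∀ i j : ℕ, m = single 0 i + single 1 j ↔ i = m 0 ∧ j = m 1 := by
        intro i j
        constructor
        · intro h
          rw [h]; simp
        · rintro ⟨rfl, rfl⟩
          ext k; fin_cases k <;> simp [h2]
      simp only [hm]
      rw [Finset.sum_congr rfl (g := fun i => if i = m 0 then
        (if m 1 < b then coeff m f else 0) else 0)]
      · rw [Finset.sum_ite_eq']
        simp only [Finset.mem_range, h2, true_and]
        split_ifs <;> simp_all
      · intro i _
        by_cases hi : i = m 0
        · simp only [hi, true_and, if_true]
          rw [Finset.sum_ite_eq']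
          simp only [Finset.mem_range, planeCoeff]
          rw [← (hm (m 0) (m 1)).2 ⟨rfl, rfl⟩]
        · simp [hi]
    · rw [if_neg (by tauto)]
      refine Finset.sum_eq_zero fun i _ => Finset.sum_eq_zero fun j _ => if_neg ?_
      rintro rfl
      simp at h2
  rw [map_add, map_add, map_add, hbox, c₁, c₂, c₃]
  by_cases h2 : m 2 = 0
  · by_cases h0 : m 0 < a
    · by_cases h1 : m 1 < b
      · simp [h2, h0, h1, Nat.not_le.2 h0, Nat.not_le.2 h1]
      · simp [h2, h0, h1, Nat.not_le.2 h0, Nat.not_lt.1 h1]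
    · simp [h2, h0, Nat.not_lt.1 h0]
  · simp [h2, Nat.one_le_iff_ne_zero.2 h2]

/-- The dimension of a quotient algebra with a given monomial basis: the independence is
certified by functionals vanishing on the ideal. -/
theorem finrank_quotient_eq (I : Ideal (MvPowerSeries (Fin 3) ℂ)) {n : ℕ} (e : Fin n → ℕ × ℕ)
    (ℓ : Fin n → MvPowerSeries (Fin 3) ℂ →ₗ[ℂ] ℂ) (hℓ : ∀ k, ∀ f ∈ I, ℓ k f = 0)
    (hℓe : ∀ k l, ℓ k (X 0 ^ (e l).1 * X 1 ^ (e l).2) = if k = l then 1 else 0) {a b : ℕ}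
    (hx : Ideal.Quotient.mk I (X 0) ^ a = 0) (hy : Ideal.Quotient.mk I (X 1) ^ b = 0)
    (hz : Ideal.Quotient.mk I (X 2) = 0)
    (hspan : ∀ i < a, ∀ j < b, Ideal.Quotient.mk I (X 0) ^ i * Ideal.Quotient.mk I (X 1) ^ j ∈
      Submodule.span ℂ (Set.range fun k =>
        Ideal.Quotient.mk I (X 0) ^ (e k).1 * Ideal.Quotient.mk I (X 1) ^ (e k).2)) :
    Module.finrank ℂ (MvPowerSeries (Fin 3) ℂ ⧸ I) = n := by
  have hsmul : ∀ (c : ℂ) (f : MvPowerSeries (Fin 3) ℂ), c • Ideal.Quotient.mk I f =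
      Ideal.Quotient.mk I (c • f) := fun c f => rfl
  have hC : ∀ (c : ℂ) (f : MvPowerSeries (Fin 3) ℂ), Ideal.Quotient.mk I (C c * f) =
      c • Ideal.Quotient.mk I f := fun c f => by
    rw [hsmul, MvPowerSeries.smul_eq_C_mul]
  have hli : LinearIndependent ℂ fun k : Fin n =>
      Ideal.Quotient.mk I (X 0) ^ (e k).1 * Ideal.Quotient.mk I (X 1) ^ (e k).2 := by
    rw [Fintype.linearIndependent_iff]
    intro c hc k
    have hmem : ∑ l, c l • (X 0 ^ (e l).1 * X 1 ^ (e l).2 : MvPowerSeries (Fin 3) ℂ) ∈ I := by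
      rw [← Ideal.Quotient.eq_zero_iff_mem, map_sum, ← hc]
      refine Finset.sum_congr rfl fun l _ => ?_
      rw [← hsmul, map_mul, map_pow, map_pow]
    have := hℓ k _ hmem
    simpa [map_sum, hℓe] using this
  have hsp : ⊤ ≤ Submodule.span ℂ (Set.range fun k : Fin n =>
      Ideal.Quotient.mk I (X 0) ^ (e k).1 * Ideal.Quotient.mk I (X 1) ^ (e k).2) := by
    rintro q -
    obtain ⟨f, rfl⟩ := Ideal.Quotient.mk_surjective q
    obtain ⟨f₁, f₂, f₃, hf⟩ := exists_box_decomposition a b f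
    rw [hf]
    simp only [map_add, map_mul _ (_ ^ _) f₁, map_mul _ (_ ^ _) f₂, map_mul _ (_ ^ _) f₃, map_pow,
      hx, hy, hz, map_sum, hC]
    simp only [zero_mul, zero_add, pow_one]
    refine Submodule.sum_mem _ fun i hi => Submodule.sum_mem _ fun j hj => ?_
    refine Submodule.smul_mem _ _ ?_
    rw [map_mul, map_pow, map_pow]
    exact hspan i (Finset.mem_range.1 hi) j (Finset.mem_range.1 hj)
  rw [Module.finrank_eq_card_basis (Module.Basis.mk hli hsp), Fintype.card_fin]

/-- The functional is only `ℂ`-linear, so its vanishing must be required on all multiples of the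
generators. -/
theorem eq_zero_of_mem_span_of_mul {S : Set (MvPowerSeries (Fin 3) ℂ)}
    {ℓ : MvPowerSeries (Fin 3) ℂ →ₗ[ℂ] ℂ} (h : ∀ s ∈ S, ∀ g, ℓ (s * g) = 0) :
    ∀ f ∈ Ideal.span S, ℓ f = 0 := by
  intro f hf
  rw [← Ideal.submodule_span_eq] at hf
  induction hf using Submodule.span_induction with
  | mem x hx => simpa using h x hx 1
  | zero => simp
  | add x y _ _ h1 h2 => rw [map_add, h1, h2, add_zero]
  | smul a x hx hx0 =>
    clear hx0
    induction hx using Submodule.span_induction generalizing a with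
    | mem x hx => rw [smul_eq_mul, mul_comm]; exact h x hx a
    | zero => simp
    | add x y _ _ h1 h2 => rw [smul_add, map_add, h1, h2, add_zero]
    | smul b x _ h2 => rw [smul_smul]; exact h2 _

/-- The relations rewrite `x³` and `y³` through `x² y` and `x y²`. In degree four everything is then
a multiple of `x² y²`, where `P` and `T` solve the linear system for `x³ y` and `x y³`, and degree
five vanishes. The elements `k` and `n` are the inverses needed for this. -/
theorem quartic_relations {Q : Type*} [CommRing Q] {x y p q s t P T k n : Q}
    (hx : x * (x * x) - p * (x * (x * y)) - q * (x * (y * y)) = 0)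
    (hy : y * (y * y) - s * (x * (x * y)) - t * (x * (y * y)) = 0)
    (hk : k * (1 - q * s) = 1) (hP : P = p + q * T) (hT : T = s * P + t)
    (hn : n * (1 - P * T) = 1) :
    (x ^ 3 * y = P * (x ^ 2 * y ^ 2) ∧ x * y ^ 3 = T * (x ^ 2 * y ^ 2)) ∧
    (x ^ 4 = (p * P + q) * (x ^ 2 * y ^ 2) ∧ y ^ 4 = (s + t * T) * (x ^ 2 * y ^ 2)) ∧
    ∀ i j : ℕ, 5 ≤ i + j → x ^ i * y ^ j = 0 := by
  have e31 : x ^ 3 * y = P * (x ^ 2 * y ^ 2) := by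
    linear_combination k * (y * hx + q * x * hy - x ^ 2 * y ^ 2 * hP - q * (x ^ 2 * y ^ 2) * hT) -
      (x ^ 3 * y - P * (x ^ 2 * y ^ 2)) * hk
  have e13 : x * y ^ 3 = T * (x ^ 2 * y ^ 2) := by
    linear_combination x * hy + s * e31 - x ^ 2 * y ^ 2 * hT
  have e40 : x ^ 4 = (p * P + q) * (x ^ 2 * y ^ 2) := by linear_combination x * hx + p * e31
  have e04 : y ^ 4 = (s + t * T) * (x ^ 2 * y ^ 2) := by linear_combination y * hy + t * e13
  have e32 : x ^ 3 * y ^ 2 = 0 := by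
    linear_combination n * (y * e31 + P * x * e13) - x ^ 3 * y ^ 2 * hn
  have e23 : x ^ 2 * y ^ 3 = 0 := by linear_combination x * e13 + T * e32
  refine ⟨⟨e31, e13⟩, ⟨e40, e04⟩, ?_⟩
  have h5 : ∀ i ≤ 5, x ^ i * y ^ (5 - i) = 0 := by
    intro i hi
    interval_cases i
    · linear_combination y * e04 + (s + t * T) * e23
    · linear_combination y * e13 + T * e23
    · exact e23
    · exact e32
    · linear_combination x * e31 + P * e32
    · linear_combination x * e40 + (p * P + q) * e32
  intro i j hij
  by_cases hi : i ≤ 5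
  · rw [show j = 5 - i + (j - (5 - i)) by omega, pow_add, ← mul_assoc, h5 i hi, zero_mul]
  · rw [show i = 5 + (i - 5) by omega, pow_add]
    linear_combination x ^ (i - 5) * y ^ j * h5 5 le_rfl

/-- The same rewriting for the weights `2` of `x` and `1` of `y`: everything of weight six is a
multiple of `x² y²`, and the listed monomials of higher weight vanish. -/
theorem cubic_relations {Q : Type*} [CommRing Q] {x y u v w k h v' n : Q}
    (hx : x * x - u * (x * (y * y)) - v * (y * (y * (y * y))) = 0)
    (hy : x * (y * (y * y)) - w * (x * (x * y)) = 0)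
    (hv : v' * v = 1) (hk : v * k = 1 - u * w) (hh : h = u + v * w) (hn : n * (1 - w * h) = 1) :
    (y ^ 5 = k * (x ^ 2 * y) ∧ y ^ 6 = k * (x ^ 2 * y ^ 2) ∧ x * y ^ 4 = w * (x ^ 2 * y ^ 2) ∧
      x ^ 3 = h * (x ^ 2 * y ^ 2)) ∧
    x ^ 4 = 0 ∧ y ^ 7 = 0 ∧ x ^ 3 * y = 0 ∧ x ^ 2 * y ^ 3 = 0 ∧ x * y ^ 5 = 0 := by
  have e05 : y ^ 5 = k * (x ^ 2 * y) := by
    linear_combination v' * (-y * hx - u * hy - x ^ 2 * y * hk) - (y ^ 5 - k * (x ^ 2 * y)) * hv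
  have e14 : x * y ^ 4 = w * (x ^ 2 * y ^ 2) := by linear_combination y * hy
  have e30 : x ^ 3 = h * (x ^ 2 * y ^ 2) := by
    linear_combination x * hx + v * e14 - x ^ 2 * y ^ 2 * hh
  have e23 : x ^ 2 * y ^ 3 = 0 := by
    linear_combination n * (x * hy + w * y * e30) - x ^ 2 * y ^ 3 * hn
  have e31 : x ^ 3 * y = 0 := by linear_combination y * e30 + h * e23
  refine ⟨⟨e05, ?_, e14, e30⟩, ?_, ?_, e31, e23, ?_⟩
  · linear_combination y * e05
  · linear_combination x * e30 + h * y * e31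
  · linear_combination y ^ 2 * e05 + k * e23
  · linear_combination y * e14 + w * e23

theorem quotient_C_mul {I : Ideal (MvPowerSeries (Fin 3) ℂ)} (c : ℂ)
    (u : MvPowerSeries (Fin 3) ℂ ⧸ I) : Ideal.Quotient.mk I (C c) * u = c • u := by
  obtain ⟨f, rfl⟩ := Ideal.Quotient.mk_surjective u
  rw [← map_mul, ← MvPowerSeries.smul_eq_C_mul]; rfl

/-- The local algebra of a non-degenerate quartic form. -/
theorem finrank_quartic {p q s t P T : ℂ} (hk : q * s ≠ 1) (hP : P = p + q * T)
    (hT : T = s * P + t) (hPT : P * T ≠ 1) :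
    Module.finrank ℂ (MvPowerSeries (Fin 3) ℂ ⧸ Ideal.span {X 0 * (X 0 * X 0) -
      C p * (X 0 * (X 0 * X 1)) - C q * (X 0 * (X 1 * X 1)),
      X 1 * (X 1 * X 1) - C s * (X 0 * (X 0 * X 1)) - C t * (X 0 * (X 1 * X 1)), X 2}) = 9 := by
  set I : Ideal (MvPowerSeries (Fin 3) ℂ) := Ideal.span {X 0 * (X 0 * X 0) -
      C p * (X 0 * (X 0 * X 1)) - C q * (X 0 * (X 1 * X 1)),
      X 1 * (X 1 * X 1) - C s * (X 0 * (X 0 * X 1)) - C t * (X 0 * (X 1 * X 1)), X 2} with hI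
  let e : Fin 9 → ℕ × ℕ := ![(0, 0), (1, 0), (0, 1), (2, 0), (1, 1), (0, 2), (2, 1), (1, 2), (2, 2)]
  have hz : Ideal.Quotient.mk I (X 2) = 0 :=
    Ideal.Quotient.eq_zero_iff_mem.2 (Ideal.subset_span (by simp))
  have hx3 := Ideal.Quotient.eq_zero_iff_mem.2 (show _ ∈ I from Ideal.subset_span
    (Set.mem_insert _ _))
  have hy3 := Ideal.Quotient.eq_zero_iff_mem.2 (show _ ∈ I from Ideal.subset_span
    (Set.mem_insert_of_mem _ (Set.mem_insert _ _)))
  simp only [map_sub, map_mul] at hx3 hy3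
  have hom : ∀ c d : ℂ, c = d → Ideal.Quotient.mk I (C c) = Ideal.Quotient.mk I (C d) :=
    fun c d h => by rw [h]
  have hk' := hom _ _ (inv_mul_cancel₀ (sub_ne_zero.2 hk.symm))
  have hn' := hom _ _ (inv_mul_cancel₀ (sub_ne_zero.2 hPT.symm))
  have hP' := hom _ _ hP
  have hT' := hom _ _ hT
  simp only [map_mul, map_sub, map_add, map_one] at hk' hn' hP' hT'
  obtain ⟨⟨e31, e13⟩, ⟨e40, e04⟩, e5⟩ := quartic_relations hx3 hy3 hk' hP' hT' hn'
  -- Each functional is the coordinate of the normal form at its basis monomial: besides that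
  -- monomial's coefficient it collects those of the monomials that the relations rewrite into it.
  refine finrank_quotient_eq I e ![planeCoeff 0 0, planeCoeff 1 0, planeCoeff 0 1, planeCoeff 2 0,
    planeCoeff 1 1, planeCoeff 0 2, planeCoeff 2 1 + p • planeCoeff 3 0 + s • planeCoeff 0 3,
    planeCoeff 1 2 + q • planeCoeff 3 0 + t • planeCoeff 0 3,
    planeCoeff 2 2 + P • planeCoeff 3 1 + T • planeCoeff 1 3 + (p * P + q) • planeCoeff 4 0 +
      (s + t * T) • planeCoeff 0 4] ?_ ?_ (a := 5) (b := 5) (by simpa using e5 5 0 le_rfl)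
    (by simpa using e5 0 5 le_rfl) hz ?_
  · intro k
    refine eq_zero_of_mem_span_of_mul fun f hf g => ?_
    simp only [Set.mem_insert_iff, Set.mem_singleton_iff] at hf
    rcases hf with rfl | rfl | rfl <;> fin_cases k <;>
      simp [sub_mul, mul_assoc, planeCoeff_C_mul, planeCoeff_X_zero_mul, planeCoeff_X_one_mul,
        planeCoeff_X_two_mul]
    · linear_combination planeCoeff 0 1 g * hP
    · linear_combination planeCoeff 1 0 g * hT
  · intro k l
    fin_cases k <;> simp [planeCoeff_X_pow_mul_X_pow] <;> fin_cases l <;> simp [e]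
  · have mem : ∀ k i j, e k = (i, j) → Ideal.Quotient.mk I (X 0) ^ i * Ideal.Quotient.mk I (X 1) ^ j ∈
        Submodule.span ℂ (Set.range fun k =>
          Ideal.Quotient.mk I (X 0) ^ (e k).1 * Ideal.Quotient.mk I (X 1) ^ (e k).2) := by
      intro k i j h
      exact Submodule.subset_span ⟨k, by simp [h]⟩
    intro i hi j hj
    by_cases hij : 5 ≤ i + j
    · rw [e5 i j hij]; exact Submodule.zero_mem _
    set S := Submodule.span ℂ (Set.range fun k =>
          Ideal.Quotient.mk I (X 0) ^ (e k).1 * Ideal.Quotient.mk I (X 1) ^ (e k).2)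
    set x := Ideal.Quotient.mk I (X 0)
    set y := Ideal.Quotient.mk I (X 1)
    have m22 : ∀ (c : ℂ) (u : MvPowerSeries (Fin 3) ℂ ⧸ I),
        u = Ideal.Quotient.mk I (C c) * (x ^ 2 * y ^ 2) → u ∈ S := by
      intro c u hu
      rw [hu, quotient_C_mul]
      exact Submodule.smul_mem _ _ (mem 8 _ _ rfl)
    have m12 : ∀ (c d : ℂ) (u : MvPowerSeries (Fin 3) ℂ ⧸ I),
        u = Ideal.Quotient.mk I (C c) * (x ^ 2 * y ^ 1) +
          Ideal.Quotient.mk I (C d) * (x ^ 1 * y ^ 2) → u ∈ S := by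
      intro c d u hu
      rw [hu, quotient_C_mul, quotient_C_mul]
      exact Submodule.add_mem _ (Submodule.smul_mem _ _ (mem 6 _ _ rfl))
        (Submodule.smul_mem _ _ (mem 7 _ _ rfl))
    have hij' : i + j ≤ 4 := by omega
    clear hij
    interval_cases i
    · interval_cases j
      · exact mem 0 _ _ rfl
      · exact mem 2 _ _ rfl
      · exact mem 5 _ _ rfl
      · exact m12 s t _ (by linear_combination hy3)
      · exact m22 (s + t * T) _ (by simp only [map_add, map_mul]; linear_combination e04)
    · interval_cases j
      · exact mem 1 _ _ rfl
      · exact mem 4 _ _ rfl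
      · exact mem 7 _ _ rfl
      · exact m22 T _ (by linear_combination e13)
      · omega
    · interval_cases j
      · exact mem 3 _ _ rfl
      · exact mem 6 _ _ rfl
      · exact mem 8 _ _ rfl
      · omega
      · omega
    · interval_cases j
      · exact m12 p q _ (by linear_combination hx3)
      · exact m22 P _ (by linear_combination e31)
      all_goals omega
    · interval_cases j
      · exact m22 (p * P + q) _ (by simp only [map_add, map_mul]; linear_combination e40)
      all_goals omega

/-- The local algebra of a non-degenerate cubic form in `x` and `y²`. -/
theorem finrank_cubic {u v w k h : ℂ} (hv : v ≠ 0) (hk : v * k = 1 - u * w) (hh : h = u + v * w)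
    (hwh : w * h ≠ 1) :
    Module.finrank ℂ (MvPowerSeries (Fin 3) ℂ ⧸ Ideal.span {X 0 * X 0 -
      C u * (X 0 * (X 1 * X 1)) - C v * (X 1 * (X 1 * (X 1 * X 1))),
      X 0 * (X 1 * (X 1 * X 1)) - C w * (X 0 * (X 0 * X 1)), X 2}) = 10 := by
  set I : Ideal (MvPowerSeries (Fin 3) ℂ) := Ideal.span {X 0 * X 0 -
      C u * (X 0 * (X 1 * X 1)) - C v * (X 1 * (X 1 * (X 1 * X 1))),
      X 0 * (X 1 * (X 1 * X 1)) - C w * (X 0 * (X 0 * X 1)), X 2} with hI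
  let e : Fin 10 → ℕ × ℕ := ![(0, 0), (0, 1), (1, 0), (0, 2), (1, 1), (0, 3), (1, 2), (0, 4), (2, 1),
    (2, 2)]
  have hz : Ideal.Quotient.mk I (X 2) = 0 :=
    Ideal.Quotient.eq_zero_iff_mem.2 (Ideal.subset_span (by simp))
  have hx2 := Ideal.Quotient.eq_zero_iff_mem.2 (show _ ∈ I from Ideal.subset_span
    (Set.mem_insert _ _))
  have hy3 := Ideal.Quotient.eq_zero_iff_mem.2 (show _ ∈ I from Ideal.subset_span
    (Set.mem_insert_of_mem _ (Set.mem_insert _ _)))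
  simp only [map_sub, map_mul] at hx2 hy3
  have hom : ∀ c d : ℂ, c = d → Ideal.Quotient.mk I (C c) = Ideal.Quotient.mk I (C d) :=
    fun c d h => by rw [h]
  have hv' := hom _ _ (inv_mul_cancel₀ hv)
  have hn' := hom _ _ (inv_mul_cancel₀ (sub_ne_zero.2 hwh.symm))
  have hk' := hom _ _ hk
  have hh' := hom _ _ hh
  simp only [map_mul, map_sub, map_add, map_one] at hk' hn' hv' hh'
  obtain ⟨⟨e05, e06, e14, e30⟩, e40, e07, e31, e23, e15⟩ := cubic_relations hx2 hy3 hv' hk' hh' hn'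
  -- Again the coordinates of the normal form; for instance `x²` is rewritten as `u x y² + v y⁴`,
  -- and so enters two of them.
  refine finrank_quotient_eq I e ![planeCoeff 0 0, planeCoeff 0 1, planeCoeff 1 0, planeCoeff 0 2,
    planeCoeff 1 1, planeCoeff 0 3, planeCoeff 1 2 + u • planeCoeff 2 0,
    planeCoeff 0 4 + v • planeCoeff 2 0, planeCoeff 2 1 + w • planeCoeff 1 3 + k • planeCoeff 0 5,
    planeCoeff 2 2 + h • planeCoeff 3 0 + w • planeCoeff 1 4 + k • planeCoeff 0 6] ?_ ?_
    (a := 4) (b := 7) e40 e07 hz ?_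
  · intro i
    refine eq_zero_of_mem_span_of_mul fun f hf g => ?_
    simp only [Set.mem_insert_iff, Set.mem_singleton_iff] at hf
    rcases hf with rfl | rfl | rfl <;> fin_cases i <;>
      simp [sub_mul, mul_assoc, planeCoeff_C_mul, planeCoeff_X_zero_mul, planeCoeff_X_one_mul,
        planeCoeff_X_two_mul]
    · linear_combination -planeCoeff 0 1 g * hk
    · linear_combination planeCoeff 1 0 g * hh - planeCoeff 0 2 g * hk
  · intro i l
    fin_cases i <;> simp [planeCoeff_X_pow_mul_X_pow] <;> fin_cases l <;> simp [e]
  · have mem : ∀ k i j, e k = (i, j) → Ideal.Quotient.mk I (X 0) ^ i * Ideal.Quotient.mk I (X 1) ^ j ∈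
        Submodule.span ℂ (Set.range fun k =>
          Ideal.Quotient.mk I (X 0) ^ (e k).1 * Ideal.Quotient.mk I (X 1) ^ (e k).2) := by
      intro k i j h
      exact Submodule.subset_span ⟨k, by simp [h]⟩
    intro i hi j hj
    set S := Submodule.span ℂ (Set.range fun k =>
          Ideal.Quotient.mk I (X 0) ^ (e k).1 * Ideal.Quotient.mk I (X 1) ^ (e k).2)
    set x := Ideal.Quotient.mk I (X 0)
    set y := Ideal.Quotient.mk I (X 1)
    have zmem : ∀ u : MvPowerSeries (Fin 3) ℂ ⧸ I, u = 0 → u ∈ S := fun u hu =>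
      hu ▸ Submodule.zero_mem S
    have m22 : ∀ (c : ℂ) (u : MvPowerSeries (Fin 3) ℂ ⧸ I),
        u = Ideal.Quotient.mk I (C c) * (x ^ 2 * y ^ 2) → u ∈ S := by
      intro c u hu
      rw [hu, quotient_C_mul]
      exact Submodule.smul_mem _ _ (mem 9 _ _ rfl)
    have m21 : ∀ (c : ℂ) (u : MvPowerSeries (Fin 3) ℂ ⧸ I),
        u = Ideal.Quotient.mk I (C c) * (x ^ 2 * y ^ 1) → u ∈ S := by
      intro c u hu
      rw [hu, quotient_C_mul]
      exact Submodule.smul_mem _ _ (mem 8 _ _ rfl)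
    interval_cases i
    · interval_cases j
      · exact mem 0 _ _ rfl
      · exact mem 1 _ _ rfl
      · exact mem 3 _ _ rfl
      · exact mem 5 _ _ rfl
      · exact mem 7 _ _ rfl
      · exact m21 k _ (by linear_combination e05)
      · exact m22 k _ (by linear_combination e06)
    · interval_cases j
      · exact mem 2 _ _ rfl
      · exact mem 4 _ _ rfl
      · exact mem 6 _ _ rfl
      · exact m21 w _ (by linear_combination hy3)
      · exact m22 w _ (by linear_combination e14)
      · exact zmem _ (by linear_combination e15)
      · exact zmem _ (by linear_combination y * e15)
    · interval_cases j
      · have : x ^ 2 * y ^ 0 = Ideal.Quotient.mk I (C u) * (x ^ 1 * y ^ 2) +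
            Ideal.Quotient.mk I (C v) * (x ^ 0 * y ^ 4) := by linear_combination hx2
        rw [this, quotient_C_mul, quotient_C_mul]
        exact Submodule.add_mem _ (Submodule.smul_mem _ _ (mem 6 _ _ rfl))
          (Submodule.smul_mem _ _ (mem 7 _ _ rfl))
      · exact mem 8 _ _ rfl
      · exact mem 9 _ _ rfl
      · exact zmem _ e23
      · exact zmem _ (by linear_combination y * e23)
      · exact zmem _ (by linear_combination y ^ 2 * e23)
      · exact zmem _ (by linear_combination y ^ 3 * e23)
    · rcases j with _ | j
      · exact m22 h _ (by linear_combination e30)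
      · exact zmem _ (by rw [pow_succ]; linear_combination y ^ j * e31)

end LocalAlgebra

/-! ### Milnor numbers of the normal forms. -/

section Milnor

set_option linter.unusedSimpArgs false

open MvPolynomial

/-- Used to replace the partial derivatives by the normalized relations, from which they differ by
non-zero constants. -/
theorem span_range_eq_of_associated {R : Type*} [CommRing R] {ι : Type*} {G H : ι → R}
    (h : ∀ i, Associated (G i) (H i)) :
    Ideal.span (Set.range G) = Ideal.span (Set.range H) := by
  apply le_antisymm
  · rw [Ideal.span_le]
    rintro _ ⟨i, rfl⟩
    exact Ideal.mem_of_dvd _ (h i).symm.dvd (Ideal.subset_span ⟨i, rfl⟩)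
  · rw [Ideal.span_le]
    rintro _ ⟨i, rfl⟩
    exact Ideal.mem_of_dvd _ (h i).dvd (Ideal.subset_span ⟨i, rfl⟩)

theorem associated_C_mul {c : ℂ} (hc : c ≠ 0) {G H : MvPowerSeries (Fin 3) ℂ}
    (h : G = MvPowerSeries.C c * H) : Associated G H := by
  refine Associated.symm ⟨Units.map (MvPowerSeries.C (σ := Fin 3) (R := ℂ)).toMonoidHom (Units.mk0 c hc), ?_⟩
  rw [h, mul_comm]; rfl

theorem coe_mvPowerSeries_ofNat (n : ℕ) [n.AtLeastTwo] :
    ((ofNat(n) : MvPolynomial (Fin 3) ℂ) : MvPowerSeries (Fin 3) ℂ) = ofNat(n) :=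
  map_ofNat (MvPolynomial.coeToMvPowerSeries.ringHom (σ := Fin 3) (R := ℂ)) n

theorem set_range_three {α : Type*} (a b c : α) : Set.range ![a, b, c] = {a, b, c} := by
  ext x
  simp only [Set.mem_range, Fin.exists_fin_succ, Set.mem_insert_iff, Set.mem_singleton_iff]
  simp [eq_comm]

/-- The stabilization of the form `x⁴ + a x² y² + y⁴`. -/
noncomputable def stabilizedFermat (a : ℂ) : MvPolynomial (Fin 3) ℂ :=
  X 0 ^ 4 + C a * X 0 ^ 2 * X 1 ^ 2 + X 1 ^ 4 + X 2 ^ 2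

/-- The stabilization of the form `x y (x² + a x y + b y²)`. -/
noncomputable def stabilizedQuartic (a b : ℂ) : MvPolynomial (Fin 3) ℂ :=
  X 0 * X 1 * (X 0 ^ 2 + C a * X 0 * X 1 + C b * X 1 ^ 2) + X 2 ^ 2

/-- The stabilization of the quasihomogeneous polynomial `x (x² + a x y² + b y⁴)`. -/
noncomputable def stabilizedCubic (a b : ℂ) : MvPolynomial (Fin 3) ℂ :=
  X 0 * (X 0 ^ 2 + C a * X 0 * X 1 ^ 2 + C b * X 1 ^ 4) + X 2 ^ 2

theorem stabilized_X9plus (α : ℝ) :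
    ParabolicClass.X9plus.stabilized α = stabilizedFermat α := by
  simp [ParabolicClass.stabilized, ParabolicClass.normalForm, stabilizedFermat]

theorem stabilized_X9one (α : ℝ) :
    ParabolicClass.X9one.stabilized α = stabilizedQuartic α (1 : ℝ) := by
  simp [ParabolicClass.stabilized, ParabolicClass.normalForm, stabilizedQuartic]

theorem stabilized_X9two (α : ℝ) :
    ParabolicClass.X9two.stabilized α = stabilizedQuartic (1 + α : ℝ) α := by
  simp [ParabolicClass.stabilized, ParabolicClass.normalForm, stabilizedQuartic]
  ring

theorem stabilized_J10three (α : ℝ) :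
    ParabolicClass.J10three.stabilized α = stabilizedCubic (-(1 + α) : ℝ) α := by
  simp [ParabolicClass.stabilized, ParabolicClass.normalForm, stabilizedCubic]
  ring

theorem stabilized_J10one (α : ℝ) :
    ParabolicClass.J10one.stabilized α = stabilizedCubic α (1 : ℝ) := by
  simp [ParabolicClass.stabilized, ParabolicClass.normalForm, stabilizedCubic]

/-- After division by `4` the relations have `p = t = 0` and `q = s = -a/2`, and the condition `q s
≠ 1` is exactly `a² ≠ 4`. -/
theorem milnorNumber_stabilizedFermat {a : ℂ} (ha : a ^ 2 ≠ 4) :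
    milnorNumber (stabilizedFermat a) = 9 := by
  have hk : -(a / 2) * -(a / 2) ≠ 1 := fun h => ha (by linear_combination 4 * h)
  have h4 : (MvPowerSeries.C (4 : ℂ) : MvPowerSeries (Fin 3) ℂ) = 4 := map_ofNat _ 4
  have h2 : (MvPowerSeries.C (2 : ℂ) : MvPowerSeries (Fin 3) ℂ) = 2 := map_ofNat _ 2
  have hC : (MvPowerSeries.C a : MvPowerSeries (Fin 3) ℂ) = 2 * MvPowerSeries.C (a / 2) := by
    rw [← h2, ← map_mul]; congr 1; ring
  have := finrank_quartic (p := 0) (t := 0) (P := 0) (T := 0) hk (by simp) (by simp) (by simp)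
  rw [← set_range_three] at this
  refine (congrArg (fun I : Ideal (MvPowerSeries (Fin 3) ℂ) =>
    Module.finrank ℂ (MvPowerSeries (Fin 3) ℂ ⧸ I)) (span_range_eq_of_associated ?_)).trans this
  intro i
  fin_cases i
  · refine associated_C_mul (c := 4) (by norm_num) ?_
    simp [stabilizedFermat, pderiv_X, coe_mvPowerSeries_ofNat, h4, hC]
    ring
  · refine associated_C_mul (c := 4) (by norm_num) ?_
    simp [stabilizedFermat, pderiv_X, coe_mvPowerSeries_ofNat, h4, hC]
    ring
  · refine associated_C_mul (c := 2) (by norm_num) ?_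
    simp [stabilizedFermat, pderiv_X, coe_mvPowerSeries_ofNat, h2]

/-- Here `∂/∂x` is solved for `y³` and `∂/∂y` for `x³`, which explains the exchange of generators.
The product `P T` equals `a² / (4 b)`. -/
theorem milnorNumber_stabilizedQuartic {a b : ℂ} (hb : b ≠ 0) (ha : a ^ 2 ≠ 4 * b) :
    milnorNumber (stabilizedQuartic a b) = 9 := by
  have := finrank_quartic (p := -(2 * a)) (q := -(3 * b)) (s := -(3 / b)) (t := -(2 * a / b))
    (P := -(a / 2)) (T := -(a / (2 * b))) (by field_simp; norm_num) (by field_simp; ring)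
    (by field_simp; ring) (by
      field_simp
      intro h
      rw [div_eq_one_iff_eq (by simpa using hb)] at h
      exact ha (by linear_combination h))
  rw [Set.insert_comm, ← set_range_three] at this
  refine (congrArg (fun I : Ideal (MvPowerSeries (Fin 3) ℂ) =>
    Module.finrank ℂ (MvPowerSeries (Fin 3) ℂ ⧸ I)) (span_range_eq_of_associated ?_)).trans this
  have h3 : (MvPowerSeries.C (3 : ℂ) : MvPowerSeries (Fin 3) ℂ) = 3 := map_ofNat _ 3
  have h2 : (MvPowerSeries.C (2 : ℂ) : MvPowerSeries (Fin 3) ℂ) = 2 := map_ofNat _ 2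
  have e1 : (MvPowerSeries.C b : MvPowerSeries (Fin 3) ℂ) * MvPowerSeries.C (3 / b) = 3 := by
    rw [← h3, ← map_mul]; congr 1; field_simp
  have e2 : (MvPowerSeries.C b : MvPowerSeries (Fin 3) ℂ) * MvPowerSeries.C (2 * a / b) =
      2 * MvPowerSeries.C a := by
    rw [← h2, ← map_mul, ← map_mul]; congr 1; field_simp
  intro i
  fin_cases i
  · refine associated_C_mul hb ?_
    simp [stabilizedQuartic, pderiv_X, coe_mvPowerSeries_ofNat, -map_div₀]
    linear_combination -(MvPowerSeries.X 0) ^ 2 * MvPowerSeries.X 1 * e1 -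
      MvPowerSeries.X 0 * MvPowerSeries.X 1 ^ 2 * e2
  · refine associated_C_mul (c := 1) one_ne_zero ?_
    simp [stabilizedQuartic, pderiv_X, coe_mvPowerSeries_ofNat, h2, h3]
    ring
  · refine associated_C_mul (c := 2) (by norm_num) ?_
    simp [stabilizedQuartic, pderiv_X, coe_mvPowerSeries_ofNat, h2]

/-- Now `∂/∂x` is solved for `x²` and `∂/∂y` for `x y³`; the product `w h` equals `a² / (4 b)`. -/
theorem milnorNumber_stabilizedCubic {a b : ℂ} (hb : b ≠ 0) (ha : a ^ 2 ≠ 4 * b) :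
    milnorNumber (stabilizedCubic a b) = 10 := by
  have := finrank_cubic (u := -(2 * a / 3)) (v := -(b / 3)) (w := -(a / (2 * b)))
    (k := (a ^ 2 / b - 3) / b) (h := -(a / 2)) (by simpa using hb) (by field_simp; ring)
    (by field_simp; ring) (by
      field_simp
      intro h
      rw [div_eq_one_iff_eq (by simpa using hb)] at h
      exact ha (by linear_combination h))
  rw [← set_range_three] at this
  refine (congrArg (fun I : Ideal (MvPowerSeries (Fin 3) ℂ) =>
    Module.finrank ℂ (MvPowerSeries (Fin 3) ℂ ⧸ I)) (span_range_eq_of_associated ?_)).trans this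
  have h3 : (MvPowerSeries.C (3 : ℂ) : MvPowerSeries (Fin 3) ℂ) = 3 := map_ofNat _ 3
  have h4 : (MvPowerSeries.C (4 : ℂ) : MvPowerSeries (Fin 3) ℂ) = 4 := map_ofNat _ 4
  have h2 : (MvPowerSeries.C (2 : ℂ) : MvPowerSeries (Fin 3) ℂ) = 2 := map_ofNat _ 2
  have e1 : 3 * (MvPowerSeries.C (2 * a / 3) : MvPowerSeries (Fin 3) ℂ) = 2 * MvPowerSeries.C a := by
    rw [← h3, ← h2, ← map_mul, ← map_mul]; congr 1; ring
  have e2 : 3 * (MvPowerSeries.C (b / 3) : MvPowerSeries (Fin 3) ℂ) = MvPowerSeries.C b := by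
    rw [← h3, ← map_mul]; congr 1; ring
  have e3 : 4 * (MvPowerSeries.C b : MvPowerSeries (Fin 3) ℂ) * MvPowerSeries.C (a / (2 * b)) =
      2 * MvPowerSeries.C a := by
    rw [← h4, ← h2, ← map_mul, ← map_mul, ← map_mul]; congr 1; field_simp; ring
  intro i
  fin_cases i
  · refine associated_C_mul (c := 3) (by norm_num) ?_
    simp [stabilizedCubic, pderiv_X, coe_mvPowerSeries_ofNat, -map_div₀, h3]
    linear_combination -(MvPowerSeries.X 0) * MvPowerSeries.X 1 ^ 2 * e1 -
      MvPowerSeries.X 1 ^ 4 * e2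
  · refine associated_C_mul (c := 4 * b) (by simpa using hb) ?_
    simp [stabilizedCubic, pderiv_X, coe_mvPowerSeries_ofNat, -map_div₀, h4]
    linear_combination -(MvPowerSeries.X 0) ^ 2 * MvPowerSeries.X 1 * e3
  · refine associated_C_mul (c := 2) (by norm_num) ?_
    simp [stabilizedCubic, pderiv_X, coe_mvPowerSeries_ofNat, h2]

end Milnor

/-! ### Real and complex gradients and Hessians. -/

section Complexification

variable {n : ℕ}

/-- The inclusion of the real space to the complex one as a linear map. -/
noncomputable def complexifyCLM (n : ℕ) : EuclideanSpace ℝ (Fin n) →L[ℝ] EuclideanSpace ℂ (Fin n) :=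
  LinearMap.toContinuousLinearMap
    { toFun := complexify
      map_add' := fun x y => by ext i; simp [complexify]
      map_smul' := fun c x => by ext i; simp [complexify] }

theorem complexifyCLM_apply (x : EuclideanSpace ℝ (Fin n)) : complexifyCLM n x = complexify x := rfl

theorem complexify_apply (x : EuclideanSpace ℝ (Fin n)) (i : Fin n) : complexify x i = x i := rfl

theorem continuous_complexify : Continuous (complexify (n := n)) := (complexifyCLM n).continuous

theorem norm_complexify (x : EuclideanSpace ℝ (Fin n)) : ‖complexify x‖ = ‖x‖ := by
  rw [EuclideanSpace.norm_eq, EuclideanSpace.norm_eq]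
  simp [complexify]

theorem complexify_injective : Function.Injective (complexify (n := n)) := fun x y h => by
  ext i
  have := congrArg (fun z : EuclideanSpace ℂ (Fin n) => z i) h
  simpa [complexify] using this

theorem complexify_zero : complexify (0 : EuclideanSpace ℝ (Fin n)) = 0 :=
  (complexifyCLM n).map_zero

/-- The real part of a vector of the complex space. -/
noncomputable def coordRe (n : ℕ) : EuclideanSpace ℂ (Fin n) →L[ℝ] EuclideanSpace ℝ (Fin n) :=
  LinearMap.toContinuousLinearMap
    { toFun := fun z => WithLp.toLp 2 fun i => (z i).re
      map_add' := fun x y => by ext i; simp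
      map_smul' := fun c x => by ext i; simp }

theorem coordRe_apply (z : EuclideanSpace ℂ (Fin n)) (i : Fin n) : coordRe n z i = (z i).re := rfl

theorem norm_coordRe_le (z : EuclideanSpace ℂ (Fin n)) : ‖coordRe n z‖ ≤ ‖z‖ := by
  rw [EuclideanSpace.norm_eq, EuclideanSpace.norm_eq]
  refine Real.sqrt_le_sqrt (Finset.sum_le_sum fun i _ => ?_)
  rw [coordRe_apply]
  exact pow_le_pow_left₀ (norm_nonneg _) (by simpa using Complex.abs_re_le_norm (z i)) 2

/-- The vector of the values of a linear function on the coordinate vectors. -/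
noncomputable def gradientMap (n : ℕ) :
    (EuclideanSpace ℂ (Fin n) →L[ℂ] ℂ) →L[ℂ] EuclideanSpace ℂ (Fin n) :=
  LinearMap.toContinuousLinearMap
    { toFun := fun L => WithLp.toLp 2 fun i => L (EuclideanSpace.single i 1)
      map_add' := fun x y => by ext i; simp
      map_smul' := fun c x => by ext i; simp }

theorem gradientMap_apply (L : EuclideanSpace ℂ (Fin n) →L[ℂ] ℂ) (i : Fin n) :
    gradientMap n L i = L (EuclideanSpace.single i 1) := rfl

theorem apply_eq_sum_gradientMap (L : EuclideanSpace ℂ (Fin n) →L[ℂ] ℂ)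
    (v : EuclideanSpace ℂ (Fin n)) : L v = ∑ i, v i * gradientMap n L i := by
  conv_lhs => rw [← (EuclideanSpace.basisFun (Fin n) ℂ).sum_repr v]
  simp [gradientMap_apply]

theorem gradientMap_injective : Function.Injective (gradientMap n) := by
  rw [injective_iff_map_eq_zero]
  intro L hL
  ext v
  rw [apply_eq_sum_gradientMap, hL]
  simp

/-- The gradient of a function of complex variables. -/
noncomputable def complexGradient (F : EuclideanSpace ℂ (Fin n) → ℂ) (z : EuclideanSpace ℂ (Fin n)) :
    EuclideanSpace ℂ (Fin n) :=
  gradientMap n (fderiv ℂ F z)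

theorem complexGradient_eq_zero {F : EuclideanSpace ℂ (Fin n) → ℂ} {z : EuclideanSpace ℂ (Fin n)} :
    complexGradient F z = 0 ↔ fderiv ℂ F z = 0 :=
  map_eq_zero_iff _ gradientMap_injective

theorem analyticAt_complexGradient {F : EuclideanSpace ℂ (Fin n) → ℂ}
    {z : EuclideanSpace ℂ (Fin n)} (hF : AnalyticAt ℂ F z) : AnalyticAt ℂ (complexGradient F) z :=
  ((gradientMap n).analyticAt _).comp hF.fderiv

theorem det_fderiv_complexGradient_ne_zero {F : EuclideanSpace ℂ (Fin n) → ℂ}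
    {z : EuclideanSpace ℂ (Fin n)} (hF : AnalyticAt ℂ F z)
    (h : Function.Injective (fderiv ℂ (fderiv ℂ F) z)) :
    (fderiv ℂ (complexGradient F) z).det ≠ 0 := by
  have hd : fderiv ℂ (complexGradient F) z = (gradientMap n).comp (fderiv ℂ (fderiv ℂ F) z) :=
    ((gradientMap n).hasFDerivAt.comp z hF.fderiv.differentiableAt.hasFDerivAt).fderiv
  intro h0
  have := LinearMap.bot_lt_ker_of_det_eq_zero h0
  rw [hd] at this
  refine this.ne' (LinearMap.ker_eq_bot.2 ?_)
  exact gradientMap_injective.comp h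

/-- The real gradient of a function of complex variables at a real point. -/
noncomputable def realGradient (F : EuclideanSpace ℂ (Fin n) → ℂ) (x : EuclideanSpace ℝ (Fin n)) :
    EuclideanSpace ℝ (Fin n) :=
  coordRe n (complexGradient F (complexify x))

theorem analyticAt_realGradient {F : EuclideanSpace ℂ (Fin n) → ℂ}
    {x : EuclideanSpace ℝ (Fin n)} (hF : AnalyticAt ℂ F (complexify x)) :
    AnalyticAt ℝ (realGradient F) x :=
  ((coordRe n).analyticAt _).comp (AnalyticAt.comp
    (f := complexifyCLM n) (analyticAt_complexGradient hF).restrictScalars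
      ((complexifyCLM n).analyticAt x))

theorem hasFDerivAt_comp_complexify {F : EuclideanSpace ℂ (Fin n) → ℂ}
    {x : EuclideanSpace ℝ (Fin n)} (hF : DifferentiableAt ℂ F (complexify x)) :
    HasFDerivAt (fun y => F (complexify y))
      (((fderiv ℂ F (complexify x)).restrictScalars ℝ).comp (complexifyCLM n)) x :=
  HasFDerivAt.comp (f := complexifyCLM n) x (hF.hasFDerivAt.restrictScalars ℝ)
    (complexifyCLM n).hasFDerivAt

theorem hasFDerivAt_re {F : EuclideanSpace ℂ (Fin n) → ℂ}
    {x : EuclideanSpace ℝ (Fin n)} (hF : DifferentiableAt ℂ F (complexify x)) :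
    HasFDerivAt (fun y => (F (complexify y)).re) (innerSL ℝ (realGradient F x)) x := by
  refine (Complex.reCLM.hasFDerivAt.comp x (hasFDerivAt_comp_complexify hF)).congr_fderiv ?_
  ext v
  simp only [ContinuousLinearMap.comp_apply, ContinuousLinearMap.coe_restrictScalars']
  rw [apply_eq_sum_gradientMap, innerSL_apply_apply, PiLp.inner_apply]
  simp [complexifyCLM_apply, complexify_apply, realGradient, coordRe_apply, complexGradient]

/-- At a real point of a real function the complex gradient is the real one. -/
theorem complexify_realGradient {F : EuclideanSpace ℂ (Fin n) → ℂ}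
    {x : EuclideanSpace ℝ (Fin n)} (hF : DifferentiableAt ℂ F (complexify x))
    (hr : ∀ᶠ y in 𝓝 x, (F (complexify y)).im = 0) :
    complexify (realGradient F x) = complexGradient F (complexify x) := by
  have h1 := Complex.imCLM.hasFDerivAt.comp x (hasFDerivAt_comp_complexify hF)
  have h2 : HasFDerivAt (fun y => (F (complexify y)).im)
      (0 : EuclideanSpace ℝ (Fin n) →L[ℝ] ℝ) x :=
    (hasFDerivAt_const (0 : ℝ) x).congr_of_eventuallyEq hr
  have h3 := h1.unique h2
  ext i
  have h4 := DFunLike.congr_fun h3 (EuclideanSpace.single i 1)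
  have h5 : complexifyCLM n (EuclideanSpace.single i 1) = EuclideanSpace.single i 1 := by
    ext j
    simp only [complexifyCLM_apply, complexify_apply, PiLp.single_apply]
    split_ifs <;> simp
  simp only [ContinuousLinearMap.comp_apply, ContinuousLinearMap.coe_restrictScalars', h5] at h4
  refine Complex.ext ?_ ?_
  · simp [complexify_apply, realGradient, coordRe_apply]
  · rw [complexify_apply, Complex.ofReal_im]
    exact h4.symm

theorem realGradient_eq_zero {F : EuclideanSpace ℂ (Fin n) → ℂ}
    {x : EuclideanSpace ℝ (Fin n)} (hF : DifferentiableAt ℂ F (complexify x))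
    (hr : ∀ᶠ y in 𝓝 x, (F (complexify y)).im = 0) :
    realGradient F x = 0 ↔ complexGradient F (complexify x) = 0 := by
  rw [← complexify_realGradient hF hr]
  exact ⟨fun h => by rw [h, complexify_zero], fun h => complexify_injective (by
    rw [h, complexify_zero])⟩

/-- In the standard bases the two derivatives have the same matrix, with real entries. -/
theorem det_fderiv_realGradient {F : EuclideanSpace ℂ (Fin n) → ℂ}
    {x : EuclideanSpace ℝ (Fin n)} (hF : AnalyticAt ℂ F (complexify x))
    (hr : ∀ᶠ y in 𝓝 x, (F (complexify y)).im = 0) :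
    ((fderiv ℝ (realGradient F) x).det : ℂ) = (fderiv ℂ (complexGradient F) (complexify x)).det := by
  have hG := (analyticAt_complexGradient hF).differentiableAt
  have hg := (analyticAt_realGradient hF).differentiableAt
  have hev : (fun y => complexifyCLM n (realGradient F y)) =ᶠ[𝓝 x]
      fun y => complexGradient F (complexifyCLM n y) := by
    have hF' : ∀ᶠ y in 𝓝 x, AnalyticAt ℂ F (complexify y) :=
      continuous_complexify.continuousAt.eventually hF.eventually_analyticAt
    filter_upwards [hF', hr.eventually_nhds] with y h1 h2
    exact complexify_realGradient h1.differentiableAt h2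
  have h1 := (complexifyCLM n).hasFDerivAt.comp x hg.hasFDerivAt
  have h2 := HasFDerivAt.comp (f := complexifyCLM n) x (hG.hasFDerivAt.restrictScalars ℝ)
    (complexifyCLM n).hasFDerivAt
  have h3 := (h1.congr_of_eventuallyEq (f₁ := fun y => complexGradient F (complexifyCLM n y))
    hev.symm).unique h2
  have hb := LinearMap.det_toMatrix (EuclideanSpace.basisFun (Fin n) ℝ).toBasis
    (fderiv ℝ (realGradient F) x : EuclideanSpace ℝ (Fin n) →ₗ[ℝ] EuclideanSpace ℝ (Fin n))
  have hB := LinearMap.det_toMatrix (EuclideanSpace.basisFun (Fin n) ℂ).toBasis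
    (fderiv ℂ (complexGradient F) (complexify x) :
      EuclideanSpace ℂ (Fin n) →ₗ[ℂ] EuclideanSpace ℂ (Fin n))
  change ((LinearMap.det _ : ℝ) : ℂ) = LinearMap.det _
  rw [← hb, ← hB]
  rw [show ((Matrix.det (LinearMap.toMatrix (EuclideanSpace.basisFun (Fin n) ℝ).toBasis
    (EuclideanSpace.basisFun (Fin n) ℝ).toBasis (fderiv ℝ (realGradient F) x :
      EuclideanSpace ℝ (Fin n) →ₗ[ℝ] EuclideanSpace ℝ (Fin n))) : ℝ) : ℂ) = Complex.ofRealHom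
      (Matrix.det _) from rfl, RingHom.map_det]
  congr 1
  ext i j
  have h4 := DFunLike.congr_fun h3 (EuclideanSpace.single j 1)
  have h5 : complexifyCLM n (EuclideanSpace.single j 1) = EuclideanSpace.single j 1 := by
    ext k
    simp only [complexifyCLM_apply, complexify_apply, PiLp.single_apply]
    split_ifs <;> simp
  simp only [ContinuousLinearMap.comp_apply, ContinuousLinearMap.coe_restrictScalars', h5] at h4
  have h6 := congrArg (fun z : EuclideanSpace ℂ (Fin n) => z i) h4
  simp only [RingHom.mapMatrix_apply, Matrix.map_apply, LinearMap.toMatrix_apply]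
  simpa [complexifyCLM_apply, complexify_apply] using h6

/-- On the segment from `L` to the identity the quadratic form is positive for `s > 0`, so the
determinant never vanishes and keeps the sign it has at the identity. No symmetry of `L` is needed.
-/
theorem det_pos_of_inner_nonneg {E : Type*} [NormedAddCommGroup E] [InnerProductSpace ℝ E]
    [FiniteDimensional ℝ E] {L : E →L[ℝ] E} (hpos : ∀ v, 0 ≤ inner ℝ (L v) v) (hdet : L.det ≠ 0) :
    0 < L.det := by
  let K : ℝ → E →L[ℝ] E := fun s => (1 - s) • L + s • ContinuousLinearMap.id ℝ E
  have hK0 : K 0 = L := by simp [K]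
  have hK1 : K 1 = ContinuousLinearMap.id ℝ E := by simp [K]
  have hne : ∀ s ∈ Icc (0 : ℝ) 1, (K s).det ≠ 0 := by
    intro s hs h0
    rcases hs.1.eq_or_lt with rfl | h
    · rw [hK0] at h0; exact hdet h0
    have hker := LinearMap.bot_lt_ker_of_det_eq_zero h0
    obtain ⟨v, hv, hv0⟩ := (Submodule.ne_bot_iff _).1 hker.ne'
    have h1 : (1 - s) • L v + s • v = 0 := hv
    have h2 : inner ℝ ((1 - s) • L v + s • v) v = 0 := by rw [h1, inner_zero_left]
    rw [inner_add_left, real_inner_smul_left, real_inner_smul_left,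
      real_inner_self_eq_norm_sq] at h2
    have h3 : 0 < ‖v‖ ^ 2 := by positivity
    nlinarith [mul_nonneg (sub_nonneg.2 hs.2) (hpos v), mul_pos h h3]
  have hc : Continuous fun s : ℝ => (K s).det :=
    ContinuousLinearMap.continuous_det.comp (by fun_prop)
  by_contra! hle
  obtain ⟨s, hs, hs0⟩ := intermediate_value_Icc zero_le_one hc.continuousOn
    (show (0 : ℝ) ∈ Icc (K 0).det (K 1).det by
      rw [hK0, hK1]; exact ⟨hle, by simp [ContinuousLinearMap.det]⟩)
  exact hne s hs hs0

/-- A non-degenerate local minimum has positive Hessian. -/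
theorem det_pos_of_isLocalMin {u : EuclideanSpace ℝ (Fin n) → ℝ}
    {g : EuclideanSpace ℝ (Fin n) → EuclideanSpace ℝ (Fin n)} {x : EuclideanSpace ℝ (Fin n)}
    (hu : ∀ᶠ y in 𝓝 x, HasFDerivAt u (innerSL ℝ (g y)) y) (hg : DifferentiableAt ℝ g x)
    (hmin : IsLocalMin u x) (hdet : (fderiv ℝ g x).det ≠ 0) : 0 < (fderiv ℝ g x).det := by
  set L := fderiv ℝ g x with hL
  have hpos : ∀ v, 0 ≤ inner ℝ (L v) v := by
    intro v
    by_contra! hneg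
    have hline : ∀ s : ℝ, HasDerivAt (fun s : ℝ => x + s • v) v s := fun s => by
      simpa using ((hasDerivAt_id s).smul_const v).const_add x
    have hcont : Continuous fun s : ℝ => x + s • v := by fun_prop
    have ht : Tendsto (fun s : ℝ => x + s • v) (𝓝 0) (𝓝 x) := by
      simpa using hcont.tendsto 0
    have h1 : ∀ᶠ s in 𝓝 (0 : ℝ), HasDerivAt (fun s : ℝ => u (x + s • v))
        (inner ℝ (g (x + s • v)) v) s := by
      filter_upwards [ht.eventually hu] with s hs
      exact hs.comp_hasDerivAt s (hline s)
    have h2 : deriv (fun s : ℝ => u (x + s • v)) =ᶠ[𝓝 0] fun s => inner ℝ (g (x + s • v)) v := by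
      filter_upwards [h1] with s hs using hs.deriv
    have h3 : HasDerivAt (fun s : ℝ => inner ℝ (g (x + s • v)) v) (inner ℝ (L v) v) 0 := by
      have hg' : HasFDerivAt g L (x + (0 : ℝ) • v) := by simpa using hg.hasFDerivAt
      have := (hg'.comp_hasDerivAt (0 : ℝ) (hline 0)).inner ℝ (hasDerivAt_const (0 : ℝ) v)
      simpa using this
    have h4 : deriv (deriv fun s : ℝ => u (x + s • v)) 0 = inner ℝ (L v) v := by
      rw [h2.deriv_eq, h3.deriv]
    have hmin' : IsLocalMin (fun s : ℝ => u (x + s • v)) 0 := by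
      have := ht.eventually hmin
      simpa [IsLocalMin, IsMinFilter] using this
    -- With a negative second derivative the minimum along the line would be a maximum too. The
    -- function would then be locally constant there, with zero second derivative.
    have hmax : IsLocalMax (fun s : ℝ => u (x + s • v)) 0 :=
      isLocalMax_of_deriv_deriv_neg (by rw [h4]; exact hneg) hmin'.deriv_eq_zero
        h1.self_of_nhds.continuousAt
    have hconst : (fun s : ℝ => u (x + s • v)) =ᶠ[𝓝 0] fun _ => u (x + (0 : ℝ) • v) := by
      filter_upwards [hmin', hmax] with s a b using le_antisymm b a
    have h5 : deriv (deriv fun s : ℝ => u (x + s • v)) 0 = 0 := by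
      rw [hconst.deriv.deriv_eq]; simp
    rw [h4] at h5
    exact hneg.ne h5
  exact det_pos_of_inner_nonneg hpos hdet

end Complexification

/-! ### Complex conjugation of points. -/

section ConjPoint

variable {n : ℕ}

/-- Complex conjugation as a real linear map. -/
noncomputable def conjPointCLM (n : ℕ) : EuclideanSpace ℂ (Fin n) →L[ℝ] EuclideanSpace ℂ (Fin n) :=
  LinearMap.toContinuousLinearMap
    { toFun := conjPoint
      map_add' := fun x y => by ext i; simp [conjPoint]
      map_smul' := fun c x => by ext i; simp [conjPoint] }

theorem conjPointCLM_apply (z : EuclideanSpace ℂ (Fin n)) : conjPointCLM n z = conjPoint z := rfl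

theorem conjPoint_apply (z : EuclideanSpace ℂ (Fin n)) (i : Fin n) :
    conjPoint z i = (starRingEnd ℂ) (z i) := rfl

theorem conjPoint_conjPoint (z : EuclideanSpace ℂ (Fin n)) : conjPoint (conjPoint z) = z := by
  ext i; simp [conjPoint_apply]

theorem norm_conjPoint (z : EuclideanSpace ℂ (Fin n)) : ‖conjPoint z‖ = ‖z‖ := by
  rw [EuclideanSpace.norm_eq, EuclideanSpace.norm_eq]
  simp [conjPoint_apply]

theorem conjPoint_eq_self_iff {z : EuclideanSpace ℂ (Fin n)} :
    conjPoint z = z ↔ z ∈ range complexify := by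
  constructor
  · intro h
    refine ⟨coordRe n z, ?_⟩
    ext i
    have := congrArg (fun w : EuclideanSpace ℂ (Fin n) => w i) h
    rw [complexify_apply, coordRe_apply]
    exact Complex.conj_eq_iff_re.1 this
  · rintro ⟨x, rfl⟩
    ext i; simp [conjPoint_apply, complexify_apply]

/-- The real and imaginary parts of a point of the complex space. -/
theorem exists_eq_add_I_smul (z : EuclideanSpace ℂ (Fin n)) :
    ∃ x y : EuclideanSpace ℝ (Fin n), ‖x‖ ≤ ‖z‖ ∧ ‖y‖ ≤ ‖z‖ ∧
      z = complexify x + Complex.I • complexify y ∧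
      conjPoint z = complexify x + (-Complex.I) • complexify y := by
  refine ⟨coordRe n z, coordRe n (-Complex.I • z), norm_coordRe_le z, ?_, ?_, ?_⟩
  · refine (norm_coordRe_le _).trans ?_
    rw [norm_smul]; simp
  · ext i
    simp only [PiLp.add_apply, PiLp.smul_apply, complexify_apply, coordRe_apply]
    apply Complex.ext <;> simp
  · ext i
    simp only [PiLp.add_apply, PiLp.smul_apply, complexify_apply, coordRe_apply, conjPoint_apply]
    apply Complex.ext <;> simp

/-- The critical points of a function commuting with the conjugation are permuted by it. -/
theorem fderiv_conjPoint_eq_zero {F : EuclideanSpace ℂ (Fin n) → ℂ} {z : EuclideanSpace ℂ (Fin n)}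
    (hF : DifferentiableAt ℂ F (conjPoint z))
    (hconj : ∀ᶠ w in 𝓝 z, F (conjPoint w) = (starRingEnd ℂ) (F w)) (hz : HasFDerivAt F
      (0 : EuclideanSpace ℂ (Fin n) →L[ℂ] ℂ) z) : fderiv ℂ F (conjPoint z) = 0 := by
  have h1 : HasFDerivAt (fun w => F (conjPointCLM n w))
      (((fderiv ℂ F (conjPoint z)).restrictScalars ℝ).comp (conjPointCLM n)) z :=
    HasFDerivAt.comp (f := conjPointCLM n) z (hF.hasFDerivAt.restrictScalars ℝ)
      (conjPointCLM n).hasFDerivAt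
  have h2 := Complex.conjCLE.hasFDerivAt.comp z (hz.restrictScalars ℝ)
  have h3 := (h1.congr_of_eventuallyEq (f₁ := Complex.conjCLE ∘ F) (by
    filter_upwards [hconj] with w hw
    simpa [conjPointCLM_apply] using hw.symm)).unique h2
  ext v
  have h4 := DFunLike.congr_fun h3 (conjPoint v)
  simpa [conjPointCLM_apply, conjPoint_conjPoint] using h4

end ConjPoint

/-! ### Real deformations over small balls. -/

section Family

variable {n l : ℕ}

/-- A function that is real on the real space commutes with the complex conjugation. -/
theorem eq_conj_of_real {Φ : EuclideanSpace ℂ (Fin n) × EuclideanSpace ℂ (Fin l) → ℂ} {R : ℝ}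
    (ha : ∀ p, ‖p‖ < R → AnalyticAt ℂ Φ p)
    (hr : ∀ p : EuclideanSpace ℝ (Fin n) × EuclideanSpace ℝ (Fin l), ‖p‖ < R →
      (Φ (complexify p.1, complexify p.2)).im = 0)
    {t : EuclideanSpace ℝ (Fin l)} (ht : ‖t‖ < R) {z : EuclideanSpace ℂ (Fin n)}
    (hz : 3 * ‖z‖ < R) :
    deformationMember Φ t (conjPoint z) = (starRingEnd ℂ) (deformationMember Φ t z) := by
  obtain ⟨x, y, hx, hy, hz1, hz2⟩ := exists_eq_add_I_smul z
  -- For `z = x + i y` the function is restricted to the complex line `x + s y`. The disc of radius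
  -- `2` contains `±i`, and there `‖x + s y‖ ≤ 3 ‖z‖`, which explains the factor `3` in the
  -- hypothesis.
  let line : ℂ → EuclideanSpace ℂ (Fin n) × EuclideanSpace ℂ (Fin l) :=
    fun s => (complexify x + s • complexify y, complexify t)
  have hline : ∀ s ∈ Metric.ball (0 : ℂ) 2, ‖line s‖ < R := by
    intro s hs
    rw [Prod.norm_def, max_lt_iff]
    refine ⟨?_, by rwa [norm_complexify]⟩
    refine (norm_add_le _ _).trans_lt ?_
    rw [norm_smul, norm_complexify, norm_complexify]
    have : ‖s‖ < 2 := by simpa using hs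
    nlinarith [norm_nonneg y, norm_nonneg s]
  have hk1 : DifferentiableOn ℂ (fun s => Φ (line s)) (Metric.ball 0 2) := by
    intro s hs
    refine DifferentiableAt.differentiableWithinAt ?_
    refine DifferentiableAt.comp s (ha _ (hline s hs)).differentiableAt ?_
    fun_prop
  have hk2 : DifferentiableOn ℂ (fun s => (starRingEnd ℂ) (Φ (line ((starRingEnd ℂ) s))))
      (Metric.ball 0 2) := by
    intro s hs
    refine DifferentiableAt.differentiableWithinAt ?_
    have hs' : (starRingEnd ℂ) s ∈ Metric.ball (0 : ℂ) 2 := by simpa using hs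
    have := (hk1.differentiableAt (Metric.isOpen_ball.mem_nhds hs')).conj_conj
    simpa [Function.comp_def] using this
  have heq := (hk1.analyticOnNhd Metric.isOpen_ball).eqOn_of_preconnected_of_frequently_eq
    (hk2.analyticOnNhd Metric.isOpen_ball)
    (convex_ball (0 : ℂ) 2).isPreconnected (Metric.mem_ball_self two_pos) (by
      have hfr : ∃ᶠ s : ℝ in 𝓝[≠] 0, (s : ℂ) ∈ Metric.ball (0 : ℂ) 2 := by
        refine Eventually.frequently ?_
        refine Filter.Eventually.filter_mono nhdsWithin_le_nhds ?_
        have hc : Continuous fun s : ℝ => (s : ℂ) := Complex.continuous_ofReal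
        exact hc.tendsto' 0 0 (by simp) (Metric.ball_mem_nhds _ two_pos)
      have htend : Tendsto (fun s : ℝ => (s : ℂ)) (𝓝[≠] 0) (𝓝[≠] 0) := by
        refine tendsto_nhdsWithin_iff.2 ⟨?_, ?_⟩
        · exact (Complex.continuous_ofReal.tendsto' 0 0 (by simp)).mono_left nhdsWithin_le_nhds
        · filter_upwards [self_mem_nhdsWithin] with s hs
          simpa using hs
      refine htend.frequently (hfr.mono fun s hs => ?_)
      have hl : line s = (complexify (x + s • y), complexify t) := by
        simp only [line, Prod.mk.injEq, and_true]
        ext i; simp [complexify_apply]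
      have hn := hline s hs
      have him : (Φ (line s)).im = 0 := by
        rw [hl]
        refine hr (x + s • y, t) ?_
        rw [hl, Prod.norm_def, norm_complexify, norm_complexify] at hn
        exact hn
      simp only [Complex.conj_ofReal]
      exact (Complex.conj_eq_iff_im.2 him).symm)
  -- The two analytic functions of `s` agree at real `s`, hence also at `-i`, which corresponds to
  -- the conjugate point.
  have := heq (show (-Complex.I) ∈ Metric.ball (0 : ℂ) 2 by simp)
  simp only [map_neg, Complex.conj_I, neg_neg, line] at this
  rw [deformationMember, deformationMember, hz2, this, ← hz1]

theorem eventually_uniformly_close {X Y E : Type*} [TopologicalSpace X] [TopologicalSpace Y]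
    [SeminormedAddCommGroup E] {H : X × Y → E} {K : Set Y} (hK : IsCompact K) {x₀ : X}
    (hH : ∀ y ∈ K, ContinuousAt H (x₀, y)) {ε : ℝ} (hε : 0 < ε) :
    ∀ᶠ x in 𝓝 x₀, ∀ y ∈ K, ‖H (x, y) - H (x₀, y)‖ < ε := by
  refine hK.eventually_forall_of_forall_eventually fun y hy => ?_
  have h1 : ContinuousAt (fun p : X × Y => H (x₀, p.2)) (x₀, y) :=
    ContinuousAt.comp (g := H) (f := fun p : X × Y => (x₀, p.2)) (hH y hy) (by fun_prop)
  have h2 : ContinuousAt (fun p : X × Y => ‖H p - H (x₀, p.2)‖) (x₀, y) :=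
    ((hH y hy).sub h1).norm
  have h3 := h2.eventually (gt_mem_nhds (show ‖H (x₀, y) - H (x₀, (x₀, y).2)‖ < ε by simpa using hε))
  exact h3

theorem analyticAt_deformationMember {Φ : EuclideanSpace ℂ (Fin n) × EuclideanSpace ℂ (Fin l) → ℂ}
    {t : EuclideanSpace ℝ (Fin l)} {z : EuclideanSpace ℂ (Fin n)}
    (h : AnalyticAt ℂ Φ (z, complexify t)) : AnalyticAt ℂ (deformationMember Φ t) z :=
  AnalyticAt.fun_comp (g := Φ) (f := fun z => (z, complexify t)) h (analyticAt_id.prod analyticAt_const)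

/-- The gradient in `z` is the restriction of the differential of `Φ` to the first factor, and this
differential is jointly continuous. -/
theorem continuousAt_complexGradient_deformationMember
    {Φ : EuclideanSpace ℂ (Fin n) × EuclideanSpace ℂ (Fin l) → ℂ}
    {t : EuclideanSpace ℝ (Fin l)} {z : EuclideanSpace ℂ (Fin n)}
    (h : AnalyticAt ℂ Φ (z, complexify t)) :
    ContinuousAt (fun p : EuclideanSpace ℝ (Fin l) × EuclideanSpace ℂ (Fin n) =>
      complexGradient (deformationMember Φ p.1) p.2) (t, z) := by
  have hc : Continuous fun p : EuclideanSpace ℝ (Fin l) × EuclideanSpace ℂ (Fin n) =>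
      (p.2, complexify p.1) := continuous_snd.prodMk (continuous_complexify.comp continuous_fst)
  have h1 : ContinuousAt (fun p : EuclideanSpace ℝ (Fin l) × EuclideanSpace ℂ (Fin n) =>
      gradientMap n ((fderiv ℂ Φ (p.2, complexify p.1)).comp
        (ContinuousLinearMap.inl ℂ _ (EuclideanSpace ℂ (Fin l))))) (t, z) := by
    have h2 : ContinuousAt (fun p : EuclideanSpace ℝ (Fin l) × EuclideanSpace ℂ (Fin n) =>
        fderiv ℂ Φ (p.2, complexify p.1)) (t, z) :=
      ContinuousAt.comp (g := fderiv ℂ Φ)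
        (f := fun p : EuclideanSpace ℝ (Fin l) × EuclideanSpace ℂ (Fin n) => (p.2, complexify p.1))
        h.fderiv.continuousAt hc.continuousAt
    exact (gradientMap n).continuous.continuousAt.comp (h2.clm_comp continuousAt_const)
  refine h1.congr_of_eventuallyEq ?_
  have h3 : ∀ᶠ p in 𝓝 (t, z), AnalyticAt ℂ Φ (p.2, complexify p.1) :=
    hc.continuousAt.eventually h.eventually_analyticAt
  filter_upwards [h3] with p hp
  rw [complexGradient]
  congr 1
  exact (HasFDerivAt.comp (g := Φ) (f := fun z => (z, complexify p.1)) p.2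
    hp.differentiableAt.hasFDerivAt (hasFDerivAt_prodMk_left p.2 (complexify p.1))).fderiv

/-- The properties of a deformation over a small ball: the degrees of the gradients do not depend on
the parameter. -/
structure IsControlled (Φ : EuclideanSpace ℂ (Fin n) × EuclideanSpace ℂ (Fin l) → ℂ) (r δ : ℝ)
    (μ : ℕ) (I : ℤ) : Prop where
  radius_pos : 0 < r
  analytic : ∀ t : EuclideanSpace ℝ (Fin l), ‖t‖ < δ → ∀ z : EuclideanSpace ℂ (Fin n), ‖z‖ ≤ r →
    AnalyticAt ℂ Φ (z, complexify t)
  real : ∀ t : EuclideanSpace ℝ (Fin l), ‖t‖ < δ → ∀ x : EuclideanSpace ℝ (Fin n), ‖x‖ ≤ r →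
    ∀ᶠ y in 𝓝 x, (deformationMember Φ t (complexify y)).im = 0
  conj : ∀ t : EuclideanSpace ℝ (Fin l), ‖t‖ < δ → ∀ z : EuclideanSpace ℂ (Fin n), ‖z‖ < r →
    deformationMember Φ t (conjPoint z) = (starRingEnd ℂ) (deformationMember Φ t z)
  gradient_ne_zero : ∀ t : EuclideanSpace ℝ (Fin l), ‖t‖ < δ → ∀ z : EuclideanSpace ℂ (Fin n),
    ‖z‖ = r → complexGradient (deformationMember Φ t) z ≠ 0
  complexDegree : ∀ t : EuclideanSpace ℝ (Fin l), ‖t‖ < δ →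
    HasComplexDegree (complexGradient (deformationMember Φ t)) (Metric.ball 0 r) μ
  realDegree : ∀ t : EuclideanSpace ℝ (Fin l), ‖t‖ < δ →
    HasDegree (realGradient (deformationMember Φ t)) (Metric.ball 0 r) I

theorem norm_eq_of_mem_frontier_ball {E : Type*} [SeminormedAddCommGroup E] {r : ℝ} {z : E}
    (hz : z ∈ frontier (Metric.ball (0 : E) r)) : ‖z‖ = r := by
  have := Metric.frontier_ball_subset_sphere hz
  simpa using this

theorem norm_le_of_mem_closure_ball {E : Type*} [SeminormedAddCommGroup E] {r : ℝ} {z : E}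
    (hz : z ∈ closure (Metric.ball (0 : E) r)) : ‖z‖ ≤ r := by
  have := Metric.closure_ball_subset_closedBall hz
  simpa using this

/-- First `r` is taken so small that `Φ` is analytic and real where needed. The gradient of `f`
vanishes only at `0`, hence is bounded below on the sphere. For small `δ` the gradients of all
members differ from it by less than this bound, and Rouché's principle carries over both degrees. -/
theorem eventually_isControlled {f : MvPolynomial (Fin n) ℂ}
    {Φ : EuclideanSpace ℂ (Fin n) × EuclideanSpace ℂ (Fin l) → ℂ} (hΦ : IsRealDeformation f Φ)
    {μ : ℕ} {I : ℤ}
    (hzero : ∀ z, complexGradient (fun z => MvPolynomial.eval z.ofLp f) z = 0 → z = 0)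
    (hdeg : ∀ r > 0, HasComplexDegree (complexGradient fun z => MvPolynomial.eval z.ofLp f)
      (Metric.ball 0 r) μ)
    (hdeg' : ∀ r > 0, HasDegree (realGradient fun z => MvPolynomial.eval z.ofLp f)
      (Metric.ball 0 r) I) :
    ∀ᶠ r in 𝓝[>] (0 : ℝ), ∀ᶠ δ in 𝓝[>] (0 : ℝ), IsControlled Φ r δ μ I := by
  obtain ⟨R₁, hR₁, h1⟩ := Metric.eventually_nhds_iff.1 hΦ.analytic.eventually_analyticAt
  obtain ⟨R₂, hR₂, h2⟩ := Metric.eventually_nhds_iff.1 hΦ.base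
  obtain ⟨R₃, hR₃, h3⟩ := Metric.eventually_nhds_iff.1 hΦ.real
  obtain ⟨R, hR, hR1, hR2, hR3⟩ : ∃ R > 0, R ≤ R₁ ∧ R ≤ R₂ ∧ R ≤ R₃ :=
    ⟨min R₁ (min R₂ R₃), by positivity, by simp, by simp, by simp⟩
  have ha : ∀ p : EuclideanSpace ℂ (Fin n) × EuclideanSpace ℂ (Fin l), ‖p‖ < R →
      AnalyticAt ℂ Φ p := fun p hp => h1 (by rw [dist_zero_right]; exact hp.trans_le hR1)
  have hb : ∀ z : EuclideanSpace ℂ (Fin n), ‖z‖ < R → Φ (z, 0) = MvPolynomial.eval z.ofLp f :=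
    fun z hz => h2 (by rw [dist_zero_right]; exact hz.trans_le hR2)
  have hr : ∀ p : EuclideanSpace ℝ (Fin n) × EuclideanSpace ℝ (Fin l), ‖p‖ < R →
      (Φ (complexify p.1, complexify p.2)).im = 0 :=
    fun p hp => h3 (by rw [dist_zero_right]; exact hp.trans_le hR3)
  have ha' : ∀ (t : EuclideanSpace ℝ (Fin l)) (z : EuclideanSpace ℂ (Fin n)), ‖t‖ < R → ‖z‖ < R →
      AnalyticAt ℂ Φ (z, complexify t) := fun t z ht hz =>
    ha _ (by rw [Prod.norm_def, norm_complexify]; exact max_lt hz ht)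
  -- The third of `R` is required by `eq_conj_of_real`.
  filter_upwards [Ioo_mem_nhdsGT (show (0 : ℝ) < R / 3 by positivity)] with r hr'
  have hrR : 3 * r < R := by linarith [hr'.2]
  have hrR' : r < R := by linarith [hr'.1]
  have hG0 : ∀ z : EuclideanSpace ℂ (Fin n), ‖z‖ ≤ r →
      complexGradient (deformationMember Φ 0) z =
        complexGradient (fun z => MvPolynomial.eval z.ofLp f) z := by
    intro z hz
    rw [complexGradient, complexGradient]
    congr 1
    refine Filter.EventuallyEq.fderiv_eq ?_
    have : ∀ᶠ w : EuclideanSpace ℂ (Fin n) in 𝓝 z, ‖w‖ < R :=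
      continuous_norm.continuousAt.eventually (gt_mem_nhds (hz.trans_lt hrR'))
    filter_upwards [this] with w hw
    rw [deformationMember, complexify_zero, hb w hw]
  have hreal : ∀ t : EuclideanSpace ℝ (Fin l), ‖t‖ < R → ∀ x : EuclideanSpace ℝ (Fin n), ‖x‖ ≤ r →
      ∀ᶠ y in 𝓝 x, (deformationMember Φ t (complexify y)).im = 0 := by
    intro t ht x hx
    have : ∀ᶠ w : EuclideanSpace ℝ (Fin n) in 𝓝 x, ‖w‖ < R :=
      continuous_norm.continuousAt.eventually (gt_mem_nhds (hx.trans_lt hrR'))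
    filter_upwards [this] with w hw
    exact hr (w, t) (by rw [Prod.norm_def]; exact max_lt hw ht)
  have hfr0 : ∀ z ∈ frontier (Metric.ball (0 : EuclideanSpace ℂ (Fin n)) r),
      complexGradient (deformationMember Φ 0) z ≠ 0 := by
    intro z hz h0
    have hz' := norm_eq_of_mem_frontier_ball hz
    rw [hG0 z hz'.le] at h0
    have := hzero z h0
    rw [this, norm_zero] at hz'
    exact hr'.1.ne hz'
  have hnorm0 : ‖(0 : EuclideanSpace ℝ (Fin l))‖ < R := by rwa [norm_zero]
  have hanal : ∀ t : EuclideanSpace ℝ (Fin l), ‖t‖ < R →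
      ∀ z ∈ closure (Metric.ball (0 : EuclideanSpace ℂ (Fin n)) r),
      AnalyticAt ℂ (complexGradient (deformationMember Φ t)) z := fun t ht z hz =>
    analyticAt_complexGradient (analyticAt_deformationMember (ha' t z ht
      ((norm_le_of_mem_closure_ball hz).trans_lt hrR')))
  obtain ⟨c, hc, hcle⟩ := exists_pos_le_norm_on_frontier Metric.isBounded_ball
    (fun z hz => (hanal 0 hnorm0 z hz).continuousAt) hfr0
  have hunif := eventually_uniformly_close (isCompact_closedBall (0 : EuclideanSpace ℂ (Fin n)) r)
    (x₀ := (0 : EuclideanSpace ℝ (Fin l)))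
    (H := fun p => complexGradient (deformationMember Φ p.1) p.2)
    (fun z hz => continuousAt_complexGradient_deformationMember (ha' 0 z hnorm0
      ((by simpa using hz : ‖z‖ ≤ r).trans_lt hrR'))) hc
  obtain ⟨δ₀, hδ₀, hclose⟩ := Metric.eventually_nhds_iff.1 hunif
  simp only at hclose
  filter_upwards [Ioo_mem_nhdsGT (show (0 : ℝ) < min δ₀ R by positivity)] with δ hδ
  have hδR : ∀ t : EuclideanSpace ℝ (Fin l), ‖t‖ < δ → ‖t‖ < R := fun t ht =>
    ht.trans (hδ.2.trans_le (min_le_right _ _))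
  have hclose' : ∀ t : EuclideanSpace ℝ (Fin l), ‖t‖ < δ → ∀ z : EuclideanSpace ℂ (Fin n), ‖z‖ ≤ r →
      ‖complexGradient (deformationMember Φ t) z - complexGradient (deformationMember Φ 0) z‖ < c :=
    fun t ht z hz => hclose (by
      rw [dist_zero_right]; exact ht.trans (hδ.2.trans_le (min_le_left _ _))) z (by simpa using hz)
  refine ⟨hr'.1, fun t ht z hz => ha' t z (hδR t ht) (hz.trans_lt hrR'),
    fun t ht => hreal t (hδR t ht), fun t ht z hz =>
      eq_conj_of_real ha hr (hδR t ht) (by linarith), fun t ht z hz h0 => ?_, fun t ht => ?_,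
    fun t ht => ?_⟩
  · have h4 := hclose' t ht z hz.le
    rw [h0, zero_sub, norm_neg] at h4
    have h5 := hcle z (by
      rw [frontier_ball _ hr'.1.ne']
      simpa using hz)
    linarith
  · refine HasComplexDegree.perturb Metric.isOpen_ball Metric.isBounded_ball (hanal 0 hnorm0)
      (hanal t (hδR t ht)) (fun z hz => ?_) ((hdeg r hr'.1).congr Metric.isOpen_ball
        fun z hz => (hG0 z (mem_ball_zero_iff.1 hz).le).symm)
    exact (hclose' t ht z (norm_eq_of_mem_frontier_ball hz).le).trans_le (hcle z hz)
  · have hdiff : ∀ t : EuclideanSpace ℝ (Fin l), ‖t‖ < R →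
        ∀ x ∈ closure (Metric.ball (0 : EuclideanSpace ℝ (Fin n)) r),
        AnalyticAt ℂ (deformationMember Φ t) (complexify x) := fun t ht x hx =>
      analyticAt_deformationMember (ha' t _ ht (by
        rw [norm_complexify]; exact (norm_le_of_mem_closure_ball hx).trans_lt hrR'))
    refine HasDegree.of_norm_sub_lt Metric.isOpen_ball Metric.isBounded_ball
      (fun x hx => (analyticAt_realGradient (hdiff 0 hnorm0 x hx)).contDiffAt)
      (fun x hx => (analyticAt_realGradient (hdiff t (hδR t ht) x hx)).contDiffAt)
      (fun x hx => ?_) ((hdeg' r hr'.1).congr Metric.isOpen_ball fun x hx => ?_)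
    · have hx' := norm_eq_of_mem_frontier_ball hx
      have hx2 : ‖complexify x‖ = r := by rw [norm_complexify, hx']
      have hxc : x ∈ closure (Metric.ball (0 : EuclideanSpace ℝ (Fin n)) r) :=
        frontier_subset_closure hx
      rw [← norm_complexify (realGradient (deformationMember Φ 0) x),
        complexify_realGradient (hdiff 0 hnorm0 x hxc).differentiableAt (hreal 0 hnorm0 x hx'.le),
        realGradient, realGradient, ← map_sub]
      refine (norm_coordRe_le _).trans_lt ((hclose' t ht _ hx2.le).trans_le (hcle _ ?_))
      rw [frontier_ball _ hr'.1.ne']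
      simpa using hx2
    · rw [realGradient, realGradient, hG0 _ (by
        rw [norm_complexify]; exact (by simpa using hx : ‖x‖ < r).le)]

end Family

/-! ### The degree on the negative set as an invariant of components of the complement of the
discriminant. -/

section Sublevel

variable {n l : ℕ} {Φ : EuclideanSpace ℂ (Fin n) × EuclideanSpace ℂ (Fin l) → ℂ} {r δ : ℝ} {μ : ℕ}
  {I : ℤ}

/-- The set of points of the real ball where the function is negative. -/
def negativeSet (F : EuclideanSpace ℂ (Fin n) → ℂ) (r : ℝ) : Set (EuclideanSpace ℝ (Fin n)) :=
  {x | x ∈ Metric.ball 0 r ∧ (F (complexify x)).re < 0}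

namespace IsControlled

theorem analyticAt (h : IsControlled Φ r δ μ I) {t : EuclideanSpace ℝ (Fin l)} (ht : ‖t‖ < δ)
    {z : EuclideanSpace ℂ (Fin n)} (hz : ‖z‖ ≤ r) : AnalyticAt ℂ (deformationMember Φ t) z :=
  analyticAt_deformationMember (h.analytic t ht z hz)

theorem analyticAt_complexify (h : IsControlled Φ r δ μ I) {t : EuclideanSpace ℝ (Fin l)}
    (ht : ‖t‖ < δ) {x : EuclideanSpace ℝ (Fin n)} (hx : ‖x‖ ≤ r) :
    AnalyticAt ℂ (deformationMember Φ t) (complexify x) :=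
  h.analyticAt ht (by rwa [norm_complexify])

theorem contDiffAt_realGradient (h : IsControlled Φ r δ μ I) {t : EuclideanSpace ℝ (Fin l)}
    (ht : ‖t‖ < δ) {x : EuclideanSpace ℝ (Fin n)} (hx : ‖x‖ ≤ r) {k : WithTop ℕ∞} :
    ContDiffAt ℝ k (realGradient (deformationMember Φ t)) x :=
  (analyticAt_realGradient (h.analyticAt_complexify ht hx)).contDiffAt

theorem realGradient_eq_zero (h : IsControlled Φ r δ μ I) {t : EuclideanSpace ℝ (Fin l)}
    (ht : ‖t‖ < δ) {x : EuclideanSpace ℝ (Fin n)} (hx : ‖x‖ ≤ r) :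
    realGradient (deformationMember Φ t) x = 0 ↔
      complexGradient (deformationMember Φ t) (complexify x) = 0 :=
  _root_.realGradient_eq_zero (h.analyticAt_complexify ht hx).differentiableAt (h.real t ht x hx)

theorem realGradient_ne_zero (h : IsControlled Φ r δ μ I) {t : EuclideanSpace ℝ (Fin l)}
    (ht : ‖t‖ < δ) {x : EuclideanSpace ℝ (Fin n)} (hx : ‖x‖ = r) :
    realGradient (deformationMember Φ t) x ≠ 0 := by
  rw [Ne, h.realGradient_eq_zero ht hx.le]
  exact h.gradient_ne_zero t ht _ (by rwa [norm_complexify])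

theorem continuousAt_re (h : IsControlled Φ r δ μ I) {t : EuclideanSpace ℝ (Fin l)}
    (ht : ‖t‖ < δ) {x : EuclideanSpace ℝ (Fin n)} (hx : ‖x‖ ≤ r) :
    ContinuousAt (fun y => (deformationMember Φ t (complexify y)).re) x :=
  (hasFDerivAt_re (h.analyticAt_complexify ht hx).differentiableAt).continuousAt

theorem isOpen_negativeSet (h : IsControlled Φ r δ μ I) {t : EuclideanSpace ℝ (Fin l)}
    (ht : ‖t‖ < δ) : IsOpen (negativeSet (deformationMember Φ t) r) := by
  rw [isOpen_iff_mem_nhds]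
  intro x hx
  have hx' := mem_ball_zero_iff.1 hx.1
  exact Filter.inter_mem (Metric.isOpen_ball.mem_nhds hx.1)
    ((h.continuousAt_re ht hx'.le).eventually (gt_mem_nhds hx.2))

theorem norm_le_of_mem_closure_negativeSet {F : EuclideanSpace ℂ (Fin n) → ℂ}
    {x : EuclideanSpace ℝ (Fin n)} (hx : x ∈ closure (negativeSet F r)) : ‖x‖ ≤ r :=
  norm_le_of_mem_closure_ball (closure_mono (fun _ h => h.1) hx)

theorem isBounded_negativeSet {F : EuclideanSpace ℂ (Fin n) → ℂ} :
    Bornology.IsBounded (negativeSet F r) :=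
  Metric.isBounded_ball.subset fun _ h => h.1

theorem re_eq_zero_of_mem_frontier (h : IsControlled Φ r δ μ I) {t : EuclideanSpace ℝ (Fin l)}
    (ht : ‖t‖ < δ) {x : EuclideanSpace ℝ (Fin n)}
    (hx : x ∈ frontier (negativeSet (deformationMember Φ t) r)) :
    ‖x‖ = r ∨ (deformationMember Φ t (complexify x)).re = 0 := by
  have hle := norm_le_of_mem_closure_negativeSet (frontier_subset_closure hx)
  rcases hle.eq_or_lt with h1 | h1
  · exact Or.inl h1
  right
  have hc := h.continuousAt_re ht hle
  apply le_antisymm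
  · by_contra! hpos
    have := hc.eventually (lt_mem_nhds hpos)
    obtain ⟨y, hy, hy'⟩ := (mem_closure_iff_frequently.1 (frontier_subset_closure hx)).and_eventually
      this |>.exists
    exact lt_asymm hy' hy.2
  · by_contra! hneg
    have hmem : x ∈ negativeSet (deformationMember Φ t) r := ⟨mem_ball_zero_iff.2 h1, hneg⟩
    rw [(h.isOpen_negativeSet ht).frontier_eq] at hx
    exact hx.2 hmem

/-- Off the discriminant the gradient does not vanish on the zero level. -/
theorem realGradient_ne_zero_of_notMem_discriminant (h : IsControlled Φ r δ μ I)
    {t : EuclideanSpace ℝ (Fin l)} (ht : ‖t‖ < δ) (htd : t ∉ discriminant Φ r)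
    {x : EuclideanSpace ℝ (Fin n)} (hx : ‖x‖ ≤ r)
    (hx' : ‖x‖ = r ∨ (deformationMember Φ t (complexify x)).re = 0) :
    realGradient (deformationMember Φ t) x ≠ 0 := by
  rcases hx.eq_or_lt with h1 | h1
  · exact h.realGradient_ne_zero ht h1
  have h2 := hx'.resolve_left h1.ne
  intro h0
  refine htd ⟨complexify x, ⟨by simpa [norm_complexify] using h1, ?_⟩, ?_⟩
  · exact complexGradient_eq_zero.1 ((h.realGradient_eq_zero ht hx).1 h0)
  · exact Complex.ext h2 (h.real t ht x hx).self_of_nhds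

/-- The gradient is bounded away from zero near the zero level and on the sphere. For nearby
parameters the negative sets differ only near the zero level, so excision and a small perturbation
of the gradient together preserve the degree. -/
theorem eventually_hasDegree_negativeSet_iff (h : IsControlled Φ r δ μ I)
    {t : EuclideanSpace ℝ (Fin l)} (ht : ‖t‖ < δ) (htd : t ∉ discriminant Φ r) (d : ℤ) :
    ∀ᶠ t' in 𝓝 t, HasDegree (realGradient (deformationMember Φ t))
        (negativeSet (deformationMember Φ t) r) d ↔
      HasDegree (realGradient (deformationMember Φ t'))
        (negativeSet (deformationMember Φ t') r) d := by
  let K := Metric.closedBall (0 : EuclideanSpace ℝ (Fin n)) r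
  have hK : IsCompact K := isCompact_closedBall 0 r
  have hKr : ∀ x ∈ K, ‖x‖ ≤ r := fun x hx => mem_closedBall_zero_iff.1 hx
  -- It is positive exactly where the gradient is non-zero or the point is off both the zero level
  -- and the sphere. Its minimum over the closed ball provides a uniform constant.
  let q : EuclideanSpace ℝ (Fin n) → ℝ := fun x => max ‖realGradient (deformationMember Φ t) x‖
    (min |(deformationMember Φ t (complexify x)).re| (r - ‖x‖))
  have hqc : ContinuousOn q K := fun x hx => by
    refine ContinuousAt.continuousWithinAt ?_
    have h1 := (h.contDiffAt_realGradient ht (hKr x hx) (k := 1)).continuousAt.norm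
    have h2 := (h.continuousAt_re ht (hKr x hx)).abs
    exact h1.max (h2.min (continuousAt_const.sub continuous_norm.continuousAt))
  have hqpos : ∀ x ∈ K, 0 < q x := by
    intro x hx
    by_cases hx' : ‖x‖ = r ∨ (deformationMember Φ t (complexify x)).re = 0
    · exact lt_max_of_lt_left (norm_pos_iff.2
        (h.realGradient_ne_zero_of_notMem_discriminant ht htd (hKr x hx) hx'))
    · push Not at hx'
      exact lt_max_of_lt_right (lt_min (abs_pos.2 hx'.2)
        (sub_pos.2 (lt_of_le_of_ne (hKr x hx) hx'.1)))
  obtain ⟨x₀, hx₀, hmin⟩ := hK.exists_isMinOn ⟨0, by simp [K, h.radius_pos.le]⟩ hqc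
  obtain ⟨c, hc, hcq⟩ : ∃ c > 0, ∀ x ∈ K, 2 * c ≤ q x :=
    ⟨q x₀ / 2, by have := hqpos x₀ hx₀; positivity, fun x hx => by
      have := hmin hx
      simp only [mem_ofPred_eq] at this
      linarith⟩
  have hbig : ∀ x ∈ K, (‖x‖ = r ∨ |(deformationMember Φ t (complexify x)).re| < c) →
      2 * c ≤ ‖realGradient (deformationMember Φ t) x‖ := by
    intro x hx hx'
    rcases le_max_iff.1 (hcq x hx) with h1 | h1
    · exact h1
    · exfalso
      rw [le_min_iff] at h1
      rcases hx' with h2 | h2 <;> linarith [h1.1, h1.2]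
  have hcomplex : ∀ x ∈ K, ‖complexify x‖ ≤ r := fun x hx => by
    rw [norm_complexify]; exact hKr x hx
  have u1 := eventually_uniformly_close hK (x₀ := t)
    (H := fun p => realGradient (deformationMember Φ p.1) p.2) (fun x hx => by
      have h1 := continuousAt_complexGradient_deformationMember (h.analytic t ht _ (hcomplex x hx))
      have h2 : ContinuousAt (fun p : EuclideanSpace ℝ (Fin l) × EuclideanSpace ℝ (Fin n) =>
          complexGradient (deformationMember Φ p.1) (complexify p.2)) (t, x) :=
        ContinuousAt.comp (g := fun p : EuclideanSpace ℝ (Fin l) × EuclideanSpace ℂ (Fin n) =>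
          complexGradient (deformationMember Φ p.1) p.2)
          (f := fun p : EuclideanSpace ℝ (Fin l) × EuclideanSpace ℝ (Fin n) => (p.1, complexify p.2))
          h1 (continuous_fst.prodMk (continuous_complexify.comp continuous_snd)).continuousAt
      exact (coordRe n).continuous.continuousAt.comp h2) hc
  have u2 := eventually_uniformly_close hK (x₀ := t)
    (H := fun p => (deformationMember Φ p.1 (complexify p.2)).re) (fun x hx => by
      have h1 : ContinuousAt Φ (complexify x, complexify t) :=
        (h.analytic t ht _ (hcomplex x hx)).continuousAt
      have h2 : ContinuousAt (fun p : EuclideanSpace ℝ (Fin l) × EuclideanSpace ℝ (Fin n) =>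
          Φ (complexify p.2, complexify p.1)) (t, x) :=
        ContinuousAt.comp (g := Φ)
          (f := fun p : EuclideanSpace ℝ (Fin l) × EuclideanSpace ℝ (Fin n) =>
            (complexify p.2, complexify p.1)) h1
          ((continuous_complexify.comp continuous_snd).prodMk
            (continuous_complexify.comp continuous_fst)).continuousAt
      exact Complex.continuous_re.continuousAt.comp h2) hc
  filter_upwards [u1, u2, continuous_norm.continuousAt.eventually (gt_mem_nhds ht)] with t' g1 g2 ht'
  have hsub : ∀ {s : EuclideanSpace ℝ (Fin l)} {x}, x ∈ negativeSet (deformationMember Φ s) r →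
      x ∈ K := fun hx => Metric.ball_subset_closedBall hx.1
  have hex : ∀ x ∈ K, |(deformationMember Φ t (complexify x)).re| < c →
      c ≤ ‖realGradient (deformationMember Φ t') x‖ := by
    intro x hx hx'
    have h1 := hbig x hx (Or.inr hx')
    have h2 := g1 x hx
    have h3 := norm_sub_norm_le (realGradient (deformationMember Φ t) x)
      (realGradient (deformationMember Φ t') x)
    rw [norm_sub_rev] at h3
    linarith
  have ex1 : ∀ x ∈ negativeSet (deformationMember Φ t) r,
      x ∉ negativeSet (deformationMember Φ t') r →
      c ≤ ‖realGradient (deformationMember Φ t') x‖ := by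
    intro x hx hx'
    refine hex x (hsub hx) ?_
    have h1 : 0 ≤ (deformationMember Φ t' (complexify x)).re := by
      by_contra! h2; exact hx' ⟨hx.1, h2⟩
    have h2 := abs_lt.1 (g2 x (hsub hx))
    rw [abs_of_neg hx.2]
    linarith [h2.2]
  have ex2 : ∀ x ∈ negativeSet (deformationMember Φ t') r,
      x ∉ negativeSet (deformationMember Φ t) r →
      c ≤ ‖realGradient (deformationMember Φ t') x‖ := by
    intro x hx hx'
    refine hex x (hsub hx) ?_
    have h1 : 0 ≤ (deformationMember Φ t (complexify x)).re := by
      by_contra! h2; exact hx' ⟨hx.1, h2⟩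
    have h2 := abs_lt.1 (g2 x (hsub hx))
    rw [abs_of_nonneg h1]
    have := hx.2
    linarith [h2.1]
  have hcl : ∀ x ∈ closure (negativeSet (deformationMember Φ t) r), ‖x‖ ≤ r := fun x hx =>
    norm_le_of_mem_closure_negativeSet hx
  have hfr : ∀ x ∈ frontier (negativeSet (deformationMember Φ t) r),
      x ∈ K ∧ 2 * c ≤ ‖realGradient (deformationMember Φ t) x‖ := by
    intro x hx
    have hxK : x ∈ K := mem_closedBall_zero_iff.2 (hcl x (frontier_subset_closure hx))
    refine ⟨hxK, hbig x hxK ?_⟩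
    rcases h.re_eq_zero_of_mem_frontier ht hx with h1 | h1
    · exact Or.inl h1
    · right; rw [h1]; simpa using hc
  constructor
  · intro hd
    refine HasDegree.excision (h.isOpen_negativeSet ht) (h.isOpen_negativeSet ht')
      (HasDegree.of_norm_sub_lt (h.isOpen_negativeSet ht) isBounded_negativeSet
        (fun x hx => h.contDiffAt_realGradient ht (hcl x hx))
        (fun x hx => h.contDiffAt_realGradient ht' (hcl x hx)) (fun x hx => ?_) hd) hc ex1 ex2
    have := hfr x hx
    linarith [g1 x this.1, this.2]
  -- Backwards the order is opposite: excision is applied first, to the gradient at `t'`, and the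
  -- perturbation is made on the fixed domain belonging to `t`.
  · intro hd
    refine HasDegree.of_norm_sub_lt (h.isOpen_negativeSet ht) isBounded_negativeSet
        (fun x hx => h.contDiffAt_realGradient ht' (hcl x hx))
        (fun x hx => h.contDiffAt_realGradient ht (hcl x hx)) (fun x hx => ?_)
      (HasDegree.excision (h.isOpen_negativeSet ht') (h.isOpen_negativeSet ht) hd hc ex2 ex1)
    have := hfr x hx
    have h1 := g1 x this.1
    have h3 := norm_sub_norm_le (realGradient (deformationMember Φ t) x)
      (realGradient (deformationMember Φ t') x)
    rw [norm_sub_rev] at h1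
    linarith [this.2]

/-- The degree of the gradient on the set of negative values is constant along the components of
the complement of the discriminant. -/
theorem hasDegree_negativeSet_of_mem_component (h : IsControlled Φ r δ μ I)
    {t₀ t : EuclideanSpace ℝ (Fin l)}
    (ht : t ∈ connectedComponentIn (Metric.ball 0 δ \ discriminant Φ r) t₀) {d : ℤ}
    (hd : HasDegree (realGradient (deformationMember Φ t₀))
      (negativeSet (deformationMember Φ t₀) r) d) :
    HasDegree (realGradient (deformationMember Φ t)) (negativeSet (deformationMember Φ t) r) d := by
  set P := Metric.ball 0 δ \ discriminant Φ r
  have ht₀ : t₀ ∈ P := connectedComponentIn_nonempty_iff.1 ⟨t, ht⟩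
  -- Having the same degree is a locally valid equivalence relation, hence it holds throughout a
  -- connected set.
  have := isPreconnected_connectedComponentIn.induction₂ (x := t₀) (y := t)
    (s := connectedComponentIn P t₀)
    (fun s s' => HasDegree (realGradient (deformationMember Φ s))
        (negativeSet (deformationMember Φ s) r) d ↔
      HasDegree (realGradient (deformationMember Φ s')) (negativeSet (deformationMember Φ s') r) d)
    (fun s hs => by
      have hsP := connectedComponentIn_subset _ _ hs
      exact (h.eventually_hasDegree_negativeSet_iff (mem_ball_zero_iff.1 hsP.1) hsP.2 d).filter_mono
        nhdsWithin_le_nhds)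
    (fun a b c _ _ _ h1 h2 => h1.trans h2) (fun a b _ _ h1 => h1.symm)
    (mem_connectedComponentIn ht₀) ht
  exact this.1 hd

/-- If a member of the family has the maximal number of critical points, all of them real, and
the ones with negative values are minima, then the degree of its gradient on the set of negative
values is the number of these minima. -/
theorem hasDegree_negativeSet_of_card (h : IsControlled Φ r δ μ I)
    {t : EuclideanSpace ℝ (Fin l)} (ht : ‖t‖ < δ) (htd : t ∉ discriminant Φ r)
    (M N : Finset (EuclideanSpace ℝ (Fin n)))
    (hM : ∀ x ∈ M, ‖x‖ < r ∧ (deformationMember Φ t (complexify x)).re < 0 ∧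
      IsLocalMin (fun y => (deformationMember Φ t (complexify y)).re) x)
    (hN : ∀ x ∈ N, ‖x‖ < r ∧ 0 < (deformationMember Φ t (complexify x)).re ∧
      realGradient (deformationMember Φ t) x = 0)
    (hcard : M.card + N.card = μ) :
    HasDegree (realGradient (deformationMember Φ t)) (negativeSet (deformationMember Φ t) r)
      M.card := by
  classical
  have hfd : ∀ x : EuclideanSpace ℝ (Fin n), ‖x‖ < r →
      HasFDerivAt (fun y => (deformationMember Φ t (complexify y)).re)
        (innerSL ℝ (realGradient (deformationMember Φ t) x)) x := fun x hx =>
    hasFDerivAt_re (h.analyticAt_complexify ht hx.le).differentiableAt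
  have hM0 : ∀ x ∈ M, realGradient (deformationMember Φ t) x = 0 := by
    intro x hx
    have h1 := (hM x hx).2.2.hasFDerivAt_eq_zero (hfd x (hM x hx).1)
    have h2 := DFunLike.congr_fun h1 (realGradient (deformationMember Φ t) x)
    simpa using h2
  have hdisj : Disjoint M N := Finset.disjoint_left.2 fun x hx hx' =>
    lt_asymm (hM x hx).2.1 (hN x hx').2.1
  have hall : ∀ x ∈ M ∪ N, ‖x‖ < r ∧ realGradient (deformationMember Φ t) x = 0 := by
    intro x hx
    rcases Finset.mem_union.1 hx with hx | hx
    · exact ⟨(hM x hx).1, hM0 x hx⟩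
    · exact ⟨(hN x hx).1, (hN x hx).2.2⟩
  let e : EuclideanSpace ℝ (Fin n) ↪ EuclideanSpace ℂ (Fin n) := ⟨complexify, complexify_injective⟩
  have hP : ((M ∪ N).map e).card = μ := by
    rw [Finset.card_map, Finset.card_union_of_disjoint hdisj, hcard]
  -- The known critical points are as many as the complex degree, so there are no others and all are
  -- simple.
  have hcrit : ∀ x : EuclideanSpace ℝ (Fin n), ‖x‖ < r → realGradient (deformationMember Φ t) x = 0 →
      x ∈ M ∪ N ∧ (fderiv ℝ (realGradient (deformationMember Φ t)) x).det ≠ 0 := by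
    intro x hx hx0
    have h1 := HasComplexDegree.det_ne_zero_of_card_eq Metric.isOpen_ball Metric.isBounded_ball
      (G := complexGradient (deformationMember Φ t))
      (fun z hz => analyticAt_complexGradient (h.analyticAt ht (norm_le_of_mem_closure_ball hz)))
      (fun z hz => h.gradient_ne_zero t ht z (norm_eq_of_mem_frontier_ball hz)) ((M ∪ N).map e)
      (by rw [hP]; exact h.complexDegree t ht) (fun p hp => by
        obtain ⟨y, hy, rfl⟩ := Finset.mem_map.1 hp
        have hy' := hall y hy
        refine ⟨?_, (h.realGradient_eq_zero ht hy'.1.le).1 hy'.2⟩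
        rw [mem_ball_zero_iff]
        change ‖complexify y‖ < r
        rw [norm_complexify]; exact hy'.1) (x := complexify x)
      (by rw [mem_ball_zero_iff, norm_complexify]; exact hx)
      ((h.realGradient_eq_zero ht hx.le).1 hx0)
    refine ⟨?_, fun h0 => h1.2 ?_⟩
    · obtain ⟨y, hy, hyx⟩ := Finset.mem_map.1 h1.1
      rwa [← complexify_injective hyx]
    · rw [← det_fderiv_realGradient (h.analyticAt_complexify ht hx.le) (h.real t ht x hx.le), h0,
        Complex.ofReal_zero]
  have hdeg := hasDegree_of_det_ne_zero (h.isOpen_negativeSet ht) isBounded_negativeSet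
    (G := realGradient (deformationMember Φ t))
    (fun x hx => h.contDiffAt_realGradient ht (norm_le_of_mem_closure_negativeSet hx))
    (fun x hx => h.realGradient_ne_zero_of_notMem_discriminant ht htd
      (norm_le_of_mem_closure_negativeSet (frontier_subset_closure hx))
      (h.re_eq_zero_of_mem_frontier ht hx))
    (fun x hx hx0 => (hcrit x (mem_ball_zero_iff.1 hx.1) hx0).2) M (fun x => by
      constructor
      · intro hx
        exact ⟨⟨mem_ball_zero_iff.2 (hM x hx).1, (hM x hx).2.1⟩, hM0 x hx⟩
      · rintro ⟨hx, hx0⟩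
        rcases Finset.mem_union.1 (hcrit x (mem_ball_zero_iff.1 hx.1) hx0).1 with h1 | h1
        · exact h1
        · exact absurd hx.2 (lt_asymm (hN x h1).2.1))
  -- Each non-degenerate minimum contributes `+1`.
  rw [Finset.sum_congr rfl (g := fun _ => (1 : ℤ)) (fun x hx => by
    rw [sign_pos]
    · simp
    · have hx' := (hM x hx).1
      refine det_pos_of_isLocalMin ?_ (h.contDiffAt_realGradient ht hx'.le (k := 1)).differentiableAt_one
        (hM x hx).2.2 (hcrit x hx' (hM0 x hx)).2
      filter_upwards [Metric.isOpen_ball.mem_nhds (mem_ball_zero_iff.2 hx')] with y hy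
      exact hfd y (mem_ball_zero_iff.1 hy))] at hdeg
  simpa using hdeg

theorem conjPoint_mem_criticalPoints (h : IsControlled Φ r δ μ I)
    {t : EuclideanSpace ℝ (Fin l)} (ht : ‖t‖ < δ) {z : EuclideanSpace ℂ (Fin n)}
    (hz : z ∈ criticalPoints (deformationMember Φ t) r) :
    conjPoint z ∈ criticalPoints (deformationMember Φ t) r := by
  have hz1 := mem_ball_zero_iff.1 hz.1
  refine ⟨by rw [mem_ball_zero_iff, norm_conjPoint]; exact hz1, ?_⟩
  refine fderiv_conjPoint_eq_zero (h.analyticAt ht (by rw [norm_conjPoint]; exact hz1.le)).differentiableAt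
    ?_ ?_
  · filter_upwards [Metric.isOpen_ball.mem_nhds hz.1] with w hw
    exact h.conj t ht w (mem_ball_zero_iff.1 hw)
  · rw [← hz.2]
    exact (h.analyticAt ht hz1.le).differentiableAt.hasFDerivAt

/-- The numbers of the real and imaginary critical points of a Morse member of the family such
that the degree of the gradient on the set of negative values is as large as possible. -/
theorem critical_points_of_isMorseOn (h : IsControlled Φ r δ μ I)
    {t : EuclideanSpace ℝ (Fin l)} (ht : ‖t‖ < δ) (htd : t ∉ discriminant Φ r)
    (hMorse : IsMorseOn (deformationMember Φ t) r) {m : ℕ} (hmI : (μ : ℤ) = 2 * m - I + 2)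
    (hd : HasDegree (realGradient (deformationMember Φ t))
      (negativeSet (deformationMember Φ t) r) m) :
    (imaginaryCriticalPoints (deformationMember Φ t) r = ∅ ∨
      ∃ a, imaginaryCriticalPoints (deformationMember Φ t) r = {a, conjPoint a}) ∧
    ((realCriticalPoints (deformationMember Φ t) r).encard = (μ : ℕ∞) ∨
      (realCriticalPoints (deformationMember Φ t) r).encard + 2 = (μ : ℕ∞)) := by
  classical
  set F := deformationMember Φ t with hF
  have hcrit : criticalPoints F r = {z | z ∈ Metric.ball 0 r ∧ complexGradient F z = 0} := by
    ext z; simp only [criticalPoints, mem_ofPred_eq, complexGradient_eq_zero]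
  have han : ∀ z ∈ closure (Metric.ball (0 : EuclideanSpace ℂ (Fin n)) r),
      AnalyticAt ℂ (complexGradient F) z := fun z hz =>
    analyticAt_complexGradient (h.analyticAt ht (norm_le_of_mem_closure_ball hz))
  have hfr : ∀ z ∈ frontier (Metric.ball (0 : EuclideanSpace ℂ (Fin n)) r),
      complexGradient F z ≠ 0 := fun z hz =>
    h.gradient_ne_zero t ht z (norm_eq_of_mem_frontier_ball hz)
  have hdet : ∀ z ∈ Metric.ball (0 : EuclideanSpace ℂ (Fin n)) r, complexGradient F z = 0 →
      (fderiv ℂ (complexGradient F) z).det ≠ 0 := fun z hz hz0 =>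
    det_fderiv_complexGradient_ne_zero (h.analyticAt ht (mem_ball_zero_iff.1 hz).le)
      (hMorse z (by rw [hcrit]; exact ⟨hz, hz0⟩))
  have hfin : (criticalPoints F r).Finite := by
    rw [hcrit]
    exact finite_complex_zeros Metric.isOpen_ball Metric.isBounded_ball han hfr hdet
  have hZ : ∀ z, z ∈ hfin.toFinset ↔ z ∈ Metric.ball 0 r ∧ complexGradient F z = 0 := by
    intro z; rw [Finite.mem_toFinset, hcrit]; rfl
  have hcard : hfin.toFinset.card = μ := by
    have := (hasComplexDegree_card Metric.isOpen_ball Metric.isBounded_ball han hfr hdet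
      hfin.toFinset hZ).unique (h.complexDegree t ht)
    exact_mod_cast this
  -- the real critical points
  have hdetR : ∀ x : EuclideanSpace ℝ (Fin n), ‖x‖ < r → realGradient F x = 0 →
      (fderiv ℝ (realGradient F) x).det ≠ 0 := by
    intro x hx hx0 h0
    refine hdet (complexify x) (by rwa [mem_ball_zero_iff, norm_complexify])
      ((h.realGradient_eq_zero ht hx.le).1 hx0) ?_
    rw [← det_fderiv_realGradient (h.analyticAt_complexify ht hx.le) (h.real t ht x hx.le), h0,
      Complex.ofReal_zero]
  have hreal : ∀ x : EuclideanSpace ℝ (Fin n), complexify x ∈ criticalPoints F r ↔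
      x ∈ Metric.ball 0 r ∧ realGradient F x = 0 := by
    intro x
    rw [hcrit]
    simp only [mem_ofPred_eq, mem_ball_zero_iff, norm_complexify]
    exact and_congr_right fun hx => (h.realGradient_eq_zero ht hx.le).symm
  have hfinR : {x : EuclideanSpace ℝ (Fin n) | x ∈ Metric.ball 0 r ∧ realGradient F x = 0}.Finite := by
    have := hfin.preimage (f := complexify) complexify_injective.injOn
    refine this.subset fun x hx => (hreal x).2 hx
  set R := hfinR.toFinset with hR
  have hRmem : ∀ x, x ∈ R ↔ x ∈ Metric.ball 0 r ∧ realGradient F x = 0 := fun x => by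
    rw [hR, Finite.mem_toFinset]; rfl
  have hRimage : realCriticalPoints F r = complexify '' (R : Set (EuclideanSpace ℝ (Fin n))) := by
    ext z
    constructor
    · rintro ⟨hz, x, rfl⟩
      exact ⟨x, (hRmem x).2 ((hreal x).1 hz), rfl⟩
    · rintro ⟨x, hx, rfl⟩
      exact ⟨(hreal x).2 ((hRmem x).1 hx), x, rfl⟩
  have hRcard : (realCriticalPoints F r).encard = R.card := by
    rw [hRimage, complexify_injective.encard_image, encard_coe_eq_coe_finsetCard]
  let s : EuclideanSpace ℝ (Fin n) → SignType := fun x =>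
    SignType.sign (fderiv ℝ (realGradient F) x).det
  have hs0 : ∀ x ∈ R, s x ≠ 0 := fun x hx => by
    have := (hRmem x).1 hx
    exact sign_ne_zero.2 (hdetR x (mem_ball_zero_iff.1 this.1) this.2)
  have hs1 : ∀ x ∈ R, (s x : ℤ) = if s x = 1 then 1 else -1 := by
    intro x hx
    have := hs0 x hx
    revert this
    generalize s x = σ
    revert σ
    decide
  have hsum : ∑ x ∈ R, (s x : ℤ) = I :=
    (hasDegree_of_det_ne_zero Metric.isOpen_ball Metric.isBounded_ball
      (fun x hx => h.contDiffAt_realGradient ht (norm_le_of_mem_closure_ball hx))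
      (fun x hx => h.realGradient_ne_zero ht (norm_eq_of_mem_frontier_ball hx))
      (fun x hx hx0 => hdetR x (mem_ball_zero_iff.1 hx) hx0) R hRmem).unique (h.realDegree t ht)
  -- The number of positive points minus the number of negative ones is the total index.
  have hsum' : ((R.filter fun x => s x = 1).card : ℤ) * 2 - R.card = I := by
    rw [← hsum, Finset.sum_congr rfl hs1, Finset.sum_ite]
    have := Finset.card_filter_add_card_filter_not (s := R) (fun x => s x = 1)
    simp only [Finset.sum_const, nsmul_eq_mul, mul_one]
    rw [← this]
    push_cast
    ring
  -- the ones with negative values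
  have hsumN : ∑ x ∈ R.filter (fun x => (F (complexify x)).re < 0), (s x : ℤ) = m := by
    refine (hasDegree_of_det_ne_zero (h.isOpen_negativeSet ht) isBounded_negativeSet
      (fun x hx => h.contDiffAt_realGradient ht (norm_le_of_mem_closure_negativeSet hx))
      (fun x hx => h.realGradient_ne_zero_of_notMem_discriminant ht htd
        (norm_le_of_mem_closure_negativeSet (frontier_subset_closure hx))
        (h.re_eq_zero_of_mem_frontier ht hx))
      (fun x hx hx0 => hdetR x (mem_ball_zero_iff.1 hx.1) hx0) _ fun x => ?_).unique hd
    rw [Finset.mem_filter, hRmem]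
    constructor
    · rintro ⟨⟨h1, h2⟩, h3⟩; exact ⟨⟨h1, h3⟩, h2⟩
    · rintro ⟨⟨h1, h3⟩, h2⟩; exact ⟨⟨h1, h2⟩, h3⟩
  -- The signed count over the negative set does not exceed the number of positive points in it.
  have hm : m ≤ (R.filter fun x => s x = 1).card := by
    have h1 : (m : ℤ) ≤ ((R.filter (fun x => (F (complexify x)).re < 0)).filter fun x => s x = 1).card := by
      rw [← hsumN, Finset.card_filter]
      push_cast
      refine Finset.sum_le_sum fun x hx => ?_
      rw [hs1 x (Finset.mem_filter.1 hx).1]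
      split_ifs <;> norm_num
    have h2 := Finset.card_le_card (Finset.filter_subset_filter (fun x => s x = 1)
      (Finset.filter_subset (fun x => (F (complexify x)).re < 0) R))
    omega
  -- the imaginary ones
  have hsplit : (imaginaryCriticalPoints F r).encard + R.card = μ := by
    have h1 : (criticalPoints F r).encard = μ := by
      rw [← hcard, ← encard_coe_eq_coe_finsetCard, Finite.coe_toFinset]
    rw [← h1, ← hRcard, add_comm, realCriticalPoints, imaginaryCriticalPoints, add_comm,
      encard_sdiff_add_encard_inter]
  have hfinI : (imaginaryCriticalPoints F r).Finite := hfin.subset sdiff_subset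
  obtain ⟨k, hk⟩ : ∃ k : ℕ, (imaginaryCriticalPoints F r).encard = k :=
    ⟨_, hfinI.encard_eq_coe⟩
  have hk' : k + R.card = μ := by
    rw [hk] at hsplit; exact_mod_cast hsplit
  -- With `p` positive points, `k + |R| = μ`, `2 p - |R| = I` and `μ = 2 m - I + 2` give `k = 2 (m +
  -- 1 - p)`, while `p ≥ m`.
  have hcases : k = 0 ∨ k = 2 := by omega
  rw [hRcard]
  rcases hcases with rfl | rfl
  · refine ⟨Or.inl ?_, Or.inl ?_⟩
    · rw [← encard_eq_zero, hk]; rfl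
    · rw [← hk']; simp
  · refine ⟨Or.inr ?_, Or.inr ?_⟩
    · obtain ⟨a, b, hab, hW⟩ := encard_eq_two.1 hk
      refine ⟨a, ?_⟩
      have ha : a ∈ imaginaryCriticalPoints F r := by rw [hW]; simp
      have hca : conjPoint a ∈ imaginaryCriticalPoints F r := by
        refine ⟨h.conjPoint_mem_criticalPoints ht ha.1, fun hr => ha.2 ?_⟩
        have := conjPoint_eq_self_iff.2 hr
        rw [conjPoint_conjPoint] at this
        rw [this]; exact hr
      rw [hW] at hca
      have hne : conjPoint a ≠ a := fun h0 => ha.2 (conjPoint_eq_self_iff.1 h0)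
      rw [hW, show conjPoint a = b by simpa [hne] using hca]
    · rw [← hk', add_comm]; simp

end IsControlled

end Sublevel

/-! ### Control of deformations of the stabilized normal forms. -/

section Stabilization

open MvPolynomial

theorem complexGradient_add_sq {A a b : ℂ × ℂ → ℂ} (h : ∀ p, HasGrad A (a p) (b p) p) :
    complexGradient (fun z : EuclideanSpace ℂ (Fin 3) => A (z 0, z 1) + z 2 ^ 2) = planarMap a b := by
  funext z
  have hp : ∀ i : Fin 3, HasFDerivAt (fun w : EuclideanSpace ℂ (Fin 3) => w i)
      (EuclideanSpace.proj i : EuclideanSpace ℂ (Fin 3) →L[ℂ] ℂ) z := fun i =>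
    (EuclideanSpace.proj i : EuclideanSpace ℂ (Fin 3) →L[ℂ] ℂ).hasFDerivAt
  have h1 : HasFDerivAt A _ (z 0, z 1) := h (z 0, z 1)
  have h2 := (h1.comp z ((hp 0).prodMk (hp 1))).add ((hp 2).pow 2)
  have h3 : fderiv ℂ (fun z : EuclideanSpace ℂ (Fin 3) => A (z 0, z 1) + z 2 ^ 2) z = _ := h2.fderiv
  rw [complexGradient, h3]
  ext i
  rw [gradientMap_apply]
  fin_cases i <;> simp [planarMap]

theorem realGradient_add_sq {A a b : ℂ × ℂ → ℂ} {a' b' : ℝ × ℝ → ℝ}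
    (h : ∀ p, HasGrad A (a p) (b p) p) (ha : ∀ x y : ℝ, a (x, y) = a' (x, y))
    (hb : ∀ x y : ℝ, b (x, y) = b' (x, y)) :
    realGradient (fun z : EuclideanSpace ℂ (Fin 3) => A (z 0, z 1) + z 2 ^ 2) = planarMap a' b' := by
  funext x
  rw [realGradient, complexGradient_add_sq h]
  ext i
  rw [coordRe_apply]
  fin_cases i <;> simp [planarMap, complexify_apply, ha, hb]

variable {l : ℕ} {Φ : EuclideanSpace ℂ (Fin 3) × EuclideanSpace ℂ (Fin l) → ℂ}

theorem eventually_isControlled_of_hasGrad {f : MvPolynomial (Fin 3) ℂ} {A a b : ℂ × ℂ → ℂ}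
    {a' b' : ℝ × ℝ → ℝ} {μ : ℕ} {I : ℤ} (hΦ : IsRealDeformation f Φ)
    (hf : ∀ z : EuclideanSpace ℂ (Fin 3), eval z.ofLp f = A (z 0, z 1) + z 2 ^ 2)
    (h : ∀ p, HasGrad A (a p) (b p) p) (ha : ∀ x y : ℝ, a (x, y) = a' (x, y))
    (hb : ∀ x y : ℝ, b (x, y) = b' (x, y))
    (hzero : ∀ x y, a (x, y) = 0 → b (x, y) = 0 → x = 0 ∧ y = 0)
    (hdeg : ∀ r > 0, HasComplexDegree (planarMap a b) (Metric.ball 0 r) μ)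
    (hdeg' : ∀ r > 0, HasDegree (planarMap a' b') (Metric.ball 0 r) I) :
    ∀ᶠ r in 𝓝[>] (0 : ℝ), ∀ᶠ δ in 𝓝[>] (0 : ℝ), IsControlled Φ r δ μ I := by
  refine eventually_isControlled hΦ ?_ ?_ ?_
  · intro z hz
    rw [show (fun z : EuclideanSpace ℂ (Fin 3) => eval z.ofLp f) = _ from funext hf,
      complexGradient_add_sq h, planarMap_eq_zero] at hz
    obtain ⟨h0, h1⟩ := hzero _ _ hz.1 hz.2.1
    ext i
    fin_cases i
    exacts [h0, h1, hz.2.2]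
  · rwa [show (fun z : EuclideanSpace ℂ (Fin 3) => eval z.ofLp f) = _ from funext hf,
      complexGradient_add_sq h]
  · rwa [show (fun z : EuclideanSpace ℂ (Fin 3) => eval z.ofLp f) = _ from funext hf,
      realGradient_add_sq h ha hb]

theorem eventually_isControlled_stabilizedFermat {a : ℝ} (ha : a ^ 2 ≠ 4) {I : ℤ}
    (hΦ : IsRealDeformation (stabilizedFermat a) Φ)
    (hdeg : ∀ r > 0, HasDegree (planarMap (fun p : ℝ × ℝ => 4 * p.1 ^ 3 + 2 * a * p.1 * p.2 ^ 2)
      (fun p => 4 * p.2 ^ 3 + 2 * a * p.1 ^ 2 * p.2)) (Metric.ball 0 r) I) :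
    ∀ᶠ r in 𝓝[>] (0 : ℝ), ∀ᶠ δ in 𝓝[>] (0 : ℝ), IsControlled Φ r δ 9 I := by
  refine eventually_isControlled_of_hasGrad hΦ (fun z => by simp [stabilizedFermat])
    (A := fun p => p.1 ^ 4 + a * p.1 ^ 2 * p.2 ^ 2 + p.2 ^ 4)
    (a := fun p => 4 * p.1 ^ 3 + 2 * a * p.1 * p.2 ^ 2)
    (b := fun p => 4 * p.2 ^ 3 + 2 * a * p.1 ^ 2 * p.2)
    (fun p => (((hasGrad_monomial 1 4 0 p).add (hasGrad_monomial (a : ℂ) 2 2 p)).add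
      (hasGrad_monomial 1 0 4 p)).congr (fun q => by ring) ?_ ?_)
    (fun x y => by push_cast; rfl) (fun x y => by push_cast; rfl)
    (fun x y h1 h2 => fermat_zero (c := a) (by exact_mod_cast ha) h1 h2)
    (fun r hr => by exact_mod_cast hasComplexDegree_fermat ha hr) hdeg
  · push_cast; ring
  · push_cast; ring

theorem eventually_isControlled_stabilizedQuartic {a b : ℝ} (hb : 0 < b) (ha : a ^ 2 ≠ 4 * b) {I : ℤ}
    (hΦ : IsRealDeformation (stabilizedQuartic a b) Φ)
    (hdeg : ∀ r > 0, HasDegree (planarMap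
      (fun p : ℝ × ℝ => 3 * p.1 ^ 2 * p.2 + 2 * a * p.1 * p.2 ^ 2 + b * p.2 ^ 3)
      (fun p => p.1 ^ 3 + 2 * a * p.1 ^ 2 * p.2 + 3 * b * p.1 * p.2 ^ 2)) (Metric.ball 0 r) I) :
    ∀ᶠ r in 𝓝[>] (0 : ℝ), ∀ᶠ δ in 𝓝[>] (0 : ℝ), IsControlled Φ r δ 9 I := by
  refine eventually_isControlled_of_hasGrad hΦ (fun z => by simp [stabilizedQuartic])
    (A := fun p => p.1 * p.2 * (p.1 ^ 2 + a * p.1 * p.2 + b * p.2 ^ 2))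
    (a := fun p => 3 * p.1 ^ 2 * p.2 + 2 * a * p.1 * p.2 ^ 2 + b * p.2 ^ 3)
    (b := fun p => p.1 ^ 3 + 2 * a * p.1 ^ 2 * p.2 + 3 * b * p.1 * p.2 ^ 2)
    (fun p => (((hasGrad_monomial 1 3 1 p).add (hasGrad_monomial (a : ℂ) 2 2 p)).add
      (hasGrad_monomial (b : ℂ) 1 3 p)).congr (fun q => by ring) ?_ ?_)
    (fun x y => by push_cast; rfl) (fun x y => by push_cast; rfl)
    (fun x y h1 h2 => quartic_zero (b := b) (c := a) (by exact_mod_cast hb.ne')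
      (by exact_mod_cast ha) h1 h2)
    (fun r hr => by exact_mod_cast hasComplexDegree_quartic hb ha hr) hdeg
  · push_cast; ring
  · push_cast; ring

theorem eventually_isControlled_stabilizedCubic {a b : ℝ} (hb : 0 < b) (ha : a ^ 2 ≠ 4 * b) {I : ℤ}
    (hΦ : IsRealDeformation (stabilizedCubic a b) Φ)
    (hdeg : ∀ r > 0, HasDegree (planarMap
      (fun p : ℝ × ℝ => 3 * p.1 ^ 2 + 2 * a * p.1 * p.2 ^ 2 + b * p.2 ^ 4)
      (fun p => 2 * a * p.1 ^ 2 * p.2 + 4 * b * p.1 * p.2 ^ 3)) (Metric.ball 0 r) I) :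
    ∀ᶠ r in 𝓝[>] (0 : ℝ), ∀ᶠ δ in 𝓝[>] (0 : ℝ), IsControlled Φ r δ 10 I := by
  refine eventually_isControlled_of_hasGrad hΦ (fun z => by simp [stabilizedCubic])
    (A := fun p => p.1 * (p.1 ^ 2 + a * p.1 * p.2 ^ 2 + b * p.2 ^ 4))
    (a := fun p => 3 * p.1 ^ 2 + 2 * a * p.1 * p.2 ^ 2 + b * p.2 ^ 4)
    (b := fun p => 2 * a * p.1 ^ 2 * p.2 + 4 * b * p.1 * p.2 ^ 3)
    (fun p => (((hasGrad_monomial 1 3 0 p).add (hasGrad_monomial (a : ℂ) 2 2 p)).add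
      (hasGrad_monomial (b : ℂ) 1 4 p)).congr (fun q => by ring) ?_ ?_)
    (fun x y => by push_cast; rfl) (fun x y => by push_cast; rfl)
    (fun x y h1 h2 => cubic_zero (b := b) (c := a) (by exact_mod_cast hb.ne')
      (by exact_mod_cast ha) h1 h2)
    (fun r hr => by exact_mod_cast hasComplexDegree_cubic hb ha hr) hdeg
  · push_cast; ring
  · push_cast; ring

end Stabilization

/-! ### Numerical data of the five classes. -/

namespace ParabolicClass

/-- The number of bounded domains in the picture where the function is negative. -/
def negativeRegions : ParabolicClass → ℕ
  | X9plus => 4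
  | X9one => 3
  | X9two => 2
  | J10three => 3
  | J10one => 4

/-- The number of crossing points of the zero set in the picture. -/
def crossings : ParabolicClass → ℕ
  | X9plus => 4
  | X9one => 5
  | X9two => 6
  | J10three => 6
  | J10one => 5

/-- The index of the gradient vector field of the real function. -/
def realIndex : ParabolicClass → ℤ
  | X9plus => 1
  | X9one => -1
  | X9two => -3
  | J10three => -2
  | J10one => 0

/-- The value, `9` or `10`, is written as the number of critical points visible in the picture:
minima, crossings and one maximum. For `X9two` and `J10three` non-degeneracy comes from `(1 + α)² -
4 α = (1 - α)² > 0`. -/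
theorem milnorNumber_stabilized (T : ParabolicClass) {α : ℝ} (hα : T.Admissible α) :
    milnorNumber (T.stabilized α) = T.negativeRegions + (T.crossings + 1) := by
  cases T
  · rw [stabilized_X9plus, milnorNumber_stabilizedFermat]
    · rfl
    · obtain ⟨h1, h2⟩ := hα
      have : α ^ 2 ≠ 4 := fun h => h2 (by nlinarith)
      exact_mod_cast this
  · rw [stabilized_X9one, milnorNumber_stabilizedQuartic]
    · rfl
    · simp
    · have h : α ^ 2 < 4 := hα
      have : α ^ 2 ≠ 4 * 1 := by linarith
      exact_mod_cast this
  · obtain ⟨h1, h2⟩ := hα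
    rw [stabilized_X9two, milnorNumber_stabilizedQuartic]
    · rfl
    · exact_mod_cast h1.ne'
    · have : (1 + α) ^ 2 ≠ 4 * α := by nlinarith [sq_nonneg (1 - α), sq_pos_of_pos (sub_pos.2 h2)]
      exact_mod_cast this
  · obtain ⟨h1, h2⟩ := hα
    rw [stabilized_J10three, milnorNumber_stabilizedCubic]
    · rfl
    · exact_mod_cast h1.ne'
    · have : (-(1 + α)) ^ 2 ≠ 4 * α := by nlinarith [sq_pos_of_pos (sub_pos.2 h2)]
      exact_mod_cast this
  · rw [stabilized_J10one, milnorNumber_stabilizedCubic]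
    · rfl
    · simp
    · have h : α ^ 2 < 4 := hα
      have : α ^ 2 ≠ 4 * 1 := by linarith
      exact_mod_cast this

/-- With `m` minima, `s` saddles and one maximum the index is `m + 1 - s`, and the Milnor number is
`m + 1 + s`. -/
theorem negativeRegions_sub_realIndex (T : ParabolicClass) :
    ((T.negativeRegions + (T.crossings + 1) : ℕ) : ℤ) = 2 * T.negativeRegions - T.realIndex + 2 := by
  cases T <;> simp [negativeRegions, crossings, realIndex]

theorem eventually_isControlled (T : ParabolicClass) {α : ℝ} (hα : T.Admissible α) {l : ℕ}
    {Φ : EuclideanSpace ℂ (Fin 3) × EuclideanSpace ℂ (Fin l) → ℂ}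
    (hΦ : IsRealDeformation (T.stabilized α) Φ) :
    ∀ᶠ r in 𝓝[>] (0 : ℝ), ∀ᶠ δ in 𝓝[>] (0 : ℝ),
      IsControlled Φ r δ (T.negativeRegions + (T.crossings + 1)) T.realIndex := by
  cases T
  · rw [stabilized_X9plus] at hΦ
    obtain ⟨h1, h2⟩ := hα
    exact eventually_isControlled_stabilizedFermat (fun h => h2 (by nlinarith)) hΦ
      fun r hr => hasDegree_fermat h1 hr
  · rw [stabilized_X9one] at hΦ
    have h : α ^ 2 < 4 := hα
    exact eventually_isControlled_stabilizedQuartic one_pos (by linarith) hΦ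
      fun r hr => by simpa [realIndex] using hasDegree_quartic_two_lines h hr
  · rw [stabilized_X9two] at hΦ
    obtain ⟨h1, h2⟩ := hα
    exact eventually_isControlled_stabilizedQuartic h1
      (by nlinarith [sq_pos_of_pos (sub_pos.2 h2)]) hΦ
      fun r hr => hasDegree_quartic_four_lines h1 h2 hr
  · rw [stabilized_J10three] at hΦ
    obtain ⟨h1, h2⟩ := hα
    exact eventually_isControlled_stabilizedCubic h1
      (by nlinarith [sq_pos_of_pos (sub_pos.2 h2)]) hΦ
      fun r hr => hasDegree_cubic_three_branches h1 h2 hr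
  · rw [stabilized_J10one] at hΦ
    have h : α ^ 2 < 4 := hα
    exact eventually_isControlled_stabilizedCubic one_pos (by linarith) hΦ
      fun r hr => by simpa [realIndex] using hasDegree_cubic_one_branch h hr

end ParabolicClass

/-! ### Critical points forced by the topology of the picture. -/

section SublevelSets

/-- Near a regular point the sublevel set of a function is connected. -/
theorem exists_isPreconnected_sublevel {E : Type*} [NormedAddCommGroup E] [NormedSpace ℝ E]
    [CompleteSpace E] {ψ : E → ℝ} {p : E} {L : E →L[ℝ] ℝ} (hψ : HasStrictFDerivAt ψ L p)
    (hL : L ≠ 0) {N : Set E} (hN : N ∈ 𝓝 p) :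
    ∃ S : Set E, ∃ N' ∈ 𝓝 p, IsPreconnected S ∧
      (∀ x ∈ S, x ∈ N ∧ ψ x < ψ p) ∧ ∀ x ∈ N', ψ x < ψ p → x ∈ S := by
  have hsurj : L.range = ⊤ := by
    obtain ⟨v, hv⟩ : ∃ v, L v ≠ 0 := by
      by_contra! h
      exact hL (ContinuousLinearMap.ext h)
    refine LinearMap.range_eq_top.2 fun y => ⟨(y / L v) • v, ?_⟩
    simp [hv]
  -- In these coordinates `ψ` is the first component, so small sublevel sets are products of an
  -- interval and a ball.
  set e := hψ.implicitToOpenPartialHomeomorph ψ L hsurj with he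
  have hfst : ∀ x, (e x).1 = ψ x := fun x => hψ.implicitToOpenPartialHomeomorph_fst hsurj x
  have hps : p ∈ e.source := hψ.mem_implicitToOpenPartialHomeomorph_source hsurj
  have hep : e.symm (e p) = p := e.left_inv hps
  have h1 : e.symm ⁻¹' N ∩ e.target ∈ 𝓝 (e p) :=
    inter_mem ((e.continuousAt_symm (e.map_source hps)).preimage_mem_nhds (by rwa [hep]))
      (e.open_target.mem_nhds (e.map_source hps))
  obtain ⟨ε, hε, hball⟩ := Metric.mem_nhds_iff.1 h1
  have hsub : Ioo (ψ p - ε) (ψ p) ×ˢ Metric.ball (e p).2 ε ⊆ e.symm ⁻¹' N ∩ e.target := by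
    rintro ⟨s, y⟩ ⟨⟨hs1, hs2⟩, hy⟩
    refine hball ?_
    rw [Metric.mem_ball, Prod.dist_eq, max_lt_iff, hfst, Real.dist_eq, abs_lt]
    exact ⟨⟨by linarith, by linarith⟩, hy⟩
  refine ⟨e.symm '' (Ioo (ψ p - ε) (ψ p) ×ˢ Metric.ball (e p).2 ε),
    e.source ∩ e ⁻¹' Metric.ball (e p) ε,
    inter_mem (e.open_source.mem_nhds hps)
      ((e.continuousAt hps).preimage_mem_nhds (Metric.ball_mem_nhds _ hε)), ?_, ?_, ?_⟩
  · exact (isPreconnected_Ioo.prod (convex_ball _ _).isPreconnected).image _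
      (e.continuousOn_symm.mono fun x hx => (hsub hx).2)
  · rintro _ ⟨⟨s, y⟩, hy, rfl⟩
    refine ⟨(hsub hy).1, ?_⟩
    rw [← hfst, e.right_inv (hsub hy).2]
    exact hy.1.2
  · rintro x ⟨hxs, hx⟩ hlt
    refine ⟨e x, ⟨?_, ?_⟩, e.left_inv hxs⟩
    · rw [mem_preimage, Metric.mem_ball, Prod.dist_eq, max_lt_iff, hfst, hfst, Real.dist_eq,
        abs_lt] at hx
      rw [hfst]
      exact ⟨by linarith [hx.1.1], hlt⟩
    · rw [mem_preimage, Metric.mem_ball, Prod.dist_eq, max_lt_iff] at hx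
      exact hx.2

/-- A compact set whose boundary contains no points of negativity of `f`. -/
structure IsCell {X : Type*} [TopologicalSpace X] (f : X → ℝ) (C : Set X) : Prop where
  isCompact : IsCompact C
  exists_neg : ∃ q ∈ C, f q < 0
  mem_nhds : ∀ q ∈ C, f q < 0 → C ∈ 𝓝 q

/-- The domain of negativity of `f` is locally divided by the point `q` into two open parts. -/
structure IsNode {X : Type*} [TopologicalSpace X] (f : X → ℝ) (q : X) : Prop where
  eq_zero : f q = 0
  exists_split : ∃ U V : Set X, IsOpen U ∧ IsOpen V ∧ Disjoint U V ∧
    (∀ᶠ z in 𝓝 q, f z < 0 → z ∈ U ∪ V) ∧ (∃ᶠ z in 𝓝 q, z ∈ U ∧ f z < 0) ∧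
    ∃ᶠ z in 𝓝 q, z ∈ V ∧ f z < 0

variable {X E : Type*} [TopologicalSpace X] [NormedAddCommGroup E] [NormedSpace ℝ E]
  {Ω : Set E} {ψ : E → ℝ} {c : ℝ} {f : X → ℝ}

omit [NormedSpace ℝ E] in
-- The minimum of `ψ` over the compact cell lies below `c`, hence at an interior point of the cell.
-- Only the signs of `ψ - c` are carried over by the homeomorphism, and they suffice.
theorem IsCell.exists_isLocalMin {C : Set X} (hC : IsCell f C) (hΩ : IsOpen Ω)
    (hψ : ContinuousOn ψ Ω) (h : Ω ≃ₜ X)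
    (hs : ∀ x : Ω, SignType.sign (ψ x - c) = SignType.sign (f (h x))) :
    ∃ x : Ω, IsLocalMin ψ x ∧ h x ∈ C ∧ f (h x) < 0 := by
  have hneg : ∀ x : Ω, ψ x < c ↔ f (h x) < 0 := fun x => by
    rw [← sign_eq_neg_one_iff, ← hs, sign_eq_neg_one_iff, sub_neg]
  obtain ⟨q, hq, hq0⟩ := hC.exists_neg
  have hK : IsCompact (h ⁻¹' C) := h.isCompact_preimage.2 hC.isCompact
  obtain ⟨x, hx, hmin⟩ := hK.exists_isMinOn ⟨h.symm q, by simpa using hq⟩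
    (continuousOn_iff_continuous_domRestrict.1 hψ).continuousOn
  have hlt : f (h x) < 0 := by
    rw [← hneg]
    have h1 := hmin (show h.symm q ∈ h ⁻¹' C by simpa using hq)
    have h2 : ψ (h.symm q) < c := by rw [hneg]; simpa using hq0
    exact lt_of_le_of_lt h1 h2
  refine ⟨x, ?_, hx, hlt⟩
  have hloc : IsLocalMin (Ω.domRestrict ψ) x :=
    hmin.isLocalMin (h.continuous.continuousAt.preimage_mem_nhds (hC.mem_nhds _ hx hlt))
  rw [IsLocalMin, IsMinFilter, ← map_nhds_subtype_coe_eq_nhds x.2 (hΩ.mem_nhds x.2)]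
  exact hloc

/-- Near a regular point the set `ψ < c` is connected, whereas the node splits it into two non-empty
open pieces. Thus a merely topological crossing already forces a critical point. -/
theorem IsNode.fderiv_eq_zero [CompleteSpace E] (hΩ : IsOpen Ω) (h : Ω ≃ₜ X)
    (hs : ∀ x : Ω, SignType.sign (ψ x - c) = SignType.sign (f (h x))) {x : Ω}
    (hx : IsNode f (h x)) (hψ : ContDiffAt ℝ 1 ψ x) : fderiv ℝ ψ x = 0 := by
  have hneg : ∀ x : Ω, ψ x < c ↔ f (h x) < 0 := fun x => by
    rw [← sign_eq_neg_one_iff, ← hs, sign_eq_neg_one_iff, sub_neg]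
  have hxc : ψ x = c := by
    rw [← sub_eq_zero, ← sign_eq_zero_iff, hs, hx.eq_zero, sign_zero]
  by_contra hne
  obtain ⟨U, V, hU, hV, hUV, hsplit, hfU, hfV⟩ := hx.exists_split
  have hmap : ∀ {A : Set Ω}, A ∈ 𝓝 x → ((↑) : Ω → E) '' A ∈ 𝓝 (x : E) := fun {A} hA => by
    rw [← map_nhds_subtype_coe_eq_nhds x.2 (hΩ.mem_nhds x.2)]
    exact image_mem_map hA
  have hN := hmap (h.continuous.continuousAt.preimage_mem_nhds hsplit)
  obtain ⟨S, N', hN', hS, hSN, hN'S⟩ := exists_isPreconnected_sublevel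
    (hψ.hasStrictFDerivAt one_ne_zero) hne hN
  have himg : ∀ {A : Set X}, IsOpen A → IsOpen (((↑) : Ω → E) '' (h ⁻¹' A)) := fun {A} hA =>
    hΩ.isOpenMap_subtype_val _ (hA.preimage h.continuous)
  have hmeet : ∀ {A : Set X}, (∃ᶠ z in 𝓝 (h x), z ∈ A ∧ f z < 0) →
      (S ∩ ((↑) : Ω → E) '' (h ⁻¹' A)).Nonempty := by
    intro A hA
    have h1 : h.symm ⁻¹' (((↑) : Ω → E) ⁻¹' N') ∈ 𝓝 (h x) :=
      h.symm.continuous.continuousAt.preimage_mem_nhds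
        (by rw [h.symm_apply_apply]; exact continuous_subtype_val.continuousAt.preimage_mem_nhds hN')
    obtain ⟨z, ⟨hzA, hz0⟩, hz⟩ := (hA.and_eventually h1).exists
    refine ⟨h.symm z, hN'S _ hz ?_, h.symm z, by simpa using hzA, rfl⟩
    rw [hxc, hneg, h.apply_symm_apply]
    exact hz0
  obtain ⟨y, -, ⟨y1, hy1, rfl⟩, ⟨y2, hy2, hy12⟩⟩ := hS _ _ (himg hU) (himg hV) (fun y hy => by
    obtain ⟨⟨z, hz, rfl⟩, hlt⟩ := hSN y hy
    rw [hxc, hneg] at hlt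
    rcases hz hlt with h1 | h1
    · exact Or.inl ⟨z, h1, rfl⟩
    · exact Or.inr ⟨z, h1, rfl⟩) (hmeet hfU) (hmeet hfV)
  obtain rfl : y2 = y1 := Subtype.ext hy12
  exact disjoint_left.1 hUV hy1 hy2

/-- What is needed of a function on the plane with `m` bounded domains of negativity, `s` crossing
points of its zero set and a bounded domain of positivity. -/
structure IsArrangement (f : X → ℝ) (m s : ℕ) : Prop where
  exists_cells : ∃ C : Fin m → Set X, (∀ i, IsCell f (C i)) ∧
    ∀ i j, i < j → ∀ q ∈ C i, q ∈ C j → 0 ≤ f q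
  exists_cell_neg : ∃ C : Set X, IsCell (-f) C
  exists_nodes : ∃ N : Finset X, N.card = s ∧ ∀ q ∈ N, IsNode f q

/-- The minima are distinct, since two cells meet only where `f` is non-negative; their values are
negative by assumption. The nodes lie on the level `c > 0` and the maximum lies above it. -/
theorem IsArrangement.exists_critical_points [CompleteSpace E] {m s : ℕ} (hf : IsArrangement f m s)
    (hΩ : IsOpen Ω) (hc : 0 < c) (hψ : ∀ x ∈ Ω, ContDiffAt ℝ 1 ψ x) (h : Ω ≃ₜ X)
    (hs : ∀ x : Ω, SignType.sign (ψ x - c) = SignType.sign (f (h x)))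
    (hmin : ∀ x ∈ Ω, IsLocalMin ψ x → ψ x < 0) :
    ∃ M N : Finset E, M.card = m ∧ N.card = s + 1 ∧ (∀ x ∈ M, x ∈ Ω ∧ IsLocalMin ψ x ∧ ψ x < 0) ∧
      ∀ x ∈ N, x ∈ Ω ∧ fderiv ℝ ψ x = 0 ∧ 0 < ψ x := by
  classical
  have hψc : ContinuousOn ψ Ω := fun x hx => (hψ x hx).continuousAt.continuousWithinAt
  obtain ⟨C, hC, hdis⟩ := hf.exists_cells
  choose x hxmin hxC hxneg using fun i => (hC i).exists_isLocalMin hΩ hψc h hs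
  obtain ⟨D, hD⟩ := hf.exists_cell_neg
  -- A maximum in the positive cell is found as a minimum for the opposite signs.
  obtain ⟨y, hymax, -, hy⟩ := hD.exists_isLocalMin (ψ := -ψ) (c := -c) hΩ hψc.neg h fun x => by
    rw [Pi.neg_apply, Pi.neg_apply, Left.sign_neg, ← hs, ← Left.sign_neg]
    congr 1; ring
  obtain ⟨N, hN, hNode⟩ := hf.exists_nodes
  have hxinj : Function.Injective fun i => (x i : E) := by
    have : ∀ i j, i < j → x i ≠ x j := fun i j hij he =>
      not_le.2 (hxneg i) (hdis i j hij _ (hxC i) (by rw [he]; exact hxC j))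
    intro i j hij
    by_contra hne
    rcases lt_or_gt_of_ne hne with h1 | h1
    · exact this i j h1 (Subtype.ext hij)
    · exact this j i h1 (Subtype.ext hij.symm)
  have hyc : c < ψ y := by
    have : 0 < f (h y) := by simpa using hy
    rw [← sign_eq_one_iff, ← hs, sign_eq_one_iff] at this
    linarith
  have hNc : ∀ q ∈ N, ψ (h.symm q) = c := fun q hq => by
    rw [← sub_eq_zero, ← sign_eq_zero_iff, hs, h.apply_symm_apply, (hNode q hq).eq_zero, sign_zero]
  refine ⟨Finset.univ.image fun i => (x i : E),
    insert (y : E) (N.image fun q => (h.symm q : E)), ?_, ?_, ?_, ?_⟩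
  · rw [Finset.card_image_of_injective _ hxinj, Finset.card_univ, Fintype.card_fin]
  · rw [Finset.card_insert_of_notMem, Finset.card_image_of_injective, hN]
    · exact Subtype.val_injective.comp h.symm.injective
    · intro hmem
      obtain ⟨q, hq, hqy⟩ := Finset.mem_image.1 hmem
      rw [← hqy, hNc q hq] at hyc
      exact lt_irrefl _ hyc
  · intro z hz
    obtain ⟨i, -, rfl⟩ := Finset.mem_image.1 hz
    exact ⟨(x i).2, hxmin i, hmin _ (x i).2 (hxmin i)⟩
  · intro z hz
    rcases Finset.mem_insert.1 hz with rfl | hz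
    · have h1 := hymax.fderiv_eq_zero
      rw [fderiv_neg, neg_eq_zero] at h1
      exact ⟨y.2, h1, hc.trans hyc⟩
    · obtain ⟨q, hq, rfl⟩ := Finset.mem_image.1 hz
      refine ⟨(h.symm q).2, ?_, by rw [hNc q hq]; exact hc⟩
      exact IsNode.fderiv_eq_zero hΩ h hs (by rw [h.apply_symm_apply]; exact hNode q hq)
        (hψ _ (h.symm q).2)

end SublevelSets

/-! ### Transverse crossings, and regions bounded by explicit inequalities. -/

section Nodes

theorem HasGrad.hasDerivAt_line {A : ℝ × ℝ → ℝ} {a b x y : ℝ} (hA : HasGrad A a b (x, y)) (v w : ℝ) :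
    HasDerivAt (fun s : ℝ => A (x + s * v, y + s * w)) (a * v + b * w) 0 := by
  have h1 : HasDerivAt (fun s : ℝ => x + s * v) v 0 := by
    simpa using ((hasDerivAt_id (0 : ℝ)).mul_const v).const_add x
  have h2 : HasDerivAt (fun s : ℝ => y + s * w) w 0 := by
    simpa using ((hasDerivAt_id (0 : ℝ)).mul_const w).const_add y
  have h3 : HasFDerivAt A (a • ContinuousLinearMap.fst ℝ ℝ ℝ + b • ContinuousLinearMap.snd ℝ ℝ ℝ)
      (x + 0 * v, y + 0 * w) := by
    simp only [zero_mul, add_zero]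
    exact hA
  refine (h3.comp_hasDerivAt (0 : ℝ) (h1.prodMk h2)).congr_deriv ?_
  simp

theorem HasDerivAt.eventually_pos {f : ℝ → ℝ} {d : ℝ} (hf : HasDerivAt f d 0) (h0 : f 0 = 0)
    (hd : 0 < d) : ∀ᶠ s in 𝓝[>] (0 : ℝ), 0 < f s := by
  have h1 := eventually_nhdsWithin_sign_eq_of_deriv_pos (by rwa [hf.deriv]) h0
  filter_upwards [nhdsWithin_le_nhds h1, self_mem_nhdsWithin] with s hs hs0
  rw [← sign_eq_one_iff, hs, sign_eq_one_iff]
  simpa using hs0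

/-- A transverse crossing of two curves. -/
theorem isNode_of_transverse {f : EuclideanSpace ℝ (Fin 2) → ℝ} {A B u : ℝ × ℝ → ℝ}
    {a a' b b' x y : ℝ} (hf : ∀ z, f z = A (z 0, z 1) * B (z 0, z 1) * u (z 0, z 1))
    (hA : Continuous A) (hB : Continuous B) (hu : Continuous u) (hA' : HasGrad A a a' (x, y))
    (hB' : HasGrad B b b' (x, y)) (hA0 : A (x, y) = 0) (hB0 : B (x, y) = 0)
    (hdet : a * b' - a' * b ≠ 0) (hu0 : u (x, y) ≠ 0) : IsNode f !₂[x, y] := by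
  -- A negative factor `u` is made positive by changing the signs of both `A` and `u`.
  wlog hpos : 0 < u (x, y) generalizing A u a a'
  · have hneg : u (x, y) < 0 := lt_of_le_of_ne (not_lt.1 hpos) hu0
    exact this (A := fun p => -A p) (u := fun p => -u p) (a := -a) (a' := -a')
      (fun z => by rw [hf]; ring) hA.neg hu.neg
      ((HasFDerivAt.neg hA').congr_fderiv (by ext <;> simp)) (by rw [hA0, neg_zero])
      (fun h => hdet (by linarith)) (neg_ne_zero.2 hu0) (neg_pos.2 hneg)
  have hc : Continuous fun z : EuclideanSpace ℝ (Fin 2) => (z 0, z 1) := by fun_prop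
  -- Transversality solves the linear system for a direction along which `A` and `B` take opposite
  -- signs; `σ = 1` and `σ = -1` lead to the two negative sectors.
  have hdir : ∀ σ : ℝ, ∃ v w, a * v + a' * w = -σ ∧ b * v + b' * w = σ := fun σ => by
    refine ⟨σ * (-b' - a') / (a * b' - a' * b), σ * (a + b) / (a * b' - a' * b), ?_, ?_⟩ <;>
    · rw [mul_div_assoc', mul_div_assoc', ← add_div, div_eq_iff hdet]
      ring
  have hline : ∀ v w : ℝ, Tendsto (fun s : ℝ => !₂[x + s * v, y + s * w]) (𝓝[>] 0) (𝓝 !₂[x, y]) := by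
    intro v w
    have : Continuous fun s : ℝ => !₂[x + s * v, y + s * w] := by fun_prop
    simpa using (this.tendsto 0).mono_left nhdsWithin_le_nhds
  have hupos : ∀ᶠ z in 𝓝 (!₂[x, y] : EuclideanSpace ℝ (Fin 2)), 0 < u (z 0, z 1) :=
    (hu.comp hc).continuousAt.eventually (lt_mem_nhds (by simpa using hpos))
  have hAs : ∀ {v w : ℝ}, 0 < a * v + a' * w → ∀ᶠ s in 𝓝[>] (0 : ℝ), 0 < A (x + s * v, y + s * w) :=
    fun h => (hA'.hasDerivAt_line _ _).eventually_pos (by simpa using hA0) h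
  have hBs : ∀ {v w : ℝ}, 0 < b * v + b' * w → ∀ᶠ s in 𝓝[>] (0 : ℝ), 0 < B (x + s * v, y + s * w) :=
    fun h => (hB'.hasDerivAt_line _ _).eventually_pos (by simpa using hB0) h
  have hAn : ∀ {v w : ℝ}, a * v + a' * w < 0 → ∀ᶠ s in 𝓝[>] (0 : ℝ), A (x + s * v, y + s * w) < 0 :=
    fun h => ((hA'.hasDerivAt_line _ _).neg.eventually_pos (by simpa using hA0)
      (neg_pos.2 h)).mono fun _ => neg_pos.1
  have hBn : ∀ {v w : ℝ}, b * v + b' * w < 0 → ∀ᶠ s in 𝓝[>] (0 : ℝ), B (x + s * v, y + s * w) < 0 :=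
    fun h => ((hB'.hasDerivAt_line _ _).neg.eventually_pos (by simpa using hB0)
      (neg_pos.2 h)).mono fun _ => neg_pos.1
  refine ⟨by simp [hf, hA0], {z | A (z 0, z 1) < 0 ∧ 0 < B (z 0, z 1)},
    {z | 0 < A (z 0, z 1) ∧ B (z 0, z 1) < 0},
    (isOpen_lt (hA.comp hc) continuous_const).inter (isOpen_lt continuous_const (hB.comp hc)),
    (isOpen_lt continuous_const (hA.comp hc)).inter (isOpen_lt (hB.comp hc) continuous_const),
    disjoint_left.2 fun z h1 h2 => lt_asymm h1.1 h2.1, ?_, ?_, ?_⟩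
  · filter_upwards [hupos] with z hz hfz
    rw [hf, mul_neg_iff] at hfz
    rcases mul_neg_iff.1 (hfz.resolve_left fun h => lt_asymm h.2 hz).1 with h | h
    · exact Or.inr h
    · exact Or.inl h
  · obtain ⟨v, w, h1, h2⟩ := hdir 1
    refine (hline v w).frequently (Eventually.frequently ?_)
    filter_upwards [hAn (v := v) (w := w) (by linarith), hBs (v := v) (w := w) (by linarith),
      (hline v w).eventually hupos] with s k1 k2 k3
    exact ⟨⟨k1, k2⟩, by rw [hf]; exact mul_neg_of_neg_of_pos (mul_neg_of_neg_of_pos k1 k2) k3⟩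
  · obtain ⟨v, w, h1, h2⟩ := hdir (-1)
    refine (hline v w).frequently (Eventually.frequently ?_)
    filter_upwards [hAs (v := v) (w := w) (by linarith), hBn (v := v) (w := w) (by linarith),
      (hline v w).eventually hupos] with s k1 k2 k3
    exact ⟨⟨k1, k2⟩, by rw [hf]; exact mul_neg_of_neg_of_pos (mul_neg_of_pos_of_neg k1 k2) k3⟩

theorem hasGrad_quadratic (a b c d e : ℝ) (p : ℝ × ℝ) :
    HasGrad (fun p => a * p.1 ^ 2 + b * p.2 ^ 2 + c * p.1 + d * p.2 + e) (2 * a * p.1 + c)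
      (2 * b * p.2 + d) p :=
  (((((hasGrad_monomial a 2 0 p).add (hasGrad_monomial b 0 2 p)).add
    (hasGrad_monomial c 1 0 p)).add (hasGrad_monomial d 0 1 p)).add
    (hasGrad_monomial e 0 0 p)).congr (fun q => by ring) (by norm_num; ring) (by norm_num; ring)

/-- The set where `g` is non-negative is bounded, and `g` is positive at all points of this set
at which `F` is negative. -/
structure IsRegion (F g : ℝ → ℝ → ℝ) : Prop where
  continuous : Continuous fun p : ℝ × ℝ => g p.1 p.2
  bounded : ∃ R, ∀ x y, 0 ≤ g x y → |x| ≤ R ∧ |y| ≤ R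
  pos : ∀ x y, 0 ≤ g x y → F x y < 0 → 0 < g x y
  nonempty : ∃ x y, 0 ≤ g x y ∧ F x y < 0

theorem IsRegion.isCell {F g : ℝ → ℝ → ℝ} (h : IsRegion F g) :
    IsCell (fun z : EuclideanSpace ℝ (Fin 2) => F (z 0) (z 1)) {z | 0 ≤ g (z 0) (z 1)} := by
  have hc : Continuous fun z : EuclideanSpace ℝ (Fin 2) => g (z 0) (z 1) :=
    h.continuous.comp (f := fun z : EuclideanSpace ℝ (Fin 2) => (z 0, z 1)) (by fun_prop)
  obtain ⟨x, y, hxy, hneg⟩ := h.nonempty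
  obtain ⟨R, hR⟩ := h.bounded
  refine ⟨Metric.isCompact_of_isClosed_isBounded (isClosed_le continuous_const hc) ?_,
    ⟨!₂[x, y], by simpa using hxy, by simpa using hneg⟩, fun q hq hlt =>
    mem_of_superset ((isOpen_lt continuous_const hc).mem_nhds (h.pos _ _ hq hlt)) fun z hz => le_of_lt (show 0 < g (z 0) (z 1) from hz)⟩
  refine (Metric.isBounded_closedBall (x := (0 : EuclideanSpace ℝ (Fin 2))) (r := 2 * R)).subset ?_
  intro z hz
  obtain ⟨h0, h1⟩ := hR _ _ hz
  have hR0 : 0 ≤ R := (abs_nonneg _).trans h0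
  rw [mem_closedBall_zero_iff, EuclideanSpace.norm_eq]
  refine Real.sqrt_le_iff.2 ⟨by positivity, ?_⟩
  simp only [Fin.sum_univ_two, Real.norm_eq_abs]
  nlinarith [abs_nonneg (z 0), abs_nonneg (z 1)]

/-- The cells are the closed sets where the functions of the list are non-negative. They may touch,
so only their open parts are required to be disjoint. -/
theorem isArrangement_of_isRegion {F : ℝ → ℝ → ℝ} {m s : ℕ} (L : List (ℝ → ℝ → ℝ))
    (hm : L.length = m) (hL : ∀ g ∈ L, IsRegion F g)
    (hdis : L.Pairwise fun g k => ∀ x y, 0 < g x y → k x y ≤ 0) {g' : ℝ → ℝ → ℝ}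
    (hg' : IsRegion (fun x y => -F x y) g') (N : Finset (ℝ × ℝ)) (hN : N.card = s)
    (hNode : ∀ p ∈ N, IsNode (fun z : EuclideanSpace ℝ (Fin 2) => F (z 0) (z 1)) !₂[p.1, p.2]) :
    IsArrangement (fun z : EuclideanSpace ℝ (Fin 2) => F (z 0) (z 1)) m s := by
  classical
  subst hm
  refine ⟨⟨_, fun i => (hL _ (L.get_mem i)).isCell, fun i j hij q hi hj => ?_⟩, ⟨_, hg'.isCell⟩,
    N.image fun p => !₂[p.1, p.2], ?_, ?_⟩
  · by_contra! hlt
    exact ((hL _ (L.get_mem j)).pos _ _ hj hlt).not_ge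
      (List.pairwise_iff_get.1 hdis i j hij _ _ ((hL _ (L.get_mem i)).pos _ _ hi hlt))
  · rw [Finset.card_image_of_injective _ ?_, hN]
    intro p q hpq
    have h0 := congrArg (fun z : EuclideanSpace ℝ (Fin 2) => z 0) hpq
    have h1 := congrArg (fun z : EuclideanSpace ℝ (Fin 2) => z 1) hpq
    exact Prod.ext (by simpa using h0) (by simpa using h1)
  · intro q hq
    obtain ⟨p, hp, rfl⟩ := Finset.mem_image.1 hq
    exact hNode p hp

end Nodes

/-! ### The pictures of `+X₉` and `X₉¹`. -/

namespace ParabolicClass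

/-- The upper and lower tips of the tall ellipse, outside the wide one; `σ` selects the half-plane.
-/
theorem isRegion_X9plus_left (σ : ℝ) (hσ : σ = 1 ∨ σ = -1) :
    IsRegion (fun x y => (4 * x ^ 2 + y ^ 2 - 4) * (x ^ 2 + 4 * y ^ 2 - 4))
      (fun x y => min (min (4 - 4 * x ^ 2 - y ^ 2) (x ^ 2 + 4 * y ^ 2 - 4)) (σ * y)) := by
  refine ⟨by fun_prop, ⟨2, fun x y h => ?_⟩, fun x y h hF => ?_, 0, σ * (3 / 2), ?_, ?_⟩
  · simp only [le_min_iff] at h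
    constructor <;> apply abs_le_of_sq_le_sq <;> nlinarith [sq_nonneg x, sq_nonneg y]
  · simp only [le_min_iff, lt_min_iff] at h ⊢
    refine ⟨⟨lt_of_le_of_ne h.1.1 fun e => ?_, lt_of_le_of_ne h.1.2 fun e => ?_⟩,
      lt_of_le_of_ne h.2 fun e => ?_⟩
    · simp [show 4 * x ^ 2 + y ^ 2 - 4 = 0 by linarith] at hF
    · simp [← e] at hF
    · obtain rfl : y = 0 := by rcases hσ with rfl | rfl <;> linarith
      linarith [h.1.1, h.1.2, sq_nonneg x]
  · rcases hσ with rfl | rfl <;> norm_num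
  · rcases hσ with rfl | rfl <;> norm_num

/-- The tips of the wide ellipse, obtained by exchanging the coordinates. -/
theorem isRegion_X9plus_right (σ : ℝ) (hσ : σ = 1 ∨ σ = -1) :
    IsRegion (fun x y => (4 * x ^ 2 + y ^ 2 - 4) * (x ^ 2 + 4 * y ^ 2 - 4))
      (fun x y => min (min (4 * x ^ 2 + y ^ 2 - 4) (4 - x ^ 2 - 4 * y ^ 2)) (σ * x)) := by
  obtain ⟨h1, ⟨R, h2⟩, h3, x, y, h4, h5⟩ := isRegion_X9plus_left σ hσ
  have hmin : ∀ x y : ℝ, min (min (4 * x ^ 2 + y ^ 2 - 4) (4 - x ^ 2 - 4 * y ^ 2)) (σ * x) =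
      min (min (4 - 4 * y ^ 2 - x ^ 2) (y ^ 2 + 4 * x ^ 2 - 4)) (σ * x) := fun x y => by
    rw [min_comm (4 * x ^ 2 + y ^ 2 - 4)]; ring_nf
  simp only [hmin]
  exact ⟨h1.comp continuous_swap, ⟨R, fun x y h => (h2 y x h).symm⟩,
    fun x y h hF => h3 y x h (by linarith), y, x, h4, by linarith⟩

theorem isArrangement_X9plus : IsArrangement X9plus.picture 4 4 := by
  have gA : ∀ p, HasGrad (fun p : ℝ × ℝ => 4 * p.1 ^ 2 + p.2 ^ 2 - 4) (8 * p.1) (2 * p.2) p := fun p =>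
    (hasGrad_quadratic 4 1 0 0 (-4) p).congr (fun q => by ring) (by ring) (by ring)
  have gB : ∀ p, HasGrad (fun p : ℝ × ℝ => p.1 ^ 2 + 4 * p.2 ^ 2 - 4) (2 * p.1) (8 * p.2) p := fun p =>
    (hasGrad_quadratic 1 4 0 0 (-4) p).congr (fun q => by ring) (by ring) (by ring)
  have hnode : ∀ x y : ℝ, x ^ 2 = 4 / 5 → y ^ 2 = 4 / 5 → IsNode X9plus.picture !₂[x, y] := by
    intro x y hx hy
    refine isNode_of_transverse (u := fun _ => 1) (fun z => (mul_one _).symm) (by fun_prop)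
      (by fun_prop) continuous_const (gA _) (gB _) (by simp only; linarith) (by simp only; linarith) ?_
      one_ne_zero
    simp only
    intro h
    have h1 : x * y = 0 := by linarith
    have h2 : x ^ 2 * y ^ 2 = 0 := by rw [← mul_pow, h1]; norm_num
    rw [hx, hy] at h2
    norm_num at h2
  set t : ℝ := √(4 / 5) with ht
  have ht2 : t ^ 2 = 4 / 5 := Real.sq_sqrt (by norm_num)
  have ht0 : 0 < t := Real.sqrt_pos.2 (by norm_num)
  have hne : t ≠ -t := by linarith
  refine isArrangement_of_isRegion
    (F := fun x y => (4 * x ^ 2 + y ^ 2 - 4) * (x ^ 2 + 4 * y ^ 2 - 4))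
    [fun x y => min (min (4 - 4 * x ^ 2 - y ^ 2) (x ^ 2 + 4 * y ^ 2 - 4)) (1 * y),
      fun x y => min (min (4 - 4 * x ^ 2 - y ^ 2) (x ^ 2 + 4 * y ^ 2 - 4)) (-1 * y),
      fun x y => min (min (4 * x ^ 2 + y ^ 2 - 4) (4 - x ^ 2 - 4 * y ^ 2)) (1 * x),
      fun x y => min (min (4 * x ^ 2 + y ^ 2 - 4) (4 - x ^ 2 - 4 * y ^ 2)) (-1 * x)]
    rfl ?_ ?_ (g' := fun x y => min (4 - 4 * x ^ 2 - y ^ 2) (4 - x ^ 2 - 4 * y ^ 2)) ?_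
    {(t, t), (t, -t), (-t, t), (-t, -t)} ?_ ?_
  · simp only [List.forall_mem_cons, List.not_mem_nil, false_imp_iff, implies_true, and_true]
    exact ⟨isRegion_X9plus_left 1 (Or.inl rfl), isRegion_X9plus_left (-1) (Or.inr rfl),
      isRegion_X9plus_right 1 (Or.inl rfl), isRegion_X9plus_right (-1) (Or.inr rfl)⟩
  · simp only [List.pairwise_cons, List.forall_mem_cons, List.not_mem_nil, false_imp_iff, implies_true,
      and_true, List.Pairwise.nil, lt_min_iff, min_le_iff]
    refine ⟨⟨?_, ?_, ?_⟩, ⟨?_, ?_⟩, ?_⟩ <;> intro x y h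
    · exact Or.inr (by linarith)
    · exact Or.inl (Or.inl (by linarith))
    · exact Or.inl (Or.inl (by linarith))
    · exact Or.inl (Or.inl (by linarith))
    · exact Or.inl (Or.inl (by linarith))
    · exact Or.inr (by linarith)
  · refine ⟨by fun_prop, ⟨2, fun x y h => ?_⟩, fun x y h hF => ?_, 0, 0, by norm_num, by norm_num⟩
    · simp only [le_min_iff] at h
      constructor <;> apply abs_le_of_sq_le_sq <;> nlinarith [sq_nonneg x, sq_nonneg y]
    · simp only [le_min_iff, lt_min_iff] at h ⊢
      refine ⟨lt_of_le_of_ne h.1 fun e => ?_, lt_of_le_of_ne h.2 fun e => ?_⟩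
      · simp [show 4 * x ^ 2 + y ^ 2 - 4 = 0 by linarith] at hF
      · simp [show x ^ 2 + 4 * y ^ 2 - 4 = 0 by linarith] at hF
  · simp [hne, hne.symm, Finset.card_insert_of_notMem]
  · intro p hp
    simp only [Finset.mem_insert, Finset.mem_singleton] at hp
    rcases hp with rfl | rfl | rfl | rfl <;> exact hnode _ _ (by simpa using ht2) (by simpa using ht2)

/-- The triangle between the crossing of the lines and the ellipse. The bound `x ≤ 2` discards the
unbounded part of the wedge beyond the ellipse. -/
theorem isRegion_X9one_outer :
    IsRegion (fun x y => (4 * y ^ 2 - x ^ 2) * (4 * (x - 2) ^ 2 + y ^ 2 - 4))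
      (fun x y => min (min (x ^ 2 - 4 * y ^ 2) (4 * (x - 2) ^ 2 + y ^ 2 - 4)) (min x (2 - x))) := by
  refine ⟨by fun_prop, ⟨2, fun x y h => ?_⟩, fun x y h hF => ?_, 1 / 2, 0, by norm_num, by norm_num⟩
  · simp only [le_min_iff] at h
    constructor <;> apply abs_le_of_sq_le_sq <;> nlinarith
  · simp only [le_min_iff, lt_min_iff] at h ⊢
    refine ⟨⟨lt_of_le_of_ne h.1.1 fun e => ?_, lt_of_le_of_ne h.1.2 fun e => ?_⟩,
      lt_of_le_of_ne h.2.1 fun e => ?_, lt_of_le_of_ne h.2.2 fun e => ?_⟩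
    · simp [show 4 * y ^ 2 - x ^ 2 = 0 by linarith] at hF
    · simp [← e] at hF
    · subst e
      nlinarith [sq_nonneg y, mul_nonneg (sq_nonneg y) (sq_nonneg y)]
    · obtain rfl : x = 2 := by linarith
      linarith [h.1.1, h.1.2]

theorem isRegion_X9one_side (σ : ℝ) (hσ : σ = 1 ∨ σ = -1) :
    IsRegion (fun x y => (4 * y ^ 2 - x ^ 2) * (4 * (x - 2) ^ 2 + y ^ 2 - 4))
      (fun x y => min (min (4 * y ^ 2 - x ^ 2) (4 - 4 * (x - 2) ^ 2 - y ^ 2)) (σ * y)) := by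
  refine ⟨by fun_prop, ⟨3, fun x y h => ?_⟩, fun x y h hF => ?_, 2, σ * (3 / 2), ?_, ?_⟩
  · simp only [le_min_iff] at h
    constructor <;> apply abs_le_of_sq_le_sq <;> nlinarith [sq_nonneg (x - 2), sq_nonneg (x - 3)]
  · simp only [le_min_iff, lt_min_iff] at h ⊢
    refine ⟨⟨lt_of_le_of_ne h.1.1 fun e => ?_, lt_of_le_of_ne h.1.2 fun e => ?_⟩,
      lt_of_le_of_ne h.2 fun e => ?_⟩
    · simp [← e] at hF
    · simp [show 4 * (x - 2) ^ 2 + y ^ 2 - 4 = 0 by linarith] at hF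
    · obtain rfl : y = 0 := by rcases hσ with rfl | rfl <;> linarith
      obtain rfl : x = 0 := by nlinarith [h.1.1, sq_nonneg x]
      linarith [h.1.2]
  · rcases hσ with rfl | rfl <;> norm_num
  · rcases hσ with rfl | rfl <;> norm_num

theorem isArrangement_X9one : IsArrangement X9one.picture 3 5 := by
  have gL : ∀ σ p, HasGrad (fun p : ℝ × ℝ => 2 * p.2 - σ * p.1) (-σ) 2 p := fun σ p =>
    (hasGrad_quadratic 0 0 (-σ) 2 0 p).congr (fun q => by ring) (by ring) (by ring)
  have gE : ∀ p, HasGrad (fun p : ℝ × ℝ => 4 * (p.1 - 2) ^ 2 + p.2 ^ 2 - 4) (8 * p.1 - 16) (2 * p.2) p :=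
    fun p => (hasGrad_quadratic 4 1 (-16) 0 12 p).congr (fun q => by ring) (by ring) (by ring)
  -- The equation of the ellipse on the lines `y = σ x / 2`, multiplied by four.
  have hnode : ∀ x σ : ℝ, 17 * x ^ 2 - 64 * x + 48 = 0 → σ = 1 ∨ σ = -1 →
      IsNode X9one.picture !₂[x, σ * x / 2] := by
    intro x σ hx hσ
    have hσ2 : σ * σ = 1 := by rcases hσ with rfl | rfl <;> norm_num
    refine isNode_of_transverse (A := fun p => 2 * p.2 - σ * p.1)
      (B := fun p => 4 * (p.1 - 2) ^ 2 + p.2 ^ 2 - 4) (u := fun p => 2 * p.2 + σ * p.1)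
      (fun z => ?_) (by fun_prop)
      (by fun_prop) (by fun_prop) (gL σ _) (gE _) (by simp only; ring) ?_ ?_ ?_
    · rcases hσ with rfl | rfl <;> simp only [picture] <;> ring
    · simp only
      linear_combination hx / 4 + x ^ 2 / 4 * hσ2
    · simp only
      intro h
      have h1 : 17 * x = 32 := by linear_combination -h - x * hσ2
      nlinarith
    · simp only
      intro h
      have h1 : x = 0 := by rcases hσ with rfl | rfl <;> linarith
      rw [h1] at hx
      norm_num at hx
  have hzero : IsNode X9one.picture !₂[0, 0] := by
    refine isNode_of_transverse (A := fun p => 2 * p.2 - 1 * p.1) (B := fun p => 2 * p.2 - (-1) * p.1)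
      (u := fun p => 4 * (p.1 - 2) ^ 2 + p.2 ^ 2 - 4)
      (fun z => by simp only [picture]; ring) (by fun_prop) (by fun_prop) (by fun_prop)
      (gL 1 _) (gL (-1) _) ?_ ?_ ?_ ?_ <;> norm_num
  have hs : √13 ^ 2 = 13 := Real.sq_sqrt (by norm_num)
  have hs0 : 0 < √13 := Real.sqrt_pos.2 (by norm_num)
  obtain ⟨x₁, hx₁⟩ : ∃ x : ℝ, x = (32 + 4 * √13) / 17 := ⟨_, rfl⟩
  obtain ⟨x₂, hx₂⟩ : ∃ x : ℝ, x = (32 - 4 * √13) / 17 := ⟨_, rfl⟩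
  have h1 : 17 * x₁ ^ 2 - 64 * x₁ + 48 = 0 := by rw [hx₁]; linear_combination 16 / 17 * hs
  have h2 : 17 * x₂ ^ 2 - 64 * x₂ + 48 = 0 := by rw [hx₂]; linear_combination 16 / 17 * hs
  have h12 : x₁ ≠ x₂ := by rw [hx₁, hx₂]; intro h; linarith
  have h10 : x₁ ≠ 0 := by rintro rfl; norm_num at h1
  have h20 : x₂ ≠ 0 := by rintro rfl; norm_num at h2
  have h1n : x₁ / 2 ≠ -x₁ / 2 := fun h => h10 (by linarith)
  have h2n : x₂ / 2 ≠ -x₂ / 2 := fun h => h20 (by linarith)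
  refine isArrangement_of_isRegion
    (F := fun x y => (4 * y ^ 2 - x ^ 2) * (4 * (x - 2) ^ 2 + y ^ 2 - 4))
    [fun x y => min (min (x ^ 2 - 4 * y ^ 2) (4 * (x - 2) ^ 2 + y ^ 2 - 4)) (min x (2 - x)),
      fun x y => min (min (4 * y ^ 2 - x ^ 2) (4 - 4 * (x - 2) ^ 2 - y ^ 2)) (1 * y),
      fun x y => min (min (4 * y ^ 2 - x ^ 2) (4 - 4 * (x - 2) ^ 2 - y ^ 2)) (-1 * y)]
    rfl ?_ ?_ (g' := fun x y => min (x ^ 2 - 4 * y ^ 2) (4 - 4 * (x - 2) ^ 2 - y ^ 2)) ?_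
    {(0, 0), (x₁, 1 * x₁ / 2), (x₁, -1 * x₁ / 2), (x₂, 1 * x₂ / 2), (x₂, -1 * x₂ / 2)} ?_ ?_
  · simp only [List.forall_mem_cons, List.not_mem_nil, false_imp_iff, implies_true, and_true]
    exact ⟨isRegion_X9one_outer, isRegion_X9one_side 1 (Or.inl rfl),
      isRegion_X9one_side (-1) (Or.inr rfl)⟩
  · simp only [List.pairwise_cons, List.forall_mem_cons, List.not_mem_nil, false_imp_iff, implies_true,
      and_true, List.Pairwise.nil, lt_min_iff, min_le_iff]
    refine ⟨⟨?_, ?_⟩, ?_⟩ <;> intro x y h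
    · exact Or.inl (Or.inl (by linarith))
    · exact Or.inl (Or.inl (by linarith))
    · exact Or.inr (by linarith)
  · refine ⟨by fun_prop, ⟨3, fun x y h => ?_⟩, fun x y h hF => ?_, 2, 0, by norm_num, by norm_num⟩
    · simp only [le_min_iff] at h
      constructor <;> apply abs_le_of_sq_le_sq <;> nlinarith [sq_nonneg (x - 2), sq_nonneg (x - 3)]
    · simp only [le_min_iff, lt_min_iff] at h ⊢
      refine ⟨lt_of_le_of_ne h.1 fun e => ?_, lt_of_le_of_ne h.2 fun e => ?_⟩
      · simp [show 4 * y ^ 2 - x ^ 2 = 0 by linarith] at hF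
      · simp [show 4 * (x - 2) ^ 2 + y ^ 2 - 4 = 0 by linarith] at hF
  · simp [h12, h10.symm, h20.symm, h1n, h2n, Finset.card_insert_of_notMem]
  · intro p hp
    simp only [Finset.mem_insert, Finset.mem_singleton] at hp
    rcases hp with rfl | rfl | rfl | rfl | rfl
    exacts [hzero, hnode _ _ h1 (Or.inl rfl), hnode _ _ h1 (Or.inr rfl), hnode _ _ h2 (Or.inl rfl),
      hnode _ _ h2 (Or.inr rfl)]

end ParabolicClass

/-! ### The pictures of `X₉²`, `J₁₀³` and `J₁₀¹`. -/

namespace ParabolicClass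

theorem isArrangement_X9two : IsArrangement X9two.picture 2 6 := by
  have gx : ∀ p, HasGrad (fun p : ℝ × ℝ => p.1) 1 0 p := fun p =>
    (hasGrad_quadratic 0 0 1 0 0 p).congr (fun q => by ring) (by ring) (by ring)
  have gy : ∀ p, HasGrad (fun p : ℝ × ℝ => p.2) 0 1 p := fun p =>
    (hasGrad_quadratic 0 0 0 1 0 p).congr (fun q => by ring) (by ring) (by ring)
  have gl : ∀ p, HasGrad (fun p : ℝ × ℝ => p.2 - p.1 + 3) (-1) 1 p := fun p =>
    (hasGrad_quadratic 0 0 (-1) 1 3 p).congr (fun q => by ring) (by ring) (by ring)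
  have gm : ∀ p, HasGrad (fun p : ℝ × ℝ => p.2 + p.1 + 7) 1 1 p := fun p =>
    (hasGrad_quadratic 0 0 1 1 7 p).congr (fun q => by ring) (by ring) (by ring)
  have hcx : Continuous fun p : ℝ × ℝ => p.1 := continuous_fst
  have hcy : Continuous fun p : ℝ × ℝ => p.2 := continuous_snd
  have hcl : Continuous fun p : ℝ × ℝ => p.2 - p.1 + 3 := by fun_prop
  have hcm : Continuous fun p : ℝ × ℝ => p.2 + p.1 + 7 := by fun_prop
  refine isArrangement_of_isRegion
    (F := fun x y => x * y * (y - x + 3) * (y + x + 7))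
    -- The triangles with vertices `(0, 0), (0, -3), (3, 0)` and `(0, -3), (0, -7), (-2, -5)`. The
    -- positive domain is the quadrangle `(0, 0), (0, -3), (-2, -5), (-7, 0)`.
    [fun x y => min x (min (-y) (y - x + 3)), fun x y => min (-x) (min (x - y - 3) (y + x + 7))]
    rfl ?_ ?_ (g' := fun x y => min (min (-x) (-y)) (min (y - x + 3) (y + x + 7))) ?_
    {(0, 0), (0, -3), (0, -7), (3, 0), (-7, 0), (-2, -5)} ?_ ?_
  · simp only [List.forall_mem_cons, List.not_mem_nil, false_imp_iff, implies_true, and_true]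
    constructor
    · refine ⟨by fun_prop, ⟨3, fun x y h => ?_⟩, fun x y h hF => ?_, 1, -1, by norm_num, by norm_num⟩
      · simp only [le_min_iff] at h
        exact ⟨abs_le.2 ⟨by linarith, by linarith⟩, abs_le.2 ⟨by linarith, by linarith⟩⟩
      · simp only [le_min_iff, lt_min_iff] at h ⊢
        refine ⟨lt_of_le_of_ne h.1 fun e => ?_, lt_of_le_of_ne h.2.1 fun e => ?_,
          lt_of_le_of_ne h.2.2 fun e => ?_⟩
        · simp [← e] at hF
        · simp [show y = 0 by linarith] at hF
        · simp [← e] at hF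
    · refine ⟨by fun_prop, ⟨7, fun x y h => ?_⟩, fun x y h hF => ?_, -1, -5, by norm_num, by norm_num⟩
      · simp only [le_min_iff] at h
        exact ⟨abs_le.2 ⟨by linarith, by linarith⟩, abs_le.2 ⟨by linarith, by linarith⟩⟩
      · simp only [le_min_iff, lt_min_iff] at h ⊢
        refine ⟨lt_of_le_of_ne h.1 fun e => ?_, lt_of_le_of_ne h.2.1 fun e => ?_,
          lt_of_le_of_ne h.2.2 fun e => ?_⟩
        · simp [show x = 0 by linarith] at hF
        · simp [show y - x + 3 = 0 by linarith] at hF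
        · simp [← e] at hF
  · simp only [List.pairwise_cons, List.forall_mem_cons, List.not_mem_nil, false_imp_iff, implies_true,
      and_true, List.Pairwise.nil, lt_min_iff, min_le_iff]
    exact fun x y h => Or.inl (by linarith)
  · refine ⟨by fun_prop, ⟨7, fun x y h => ?_⟩, fun x y h hF => ?_, -1, -1, by norm_num, by norm_num⟩
    · simp only [le_min_iff] at h
      exact ⟨abs_le.2 ⟨by linarith, by linarith⟩, abs_le.2 ⟨by linarith, by linarith⟩⟩
    · simp only [le_min_iff, lt_min_iff] at h ⊢
      refine ⟨⟨lt_of_le_of_ne h.1.1 fun e => ?_, lt_of_le_of_ne h.1.2 fun e => ?_⟩,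
        lt_of_le_of_ne h.2.1 fun e => ?_, lt_of_le_of_ne h.2.2 fun e => ?_⟩
      · simp [show x = 0 by linarith] at hF
      · simp [show y = 0 by linarith] at hF
      · simp [← e] at hF
      · simp [← e] at hF
  · norm_num [Finset.card_insert_of_notMem]
  · intro p hp
    simp only [Finset.mem_insert, Finset.mem_singleton] at hp
    rcases hp with rfl | rfl | rfl | rfl | rfl | rfl
    · exact isNode_of_transverse (u := fun p => (p.2 - p.1 + 3) * (p.2 + p.1 + 7)) (fun z => by ring)
        hcx hcy (hcl.mul hcm) (gx _) (gy _) (by norm_num) (by norm_num) (by norm_num) (by norm_num)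
    · exact isNode_of_transverse (u := fun p => p.2 * (p.2 + p.1 + 7)) (fun z => by ring)
        hcx hcl (hcy.mul hcm) (gx _) (gl _) (by norm_num) (by norm_num) (by norm_num) (by norm_num)
    · exact isNode_of_transverse (u := fun p => p.2 * (p.2 - p.1 + 3)) (fun z => by ring)
        hcx hcm (hcy.mul hcl) (gx _) (gm _) (by norm_num) (by norm_num) (by norm_num) (by norm_num)
    · exact isNode_of_transverse (u := fun p => p.1 * (p.2 + p.1 + 7)) (fun z => by ring)
        hcy hcl (hcx.mul hcm) (gy _) (gl _) (by norm_num) (by norm_num) (by norm_num) (by norm_num)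
    · exact isNode_of_transverse (u := fun p => p.1 * (p.2 - p.1 + 3)) (fun z => by ring)
        hcy hcm (hcx.mul hcl) (gy _) (gm _) (by norm_num) (by norm_num) (by norm_num) (by norm_num)
    · exact isNode_of_transverse (u := fun p => p.1 * p.2) (fun z => by ring)
        hcl hcm (hcx.mul hcy) (gl _) (gm _) (by norm_num) (by norm_num) (by norm_num) (by norm_num)

/-- The domains below the line and above both parabolas, one on each side of the axis. -/
theorem isRegion_J10three_side (σ : ℝ) (hσ : σ = 1 ∨ σ = -1) :
    IsRegion (fun x y => y * (y + 3 - x ^ 2) * (y - 1 + x ^ 2))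
      (fun x y => min (min (-y) (y + 3 - x ^ 2)) (min (y - 1 + x ^ 2) (σ * x))) := by
  refine ⟨by fun_prop, ⟨3, fun x y h => ?_⟩, fun x y h hF => ?_, σ * (3 / 2), -1 / 2, ?_, ?_⟩
  · simp only [le_min_iff] at h
    refine ⟨abs_le_of_sq_le_sq ?_ ?_, abs_le.2 ⟨?_, ?_⟩⟩ <;> nlinarith [sq_nonneg x]
  · simp only [le_min_iff, lt_min_iff] at h ⊢
    refine ⟨⟨lt_of_le_of_ne h.1.1 fun e => ?_, lt_of_le_of_ne h.1.2 fun e => ?_⟩,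
      lt_of_le_of_ne h.2.1 fun e => ?_, lt_of_le_of_ne h.2.2 fun e => ?_⟩
    · simp [show y = 0 by linarith] at hF
    · simp [← e] at hF
    · simp [← e] at hF
    · obtain rfl : x = 0 := by rcases hσ with rfl | rfl <;> linarith
      linarith [h.1.1, h.2.1]
  · rcases hσ with rfl | rfl <;> norm_num
  · rcases hσ with rfl | rfl <;> norm_num

theorem isArrangement_J10three : IsArrangement J10three.picture 3 6 := by
  have gy : ∀ p, HasGrad (fun p : ℝ × ℝ => p.2) 0 1 p := fun p =>
    (hasGrad_quadratic 0 0 0 1 0 p).congr (fun q => by ring) (by ring) (by ring)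
  have gl : ∀ p, HasGrad (fun p : ℝ × ℝ => p.2 + 3 - p.1 ^ 2) (-2 * p.1) 1 p := fun p =>
    (hasGrad_quadratic (-1) 0 0 1 3 p).congr (fun q => by ring) (by ring) (by ring)
  have gm : ∀ p, HasGrad (fun p : ℝ × ℝ => p.2 - 1 + p.1 ^ 2) (2 * p.1) 1 p := fun p =>
    (hasGrad_quadratic 1 0 0 1 (-1) p).congr (fun q => by ring) (by ring) (by ring)
  have hcy : Continuous fun p : ℝ × ℝ => p.2 := continuous_snd
  have hcl : Continuous fun p : ℝ × ℝ => p.2 + 3 - p.1 ^ 2 := by fun_prop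
  have hcm : Continuous fun p : ℝ × ℝ => p.2 - 1 + p.1 ^ 2 := by fun_prop
  have hne : ∀ {x a : ℝ}, x ^ 2 = a → 0 < a → x ≠ 0 := by
    rintro x a hx ha rfl
    norm_num at hx
    exact ha.ne hx
  have n3 : ∀ x : ℝ, x ^ 2 = 3 → IsNode J10three.picture !₂[x, 0] := fun x hx =>
    isNode_of_transverse (u := fun p => p.2 - 1 + p.1 ^ 2) (fun z => rfl) hcy hcl hcm (gy _) (gl _)
      rfl (by simp only; linarith) (by simpa using hne hx (by norm_num)) (by simp only; linarith)
  have n1 : ∀ x : ℝ, x ^ 2 = 1 → IsNode J10three.picture !₂[x, 0] := fun x hx =>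
    isNode_of_transverse (u := fun p => p.2 + 3 - p.1 ^ 2) (fun z => by simp only [picture]; ring)
      hcy hcm hcl (gy _) (gm _)
      rfl (by simp only; linarith) (by simpa using hne hx (by norm_num)) (by simp only; linarith)
  have n2 : ∀ x : ℝ, x ^ 2 = 2 → IsNode J10three.picture !₂[x, -1] := fun x hx =>
    isNode_of_transverse (u := fun p => p.2) (fun z => by simp only [picture]; ring)
      hcl hcm hcy (gl _) (gm _) (by simp only; linarith) (by simp only; linarith)
      (fun h => hne hx (by norm_num) (by linarith [show -2 * x * 1 - 1 * (2 * x) = 0 from h]))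
      (by norm_num)
  obtain ⟨s, hs0, hs⟩ : ∃ s : ℝ, 1 < s ∧ s ^ 2 = 3 :=
    ⟨√3, Real.lt_sqrt_of_sq_lt (by norm_num), Real.sq_sqrt (by norm_num)⟩
  obtain ⟨t, ht0, ht⟩ : ∃ t : ℝ, 0 < t ∧ t ^ 2 = 2 :=
    ⟨√2, Real.sqrt_pos.2 (by norm_num), Real.sq_sqrt (by norm_num)⟩
  refine isArrangement_of_isRegion
    (F := fun x y => y * (y + 3 - x ^ 2) * (y - 1 + x ^ 2))
    [fun x y => min y (1 - x ^ 2 - y),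
      fun x y => min (min (-y) (y + 3 - x ^ 2)) (min (y - 1 + x ^ 2) (1 * x)),
      fun x y => min (min (-y) (y + 3 - x ^ 2)) (min (y - 1 + x ^ 2) (-1 * x))]
    rfl ?_ ?_ (g' := fun x y => min (-y) (min (y + 3 - x ^ 2) (1 - x ^ 2 - y))) ?_
    {(s, 0), (-s, 0), (1, 0), (-1, 0), (t, -1), (-t, -1)} ?_ ?_
  · simp only [List.forall_mem_cons, List.not_mem_nil, false_imp_iff, implies_true, and_true]
    refine ⟨?_, isRegion_J10three_side 1 (Or.inl rfl), isRegion_J10three_side (-1) (Or.inr rfl)⟩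
    refine ⟨by fun_prop, ⟨1, fun x y h => ?_⟩, fun x y h hF => ?_, 0, 1 / 2, by norm_num, by norm_num⟩
    · simp only [le_min_iff] at h
      refine ⟨abs_le_of_sq_le_sq ?_ ?_, abs_le.2 ⟨?_, ?_⟩⟩ <;> nlinarith [sq_nonneg x]
    · simp only [le_min_iff, lt_min_iff] at h ⊢
      refine ⟨lt_of_le_of_ne h.1 fun e => ?_, lt_of_le_of_ne h.2 fun e => ?_⟩
      · simp [← e] at hF
      · simp [show y - 1 + x ^ 2 = 0 by linarith] at hF
  · simp only [List.pairwise_cons, List.forall_mem_cons, List.not_mem_nil, false_imp_iff, implies_true,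
      and_true, List.Pairwise.nil, lt_min_iff, min_le_iff]
    refine ⟨⟨?_, ?_⟩, ?_⟩ <;> intro x y h
    · exact Or.inl (Or.inl (by linarith))
    · exact Or.inl (Or.inl (by linarith))
    · exact Or.inr (Or.inr (by linarith))
  · refine ⟨by fun_prop, ⟨3, fun x y h => ?_⟩, fun x y h hF => ?_, 0, -1, by norm_num, by norm_num⟩
    · simp only [le_min_iff] at h
      refine ⟨abs_le_of_sq_le_sq ?_ ?_, abs_le.2 ⟨?_, ?_⟩⟩ <;> nlinarith [sq_nonneg x]
    · simp only [le_min_iff, lt_min_iff] at h ⊢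
      refine ⟨lt_of_le_of_ne h.1 fun e => ?_, lt_of_le_of_ne h.2.1 fun e => ?_,
        lt_of_le_of_ne h.2.2 fun e => ?_⟩
      · simp [show y = 0 by linarith] at hF
      · simp [← e] at hF
      · simp [show y - 1 + x ^ 2 = 0 by linarith] at hF
  · have h1 : s ≠ -s := by linarith
    have h2 : s ≠ 1 := by linarith
    have h3 : s ≠ -1 := by linarith
    have h4 : -s ≠ 1 := by linarith
    have h5 : t ≠ -t := by linarith
    have h6 : (1 : ℝ) ≠ -1 := by norm_num
    simp [h1, h2, h3, h4, h5, h6, Finset.card_insert_of_notMem]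
  · intro p hp
    simp only [Finset.mem_insert, Finset.mem_singleton] at hp
    rcases hp with rfl | rfl | rfl | rfl | rfl | rfl
    exacts [n3 _ hs, n3 _ (by simpa using hs), n1 _ (by norm_num), n1 _ (by norm_num), n2 _ ht,
      n2 _ (by simpa using ht)]

/-- The inner part of the figure eight. -/
theorem abs_le_of_figure_eight {x y : ℝ} (h : 0 ≤ 16 * x ^ 2 - x ^ 4 - 16 * y ^ 2) :
    |x| ≤ 4 ∧ |y| ≤ 2 := by
  constructor
  · refine abs_le_of_sq_le_sq ?_ (by norm_num)
    by_contra! hx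
    nlinarith [sq_nonneg y, mul_pos (show 0 < x ^ 2 by linarith) (show 0 < x ^ 2 - 16 by linarith)]
  · exact abs_le_of_sq_le_sq (by nlinarith [sq_nonneg (x ^ 2 - 8)]) (by norm_num)

/-- The whole loop that the parabola does not meet. -/
theorem isRegion_J10one_far :
    IsRegion (fun x y => (6 * (x - 3) ^ 2 - 3 - y) * (x ^ 4 - 16 * x ^ 2 + 16 * y ^ 2))
      (fun x y => min (16 * x ^ 2 - x ^ 4 - 16 * y ^ 2) (-x)) := by
  refine ⟨by fun_prop, ⟨4, fun x y h => ?_⟩, fun x y h hF => ?_, -1, 0, by norm_num, by norm_num⟩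
  · simp only [le_min_iff] at h
    obtain ⟨h1, h2⟩ := abs_le_of_figure_eight h.1
    exact ⟨h1, by linarith⟩
  · simp only [le_min_iff, lt_min_iff] at h ⊢
    refine ⟨lt_of_le_of_ne h.1 fun e => ?_, lt_of_le_of_ne h.2 fun e => ?_⟩
    · simp [show x ^ 4 - 16 * x ^ 2 + 16 * y ^ 2 = 0 by linarith] at hF
    · obtain rfl : x = 0 := by linarith
      obtain rfl : y = 0 := by nlinarith [h.1, sq_nonneg y]
      norm_num at hF

/-- The part of the other loop to the left of the parabola. At `x = 3` the loop stays inside the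
parabola, which separates this part from the right one. -/
theorem isRegion_J10one_left :
    IsRegion (fun x y => (6 * (x - 3) ^ 2 - 3 - y) * (x ^ 4 - 16 * x ^ 2 + 16 * y ^ 2))
      (fun x y => min (min (6 * (x - 3) ^ 2 - 3 - y) (16 * x ^ 2 - x ^ 4 - 16 * y ^ 2))
        (min x (3 - x))) := by
  refine ⟨by fun_prop, ⟨4, fun x y h => ?_⟩, fun x y h hF => ?_, 1, 0, by norm_num, by norm_num⟩
  · simp only [le_min_iff] at h
    obtain ⟨h1, h2⟩ := abs_le_of_figure_eight h.1.2
    exact ⟨h1, by linarith⟩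
  · simp only [le_min_iff, lt_min_iff] at h ⊢
    refine ⟨⟨lt_of_le_of_ne h.1.1 fun e => ?_, lt_of_le_of_ne h.1.2 fun e => ?_⟩,
      lt_of_le_of_ne h.2.1 fun e => ?_, lt_of_le_of_ne h.2.2 fun e => ?_⟩
    · simp [← e] at hF
    · simp [show x ^ 4 - 16 * x ^ 2 + 16 * y ^ 2 = 0 by linarith] at hF
    · obtain rfl : x = 0 := by linarith
      obtain rfl : y = 0 := by nlinarith [h.1.2, sq_nonneg y]
      norm_num at hF
    · obtain rfl : x = 3 := by linarith
      linarith [h.1.1, (abs_le.1 (abs_le_of_figure_eight h.1.2).2).1]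

theorem isRegion_J10one_right :
    IsRegion (fun x y => (6 * (x - 3) ^ 2 - 3 - y) * (x ^ 4 - 16 * x ^ 2 + 16 * y ^ 2))
      (fun x y => min (min (6 * (x - 3) ^ 2 - 3 - y) (16 * x ^ 2 - x ^ 4 - 16 * y ^ 2)) (x - 3)) := by
  refine ⟨by fun_prop, ⟨4, fun x y h => ?_⟩, fun x y h hF => ?_, 39 / 10, 0, by norm_num, by norm_num⟩
  · simp only [le_min_iff] at h
    obtain ⟨h1, h2⟩ := abs_le_of_figure_eight h.1.2
    exact ⟨h1, by linarith⟩
  · simp only [le_min_iff, lt_min_iff] at h ⊢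
    refine ⟨⟨lt_of_le_of_ne h.1.1 fun e => ?_, lt_of_le_of_ne h.1.2 fun e => ?_⟩,
      lt_of_le_of_ne h.2 fun e => ?_⟩
    · simp [← e] at hF
    · simp [show x ^ 4 - 16 * x ^ 2 + 16 * y ^ 2 = 0 by linarith] at hF
    · obtain rfl : x = 3 := by linarith
      linarith [h.1.1, (abs_le.1 (abs_le_of_figure_eight h.1.2).2).1]

/-- The tip of the parabola under the loop. The condition `y < 0` discards the unbounded part above,
and on `y = 0` the interior of the parabola lies inside the loop. -/
theorem isRegion_J10one_below :
    IsRegion (fun x y => (6 * (x - 3) ^ 2 - 3 - y) * (x ^ 4 - 16 * x ^ 2 + 16 * y ^ 2))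
      (fun x y => min (min (y + 3 - 6 * (x - 3) ^ 2) (x ^ 4 - 16 * x ^ 2 + 16 * y ^ 2)) (-y)) := by
  refine ⟨by fun_prop, ⟨4, fun x y h => ?_⟩, fun x y h hF => ?_, 3, -29 / 10, by norm_num, by norm_num⟩
  · simp only [le_min_iff] at h
    refine ⟨abs_le.2 ⟨?_, ?_⟩, abs_le.2 ⟨?_, ?_⟩⟩ <;> nlinarith [sq_nonneg (x - 3)]
  · simp only [le_min_iff, lt_min_iff] at h ⊢
    refine ⟨⟨lt_of_le_of_ne h.1.1 fun e => ?_, lt_of_le_of_ne h.1.2 fun e => ?_⟩,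
      lt_of_le_of_ne h.2 fun e => ?_⟩
    · simp [show 6 * (x - 3) ^ 2 - 3 - y = 0 by linarith] at hF
    · simp [← e] at hF
    · obtain rfl : y = 0 := by linarith
      have h1 : 2 < x := by nlinarith [h.1.1]
      have h2 : x < 4 := by nlinarith [h.1.1]
      nlinarith [h.1.2, mul_pos (mul_pos (show 0 < x by linarith) (show 0 < x by linarith))
        (mul_pos (show 0 < 4 - x by linarith) (show 0 < 4 + x by linarith))]

/-- Here one curve crosses itself, and its equation is not presented as a product of two. The split
is made by the line `x = 0`, on which the quartic is non-negative, while it is negative on the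
horizontal axis near the origin. -/
theorem isNode_figure_eight : IsNode J10one.picture !₂[0, 0] := by
  have hc : Continuous fun z : EuclideanSpace ℝ (Fin 2) => 6 * (z 0 - 3) ^ 2 - 3 - z 1 := by fun_prop
  have hc0 : Continuous fun z : EuclideanSpace ℝ (Fin 2) => z 0 := by fun_prop
  have hline : ∀ v : ℝ, Tendsto (fun s : ℝ => !₂[s * v, 0]) (𝓝[>] 0) (𝓝 !₂[0, 0]) := by
    intro v
    have : Continuous fun s : ℝ => !₂[s * v, 0] := by fun_prop
    simpa using (this.tendsto 0).mono_left nhdsWithin_le_nhds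
  have hmem : ∀ᶠ s in 𝓝[>] (0 : ℝ), 0 < s ∧ s < 1 := Ioo_mem_nhdsGT one_pos
  have hneg : ∀ s v : ℝ, v ^ 2 = 1 → 0 < s → s < 1 → J10one.picture !₂[s * v, 0] < 0 := by
    intro s v hv h0 h1
    have h2 : (s * v) ^ 2 = s ^ 2 := by rw [mul_pow, hv, mul_one]
    have h3 : (s * v) ^ 4 = s ^ 4 := by rw [show (s * v) ^ 4 = ((s * v) ^ 2) ^ 2 by ring, h2]; ring
    have h4 : |s * v| < 1 := by
      rw [← sq_lt_one_iff_abs_lt_one, h2]; nlinarith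
    have h5 := abs_lt.1 h4
    refine mul_neg_of_pos_of_neg ?_ ?_
    · simp only [Matrix.cons_val_zero, Matrix.cons_val_one]
      nlinarith
    · simp only [Matrix.cons_val_zero, Matrix.cons_val_one, h2, h3]
      have h6 : 0 < 16 - s ^ 2 := by nlinarith
      nlinarith [mul_pos (sq_pos_of_pos h0) h6]
  refine ⟨by simp [picture], {z | z 0 < 0}, {z | 0 < z 0}, isOpen_lt hc0 continuous_const,
    isOpen_lt continuous_const hc0, disjoint_left.2 fun z (h1 : z 0 < 0) (h2 : 0 < z 0) => lt_asymm h1 h2, ?_, ?_, ?_⟩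
  · have hpos : ∀ᶠ z in 𝓝 (!₂[0, 0] : EuclideanSpace ℝ (Fin 2)), 0 < 6 * (z 0 - 3) ^ 2 - 3 - z 1 :=
      hc.continuousAt.eventually (lt_mem_nhds (by norm_num))
    filter_upwards [hpos] with z hz hlt
    refine lt_or_gt_of_ne (a := z 0) (b := 0) fun h0 => ?_
    simp only [picture, h0] at hlt
    rw [h0] at hz
    nlinarith [mul_nonneg hz.le (sq_nonneg (z 1))]
  · refine (hline (-1)).frequently (Eventually.frequently ?_)
    filter_upwards [hmem] with s hs
    exact ⟨by simpa using hs.1, hneg s (-1) (by norm_num) hs.1 hs.2⟩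
  · refine (hline 1).frequently (Eventually.frequently ?_)
    filter_upwards [hmem] with s hs
    exact ⟨by simpa using hs.1, hneg s 1 (by norm_num) hs.1 hs.2⟩

theorem isArrangement_J10one : IsArrangement J10one.picture 4 5 := by
  have gA : ∀ p, HasGrad (fun p : ℝ × ℝ => 6 * (p.1 - 3) ^ 2 - 3 - p.2) (12 * p.1 - 36) (-1) p :=
    fun p => (hasGrad_quadratic 6 0 (-36) (-1) 51 p).congr (fun q => by ring) (by ring) (by ring)
  have gB : ∀ p, HasGrad (fun p : ℝ × ℝ => p.1 ^ 4 - 16 * p.1 ^ 2 + 16 * p.2 ^ 2)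
      (4 * p.1 ^ 3 - 32 * p.1) (32 * p.2) p := fun p =>
    ((hasGrad_monomial 1 4 0 p).add (hasGrad_quadratic (-16) 16 0 0 0 p)).congr (fun q => by ring)
      (by norm_num; ring) (by norm_num)
  -- The figure eight restricted to the parabola `(3 + s, 6 s² - 3)`. Non-vanishing of the
  -- derivative of this polynomial means transversality.
  have hnode : ∀ s : ℝ, 577 * s ^ 4 + 12 * s ^ 3 - 538 * s ^ 2 + 12 * s + 81 = 0 →
      2308 * s ^ 3 + 36 * s ^ 2 - 1076 * s + 12 ≠ 0 →
      IsNode J10one.picture !₂[3 + s, 6 * s ^ 2 - 3] := by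
    intro s hs hs'
    refine isNode_of_transverse (u := fun _ => 1) (fun z => (mul_one _).symm) (by fun_prop)
      (by fun_prop) continuous_const (gA _) (gB _) (by simp only; ring)
      (by simp only; linear_combination hs) (fun h => hs' ?_) one_ne_zero
    simp only at h
    linear_combination h
  have hroot : Continuous fun s : ℝ => 577 * s ^ 4 + 12 * s ^ 3 - 538 * s ^ 2 + 12 * s + 81 := by
    fun_prop
  -- Sign changes on four disjoint intervals give the four crossings.
  obtain ⟨s₁, ⟨h1, h1'⟩, e1⟩ := intermediate_value_Icc' (show (-1 : ℝ) ≤ -3 / 4 by norm_num)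
    hroot.continuousOn (show (0 : ℝ) ∈ _ by norm_num)
  obtain ⟨s₂, ⟨h2, h2'⟩, e2⟩ := intermediate_value_Icc (show (-3 / 5 : ℝ) ≤ -3 / 10 by norm_num)
    hroot.continuousOn (show (0 : ℝ) ∈ _ by norm_num)
  obtain ⟨s₃, ⟨h3, h3'⟩, e3⟩ := intermediate_value_Icc' (show (3 / 10 : ℝ) ≤ 3 / 5 by norm_num)
    hroot.continuousOn (show (0 : ℝ) ∈ _ by norm_num)
  obtain ⟨s₄, ⟨h4, h4'⟩, e4⟩ := intermediate_value_Icc (show (3 / 4 : ℝ) ≤ 1 by norm_num)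
    hroot.continuousOn (show (0 : ℝ) ∈ _ by norm_num)
  -- The derivative is `s (2308 s² - 1076) + 36 s² + 12`. The bounds for the bracket on the outer
  -- and inner intervals determine its sign at the roots.
  have hout : ∀ s : ℝ, 3 / 4 ≤ |s| → 222 ≤ 2308 * s ^ 2 - 1076 := fun s hs => by
    rw [← sq_abs]; nlinarith
  have hin : ∀ s : ℝ, |s| ≤ 3 / 5 → 2308 * s ^ 2 - 1076 ≤ -245 := fun s hs => by
    rw [← sq_abs]; nlinarith [abs_nonneg s]
  have d1 : 2308 * s₁ ^ 3 + 36 * s₁ ^ 2 - 1076 * s₁ + 12 ≠ 0 := by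
    have := hout s₁ (le_abs.2 (Or.inr (by linarith)))
    nlinarith
  have d2 : 2308 * s₂ ^ 3 + 36 * s₂ ^ 2 - 1076 * s₂ + 12 ≠ 0 := by
    have := hin s₂ (abs_le.2 ⟨by linarith, by linarith⟩)
    nlinarith
  have d3 : 2308 * s₃ ^ 3 + 36 * s₃ ^ 2 - 1076 * s₃ + 12 ≠ 0 := by
    have := hin s₃ (abs_le.2 ⟨by linarith, by linarith⟩)
    nlinarith
  have d4 : 2308 * s₄ ^ 3 + 36 * s₄ ^ 2 - 1076 * s₄ + 12 ≠ 0 := by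
    have := hout s₄ (le_abs.2 (Or.inl (by linarith)))
    nlinarith
  refine isArrangement_of_isRegion
    (F := fun x y => (6 * (x - 3) ^ 2 - 3 - y) * (x ^ 4 - 16 * x ^ 2 + 16 * y ^ 2))
    [_, _, _, _] rfl
    (by
      simp only [List.forall_mem_cons, List.not_mem_nil, false_imp_iff, implies_true, and_true]
      exact ⟨isRegion_J10one_far, isRegion_J10one_left, isRegion_J10one_right,
        isRegion_J10one_below⟩)
    ?_ (g' := fun x y => min (y + 3 - 6 * (x - 3) ^ 2) (16 * x ^ 2 - x ^ 4 - 16 * y ^ 2)) ?_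
    {(0, 0), (3 + s₁, 6 * s₁ ^ 2 - 3), (3 + s₂, 6 * s₂ ^ 2 - 3), (3 + s₃, 6 * s₃ ^ 2 - 3),
      (3 + s₄, 6 * s₄ ^ 2 - 3)} ?_ ?_
  · simp only [List.pairwise_cons, List.forall_mem_cons, List.not_mem_nil, false_imp_iff, implies_true,
      and_true, List.Pairwise.nil, lt_min_iff, min_le_iff]
    refine ⟨⟨?_, ?_, ?_⟩, ⟨?_, ?_⟩, ?_⟩ <;> intro x y h
    · exact Or.inr (Or.inl (by linarith))
    · exact Or.inr (by linarith)
    · exact Or.inl (Or.inr (by linarith))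
    · exact Or.inr (by linarith)
    · exact Or.inl (Or.inl (by linarith))
    · exact Or.inl (Or.inl (by linarith))
  · refine ⟨by fun_prop, ⟨4, fun x y h => ?_⟩, fun x y h hF => ?_, 3, 0, by norm_num, by norm_num⟩
    · simp only [le_min_iff] at h
      obtain ⟨h1, h2⟩ := abs_le_of_figure_eight h.2
      exact ⟨h1, by linarith⟩
    · simp only [le_min_iff, lt_min_iff] at h ⊢
      refine ⟨lt_of_le_of_ne h.1 fun e => ?_, lt_of_le_of_ne h.2 fun e => ?_⟩
      · simp [show 6 * (x - 3) ^ 2 - 3 - y = 0 by linarith] at hF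
      · simp [show x ^ 4 - 16 * x ^ 2 + 16 * y ^ 2 = 0 by linarith] at hF
  · have k1 : (0 : ℝ) ≠ 3 + s₁ := by linarith
    have k2 : (0 : ℝ) ≠ 3 + s₂ := by linarith
    have k3 : (0 : ℝ) ≠ 3 + s₃ := by linarith
    have k4 : (0 : ℝ) ≠ 3 + s₄ := by linarith
    have k12 : s₁ ≠ s₂ := by linarith
    have k13 : s₁ ≠ s₃ := by linarith
    have k14 : s₁ ≠ s₄ := by linarith
    have k23 : s₂ ≠ s₃ := by linarith
    have k24 : s₂ ≠ s₄ := by linarith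
    have k34 : s₃ ≠ s₄ := by linarith
    simp [k1, k2, k3, k4, k12, k13, k14, k23, k24, k34, Finset.card_insert_of_notMem]
  · intro p hp
    simp only [Finset.mem_insert, Finset.mem_singleton] at hp
    rcases hp with rfl | rfl | rfl | rfl | rfl
    exacts [isNode_figure_eight, hnode _ e1 d1, hnode _ e2 d2, hnode _ e3 d3, hnode _ e4 d4]

theorem isArrangement_picture (T : ParabolicClass) :
    IsArrangement T.picture T.negativeRegions T.crossings := by
  cases T
  exacts [isArrangement_X9plus, isArrangement_X9one, isArrangement_X9two, isArrangement_J10three,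
    isArrangement_J10one]

end ParabolicClass

/-! ### From critical points in the plane to critical points in three-space. -/

section Suspension

variable {l : ℕ} {Φ : EuclideanSpace ℂ (Fin 3) × EuclideanSpace ℂ (Fin l) → ℂ} {r δ : ℝ} {μ : ℕ}
  {I : ℤ}

/-- The inclusion of the coordinate plane into the space. -/
noncomputable def planeInclusion (p : EuclideanSpace ℝ (Fin 2)) : EuclideanSpace ℝ (Fin 3) :=
  !₂[p 0, p 1, 0]

/-- The projection of the space to the coordinate plane. -/
noncomputable def planeProjection (x : EuclideanSpace ℝ (Fin 3)) : EuclideanSpace ℝ (Fin 2) :=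
  !₂[x 0, x 1]

theorem planeProjection_planeInclusion (p : EuclideanSpace ℝ (Fin 2)) :
    planeProjection (planeInclusion p) = p := by
  ext i; fin_cases i <;> simp [planeProjection, planeInclusion]

theorem planeInclusion_injective : Function.Injective planeInclusion :=
  Function.LeftInverse.injective planeProjection_planeInclusion

theorem norm_planeInclusion (p : EuclideanSpace ℝ (Fin 2)) : ‖planeInclusion p‖ = ‖p‖ := by
  simp [EuclideanSpace.norm_eq, Fin.sum_univ_three, Fin.sum_univ_two, planeInclusion]

theorem contDiff_planeInclusion {k : WithTop ℕ∞} : ContDiff ℝ k planeInclusion := by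
  rw [contDiff_euclidean]
  intro i
  fin_cases i <;> simp [planeInclusion] <;> fun_prop

theorem differentiable_planeProjection : Differentiable ℝ planeProjection := by
  rw [differentiable_euclidean]
  intro i
  fin_cases i <;> simp [planeProjection] <;> fun_prop

/-- A real function that coincides in a ball with a function of two variables plus the square of
the third one. -/
theorem IsControlled.exists_critical_points (h : IsControlled Φ r δ μ I)
    {t : EuclideanSpace ℝ (Fin l)} (ht : ‖t‖ < δ) {T : ParabolicClass}
    (hT : IsChosenPerturbation T r (deformationMember Φ t)) :
    ∃ M N : Finset (EuclideanSpace ℝ (Fin 3)),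
      M.card = T.negativeRegions ∧ N.card = T.crossings + 1 ∧
      (∀ x ∈ M, ‖x‖ < r ∧ (deformationMember Φ t (complexify x)).re < 0 ∧
        IsLocalMin (fun y => (deformationMember Φ t (complexify y)).re) x) ∧
      ∀ x ∈ N, ‖x‖ < r ∧ 0 < (deformationMember Φ t (complexify x)).re ∧
        realGradient (deformationMember Φ t) x = 0 := by
  classical
  obtain ⟨g, hg, c, hc, ⟨e, he⟩, hmin⟩ := hT
  set u : EuclideanSpace ℝ (Fin 3) → ℝ := fun x => (deformationMember Φ t (complexify x)).re with hu
  set ψ : EuclideanSpace ℝ (Fin 2) → ℝ := fun x => (g (complexify x)).re with hψ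
  have hsum : ∀ x, ‖x‖ < r → u x = ψ (planeProjection x) + x 2 ^ 2 := by
    intro x hx
    have h1 := hg (complexify x) (by rwa [mem_ball_zero_iff, norm_complexify])
    have h2 : (!₂[complexify x 0, complexify x 1] : EuclideanSpace ℂ (Fin 2)) =
        complexify (planeProjection x) := by
      ext i; fin_cases i <;> simp [planeProjection, complexify_apply]
    rw [h2] at h1
    simp only [hu, hψ, h1, complexify_apply, Complex.add_re, ← Complex.ofReal_pow,
      Complex.ofReal_re]
  have hplane : ∀ p, ‖p‖ < r → u (planeInclusion p) = ψ p := by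
    intro p hp
    rw [hsum _ (by rwa [norm_planeInclusion]), planeProjection_planeInclusion]
    simp [planeInclusion]
  have hnear : ∀ x : EuclideanSpace ℝ (Fin 3), ‖x‖ < r →
      u =ᶠ[𝓝 x] fun y => ψ (planeProjection y) + y 2 ^ 2 := fun x hx => by
    filter_upwards [Metric.isOpen_ball.mem_nhds (mem_ball_zero_iff.2 hx)] with y hy
    exact hsum y (mem_ball_zero_iff.1 hy)
  have huc : ∀ x, ‖x‖ < r → ContDiffAt ℝ 1 u x := fun x hx =>
    Complex.reCLM.contDiff.contDiffAt.comp x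
      (((h.analyticAt ht (z := complexify x)
        (by rw [norm_complexify]; exact hx.le)).contDiffAt.restrict_scalars ℝ).comp x
        (complexifyCLM 3).contDiff.contDiffAt)
  have hψc : ∀ p ∈ Metric.ball (0 : EuclideanSpace ℝ (Fin 2)) r, ContDiffAt ℝ 1 ψ p := by
    intro p hp
    have hp' := mem_ball_zero_iff.1 hp
    have h1 := (huc _ (by rwa [norm_planeInclusion])).comp p contDiff_planeInclusion.contDiffAt
    refine h1.congr_of_eventuallyEq ?_
    filter_upwards [Metric.isOpen_ball.mem_nhds hp] with q hq
    exact (hplane q (mem_ball_zero_iff.1 hq)).symm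
  obtain ⟨M, N, hM, hN, hM', hN'⟩ := T.isArrangement_picture.exists_critical_points
    Metric.isOpen_ball hc hψc e he hmin
  refine ⟨M.image planeInclusion, N.image planeInclusion, ?_, ?_, ?_, ?_⟩
  · rw [Finset.card_image_of_injective _ planeInclusion_injective, hM]
  · rw [Finset.card_image_of_injective _ planeInclusion_injective, hN]
  · intro x hx
    obtain ⟨p, hp, rfl⟩ := Finset.mem_image.1 hx
    obtain ⟨hpr, hpmin, hneg⟩ := hM' p hp
    have hpr' := mem_ball_zero_iff.1 hpr
    have hxr : ‖planeInclusion p‖ < r := by rwa [norm_planeInclusion]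
    refine ⟨hxr, by rw [← hplane p hpr'] at hneg; exact hneg, ?_⟩
    have h1 : Tendsto planeProjection (𝓝 (planeInclusion p)) (𝓝 p) := by
      have := differentiable_planeProjection.continuous.tendsto (planeInclusion p)
      rwa [planeProjection_planeInclusion] at this
    -- Adding the square of the third coordinate preserves minima in the plane.
    filter_upwards [hnear _ hxr, h1.eventually hpmin] with y hy1 hy2
    change u (planeInclusion p) ≤ u y
    rw [hplane p hpr', hy1]
    nlinarith [sq_nonneg (y 2)]
  · intro x hx
    obtain ⟨p, hp, rfl⟩ := Finset.mem_image.1 hx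
    obtain ⟨hpr, hcrit, hpos⟩ := hN' p hp
    have hpr' := mem_ball_zero_iff.1 hpr
    have hxr : ‖planeInclusion p‖ < r := by rwa [norm_planeInclusion]
    refine ⟨hxr, by rw [← hplane p hpr'] at hpos; exact hpos, ?_⟩
    have h1 : HasFDerivAt u (innerSL ℝ (realGradient (deformationMember Φ t) (planeInclusion p)))
        (planeInclusion p) := hasFDerivAt_re (h.analyticAt_complexify ht hxr.le).differentiableAt
    have h2 : HasFDerivAt ψ (0 : EuclideanSpace ℝ (Fin 2) →L[ℝ] ℝ)
        (planeProjection (planeInclusion p)) := by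
      rw [planeProjection_planeInclusion, ← hcrit]
      exact ((hψc p hpr).differentiableAt one_ne_zero).hasFDerivAt
    -- Both terms have zero differential at the point, the second because the third coordinate
    -- vanishes there.
    have h3 := (h2.comp _ (differentiable_planeProjection (planeInclusion p)).hasFDerivAt).add
      ((EuclideanSpace.proj (2 : Fin 3) : EuclideanSpace ℝ (Fin 3) →L[ℝ] ℝ).hasFDerivAt.pow 2
        (x := planeInclusion p))
    have h4 := h1.unique (h3.congr_of_eventuallyEq (hnear _ hxr))
    have h5 := DFunLike.congr_fun h4 (realGradient (deformationMember Φ t) (planeInclusion p))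
    rw [innerSL_apply_apply] at h5
    refine inner_self_eq_zero.1 (h5.trans ?_)
    simp [planeInclusion]

end Suspension

end

/-! ### The theorem. -/

theorem mainTheorem3 (T : ParabolicClass) (α : ℝ) (hα : T.Admissible α) (l : ℕ)
    (Φ : EuclideanSpace ℂ (Fin 3) × EuclideanSpace ℂ (Fin l) → ℂ)
    (hΦ : IsRealDeformation (T.stabilized α) Φ) :
    ∀ᶠ r in 𝓝[>] (0 : ℝ), ∀ᶠ δ in 𝓝[>] (0 : ℝ),
      ∀ t₀ t : EuclideanSpace ℝ (Fin l),
        IsChosenPerturbation T r (deformationMember Φ t₀) →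
        t ∈ connectedComponentIn (Metric.ball 0 δ \ discriminant Φ r) t₀ →
        IsMorseOn (deformationMember Φ t) r →
        (imaginaryCriticalPoints (deformationMember Φ t) r = ∅ ∨
          ∃ a, imaginaryCriticalPoints (deformationMember Φ t) r = {a, conjPoint a}) ∧
        ((realCriticalPoints (deformationMember Φ t) r).encard =
            (milnorNumber (T.stabilized α) : ℕ∞) ∨
          (realCriticalPoints (deformationMember Φ t) r).encard + 2 =
            (milnorNumber (T.stabilized α) : ℕ∞)) := by
  filter_upwards [T.eventually_isControlled hα hΦ] with r hr
  filter_upwards [hr] with δ h t₀ t hT ht hMorse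
  obtain ⟨ht₀, htd₀⟩ := connectedComponentIn_nonempty_iff.1 ⟨t, ht⟩
  obtain ⟨htδ, htd⟩ := connectedComponentIn_subset _ _ ht
  rw [mem_ball_zero_iff] at ht₀ htδ
  obtain ⟨M, N, hM, hN, hM', hN'⟩ := h.exists_critical_points ht₀ hT
  have hd := h.hasDegree_negativeSet_of_card ht₀ htd₀ M N hM' hN' (by rw [hM, hN])
  rw [hM] at hd
  rw [T.milnorNumber_stabilized hα]
  exact h.critical_points_of_isMorseOn htδ htd hMorse T.negativeRegions_sub_realIndex
    (h.hasDegree_negativeSet_of_mem_component ht hd)
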